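/- **Setting.** Let $n\ge 1$, let $S=S(\mathbb C^n)$ be the compact convex set of density matrices ($\rho\ge 0$, $\operatorname{tr}\rho=1$), and let $A,B,C$ be complex $n\times n$ matrices with $A$ and $B$ Hermitian and $C$ arbitrary. $C(S)$ carries the sup-norm. $C^k(S)$ is the space of functions that are $k$ times continuously differentiable on $S$, regarded as a convex body in its affine hull (direction: the traceless Hermitian matrices with the norm $(\operatorname{tr}X^2)^{1/2}$); $\|f\|_{C^k}$ is the sum of the sup-norms of the derivatives of $f$ of orders $0,\dots,k$. Put $$b(\rho)=-i[A,\rho]-\tfrac12\{C^*C,\rho\}+\operatorname{tr}(C^*C\rho)\,\rho,$$ $$L_{count}f(\rho)=(f'(\rho),b(\rho))+\operatorname{tr}(C^*C\rho)\Big[f\Big(\frac{C\rho C^*}{\operatorname{tr}(C\rho C^*)}\Big)-f(\rho)\Big],$$ the last term being $0$ where $\operatorname{tr}(C^*C\rho)=0$. *The measurement chains.* For $h>0$ let $H_h=\begin{pmatrix}A&0\\0&B\end{pmatrix}+\frac1{\sqrt h}\begin{pmatrix}0&-iC^*\\ iC&0\end{pmatrix}$ on $\mathbb C^n\otimes\mathbb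 C^2$, $\Omega=P_0=\begin{pmatrix}1&0\\0&0\end{pmatrix}$, $P_1=\begin{pmatrix}0&0\\0&1\end{pmatrix}$. With $\operatorname{tr}_{p1}$ the partial trace over $\mathbb C^2$, put $\tilde\rho_h^j=\operatorname{tr}_{p1}\big[(I\otimes P_j)e^{-ihH_h}(\rho\otimes\Omega)e^{ihH_h}(I\otimes P_j)\big]$, $p_j=\operatorname{tr}\tilde\rho^j_h$ and $$U_hf(\rho)=\sum_{j=0,1}p_j\,f(\tilde\rho_h^j/p_j)$$ (terms with $p_j=0$ are omitted). For $\lambda>0$ let $T^\lambda_s=e^{sL^\lambda}$ with $L^\lambda=(U_\lambda-1)/\lambda$: this is the semigroup of the continuous-time chain with transitions $U_\lambda$ separated by independent exponential waiting times of mean $\lambda$. **Theorem.** There is a real function $\kappa(t)$, depending only on $n$, $t$ and the norms of $A,B,C$, such that the following holds. (i) There is a (conservative) Feller semigroup $(T_t)_{t\ge0}$ on $C(S)$ whose generator equals $L_{count}$ on $C^1(S)$ and for which $C^1(S)$ and $C^2(S)$ are cores; there is a corresponding Feller process $O^\rho_t$ (càdlàg and Markov with semigroup $T_t$, started at $\rho$)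 for every $\rho\in S$. If $C$ is invertible or of rank at most $1$ (so for every $C$ if $n\le2$), then moreover $C^1(S)$ and $C^2(S)$ are invariant under $T_t$, and the $T_s$ are bounded in each of these spaces uniformly for $s\in[0,t]$, for every $t>0$. (ii) As $h\to0$, $(U_h)^{[s/h]}f\to T_sf$ in $C(S)$ for all $f\in C(S)$ and $s\ge0$. For every $\rho\in S$ the chain with transition operator $U_h$ started at $\rho$, run with time step $h$ (its state at time $s$ being that after $[s/h]$ steps), converges in distribution on the Skorokhod space $D([0,\infty),S)$ to $O^\rho$. For all $f\in C^2(S)$, $h>0$ and $0\le s\le t$, $$\|(U_h)^{[s/h]}f-T_sf\|\le\big(\sqrt h\,s+(s-h[s/h])\big)\,\kappa(t)\,\|f\|_{C^2};$$ in particular the bound is $\sqrt h\,s\,\kappa(t)\|f\|_{C^2}$ when $s$ is a multiple of $h$. (iii) As $\lambda\to0$, $T^\lambda_sf\to T_sf$ in $C(S)$ for all $f\in C(S)$ and $s\ge0$. The càdlàg Markov processes with semigroups $T^\lambda$ started at $\rho$ converge in distribution on $D([0,\infty),S)$ to $O^\rho$, and for all $f\in C^2(S)$, $\lambda>0$ and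 $0\le s\le t$, $$\|T^\lambda_sf-T_sf\|\le\sqrt\lambda\,s\,\kappa(t)\,\|f\|_{C^2}.$$ (iv) The limit process solves the Belavkin counting equation: for every $\rho\in S$ there are, on some filtered probability space, an adapted càdlàg process $\rho_t$ with the law of $O^\rho$ and an adapted counting process $N_t$ such that $N_t-\int_0^t\operatorname{tr}(C^*C\rho_s)\,ds$ is a martingale and almost surely, for all $t\ge0$, $$\rho_t=\rho+\int_0^tb(\rho_s)\,ds+\int_{(0,t]}\Big(\frac{C\rho_{s-}C^*}{\operatorname{tr}(C\rho_{s-}C^*)}-\rho_{s-}\Big)dN_s .$$ -/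

import Mathlib

open MeasureTheory ProbabilityTheory Filter Topology Set
open scoped NNReal BoundedContinuousFunction Kronecker ComplexOrder

noncomputable section

namespace QFilter

/-! ### States -/

/-- Density matrices: positive semidefinite with unit trace. -/
def IsState {n : ℕ} (ρ : Matrix (Fin n) (Fin n) ℂ) : Prop :=
  ρ.PosSemidef ∧ ρ.trace = 1

/-- The state space `S(ℂⁿ)`. -/
def State (n : ℕ) : Type := {ρ : Matrix (Fin n) (Fin n) ℂ // IsState ρ}

namespace State

variable {n : ℕ}

/-- The density matrix of a state. -/
def mat (ρ : State n) : Matrix (Fin n) (Fin n) ℂ := ρ.1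

instance : UniformSpace (State n) :=
  inferInstanceAs (UniformSpace {ρ : Matrix (Fin n) (Fin n) ℂ // IsState ρ})

instance : MeasurableSpace (State n) := borel _

instance : BorelSpace (State n) := ⟨rfl⟩

theorem isInducing_mat : IsInducing (mat : State n → Matrix (Fin n) (Fin n) ℂ) :=
  IsInducing.subtypeVal

theorem continuous_mat : Continuous (mat : State n → Matrix (Fin n) (Fin n) ℂ) :=
  isInducing_mat.continuous

theorem posSemidef (ρ : State n) : ρ.mat.PosSemidef := ρ.2.1

theorem trace_eq (ρ : State n) : ρ.mat.trace = 1 := ρ.2.2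

open Classical in
/-- The normalized state `X / tr X` of a nonzero positive matrix `X`. If `X / tr X` is not a state
(for a positive `X` this happens only if `X = 0`) the value is the irrelevant default `σ`. -/
def normalize (X : Matrix (Fin n) (Fin n) ℂ) (σ : State n) : State n :=
  if h : IsState (X.trace.re⁻¹ • X) then (⟨X.trace.re⁻¹ • X, h⟩ : {ρ // IsState ρ}) else σ

theorem normalize_mat {X : Matrix (Fin n) (Fin n) ℂ} (hX : X.PosSemidef) (h0 : 0 < X.trace.re)
    (σ : State n) : (normalize X σ).mat = X.trace.re⁻¹ • X := by
  have him : X.trace = (X.trace.re : ℂ) := by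
    have := hX.trace_nonneg
    rw [Complex.le_def] at this
    exact Complex.ext rfl this.2.symm
  have h : IsState (X.trace.re⁻¹ • X) := by
    refine ⟨hX.smul (inv_nonneg.2 h0.le), ?_⟩
    rw [Matrix.trace_smul, him, Complex.ofReal_re, Complex.real_smul, ← Complex.ofReal_mul,
      inv_mul_cancel₀ h0.ne', Complex.ofReal_one]
  have h' : normalize X σ = (⟨X.trace.re⁻¹ • X, h⟩ : {ρ // IsState ρ}) := dif_pos h
  rw [h']
  rfl

theorem trace_re_nonneg {X : Matrix (Fin n) (Fin n) ℂ} (hX : X.PosSemidef) : 0 ≤ X.trace.re :=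
  (Complex.le_def.1 hX.trace_nonneg).1

theorem continuous_weight_mul {X : State n → Matrix (Fin n) (Fin n) ℂ} (hX : Continuous X)
    (hpos : ∀ ρ, (X ρ).PosSemidef) (f : State n →ᵇ ℝ) :
    Continuous fun ρ => (X ρ).trace.re * f (normalize (X ρ) ρ) := by
  have hp : Continuous fun ρ => (X ρ).trace.re := Complex.continuous_re.comp hX.matrix_trace
  rw [continuous_iff_continuousAt]
  intro ρ₀
  rcases (trace_re_nonneg (hpos ρ₀)).eq_or_lt with h0 | h0
  · have hlim : Tendsto (fun ρ => (X ρ).trace.re * ‖f‖) (𝓝 ρ₀) (𝓝 0) := by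
      have := (hp.mul_const ‖f‖).tendsto ρ₀
      rwa [← h0, zero_mul] at this
    change Tendsto _ _ (𝓝 ((X ρ₀).trace.re * _))
    rw [← h0, zero_mul]
    refine squeeze_zero_norm (fun ρ => ?_) hlim
    rw [norm_mul, Real.norm_of_nonneg (trace_re_nonneg (hpos ρ))]
    exact mul_le_mul_of_nonneg_left (f.norm_coe_le_norm _) (trace_re_nonneg (hpos ρ))
  · refine hp.continuousAt.mul (f.continuous.continuousAt.comp ?_)
    rw [isInducing_mat.continuousAt_iff]
    have h1 : ContinuousAt (fun ρ => (X ρ).trace.re⁻¹ • X ρ) ρ₀ :=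
      (hp.continuousAt.inv₀ h0.ne').smul hX.continuousAt
    refine h1.congr ?_
    filter_upwards [hp.continuousAt.eventually (lt_mem_nhds h0)] with ρ hρ
    exact (normalize_mat (hpos ρ) hρ ρ).symm

end State

/-! ### Repeated indirect measurements -/

section Measurement

variable {n : ℕ}

/-- Operators on `ℂⁿ ⊗ ℂ²`. -/
abbrev BiMat (n : ℕ) : Type := Matrix (Fin n × Fin 2) (Fin n × Fin 2) ℂ

/-- Partial trace over the second factor. -/
def partialTrace (M : BiMat n) : Matrix (Fin n) (Fin n) ℂ :=
  Matrix.of fun i j => ∑ k, M (i, k) (j, k)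

/-- The diagonal projectors `P₀`, `P₁` of the measured observable; `P₀` is also the vacuum. -/
def proj (j : Fin 2) : Matrix (Fin 2) (Fin 2) ℂ := Matrix.single j j 1

/-- The scaled Hamiltonian with diagonal blocks `A`, `B` and off-diagonal blocks
`-iC*/√t` (upper right) and `iC/√t` (lower left). -/
def hamiltonian (A B C : Matrix (Fin n) (Fin n) ℂ) (t : ℝ≥0) : BiMat n :=
  A ⊗ₖ proj 0 + B ⊗ₖ proj 1
    + (1 / √(t : ℝ)) • ((Complex.I • C) ⊗ₖ Matrix.single 1 0 1
        - (Complex.I • C.conjTranspose) ⊗ₖ Matrix.single 0 1 1)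

/-- The state `e^{-itH} (ρ ⊗ Ω) e^{itH}` of atom and device after an interaction of length `t`. -/
def evolved (A B C : Matrix (Fin n) (Fin n) ℂ) (t : ℝ≥0) (ρ : Matrix (Fin n) (Fin n) ℂ) : BiMat n :=
  NormedSpace.exp (-((Complex.I * (t : ℝ)) • hamiltonian A B C t)) * (ρ ⊗ₖ proj 0)
    * NormedSpace.exp ((Complex.I * (t : ℝ)) • hamiltonian A B C t)

/-- The non-normalized state of the atom after outcome `j`. -/
def outcome (A B C : Matrix (Fin n) (Fin n) ℂ) (t : ℝ≥0) (j : Fin 2)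
    (ρ : Matrix (Fin n) (Fin n) ℂ) : Matrix (Fin n) (Fin n) ℂ :=
  partialTrace (((1 : Matrix (Fin n) (Fin n) ℂ) ⊗ₖ proj j) * evolved A B C t ρ
    * ((1 : Matrix (Fin n) (Fin n) ℂ) ⊗ₖ proj j))

/-- The probability of outcome `j`. -/
def outcomeProb (A B C : Matrix (Fin n) (Fin n) ℂ) (t : ℝ≥0) (j : Fin 2) (ρ : State n) : ℝ :=
  (outcome A B C t j ρ.mat).trace.re

/-- The new state of the atom after outcome `j`. -/
def outcomeState (A B C : Matrix (Fin n) (Fin n) ℂ) (t : ℝ≥0) (j : Fin 2) (ρ : State n) : State n :=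
  State.normalize (outcome A B C t j ρ.mat) ρ

theorem partialTrace_eq_sum (M : BiMat n) :
    partialTrace M = ∑ k, M.submatrix (fun i => (i, k)) (fun i => (i, k)) := by
  ext i j
  simp [partialTrace, Matrix.sum_apply]

theorem trace_partialTrace (M : BiMat n) : (partialTrace M).trace = M.trace := by
  simp [partialTrace, Matrix.trace, Fintype.sum_prod_type]

theorem proj_conjTranspose (j : Fin 2) : (proj j).conjTranspose = proj j := by
  simp [proj, Matrix.conjTranspose_single]

theorem proj_mul_self (j : Fin 2) : proj j * proj j = proj j := by
  simp [proj]

theorem one_kron_proj_conjTranspose (j : Fin 2) :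
    ((1 : Matrix (Fin n) (Fin n) ℂ) ⊗ₖ proj j).conjTranspose = 1 ⊗ₖ proj j := by
  rw [Matrix.conjTranspose_kronecker, Matrix.conjTranspose_one, proj_conjTranspose]

theorem sum_one_kron_proj :
    ∑ j, ((1 : Matrix (Fin n) (Fin n) ℂ) ⊗ₖ proj j) = 1 := by
  have h : proj 0 + proj 1 = 1 := by
    ext i j
    fin_cases i <;> fin_cases j <;> simp [proj]
  rw [Fin.sum_univ_two, ← Matrix.kronecker_add, h, Matrix.one_kronecker_one]

theorem hamiltonian_isHermitian {A B : Matrix (Fin n) (Fin n) ℂ} (hA : A.IsHermitian)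
    (hB : B.IsHermitian) (C : Matrix (Fin n) (Fin n) ℂ) (t : ℝ≥0) :
    (hamiltonian A B C t).IsHermitian := by
  unfold hamiltonian Matrix.IsHermitian
  simp only [Matrix.conjTranspose_add, Matrix.conjTranspose_sub, Matrix.conjTranspose_smul,
    Matrix.conjTranspose_kronecker, proj_conjTranspose, hA.eq, hB.eq, Matrix.conjTranspose_single,
    Matrix.conjTranspose_conjTranspose, star_one, star_trivial]
  have h1 : star Complex.I = -Complex.I := by simp
  have h2 : ∀ (M : Matrix (Fin n) (Fin n) ℂ) (E : Matrix (Fin 2) (Fin 2) ℂ),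
      (-M) ⊗ₖ E = -(M ⊗ₖ E) := fun M E => by
    ext i j
    simp [Matrix.kroneckerMap_apply]
  rw [h1, neg_smul, neg_smul, h2, h2]
  congr 2
  abel

theorem exp_neg_conjTranspose {H : BiMat n} (hH : H.IsHermitian) (t : ℝ≥0) :
    (NormedSpace.exp (-((Complex.I * (t : ℝ)) • H))).conjTranspose
      = NormedSpace.exp ((Complex.I * (t : ℝ)) • H) := by
  rw [← Matrix.exp_conjTranspose]
  congr 1
  rw [Matrix.conjTranspose_neg, Matrix.conjTranspose_smul, hH.eq]
  simp

theorem exp_mul_exp_neg (H : BiMat n) :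
    NormedSpace.exp H * NormedSpace.exp (-H) = 1 := by
  rw [← Matrix.exp_add_of_commute _ _ (Commute.refl H).neg_right, add_neg_cancel,
    NormedSpace.exp_zero]

theorem outcome_posSemidef {A B : Matrix (Fin n) (Fin n) ℂ} (hA : A.IsHermitian)
    (hB : B.IsHermitian) (C : Matrix (Fin n) (Fin n) ℂ) (t : ℝ≥0) (j : Fin 2)
    {ρ : Matrix (Fin n) (Fin n) ℂ} (hρ : ρ.PosSemidef) : (outcome A B C t j ρ).PosSemidef := by
  have hΩ : (proj 0).PosSemidef := by
    have := Matrix.posSemidef_conjTranspose_mul_self (proj 0)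
    rwa [proj_conjTranspose, proj_mul_self] at this
  have h1 : (evolved A B C t ρ).PosSemidef := by
    have := (hρ.kronecker hΩ).mul_mul_conjTranspose_same
      (NormedSpace.exp (-((Complex.I * (t : ℝ)) • hamiltonian A B C t)))
    rwa [exp_neg_conjTranspose (hamiltonian_isHermitian hA hB C t)] at this
  have h2 := h1.mul_mul_conjTranspose_same ((1 : Matrix (Fin n) (Fin n) ℂ) ⊗ₖ proj j)
  rw [one_kron_proj_conjTranspose] at h2
  unfold outcome
  rw [partialTrace_eq_sum]
  exact Matrix.posSemidef_sum _ fun k _ => h2.submatrix _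

theorem outcomeProb_nonneg {A B : Matrix (Fin n) (Fin n) ℂ} (hA : A.IsHermitian)
    (hB : B.IsHermitian) (C : Matrix (Fin n) (Fin n) ℂ) (t : ℝ≥0) (j : Fin 2) (ρ : State n) :
    0 ≤ outcomeProb A B C t j ρ :=
  State.trace_re_nonneg (outcome_posSemidef hA hB C t j ρ.posSemidef)

theorem sum_outcomeProb (A B C : Matrix (Fin n) (Fin n) ℂ) (t : ℝ≥0) (ρ : State n) :
    ∑ j, outcomeProb A B C t j ρ = 1 := by
  have h1 : ∀ j, (outcome A B C t j ρ.mat).trace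
      = (evolved A B C t ρ.mat * ((1 : Matrix (Fin n) (Fin n) ℂ) ⊗ₖ proj j)).trace := by
    intro j
    unfold outcome
    rw [trace_partialTrace, Matrix.mul_assoc, Matrix.trace_mul_comm, Matrix.mul_assoc,
      ← Matrix.mul_kronecker_mul, one_mul, proj_mul_self]
  have h2 : ∑ j, (outcome A B C t j ρ.mat).trace = 1 := by
    rw [Finset.sum_congr rfl fun j _ => h1 j, ← Matrix.trace_sum, ← Finset.mul_sum,
      sum_one_kron_proj, mul_one]
    unfold evolved
    rw [Matrix.trace_mul_comm, ← Matrix.mul_assoc, exp_mul_exp_neg, one_mul,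
      Matrix.trace_kronecker, ρ.trace_eq]
    simp [proj]
  have h3 := congrArg Complex.re h2
  simpa [outcomeProb] using h3

theorem continuous_outcome (A B C : Matrix (Fin n) (Fin n) ℂ) (t : ℝ≥0) (j : Fin 2) :
    Continuous fun ρ : State n => outcome A B C t j ρ.mat := by
  have h0 : Continuous fun ρ : State n => ρ.mat ⊗ₖ proj 0 := by
    refine continuous_matrix fun a b => ?_
    simp only [Matrix.kroneckerMap_apply]
    exact (State.continuous_mat.matrix_elem _ _).mul continuous_const
  have h1 : Continuous fun ρ : State n => ((1 : Matrix (Fin n) (Fin n) ℂ) ⊗ₖ proj j)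
      * evolved A B C t ρ.mat * ((1 : Matrix (Fin n) (Fin n) ℂ) ⊗ₖ proj j) := by
    unfold evolved
    fun_prop
  unfold outcome partialTrace
  refine continuous_matrix fun a b => ?_
  exact continuous_finsetSum Finset.univ fun k _ => h1.matrix_elem (a, k) (b, k)

theorem norm_transition_le {A B : Matrix (Fin n) (Fin n) ℂ} (hA : A.IsHermitian)
    (hB : B.IsHermitian) (C : Matrix (Fin n) (Fin n) ℂ) (t : ℝ≥0) (f : State n →ᵇ ℝ)
    (ρ : State n) : ‖∑ j, outcomeProb A B C t j ρ * f (outcomeState A B C t j ρ)‖ ≤ ‖f‖ := by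
  refine (norm_sum_le _ _).trans ?_
  calc ∑ j, ‖outcomeProb A B C t j ρ * f (outcomeState A B C t j ρ)‖
      ≤ ∑ j, outcomeProb A B C t j ρ * ‖f‖ := by
        refine Finset.sum_le_sum fun j _ => ?_
        rw [norm_mul, Real.norm_of_nonneg (outcomeProb_nonneg hA hB C t j ρ)]
        exact mul_le_mul_of_nonneg_left (f.norm_coe_le_norm _)
          (outcomeProb_nonneg hA hB C t j ρ)
    _ = ‖f‖ := by rw [← Finset.sum_mul, sum_outcomeProb, one_mul]

/-- The transition operator `U_t f(ρ) = ∑ⱼ pⱼ(t) f(ρₜʲ)` of the chain of successive indirect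
measurements, as a bounded operator on `C(S(ℂⁿ))`. -/
def transitionOp {A B : Matrix (Fin n) (Fin n) ℂ} (hA : A.IsHermitian) (hB : B.IsHermitian)
    (C : Matrix (Fin n) (Fin n) ℂ) (t : ℝ≥0) : (State n →ᵇ ℝ) →L[ℝ] (State n →ᵇ ℝ) :=
  LinearMap.mkContinuous
    { toFun := fun f => BoundedContinuousFunction.ofNormedAddCommGroup
        (fun ρ => ∑ j, outcomeProb A B C t j ρ * f (outcomeState A B C t j ρ))
        (continuous_finsetSum _ fun j _ =>
          State.continuous_weight_mul (continuous_outcome A B C t j)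
            (fun ρ => outcome_posSemidef hA hB C t j ρ.posSemidef) f)
        ‖f‖
        (fun ρ => norm_transition_le hA hB C t f ρ)
      map_add' := fun f g => by
        ext ρ
        simp [mul_add, Finset.sum_add_distrib]
      map_smul' := fun c f => by
        ext ρ
        simp [mul_add, mul_left_comm] }
    1 (fun f => by
      rw [one_mul]
      exact BoundedContinuousFunction.norm_ofNormedAddCommGroup_le _ (norm_nonneg f)
        (fun ρ => norm_transition_le hA hB C t f ρ))

/-- The semigroup `e^{sL}` with bounded generator `L`. -/
def expSemigroup {E : Type*} [NormedAddCommGroup E] [NormedSpace ℝ E] (L : E →L[ℝ] E) (s : ℝ≥0) :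
    E →L[ℝ] E :=
  NormedSpace.exp ((s : ℝ) • L)

/-- The semigroup of the continuous-time chain: transitions `U_τ` at the times of a Poisson clock
of mean waiting time `τ`, that is, the semigroup with the bounded generator `(U_τ - 1)/τ`. -/
def poissonSemigroup {A B : Matrix (Fin n) (Fin n) ℂ} (hA : A.IsHermitian) (hB : B.IsHermitian)
    (C : Matrix (Fin n) (Fin n) ℂ) (τ : ℝ≥0) (s : ℝ≥0) :
    (State n →ᵇ ℝ) →L[ℝ] (State n →ᵇ ℝ) :=
  expSemigroup ((τ : ℝ)⁻¹ • (transitionOp hA hB C τ - 1)) s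

end Measurement

/-! ### Feller semigroups -/

section Semigroup

variable {X : Type*} [TopologicalSpace X]

/-- Conservative Feller semigroups on `C(X)`, for compact `X`. -/
structure IsFellerSemigroup (T : ℝ≥0 → (X →ᵇ ℝ) →L[ℝ] (X →ᵇ ℝ)) : Prop where
  zero : T 0 = 1
  add : ∀ s t, T (s + t) = T s * T t
  nonneg : ∀ t f, 0 ≤ f → 0 ≤ T t f
  const_one : ∀ t, T t 1 = 1
  continuous : ∀ f, Tendsto (fun t => T t f) (𝓝 0) (𝓝 f)

/-- The graph of the infinitesimal generator of `T`. -/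
def generatorGraph (T : ℝ≥0 → (X →ᵇ ℝ) →L[ℝ] (X →ᵇ ℝ)) : Set ((X →ᵇ ℝ) × (X →ᵇ ℝ)) :=
  {p | Tendsto (fun t : ℝ≥0 => (t : ℝ)⁻¹ • (T t p.1 - p.1)) (𝓝[>] 0) (𝓝 p.2)}

/-- `D` is a core: it lies in the domain of the generator, and the generator is the closure of its
restriction to `D`. -/
def IsCore (T : ℝ≥0 → (X →ᵇ ℝ) →L[ℝ] (X →ᵇ ℝ)) (D : Set (X →ᵇ ℝ)) : Prop :=
  (∀ f ∈ D, ∃ g, (f, g) ∈ generatorGraph T) ∧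
    closure {p | p ∈ generatorGraph T ∧ p.1 ∈ D} = generatorGraph T

end Semigroup

/-! ### Processes with càdlàg paths -/

section Paths

/-- Right-continuous paths with left limits. -/
def IsCadlag {X : Type*} [TopologicalSpace X] (x : ℝ≥0 → X) : Prop :=
  (∀ t, ContinuousWithinAt x (Ici t) t) ∧ ∀ t, 0 < t → ∃ l, Tendsto x (𝓝[<] t) (𝓝 l)

/-- The path space `D([0,∞), X)`, with the `σ`-algebra generated by the evaluations. -/
abbrev CadlagPath (X : Type*) [TopologicalSpace X] : Type _ := {x : ℝ≥0 → X // IsCadlag x}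

/-- Convergence of a sequence of càdlàg paths in the Skorokhod (J1) topology. -/
def SkorokhodTendsto {X : Type*} [UniformSpace X] (x : ℕ → CadlagPath X) (y : CadlagPath X) :
    Prop :=
  ∃ φ : ℕ → (ℝ≥0 ≃o ℝ≥0), TendstoUniformly (fun k t => φ k t) id atTop ∧
    ∀ b, TendstoUniformlyOn (fun k t => (x k).1 (φ k t)) y.1 atTop (Iic b)

/-- Bounded Skorokhod-continuous functionals on the path space. (The Skorokhod topology is
metrizable, so that continuity is sequential, and its Borel `σ`-algebra is the one generated by the
evaluations.) -/
structure IsTestFunctional {X : Type*} [UniformSpace X] [MeasurableSpace X]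
    (F : CadlagPath X → ℝ) : Prop where
  measurable : Measurable F
  bounded : ∃ c, ∀ x, |F x| ≤ c
  continuous : ∀ x y, SkorokhodTendsto x y → Tendsto (fun k => F (x k)) atTop (𝓝 (F y))

/-- Convergence in distribution, as `h → 0`, of processes with laws `Q h` on the path space. -/
def ConvergesInLaw {X : Type*} [UniformSpace X] [MeasurableSpace X]
    (Q : ℝ≥0 → Measure (CadlagPath X)) (P : Measure (CadlagPath X)) : Prop :=
  ∀ F : CadlagPath X → ℝ, IsTestFunctional F →
    Tendsto (fun h => ∫ x, F x ∂(Q h)) (𝓝[>] 0) (𝓝 (∫ x, F x ∂P))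

/-- `P` is the law of a càdlàg Markov process with semigroup `T` started at `a`. -/
structure IsMarkovLaw {X : Type*} [TopologicalSpace X] [MeasurableSpace X]
    (T : ℝ≥0 → (X →ᵇ ℝ) →L[ℝ] (X →ᵇ ℝ)) (a : X) (P : Measure (CadlagPath X)) : Prop where
  prob : IsProbabilityMeasure P
  start : ∀ᵐ x ∂P, x.1 0 = a
  markov : ∀ (s t : ℝ≥0) (f : X →ᵇ ℝ),
    P[fun x => f (x.1 (s + t)) |
        ⨆ r : Iic s, MeasurableSpace.comap (fun x : CadlagPath X => x.1 r) inferInstance]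
      =ᵐ[P] fun x => T t f (x.1 s)

/-- `P` is the law of a discrete-time Markov chain with transition operator `U` started at `a`. -/
structure IsChainLaw {X : Type*} [TopologicalSpace X] [MeasurableSpace X]
    (U : (X →ᵇ ℝ) →L[ℝ] (X →ᵇ ℝ)) (a : X) (P : Measure (ℕ → X)) : Prop where
  prob : IsProbabilityMeasure P
  start : ∀ᵐ x ∂P, x 0 = a
  markov : ∀ (k : ℕ) (f : X →ᵇ ℝ),
    P[fun x => f (x (k + 1)) |
        ⨆ j : Iic k, MeasurableSpace.comap (fun x : ℕ → X => x j) inferInstance]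
      =ᵐ[P] fun x => U f (x k)

theorem isCadlag_comp_floor {X : Type*} [TopologicalSpace X] (h : ℝ≥0) (x : ℕ → X) :
    IsCadlag fun t : ℝ≥0 => x ⌊t / h⌋₊ := by
  rcases eq_zero_or_pos h with rfl | hh
  · simp only [div_zero, Nat.floor_zero]
    exact ⟨fun t => continuousWithinAt_const, fun t _ => ⟨_, tendsto_const_nhds⟩⟩
  refine ⟨fun t => ?_, fun t ht => ?_⟩
  · have h1 : ∀ᶠ u in 𝓝[≥] t, ⌊u / h⌋₊ = ⌊t / h⌋₊ := by
      have h2 : t < h * (⌊t / h⌋₊ + 1) := by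
        rw [← div_lt_iff₀' hh]
        exact Nat.lt_floor_add_one _
      filter_upwards [self_mem_nhdsWithin, mem_nhdsWithin_of_mem_nhds (Iio_mem_nhds h2)]
        with u hu hu'
      rw [Nat.floor_eq_iff zero_le]
      refine ⟨(Nat.floor_le zero_le).trans (div_le_div_of_nonneg_right hu hh.le), ?_⟩
      rw [div_lt_iff₀' hh]
      exact hu'
    refine ContinuousWithinAt.congr_of_eventuallyEq continuousWithinAt_const
      (f := fun _ => x ⌊t / h⌋₊) ?_ rfl
    filter_upwards [h1] with u hu
    rw [hu]
  · obtain ⟨m, hm⟩ : ∃ m : ℕ, ⌈t / h⌉₊ = m + 1 :=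
      Nat.exists_eq_succ_of_ne_zero (Nat.ceil_pos.2 (div_pos ht hh)).ne'
    refine ⟨x m, tendsto_const_nhds.congr' ?_⟩
    have h2 : h * m < t := by
      rw [← lt_div_iff₀' hh]
      refine Nat.lt_ceil.1 ?_
      omega
    filter_upwards [self_mem_nhdsWithin, mem_nhdsWithin_of_mem_nhds (Ioi_mem_nhds h2)]
      with u hu hu'
    have h3 : ⌊u / h⌋₊ = m := by
      rw [Nat.floor_eq_iff zero_le]
      refine ⟨((lt_div_iff₀' hh).2 hu').le, ?_⟩
      have h4 : t / h ≤ (m : ℝ≥0) + 1 := by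
        have := Nat.le_ceil (t / h)
        rw [hm] at this
        exact_mod_cast this
      exact ((div_lt_div_iff_of_pos_right hh).2 hu).trans_le h4
    rw [h3]

/-- The path `t ↦ x_[t/h]` of a chain observed with time step `h`. -/
def stepPath {X : Type*} [TopologicalSpace X] (h : ℝ≥0) (x : ℕ → X) : CadlagPath X :=
  ⟨fun t => x ⌊t / h⌋₊, isCadlag_comp_floor h x⟩

/-- Paths of counting processes: from `0`, nondecreasing, right-continuous, with unit jumps. -/
structure IsCountingPath (N : ℝ≥0 → ℕ) : Prop where
  zero : N 0 = 0
  mono : Monotone N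
  right_cont : ∀ t, ContinuousWithinAt N (Ici t) t
  unit_jump : ∀ t, N t ≤ Function.leftLim N t + 1

/-- The jump times of `N` in `(0, t]`. -/
def jumpTimes (N : ℝ≥0 → ℕ) (t : ℝ≥0) : Set ℝ≥0 :=
  {s | s ≤ t ∧ Function.leftLim N s ≠ N s}

end Paths

attribute [local instance] Matrix.frobeniusNormedAddCommGroup Matrix.frobeniusNormedSpace

/-! ### Differentiable functions on the state space -/

section Smooth

variable {n : ℕ}

/-- The real vector space of traceless Hermitian matrices (with the Frobenius norm), which is the
direction of the affine hull of `S(ℂⁿ)`. -/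
def TracelessHermitian (n : ℕ) : Submodule ℝ (Matrix (Fin n) (Fin n) ℂ) where
  carrier := {X | X.IsHermitian ∧ X.trace = 0}
  add_mem' := fun hX hY => ⟨hX.1.add hY.1, by rw [Matrix.trace_add, hX.2, hY.2, add_zero]⟩
  zero_mem' := ⟨Matrix.isHermitian_zero, Matrix.trace_zero _ _⟩
  smul_mem' := fun c X hX => ⟨by
    unfold Matrix.IsHermitian
    rw [Matrix.conjTranspose_smul, hX.1.eq, star_trivial], by
    rw [Matrix.trace_smul, hX.2, smul_zero]⟩

/-- The maximally mixed state `I/n`. -/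
def center (n : ℕ) : Matrix (Fin n) (Fin n) ℂ := (n : ℝ)⁻¹ • (1 : Matrix (Fin n) (Fin n) ℂ)

/-- `S(ℂⁿ)` in the affine coordinate `ρ = I/n + x`: a convex compact subset of
`TracelessHermitian n` with nonempty interior. -/
def coordDomain (n : ℕ) : Set (TracelessHermitian n) :=
  {x | IsState (center n + (x : Matrix (Fin n) (Fin n) ℂ))}

/-- The coordinate `ρ - I/n` of a state. -/
def coord (ρ : State n) : TracelessHermitian n :=
  ⟨ρ.mat - center n, by
    have hn : (n : ℝ) ≠ 0 := by
      rintro h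
      have h0 : n = 0 := by exact_mod_cast h
      subst h0
      have := ρ.trace_eq
      simp [Matrix.trace] at this
    refine ⟨ρ.posSemidef.isHermitian.sub ?_, ?_⟩
    · change (center n).conjTranspose = center n
      unfold center
      rw [Matrix.conjTranspose_smul, Matrix.conjTranspose_one, star_trivial]
    · unfold center
      rw [Matrix.trace_sub, ρ.trace_eq, Matrix.trace_smul, Matrix.trace_one, Fintype.card_fin,
        Complex.real_smul]
      have : (n : ℂ) ≠ 0 := by exact_mod_cast hn
      push_cast
      rw [inv_mul_cancel₀ this, sub_self]⟩

open Classical in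
/-- A function on `S(ℂⁿ)` in the affine coordinate (extended by the irrelevant value `0`). -/
def inCoord (f : State n →ᵇ ℝ) (x : TracelessHermitian n) : ℝ :=
  if h : IsState (center n + (x : Matrix (Fin n) (Fin n) ℂ)) then f ⟨_, h⟩ else 0

/-- The space `Cᵏ(S(ℂⁿ))`. -/
def Ck (n k : ℕ) : Set (State n →ᵇ ℝ) := {f | ContDiffOn ℝ k (inCoord f) (coordDomain n)}

/-- The norm of `Cᵏ(S(ℂⁿ))`: the sum of the sup-norms of the derivatives of order at most `k`
(finite suprema for `f` in `Ck n k`, by compactness). -/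
def ckNorm (k : ℕ) (f : State n →ᵇ ℝ) : ℝ :=
  ∑ j ∈ Finset.range (k + 1),
    ⨆ ρ : State n, ‖iteratedFDerivWithin ℝ j (inCoord f) (coordDomain n) (coord ρ)‖

end Smooth

/-! ### The counting generator and the Belavkin equation -/

section Belavkin

variable {n : ℕ}

/-- The jump intensity `tr(C*Cρ)`. -/
def jumpRate (C : Matrix (Fin n) (Fin n) ℂ) (ρ : State n) : ℝ :=
  (C.conjTranspose * C * ρ.mat).trace.re

/-- The state `CρC*/tr(CρC*)` after a jump (with irrelevant value where `tr(CρC*) = 0`). -/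
def jumpState (C : Matrix (Fin n) (Fin n) ℂ) (ρ : State n) : State n :=
  State.normalize (C * ρ.mat * C.conjTranspose) ρ

/-- The drift `-i[A,ρ] - ½{C*C,ρ} + tr(C*Cρ)ρ`. -/
def drift (A C : Matrix (Fin n) (Fin n) ℂ) (ρ : State n) : Matrix (Fin n) (Fin n) ℂ :=
  -(Complex.I • (A * ρ.mat - ρ.mat * A))
    - (1 / 2 : ℝ) • (C.conjTranspose * C * ρ.mat + ρ.mat * (C.conjTranspose * C))
    + jumpRate C ρ • ρ.mat

theorem drift_mem {A : Matrix (Fin n) (Fin n) ℂ} (hA : A.IsHermitian)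
    (C : Matrix (Fin n) (Fin n) ℂ) (ρ : State n) : drift A C ρ ∈ TracelessHermitian n := by
  have hρ := ρ.posSemidef.isHermitian.eq
  refine ⟨?_, ?_⟩
  · unfold drift Matrix.IsHermitian
    simp only [Matrix.conjTranspose_add, Matrix.conjTranspose_sub, Matrix.conjTranspose_smul,
      Matrix.conjTranspose_neg, Matrix.conjTranspose_mul, Matrix.conjTranspose_conjTranspose,
      hA.eq, hρ, star_trivial]
    have h1 : star Complex.I = -Complex.I := by simp
    rw [h1, add_comm (C.conjTranspose * C * ρ.mat), Matrix.mul_assoc C.conjTranspose C]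
    congr 2
    rw [neg_smul, neg_neg, ← smul_neg, neg_sub]
  · have him : (C.conjTranspose * C * ρ.mat).trace = (jumpRate C ρ : ℂ) := by
      have h := (ρ.posSemidef.mul_mul_conjTranspose_same C).trace_nonneg
      rw [Matrix.trace_mul_comm, ← Matrix.mul_assoc, Complex.le_def] at h
      exact Complex.ext rfl h.2.symm
    unfold drift
    rw [Matrix.trace_add, Matrix.trace_sub, Matrix.trace_neg, Matrix.trace_smul, Matrix.trace_sub,
      Matrix.trace_mul_comm A, sub_self, smul_zero, Matrix.trace_smul, Matrix.trace_add,
      Matrix.trace_mul_comm ρ.mat, him, Matrix.trace_smul, ρ.trace_eq, Complex.real_smul,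
      Complex.real_smul]
    push_cast
    ring

/-- The generator `L_count f(ρ) = (f'(ρ), b(ρ)) + tr(C*Cρ) (f(CρC*/tr(C*Cρ)) - f(ρ))`, with `b` the
drift. -/
def countGenerator {A : Matrix (Fin n) (Fin n) ℂ} (hA : A.IsHermitian)
    (C : Matrix (Fin n) (Fin n) ℂ) (f : State n →ᵇ ℝ) (ρ : State n) : ℝ :=
  fderivWithin ℝ (inCoord f) (coordDomain n) (coord ρ) ⟨drift A C ρ, drift_mem hA C ρ⟩
    + jumpRate C ρ * (f (jumpState C ρ) - f ρ)

/-- The càdlàg process `Z` and the counting process `N` solve the Belavkin equation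
`dρ = (-i[A,ρ] - ½{C*C,ρ} + tr(CρC*)ρ) dt + (CρC*/tr(CρC*) - ρ) dN`, with the state before the jump
in the integrand of `dN`, where `N` has intensity `tr(C*Cρ)`. -/
structure SolvesBelavkin (A C : Matrix (Fin n) (Fin n) ℂ) (ρ : State n)
    {Ω : Type*} {m : MeasurableSpace Ω} (P : Measure Ω) (ℱ : Filtration ℝ≥0 m)
    (Z : Ω → CadlagPath (State n)) (N : ℝ≥0 → Ω → ℕ) : Prop where
  adapted_state : ∀ t, Measurable[ℱ t] fun ω => (Z ω).1 t
  adapted_count : ∀ t, Measurable[ℱ t] (N t)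
  counting : ∀ᵐ ω ∂P, IsCountingPath fun t => N t ω
  compensated : Martingale
    (fun t ω => (N t ω : ℝ) - ∫ s in (0 : ℝ)..t, jumpRate C ((Z ω).1 s.toNNReal)) ℱ P
  equation : ∀ᵐ ω ∂P, ∀ t : ℝ≥0,
    ((Z ω).1 t).mat = ρ.mat + (∫ s in (0 : ℝ)..t, drift A C ((Z ω).1 s.toNNReal))
      + ∑ᶠ s ∈ jumpTimes (fun u => N u ω) t,
          ((jumpState C (Function.leftLim (Z ω).1 s)).mat - (Function.leftLim (Z ω).1 s).mat)

end Belavkin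

end QFilter
end

attribute [local instance] Matrix.frobeniusNormedAddCommGroup Matrix.frobeniusNormedSpace

attribute [local instance] Matrix.frobeniusNormedAddCommGroup Matrix.frobeniusNormedSpace

noncomputable section

namespace QFilter

open scoped Matrix
open Matrix (IsHermitian PosSemidef conjTranspose_add conjTranspose_apply
  conjTranspose_conjTranspose conjTranspose_mul conjTranspose_one conjTranspose_smul
  conjTranspose_sub frobeniusNormedAlgebra frobeniusNormedRing frobenius_norm_conjTranspose
  frobenius_norm_def frobenius_norm_mul kroneckerMap_apply trace_add trace_mul_comm trace_smul
  trace_sub trace_vecMulVec vecMulVec)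
open ENNReal (ofReal ofReal_add ofReal_le_ofReal ofReal_mul ofReal_ne_top ofReal_one)
open BoundedContinuousFunction (evalCLM mkOfCompact)
open NNReal (continuous_coe)
open Real (exp exp_add exp_nonneg exp_pos norm_of_nonneg)

/-! ### The cone of positive matrices and homogeneous extensions -/

section Cone

variable {n : ℕ}

/-- Complex square matrices. -/
abbrev Mat (n : ℕ) : Type := Matrix (Fin n) (Fin n) ℂ

theorem norm_sq_eq_trace (B : Mat n) : ‖B‖ ^ 2 = (Bᴴ * B).trace.re := by
  rw [frobenius_norm_def, ← Real.rpow_natCast, ← Real.rpow_mul (by positivity)]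
  norm_num
  rw [Matrix.trace, Complex.re_sum, Finset.sum_comm]
  refine Finset.sum_congr rfl fun i _ => ?_
  rw [Matrix.diag_apply, Matrix.mul_apply, Complex.re_sum]
  refine Finset.sum_congr rfl fun j _ => ?_
  rw [conjTranspose_apply, ← Complex.normSq_eq_norm_sq, Complex.star_def,
    ← Complex.normSq_eq_conj_mul_self, Complex.ofReal_re]

theorem exists_eq_conjTranspose_mul_self {X : Mat n} (hX : X.PosSemidef) :
    ∃ B : Mat n, X = Bᴴ * B := by
  open MatrixOrder Matrix.Norms.L2Operator in
  obtain ⟨B, hB⟩ := CStarAlgebra.nonneg_iff_eq_star_mul_self.1 hX.nonneg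
  exact ⟨B, hB⟩

theorem norm_le_trace {X : Mat n} (hX : X.PosSemidef) : ‖X‖ ≤ X.trace.re := by
  obtain ⟨B, rfl⟩ := exists_eq_conjTranspose_mul_self hX
  rw [← norm_sq_eq_trace, sq]
  refine (frobenius_norm_mul _ _).trans ?_
  rw [frobenius_norm_conjTranspose]

theorem trace_conj_le (W : Mat n) {X : Mat n} (hX : X.PosSemidef) :
    (W * X * Wᴴ).trace.re ≤ ‖W‖ ^ 2 * X.trace.re := by
  obtain ⟨B, rfl⟩ := exists_eq_conjTranspose_mul_self hX
  have h : (W * (Bᴴ * B) * Wᴴ).trace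
      = ((B * Wᴴ)ᴴ * (B * Wᴴ)).trace := by
    simp only [conjTranspose_mul, conjTranspose_conjTranspose, Matrix.mul_assoc]
  rw [h, ← norm_sq_eq_trace, ← norm_sq_eq_trace, ← mul_pow]
  refine pow_le_pow_left₀ (norm_nonneg _) ?_ 2
  refine (frobenius_norm_mul _ _).trans ?_
  rw [frobenius_norm_conjTranspose, mul_comm]

theorem abs_trace_re_le (X : Mat n) : |X.trace.re| ≤ n * ‖X‖ := by
  have hentry : ∀ i, ‖X i i‖ ≤ ‖X‖ := fun i => by
    refine abs_le_of_sq_le_sq' ?_ (norm_nonneg _) |>.2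
    rw [norm_sq_eq_trace, Matrix.trace, Complex.re_sum]
    have h1 : ∀ j, (Xᴴ * X).diag j = ∑ k, ((‖X k j‖ ^ 2 : ℝ) : ℂ) := fun j => by
      rw [Matrix.diag_apply, Matrix.mul_apply]
      refine Finset.sum_congr rfl fun k _ => ?_
      rw [conjTranspose_apply, ← Complex.normSq_eq_norm_sq, Complex.star_def,
        ← Complex.normSq_eq_conj_mul_self]
    simp only [h1, ← Complex.ofReal_sum, Complex.ofReal_re]
    calc ‖X i i‖ ^ 2 ≤ ∑ k, ‖X k i‖ ^ 2 :=
          Finset.single_le_sum (f := fun k => ‖X k i‖ ^ 2) (fun _ _ => by positivity)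
            (Finset.mem_univ i)
      _ ≤ _ := Finset.single_le_sum (f := fun i => ∑ k, ‖X k i‖ ^ 2)
            (fun _ _ => by positivity) (Finset.mem_univ i)
  calc |X.trace.re| ≤ ‖X.trace‖ := Complex.abs_re_le_norm _
    _ ≤ ∑ i, ‖X i i‖ := norm_sum_le _ _
    _ ≤ ∑ _i : Fin n, ‖X‖ := Finset.sum_le_sum fun i _ => hentry i
    _ = n * ‖X‖ := by simp

theorem posSemidef_norm_smul_one_add {Z : Mat n} (hZ : Z.IsHermitian) {c : ℝ} (hc : ‖Z‖ ≤ c) :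
    (c • (1 : Mat n) + Z).PosSemidef := by
  refine PosSemidef.of_dotProduct_mulVec_nonneg ?_ fun x => ?_
  · refine IsHermitian.add ?_ hZ
    unfold IsHermitian
    rw [conjTranspose_smul, conjTranspose_one, star_trivial]
  set X : Mat n := vecMulVec x (star x) with hX
  have hXp : X.PosSemidef := Matrix.posSemidef_vecMulVec_self_star x
  have htr : ∀ M : Mat n, star x ⬝ᵥ (M.mulVec x) = (M * X).trace := fun M => by
    rw [hX, Matrix.mul_vecMulVec, trace_vecMulVec, dotProduct_comm]
  have hre : ∀ M : Mat n, M.IsHermitian → (star x ⬝ᵥ (M.mulVec x)).im = 0 := fun M hM => by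
    have := hM.im_star_dotProduct_mulVec_self x
    simpa using this
  have hXn : ‖(Z * X).trace‖ ≤ ‖Z‖ * X.trace.re := by
    obtain ⟨B, hB⟩ := exists_eq_conjTranspose_mul_self hXp
    rw [hX, Matrix.mul_vecMulVec, trace_vecMulVec, trace_vecMulVec]
    have h1 : ‖Matrix.replicateCol Unit (Z.mulVec x)‖ ≤ ‖Z‖ * ‖Matrix.replicateCol Unit x‖ := by
      rw [Matrix.replicateCol_mulVec]
      exact frobenius_norm_mul _ _
    rw [Matrix.frobenius_norm_replicateCol, Matrix.frobenius_norm_replicateCol] at h1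
    have h2 := norm_inner_le_norm (𝕜 := ℂ) (WithLp.toLp 2 x : EuclideanSpace ℂ (Fin n))
      (WithLp.toLp 2 (Z.mulVec x))
    rw [EuclideanSpace.inner_toLp_toLp] at h2
    have h3 : (x ⬝ᵥ star x).re = ‖(WithLp.toLp 2 x : EuclideanSpace ℂ (Fin n))‖ ^ 2 := by
      rw [EuclideanSpace.norm_sq_eq]
      simp only [dotProduct, Complex.re_sum, Pi.star_apply, Complex.star_def, Complex.mul_conj,
        Complex.ofReal_re, Complex.normSq_eq_norm_sq]
    rw [h3]
    refine h2.trans ?_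
    calc _ ≤ ‖(WithLp.toLp 2 x : EuclideanSpace ℂ (Fin n))‖
          * (‖Z‖ * ‖(WithLp.toLp 2 x : EuclideanSpace ℂ (Fin n))‖) :=
          mul_le_mul_of_nonneg_left h1 (norm_nonneg _)
      _ = _ := by ring
  have hXt := State.trace_re_nonneg hXp
  rw [Matrix.add_mulVec, dotProduct_add, Complex.le_def]
  constructor
  · rw [Complex.add_re, htr Z, htr, Matrix.smul_mul, one_mul, trace_smul, Complex.smul_re]
    have := (abs_le.1 ((Complex.abs_re_le_norm _).trans hXn)).1
    simp only [Complex.zero_re, smul_eq_mul]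
    nlinarith
  · rw [Complex.add_im, hre Z hZ, htr, Matrix.smul_mul, one_mul, trace_smul, Complex.smul_im]
    have := (Complex.le_def.1 hXp.trace_nonneg).2
    simp only [Complex.zero_im] at this ⊢
    rw [← this]
    simp

theorem trace_im {X : Mat n} (hX : X.PosSemidef) : X.trace.im = 0 :=
  (Complex.le_def.1 hX.trace_nonneg).2.symm

theorem trace_eq_ofReal {X : Mat n} (hX : X.PosSemidef) : X.trace = (X.trace.re : ℂ) :=
  Complex.ext rfl (trace_im hX)

theorem eq_zero_of_trace {X : Mat n} (hX : X.PosSemidef) (h : X.trace.re = 0) : X = 0 :=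
  hX.trace_eq_zero_iff.1 (by rw [trace_eq_ofReal hX, h, Complex.ofReal_zero])

theorem trace_smul_re (c : ℝ) (X : Mat n) : (c • X).trace.re = c * X.trace.re := by
  rw [trace_smul, Complex.smul_re, smul_eq_mul]

theorem isState_smul {X : Mat n} (hX : X.PosSemidef) (h0 : 0 < X.trace.re) :
    IsState (X.trace.re⁻¹ • X) := by
  refine ⟨hX.smul (inv_nonneg.2 h0.le), ?_⟩
  rw [trace_smul, trace_eq_ofReal hX, Complex.ofReal_re, Complex.real_smul,
    ← Complex.ofReal_mul, inv_mul_cancel₀ h0.ne', Complex.ofReal_one]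

theorem State.ext {ρ σ : State n} (h : ρ.mat = σ.mat) : ρ = σ := Subtype.ext h

/-- The state with a given density matrix. -/
def State.mk (X : Mat n) (h : IsState X) : State n := ⟨X, h⟩

@[simp] theorem State.mk_mat (X : Mat n) (h : IsState X) : (State.mk X h).mat = X := rfl

theorem State.trace_re (ρ : State n) : ρ.mat.trace.re = 1 := by
  rw [ρ.trace_eq, Complex.one_re]

theorem State.norm_mat_le (ρ : State n) : ‖ρ.mat‖ ≤ 1 :=
  (norm_le_trace ρ.posSemidef).trans ρ.trace_re.le

open Classical in
/-- The extension of a function on states to a function on positive matrices that is homogeneous of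
degree one. -/
def hom (f : State n →ᵇ ℝ) (X : Mat n) : ℝ :=
  if h : IsState (X.trace.re⁻¹ • X) then X.trace.re * f (State.mk _ h) else 0

theorem hom_of_pos (f : State n →ᵇ ℝ) {X : Mat n} (hX : X.PosSemidef) (h0 : 0 < X.trace.re) :
    hom f X = X.trace.re * f (State.mk _ (isState_smul hX h0)) := dif_pos _

theorem hom_zero (f : State n →ᵇ ℝ) : hom f 0 = 0 := by
  unfold hom
  split_ifs <;> simp

theorem hom_eq_normalize (f : State n →ᵇ ℝ) {X : Mat n} (hX : X.PosSemidef) (σ : State n) :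
    X.trace.re * f (State.normalize X σ) = hom f X := by
  rcases (State.trace_re_nonneg hX).eq_or_lt with h0 | h0
  · rw [← h0, eq_zero_of_trace hX h0.symm, hom_zero, zero_mul]
  · rw [hom_of_pos f hX h0]
    congr 2
    exact State.ext (State.normalize_mat hX h0 σ)

theorem hom_eq_of_smul (f : State n →ᵇ ℝ) {c : ℝ} (hc : 0 ≤ c) (ρ : State n) :
    hom f (c • ρ.mat) = c * f ρ := by
  have ht : (c • ρ.mat).trace.re = c := by rw [trace_smul_re, ρ.trace_re, mul_one]
  rcases hc.eq_or_lt with rfl | h0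
  · rw [zero_smul, hom_zero, zero_mul]
  · rw [hom_of_pos f (ρ.posSemidef.smul hc) (by rwa [ht])]
    congr 1
    congr 1
    apply State.ext
    rw [State.mk_mat, ht, smul_smul, inv_mul_cancel₀ h0.ne', one_smul]

theorem hom_mat (f : State n →ᵇ ℝ) (ρ : State n) : hom f ρ.mat = f ρ := by
  have := hom_eq_of_smul f zero_le_one ρ
  rwa [one_smul, one_mul] at this

/-- A nonzero positive matrix is a positive multiple of a state. -/
theorem exists_smul_state {X : Mat n} (hX : X.PosSemidef) (h0 : 0 < X.trace.re) :
    ∃ ρ : State n, X = X.trace.re • ρ.mat :=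
  ⟨State.mk _ (isState_smul hX h0), by
    rw [State.mk_mat, smul_smul, mul_inv_cancel₀ h0.ne', one_smul]⟩

theorem eq_zero_or_exists_smul_state {X : Mat n} (hX : X.PosSemidef) :
    X = 0 ∨ ∃ (c : ℝ) (ρ : State n), 0 < c ∧ X = c • ρ.mat := by
  rcases (State.trace_re_nonneg hX).eq_or_lt with h0 | h0
  · exact Or.inl (eq_zero_of_trace hX h0.symm)
  · obtain ⟨ρ, hρ⟩ := exists_smul_state hX h0
    exact Or.inr ⟨_, ρ, h0, hρ⟩

theorem hom_smul (f : State n →ᵇ ℝ) {c : ℝ} (hc : 0 ≤ c) {X : Mat n} (hX : X.PosSemidef) :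
    hom f (c • X) = c * hom f X := by
  rcases eq_zero_or_exists_smul_state hX with rfl | ⟨d, ρ, hd, rfl⟩
  · rw [smul_zero, hom_zero, mul_zero]
  · rw [smul_smul, hom_eq_of_smul f (mul_nonneg hc hd.le), hom_eq_of_smul f hd.le, mul_assoc]

theorem abs_hom_le (f : State n →ᵇ ℝ) {X : Mat n} (hX : X.PosSemidef) :
    |hom f X| ≤ X.trace.re * ‖f‖ := by
  rcases eq_zero_or_exists_smul_state hX with rfl | ⟨d, ρ, hd, rfl⟩
  · simp [hom_zero]
  · rw [hom_eq_of_smul f hd.le, trace_smul_re, ρ.trace_re, mul_one, abs_mul, abs_of_pos hd]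
    exact mul_le_mul_of_nonneg_left (f.norm_coe_le_norm ρ) hd.le

theorem hom_nonneg {f : State n →ᵇ ℝ} (hf : 0 ≤ f) {X : Mat n} (hX : X.PosSemidef) :
    0 ≤ hom f X := by
  rcases eq_zero_or_exists_smul_state hX with rfl | ⟨d, ρ, hd, rfl⟩
  · simp [hom_zero]
  · rw [hom_eq_of_smul f hd.le]
    exact mul_nonneg hd.le (hf ρ)

theorem hom_add (f g : State n →ᵇ ℝ) (X : Mat n) : hom (f + g) X = hom f X + hom g X := by
  unfold hom
  split_ifs <;> simp [mul_add]

theorem hom_sub (f g : State n →ᵇ ℝ) (X : Mat n) : hom (f - g) X = hom f X - hom g X := by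
  unfold hom
  split_ifs <;> simp [mul_sub]

theorem hom_const_smul (c : ℝ) (f : State n →ᵇ ℝ) (X : Mat n) : hom (c • f) X = c * hom f X := by
  unfold hom
  split_ifs <;> simp [mul_left_comm]

theorem continuous_hom_comp {α : Type*} [TopologicalSpace α] {X : α → Mat n} (hX : Continuous X)
    (hpos : ∀ a, (X a).PosSemidef) (f : State n →ᵇ ℝ) : Continuous fun a => hom f (X a) := by
  have hp : Continuous fun a => (X a).trace.re := Complex.continuous_re.comp hX.matrix_trace
  rw [continuous_iff_continuousAt]
  intro a₀
  rcases (State.trace_re_nonneg (hpos a₀)).eq_or_lt with h0 | h0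
  · have hlim : Tendsto (fun a => (X a).trace.re * ‖f‖) (𝓝 a₀) (𝓝 0) := by
      have := (hp.mul_const ‖f‖).tendsto a₀
      rwa [← h0, zero_mul] at this
    rw [ContinuousAt, eq_zero_of_trace (hpos a₀) h0.symm, hom_zero]
    exact squeeze_zero_norm (fun a => abs_hom_le f (hpos a)) hlim
  · obtain ⟨σ, -⟩ := exists_smul_state (hpos a₀) h0
    have h2 : (fun a => hom f (X a)) = fun a => (X a).trace.re * f (State.normalize (X a) σ) :=
      funext fun a => (hom_eq_normalize f (hpos a) σ).symm
    rw [h2]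
    refine hp.continuousAt.mul (f.continuous.continuousAt.comp ?_)
    rw [State.isInducing_mat.continuousAt_iff]
    have h1 : ContinuousAt (fun a => (X a).trace.re⁻¹ • X a) a₀ :=
      (hp.continuousAt.inv₀ h0.ne').smul hX.continuousAt
    refine h1.congr ?_
    filter_upwards [hp.continuousAt.eventually (lt_mem_nhds h0)] with a ha
    exact (State.normalize_mat (hpos a) ha σ).symm

end Cone

/-! ### Topology of the state space -/

section Topology

variable {n : ℕ}

theorem State.isUniformInducing_mat : IsUniformInducing (State.mat : State n → Mat n) :=
  ⟨rfl⟩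

theorem isClosed_isState : IsClosed {X : Mat n | IsState X} := by
  have h : {X : Mat n | IsState X} = {X | Xᴴ = X} ∩
      (⋂ v : Fin n → ℂ, {X | 0 ≤ star v ⬝ᵥ (X.mulVec v)}) ∩ {X | X.trace = 1} := by
    ext X
    simp only [mem_ofPred_eq, mem_inter_iff, mem_iInter]
    unfold IsState
    rw [Matrix.posSemidef_iff_dotProduct_mulVec]
    rfl
  rw [h]
  refine (IsClosed.inter (isClosed_eq (by fun_prop) continuous_id) (isClosed_iInter fun v =>
    ?_)).inter
    (isClosed_eq (by fun_prop) continuous_const)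
  have hle : ∀ z : ℂ, 0 ≤ z ↔ 0 ≤ z.re ∧ z.im = 0 := fun z => by
    rw [Complex.le_def]
    simp [eq_comm]
  simp only [hle]
  have hc : Continuous fun X : Mat n => star v ⬝ᵥ (X.mulVec v) := by fun_prop
  exact (isClosed_le continuous_const (Complex.continuous_re.comp hc)).inter
    (isClosed_eq (Complex.continuous_im.comp hc) continuous_const)

theorem isCompact_isState : IsCompact {X : Mat n | IsState X} := by
  have : ProperSpace (Mat n) := FiniteDimensional.proper ℝ _
  refine Metric.isCompact_of_isClosed_isBounded isClosed_isState ?_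
  refine (Metric.isBounded_closedBall (x := (0 : Mat n)) (r := 1)).subset fun X hX => ?_
  rw [mem_closedBall_zero_iff]
  exact (State.mk X hX).norm_mat_le

instance : CompactSpace (State n) := isCompact_iff_compactSpace.1 isCompact_isState

instance : T2Space (State n) :=
  inferInstanceAs (T2Space {ρ : Matrix (Fin n) (Fin n) ℂ // IsState ρ})

instance : (uniformity (State n)).IsCountablyGenerated := by
  have : (uniformity (Mat n)).IsCountablyGenerated :=
    inferInstanceAs (uniformity (Fin n → Fin n → ℂ)).IsCountablyGenerated
  rw [← State.isUniformInducing_mat.comap_uniformity]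
  infer_instance

instance : SecondCountableTopology (State n) := by
  have : SecondCountableTopology (Mat n) :=
    inferInstanceAs (SecondCountableTopology (Fin n → Fin n → ℂ))
  exact State.isInducing_mat.secondCountableTopology

end Topology

/-! ### Operators induced by conjugations, and a Lipschitz condition -/

section ConjOp

variable {n : ℕ}

theorem posSemidef_conj (W : Mat n) {X : Mat n} (hX : X.PosSemidef) :
    (W * X * Wᴴ).PosSemidef := hX.mul_mul_conjTranspose_same W

/-- The operator `f ↦ (ρ ↦ F(WρW*))`, where `F` is the homogeneous extension of `f`. -/
def conjOp (W : Mat n) : (State n →ᵇ ℝ) →L[ℝ] (State n →ᵇ ℝ) :=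
  LinearMap.mkContinuous
    { toFun := fun f => mkOfCompact
        ⟨fun ρ => hom f (W * ρ.mat * Wᴴ), continuous_hom_comp
          (by have := State.continuous_mat (n := n); fun_prop)
          (fun ρ => posSemidef_conj W ρ.posSemidef) f⟩
      map_add' := fun f g => by
        ext ρ
        simp [hom_add]
      map_smul' := fun c f => by
        ext ρ
        simp [hom_const_smul] }
    (‖W‖ ^ 2) (fun f => by
      refine (BoundedContinuousFunction.norm_le (by positivity)).2 fun ρ => ?_
      refine (abs_hom_le f (posSemidef_conj W ρ.posSemidef)).trans ?_
      refine mul_le_mul_of_nonneg_right ?_ (norm_nonneg f)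
      have := trace_conj_le W ρ.posSemidef
      rwa [ρ.trace_re, mul_one] at this)

theorem conjOp_apply (W : Mat n) (f : State n →ᵇ ℝ) (ρ : State n) :
    conjOp W f ρ = hom f (W * ρ.mat * Wᴴ) := rfl

theorem norm_conjOp_le (W : Mat n) : ‖conjOp W‖ ≤ ‖W‖ ^ 2 :=
  LinearMap.mkContinuous_norm_le _ (by positivity) _

theorem hom_conjOp (W : Mat n) (f : State n →ᵇ ℝ) {X : Mat n} (hX : X.PosSemidef) :
    hom (conjOp W f) X = hom f (W * X * Wᴴ) := by
  rcases eq_zero_or_exists_smul_state hX with rfl | ⟨d, ρ, hd, rfl⟩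
  · simp [hom_zero]
  · rw [hom_eq_of_smul _ hd.le, conjOp_apply, Matrix.mul_smul, Matrix.smul_mul,
      hom_smul f hd.le (posSemidef_conj W ρ.posSemidef)]

theorem conjOp_mul (V W : Mat n) : conjOp V * conjOp W = conjOp (W * V) := by
  ext f ρ
  change conjOp V (conjOp W f) ρ = _
  rw [conjOp_apply, hom_conjOp _ _ (posSemidef_conj V ρ.posSemidef), conjOp_apply,
    conjTranspose_mul]
  simp only [Matrix.mul_assoc]

theorem conjOp_one : conjOp (1 : Mat n) = 1 := by
  ext f ρ
  change conjOp 1 f ρ = f ρ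
  rw [conjOp_apply, conjTranspose_one, one_mul, mul_one, hom_mat]

theorem conjOp_nonneg (W : Mat n) {f : State n →ᵇ ℝ} (hf : 0 ≤ f) : 0 ≤ conjOp W f :=
  fun ρ => hom_nonneg hf (posSemidef_conj W ρ.posSemidef)

theorem continuous_conjOp {α : Type*} [TopologicalSpace α] {W : α → Mat n} (hW : Continuous W)
    (f : State n →ᵇ ℝ) : Continuous fun a => conjOp (W a) f := by
  have h1 : Continuous fun p : α × State n => hom f (W p.1 * p.2.mat * (W p.1)ᴴ) := by
    refine continuous_hom_comp ?_ (fun p => posSemidef_conj _ p.2.posSemidef) f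
    have h2 : Continuous fun p : α × State n => W p.1 := hW.comp continuous_fst
    have h3 : Continuous fun p : α × State n => p.2.mat := State.continuous_mat.comp continuous_snd
    fun_prop
  exact (ContinuousMap.isometryEquivBoundedOfCompact (State n) ℝ).continuous.comp
    (ContinuousMap.curry ⟨_, h1⟩).continuous

/-- A Lipschitz condition for the homogeneous extension of `f`, in terms of traces of positive
increments. -/
def HLip (K : ℝ) (f : State n →ᵇ ℝ) : Prop :=
  ∀ X P : Mat n, X.PosSemidef → P.PosSemidef → |hom f (X + P) - hom f X| ≤ K * P.trace.re

namespace HLip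

variable {K L : ℝ} {f g : State n →ᵇ ℝ}

theorem mono (hf : HLip K f) (h : K ≤ L) : HLip L f := fun X P hX hP =>
  (hf X P hX hP).trans (mul_le_mul_of_nonneg_right h (State.trace_re_nonneg hP))

theorem abs_le (hf : HLip K f) (ρ : State n) : |f ρ| ≤ K := by
  have := hf 0 ρ.mat PosSemidef.zero ρ.posSemidef
  rwa [zero_add, hom_zero, sub_zero, hom_mat, ρ.trace_re, mul_one] at this

theorem norm_le (hf : HLip K f) (hK : 0 ≤ K) : ‖f‖ ≤ K :=
  (BoundedContinuousFunction.norm_le hK).2 hf.abs_le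

theorem abs_sub_le (hf : HLip K f) (hK : 0 ≤ K) {X Y : Mat n} (hX : X.PosSemidef)
    (hY : Y.PosSemidef) : |hom f X - hom f Y| ≤ 3 * n * K * ‖X - Y‖ := by
  set c := ‖X - Y‖
  have hc : (0 : ℝ) ≤ c := norm_nonneg _
  have hP : (c • (1 : Mat n)).PosSemidef := PosSemidef.one.smul hc
  have hQ : (c • (1 : Mat n) + (X - Y)).PosSemidef :=
    posSemidef_norm_smul_one_add (hX.isHermitian.sub hY.isHermitian) le_rfl
  have e : X + c • (1 : Mat n) = Y + (c • (1 : Mat n) + (X - Y)) := by abel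
  have h1 := hf X _ hX hP
  have h2 := hf Y _ hY hQ
  rw [e] at h1
  have t1 : (c • (1 : Mat n)).trace.re = n * c := by
    rw [trace_smul_re]
    simp [mul_comm]
  have t2 : (c • (1 : Mat n) + (X - Y)).trace.re ≤ 2 * n * c := by
    rw [trace_add, Complex.add_re, t1]
    have := (le_abs_self _).trans (abs_trace_re_le (X - Y))
    linarith
  rw [t1] at h1
  have h3 := mul_le_mul_of_nonneg_left t2 hK
  rw [_root_.abs_le] at h1 h2 ⊢
  constructor <;> nlinarith

theorem of_lipschitz {M : ℝ} (hM : ∀ ρ, |f ρ| ≤ M)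
    (hL : ∀ ρ σ : State n, |f ρ - f σ| ≤ L * ‖ρ.mat - σ.mat‖) (hL0 : 0 ≤ L) :
    HLip (M + 2 * L) f := by
  intro X P hX hP
  rcases eq_zero_or_exists_smul_state hP with rfl | ⟨p, π, hp, rfl⟩
  · simp
  rw [trace_smul_re, π.trace_re, mul_one]
  rcases eq_zero_or_exists_smul_state hX with rfl | ⟨x, σ, hx, rfl⟩
  · rw [zero_add, hom_zero, sub_zero, hom_eq_of_smul f hp.le, abs_mul, abs_of_pos hp, mul_comm]
    refine mul_le_mul_of_nonneg_right ((hM π).trans ?_) hp.le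
    linarith
  have hs : (x • σ.mat + p • π.mat).PosSemidef :=
    (σ.posSemidef.smul hx.le).add (π.posSemidef.smul hp.le)
  have ht : (x • σ.mat + p • π.mat).trace.re = x + p := by
    rw [trace_add, Complex.add_re, trace_smul_re, trace_smul_re, σ.trace_re, π.trace_re]
    ring
  obtain ⟨τ, hτ⟩ := exists_smul_state hs (by rw [ht]; positivity)
  rw [ht] at hτ
  have hxp : 0 < x + p := by positivity
  have e2 : x • (τ.mat - σ.mat) = p • (π.mat - τ.mat) := by
    rw [smul_sub, smul_sub, sub_eq_sub_iff_add_eq_add, ← add_smul, ← hτ, add_comm]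
  have h1 : x * ‖τ.mat - σ.mat‖ ≤ p * 2 := by
    have := congrArg norm e2
    rw [norm_smul, norm_smul, norm_of_nonneg hx.le, norm_of_nonneg hp.le] at this
    rw [this]
    refine mul_le_mul_of_nonneg_left ?_ hp.le
    refine (norm_sub_le _ _).trans ?_
    linarith [π.norm_mat_le, τ.norm_mat_le]
  rw [hτ, hom_eq_of_smul f hxp.le, hom_eq_of_smul f hx.le]
  have e3 : (x + p) * f τ - x * f σ = p * f τ + x * (f τ - f σ) := by ring
  rw [e3]
  refine (abs_add_le _ _).trans ?_
  rw [abs_mul, abs_mul, abs_of_pos hp, abs_of_pos hx]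
  have h2 := mul_le_mul_of_nonneg_left (hM τ) hp.le
  have h3 := mul_le_mul_of_nonneg_left (hL τ σ) hx.le
  have h4 := mul_le_mul_of_nonneg_left h1 hL0
  linarith

theorem add (hf : HLip K f) (hg : HLip L g) : HLip (K + L) (f + g) := fun X P hX hP => by
  have h1 := hf X P hX hP
  have h2 := hg X P hX hP
  rw [hom_add, hom_add, add_mul]
  have e : hom f (X + P) + hom g (X + P) - (hom f X + hom g X)
    = (hom f (X + P) - hom f X) + (hom g (X + P) - hom g X) := by ring
  rw [e]
  exact (abs_add_le _ _).trans (add_le_add h1 h2)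

theorem conjOp (hf : HLip K f) (hK : 0 ≤ K) (W : Mat n) : HLip (K * ‖W‖ ^ 2) (conjOp W f) :=
  fun X P hX hP => by
    rw [hom_conjOp _ _ (hX.add hP), hom_conjOp _ _ hX, Matrix.mul_add, Matrix.add_mul,
      _root_.mul_assoc K]
    exact (hf _ _ (posSemidef_conj W hX) (posSemidef_conj W hP)).trans
      (mul_le_mul_of_nonneg_left (trace_conj_le W hP) hK)

theorem conjOp_add_conjOp (hf : HLip K f) {V W : Mat n}
    (h : Vᴴ * V + Wᴴ * W = 1) :
    HLip K (QFilter.conjOp V f + QFilter.conjOp W f) := fun X P hX hP => by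
  have h1 := hf _ _ (posSemidef_conj V hX) (posSemidef_conj V hP)
  have h2 := hf _ _ (posSemidef_conj W hX) (posSemidef_conj W hP)
  have ht : (V * P * Vᴴ).trace.re + (W * P * Wᴴ).trace.re
      = P.trace.re := by
    rw [← Complex.add_re, trace_mul_comm, trace_mul_comm (W * P), ← Matrix.mul_assoc,
      ← Matrix.mul_assoc, ← trace_add, ← Matrix.add_mul, h, Matrix.one_mul]
  rw [hom_add, hom_add, hom_conjOp _ _ (hX.add hP), hom_conjOp _ _ hX, hom_conjOp _ _ (hX.add hP),
    hom_conjOp _ _ hX, ← ht, mul_add]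
  simp only [Matrix.mul_add, Matrix.add_mul]
  rw [_root_.abs_le] at h1 h2 ⊢
  constructor <;> linarith

theorem of_tendsto {ι : Type*} {l : Filter ι} [l.NeBot] {F : ι → State n →ᵇ ℝ}
    (hF : ∀ i, HLip K (F i)) (h : Tendsto F l (𝓝 f)) : HLip K f := fun X P hX hP => by
  have hc : ∀ Y : Mat n, Y.PosSemidef → Tendsto (fun i => hom (F i) Y) l (𝓝 (hom f Y)) := by
    intro Y hY
    rw [tendsto_iff_norm_sub_tendsto_zero] at h ⊢
    have h0 := h.const_mul Y.trace.re
    rw [mul_zero] at h0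
    refine squeeze_zero (fun _ => norm_nonneg _) (fun i => ?_) h0
    rw [← hom_sub]
    exact abs_hom_le _ hY
  exact le_of_tendsto ((hc _ (hX.add hP)).sub (hc _ hX)).abs
    (Eventually.of_forall fun i => hF i X P hX hP)

end HLip

end ConjOp

/-! ### The transition operator in terms of Kraus operators -/

section Kraus

variable {n : ℕ}

/-- The Kraus operators of one measurement. -/
def kraus (A B C : Mat n) (t : ℝ≥0) (j : Fin 2) : Mat n :=
  (NormedSpace.exp (-((Complex.I * (t : ℝ)) • hamiltonian A B C t))).submatrix
    (fun i => (i, j)) (fun i => (i, 0))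

variable {A B : Mat n} (hA : A.IsHermitian) (hB : B.IsHermitian) (C : Mat n) (t : ℝ≥0)
include hA hB

theorem outcome_eq (j : Fin 2) (X : Mat n) :
    outcome A B C t j X = kraus A B C t j * X * (kraus A B C t j)ᴴ := by
  unfold outcome evolved
  rw [← exp_neg_conjTranspose (hamiltonian_isHermitian hA hB C t)]
  unfold kraus
  generalize NormedSpace.exp (-((Complex.I * (t : ℝ)) • hamiltonian A B C t)) = E
  have h1 : ∀ (M : BiMat n) (i i' : Fin n) (k : Fin 2),
      ((1 : Mat n) ⊗ₖ proj j * M * ((1 : Mat n) ⊗ₖ proj j)) (i, k) (i', k)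
        = if k = j then M (i, k) (i', k) else 0 := by
    intro M i i' k
    simp only [Matrix.mul_apply, kroneckerMap_apply, proj, Matrix.single_apply,
      Fintype.sum_prod_type, Matrix.one_apply]
    by_cases hk : k = j
    · subst hk
      simp
    · have hk' : ¬ j = k := fun h => hk h.symm
      simp [hk, hk']
  ext i i'
  simp only [partialTrace, Matrix.of_apply, h1]
  rw [Finset.sum_ite_eq' Finset.univ j (fun k =>
    (E * (X ⊗ₖ proj 0) * Eᴴ) (i, k) (i', k)), if_pos (Finset.mem_univ j)]
  simp [Matrix.mul_apply, kroneckerMap_apply, proj, Matrix.single_apply,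
      Fintype.sum_prod_type, ite_and]

theorem kraus_sum : (kraus A B C t 0)ᴴ * kraus A B C t 0
    + (kraus A B C t 1)ᴴ * kraus A B C t 1 = 1 := by
  have h := exp_neg_conjTranspose (hamiltonian_isHermitian hA hB C t) t
  have h2 := exp_mul_exp_neg ((Complex.I * (t : ℝ)) • hamiltonian A B C t)
  rw [← h] at h2
  unfold kraus
  generalize NormedSpace.exp (-((Complex.I * (t : ℝ)) • hamiltonian A B C t)) = E at h2
  ext i i'
  have h3 := congrFun (congrFun h2 (i, 0)) (i', 0)
  rw [Matrix.mul_apply, Fintype.sum_prod_type] at h3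
  simp only [Fin.sum_univ_two, Finset.sum_add_distrib] at h3
  rw [Matrix.add_apply, Matrix.mul_apply, Matrix.mul_apply]
  simp only [conjTranspose_apply, Matrix.submatrix_apply] at h3 ⊢
  rw [h3]
  simp [Matrix.one_apply]

theorem transitionOp_eq :
    transitionOp hA hB C t = conjOp (kraus A B C t 0) + conjOp (kraus A B C t 1) := by
  ext f ρ
  have h : ∀ j, outcomeProb A B C t j ρ * f (outcomeState A B C t j ρ)
      = conjOp (kraus A B C t j) f ρ := fun j => by
    rw [outcomeProb, outcomeState, hom_eq_normalize f (outcome_posSemidef hA hB C t j ρ.posSemidef),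
      outcome_eq hA hB, conjOp_apply]
  change ∑ j, outcomeProb A B C t j ρ * f (outcomeState A B C t j ρ) = _
  rw [Fin.sum_univ_two, h, h]
  rfl

theorem norm_transitionOp_le : ‖transitionOp hA hB C t‖ ≤ 1 :=
  LinearMap.mkContinuous_norm_le _ zero_le_one _

theorem HLip.transitionOp {K : ℝ} {f : State n →ᵇ ℝ} (hf : HLip K f) :
    HLip K (transitionOp hA hB C t f) := by
  rw [transitionOp_eq]
  exact hf.conjOp_add_conjOp (kraus_sum hA hB C t)

theorem HLip.transitionOp_pow {K : ℝ} {f : State n →ᵇ ℝ} (hf : HLip K f) (m : ℕ) :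
    HLip K ((QFilter.transitionOp hA hB C t ^ m) f) := by
  induction m with
  | zero => exact hf
  | succ m ih =>
    rw [pow_succ']
    exact ih.transitionOp hA hB C t

theorem transitionOp_nonneg {f : State n →ᵇ ℝ} (hf : 0 ≤ f) : 0 ≤ transitionOp hA hB C t f := by
  rw [transitionOp_eq]
  exact add_nonneg (conjOp_nonneg _ hf) (conjOp_nonneg _ hf)

theorem transitionOp_one : transitionOp hA hB C t 1 = 1 := by
  ext ρ
  change ∑ j, outcomeProb A B C t j ρ * 1 = 1
  simp only [mul_one]
  exact sum_outcomeProb A B C t ρ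

end Kraus

/-! ### Asymptotics of the Kraus operators -/

section Asymptotics

attribute [local instance] frobeniusNormedRing frobeniusNormedAlgebra

theorem norm_exp_sub_sum_le {𝔸 : Type*} [NormedRing 𝔸] [NormedAlgebra ℝ 𝔸] [CompleteSpace 𝔸]
    (x : 𝔸) {N : ℕ} (hN : 0 < N) :
    ‖NormedSpace.exp x - ∑ k ∈ Finset.range N, ((k.factorial : ℝ)⁻¹) • x ^ k‖
      ≤ ‖x‖ ^ N * exp ‖x‖ := by
  have hs := NormedSpace.exp_series_hasSum_exp' (𝕂 := ℝ) x
  have hs' := (hasSum_nat_add_iff' N).2 hs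
  have hr := (NormedSpace.exp_series_hasSum_exp' (𝕂 := ℝ) ‖x‖).mul_left (‖x‖ ^ N)
  rw [← Real.exp_eq_exp_ℝ] at hr
  rw [← hs'.tsum_eq]
  refine tsum_of_norm_bounded hr fun k => ?_
  rw [norm_smul, norm_inv, Real.norm_natCast, smul_eq_mul]
  have h1 : ‖x ^ (k + N)‖ ≤ ‖x‖ ^ N * ‖x‖ ^ k := by
    rw [← pow_add, add_comm N]
    exact norm_pow_le' x (by omega)
  have h2 : ((k + N).factorial : ℝ)⁻¹ ≤ (k.factorial : ℝ)⁻¹ := by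
    refine inv_anti₀ (by positivity) ?_
    exact_mod_cast Nat.factorial_le (by omega)
  calc _ ≤ (k.factorial : ℝ)⁻¹ * (‖x‖ ^ N * ‖x‖ ^ k) :=
        mul_le_mul h2 h1 (norm_nonneg _) (by positivity)
    _ = _ := by ring

variable {n : ℕ}

/-- The block of an operator on `ℂⁿ ⊗ ℂ²` that maps the vacuum sector to the sector `j`. -/
def block (j : Fin 2) (M : BiMat n) : Mat n := M.submatrix (fun i => (i, j)) (fun i => (i, 0))

theorem block_add (j : Fin 2) (M N : BiMat n) : block j (M + N) = block j M + block j N := rfl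

theorem block_sub (j : Fin 2) (M N : BiMat n) : block j (M - N) = block j M - block j N := rfl

theorem block_smul (j : Fin 2) (c : ℝ) (M : BiMat n) : block j (c • M) = c • block j M := rfl

theorem norm_block_le (j : Fin 2) (M : BiMat n) : ‖block j M‖ ≤ ‖M‖ := by
  rw [frobenius_norm_def, frobenius_norm_def]
  refine Real.rpow_le_rpow (by positivity) ?_ (by positivity)
  simp only [block, Matrix.submatrix_apply, Fintype.sum_prod_type]
  refine Finset.sum_le_sum fun i _ => ?_
  calc ∑ i', ‖M (i, j) (i', 0)‖ ^ (2 : ℝ) ≤ ∑ i', ∑ k, ‖M (i, j) (i', k)‖ ^ (2 : ℝ) :=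
        Finset.sum_le_sum fun i' _ => Finset.single_le_sum
          (f := fun k => ‖M (i, j) (i', k)‖ ^ (2 : ℝ)) (fun _ _ => by positivity)
            (Finset.mem_univ _)
    _ ≤ _ := Finset.single_le_sum
          (f := fun l => ∑ i', ∑ k, ‖M (i, l) (i', k)‖ ^ (2 : ℝ)) (fun _ _ => by positivity)
          (Finset.mem_univ j)

/-- The diagonal part of `-iH`. -/
def diagPart (A B : Mat n) : BiMat n := -(Complex.I • (A ⊗ₖ proj 0 + B ⊗ₖ proj 1))

/-- The off-diagonal part of `-iH`, without the scaling. -/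
def offPart (C : Mat n) : BiMat n :=
  C ⊗ₖ Matrix.single 1 0 1 - Cᴴ ⊗ₖ Matrix.single 0 1 1

theorem neg_hamiltonian_eq (A B C : Mat n) (t : ℝ≥0) :
    -((Complex.I * (t : ℝ)) • hamiltonian A B C t)
      = ((√(t : ℝ)) ^ 2) • diagPart A B + √(t : ℝ) • offPart C := by
  have hs : (√(t : ℝ)) ^ 2 = t := Real.sq_sqrt t.2
  have hs' : (t : ℂ) * ((1 / √(t : ℝ) : ℝ) : ℂ) = ((√(t : ℝ) : ℝ) : ℂ) := by
    have : ((t : ℝ) : ℂ) * ((1 / √(t : ℝ) : ℝ) : ℂ) = ((t * (1 / √(t : ℝ)) : ℝ) :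
      ℂ) := by push_cast; rfl
    erw [this]
    congr 1
    rw [mul_one_div, Real.div_sqrt]
  rw [hs]
  ext ⟨i, k⟩ ⟨i', k'⟩
  simp only [hamiltonian, diagPart, offPart, Matrix.neg_apply, Matrix.smul_apply, Matrix.add_apply,
    Matrix.sub_apply, kroneckerMap_apply, smul_eq_mul, Complex.real_smul]
  rw [← hs']
  push_cast
  linear_combination ((t : ℂ) * (1 / (√(t : ℝ) : ℝ) : ℂ) *
    (Cᴴ i i' * Matrix.single 0 1 1 k k' - C i i' * Matrix.single 1 0 1 k k')) * Complex.I_mul_I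

/-- Operators that preserve the two sectors. -/
def IsEvenOp (M : BiMat n) : Prop := ∀ i i', M (i, 0) (i', 1) = 0 ∧ M (i, 1) (i', 0) = 0

/-- Operators that exchange the two sectors. -/
def IsOddOp (M : BiMat n) : Prop := ∀ i i', M (i, 0) (i', 0) = 0 ∧ M (i, 1) (i', 1) = 0

theorem IsEvenOp.mul_odd {M N : BiMat n} (hM : IsEvenOp M) (hN : IsOddOp N) : IsOddOp (M * N) :=
  fun i i' => by
    simp only [Matrix.mul_apply, Fintype.sum_prod_type, Fin.sum_univ_two]
    exact ⟨Finset.sum_eq_zero fun a _ => by rw [(hN a i').1, (hM i a).1]; simp,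
      Finset.sum_eq_zero fun a _ => by rw [(hN a i').2, (hM i a).2]; simp⟩

theorem IsOddOp.mul_even {M N : BiMat n} (hM : IsOddOp M) (hN : IsEvenOp N) : IsOddOp (M * N) :=
  fun i i' => by
    simp only [Matrix.mul_apply, Fintype.sum_prod_type, Fin.sum_univ_two]
    exact ⟨Finset.sum_eq_zero fun a _ => by rw [(hN a i').2, (hM i a).1]; simp,
      Finset.sum_eq_zero fun a _ => by rw [(hN a i').1, (hM i a).2]; simp⟩

theorem IsOddOp.mul_odd {M N : BiMat n} (hM : IsOddOp M) (hN : IsOddOp N) : IsEvenOp (M * N) :=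
  fun i i' => by
    simp only [Matrix.mul_apply, Fintype.sum_prod_type, Fin.sum_univ_two]
    exact ⟨Finset.sum_eq_zero fun a _ => by rw [(hN a i').2, (hM i a).1]; simp,
      Finset.sum_eq_zero fun a _ => by rw [(hN a i').1, (hM i a).2]; simp⟩

theorem IsOddOp.block_zero {M : BiMat n} (hM : IsOddOp M) : block 0 M = 0 :=
  Matrix.ext fun i i' => (hM i i').1

theorem IsEvenOp.block_one {M : BiMat n} (hM : IsEvenOp M) : block 1 M = 0 :=
  Matrix.ext fun i i' => (hM i i').2

theorem isEvenOp_diagPart (A B : Mat n) : IsEvenOp (diagPart A B) := fun i i' => by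
  simp [diagPart, proj, kroneckerMap_apply]

theorem isOddOp_offPart (C : Mat n) : IsOddOp (offPart C) := fun i i' => by
  simp [offPart, kroneckerMap_apply]

/-- The generator `-iA - ½C*C` of the evolution between jumps. -/
def effGen (A C : Mat n) : Mat n := -(Complex.I • A) - (1 / 2 : ℝ) • (Cᴴ * C)

theorem block_zero_second_order (A B C : Mat n) :
    block 0 (diagPart A B + (1 / 2 : ℝ) • (offPart C * offPart C)) = effGen A C := by
  ext i i'
  simp [block, diagPart, offPart, effGen, Matrix.mul_apply, kroneckerMap_apply, proj,
    Fintype.sum_prod_type, Matrix.single_apply, sub_eq_add_neg]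

theorem block_zero_one : block 0 (1 : BiMat n) = 1 := by
  ext i i'
  simp [block, Matrix.one_apply]

theorem block_one_one : block 1 (1 : BiMat n) = 0 := by
  ext i i'
  simp [block]

theorem block_one_offPart (C : Mat n) : block 1 (offPart C) = C := by
  ext i i'
  simp [block, offPart, kroneckerMap_apply]

theorem norm_exp_sub_third_order_le {D N : BiMat n} {b z : ℝ} (hD : ‖D‖ ≤ b) (hN : ‖N‖ ≤ b)
    (hz0 : 0 ≤ z) (hz1 : z ≤ 1) :
    ‖NormedSpace.exp (z ^ 2 • D + z • N) - (1 + z • N + z ^ 2 • (D + (1 / 2 : ℝ) • (N * N))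
        + z ^ 3 • ((1 / 2 : ℝ) • (D * N + N * D) + (1 / 6 : ℝ) • (N * N * N)))‖
      ≤ (16 * b ^ 4 * exp (2 * b) + (b ^ 2 + 2 * b ^ 3)) * z ^ 4 := by
  set M := z ^ 2 • D + z • N with hM
  have hb : 0 ≤ b := (norm_nonneg _).trans hD
  have hMn : ‖M‖ ≤ 2 * b * z := by
    refine (norm_add_le _ _).trans ?_
    rw [norm_smul, norm_smul, norm_of_nonneg hz0, norm_of_nonneg (by positivity)]
    nlinarith [mul_le_mul_of_nonneg_left hD (by positivity : (0 : ℝ) ≤ z ^ 2),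
      mul_le_mul_of_nonneg_left hN hz0, mul_nonneg hb hz0,
      mul_le_mul_of_nonneg_left hz1 (mul_nonneg hb hz0)]
  have h1 := norm_exp_sub_sum_le M (N := 4) (by norm_num)
  simp only [Finset.sum_range_succ, Finset.sum_range_zero, zero_add, Nat.factorial, pow_zero,
    pow_one] at h1
  norm_num at h1
  have hQ : 1 + M + (1 / 2 : ℝ) • M ^ 2 + (1 / 6 : ℝ) • M ^ 3
      - (1 + z • N + z ^ 2 • (D + (1 / 2 : ℝ) • (N * N))
        + z ^ 3 • ((1 / 2 : ℝ) • (D * N + N * D) + (1 / 6 : ℝ) • (N * N * N)))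
      = z ^ 4 • ((1 / 2 : ℝ) • (D * D) + (1 / 6 : ℝ) • (D * N * N + N * D * N + N * N * D))
        + z ^ 5 • ((1 / 6 : ℝ) • (D * D * N + D * N * D + N * D * D))
        + z ^ 6 • ((1 / 6 : ℝ) • (D * D * D)) := by
    rw [hM]
    simp only [pow_two, pow_three, add_mul, mul_add,
      smul_mul_assoc, mul_smul_comm, smul_add, smul_smul, ← mul_assoc]
    simp only [pow_succ, pow_zero, one_mul]
    module
  have hm2 : ∀ X Y : BiMat n, ‖X‖ ≤ b → ‖Y‖ ≤ b → ‖X * Y‖ ≤ b ^ 2 := fun X Y hX hY => by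
    rw [sq]
    exact (norm_mul_le _ _).trans (mul_le_mul hX hY (norm_nonneg _) hb)
  have hm3 : ∀ X Y Z : BiMat n, ‖X‖ ≤ b → ‖Y‖ ≤ b → ‖Z‖ ≤ b → ‖X * Y * Z‖ ≤ b ^ 3 :=
    fun X Y Z hX hY hZ => by
      rw [pow_succ]
      exact (norm_mul_le _ _).trans (mul_le_mul (hm2 X Y hX hY) hZ (norm_nonneg _) (by positivity))
  have hQn : ‖1 + M + (1 / 2 : ℝ) • M ^ 2 + (1 / 6 : ℝ) • M ^ 3
      - (1 + z • N + z ^ 2 • (D + (1 / 2 : ℝ) • (N * N))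
        + z ^ 3 • ((1 / 2 : ℝ) • (D * N + N * D) + (1 / 6 : ℝ) • (N * N * N)))‖
      ≤ (b ^ 2 + 2 * b ^ 3) * z ^ 4 := by
    rw [hQ]
    have z5 : z ^ 5 ≤ z ^ 4 := pow_le_pow_of_le_one hz0 hz1 (by norm_num)
    have z6 : z ^ 6 ≤ z ^ 4 := pow_le_pow_of_le_one hz0 hz1 (by norm_num)
    have e1 : ‖(1 / 2 : ℝ) • (D * D) + (1 / 6 : ℝ) • (D * N * N + N * D * N + N * N * D)‖
        ≤ b ^ 2 + b ^ 3 := by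
      refine (norm_add_le _ _).trans (add_le_add ?_ ?_)
      · rw [norm_smul]
        norm_num
        linarith [hm2 D D hD hD, norm_nonneg (D * D)]
      · rw [norm_smul]
        norm_num
        have := norm_add₃_le (a := D * N * N) (b := N * D * N) (c := N * N * D)
        linarith [hm3 _ _ _ hD hN hN, hm3 _ _ _ hN hD hN, hm3 _ _ _ hN hN hD, pow_nonneg hb 3]
    have e2 : ‖(1 / 6 : ℝ) • (D * D * N + D * N * D + N * D * D)‖ ≤ b ^ 3 / 2 := by
      rw [norm_smul]
      norm_num
      have := norm_add₃_le (a := D * D * N) (b := D * N * D) (c := N * D * D)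
      linarith [hm3 _ _ _ hD hD hN, hm3 _ _ _ hD hN hD, hm3 _ _ _ hN hD hD]
    have e3 : ‖(1 / 6 : ℝ) • (D * D * D)‖ ≤ b ^ 3 / 2 := by
      rw [norm_smul]
      norm_num
      linarith [hm3 _ _ _ hD hD hD, pow_nonneg hb 3]
    refine norm_add₃_le.trans ?_
    rw [norm_smul (z ^ 4), norm_smul (z ^ 5), norm_smul (z ^ 6),
      norm_of_nonneg (by positivity : (0 : ℝ) ≤ z ^ 4),
      norm_of_nonneg (by positivity : (0 : ℝ) ≤ z ^ 5),
      norm_of_nonneg (by positivity : (0 : ℝ) ≤ z ^ 6)]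
    have z4 : 0 ≤ z ^ 4 := by positivity
    have f1 := mul_le_mul_of_nonneg_left e1 z4
    have f2 := mul_le_mul z5 e2 (norm_nonneg _) z4
    have f3 := mul_le_mul z6 e3 (norm_nonneg _) z4
    nlinarith
  have hR : ‖M‖ ^ 4 * exp ‖M‖ ≤ 16 * b ^ 4 * exp (2 * b) * z ^ 4 := by
    have k1 : ‖M‖ ^ 4 ≤ (2 * b * z) ^ 4 := pow_le_pow_left₀ (norm_nonneg _) hMn 4
    have k2 : exp ‖M‖ ≤ exp (2 * b) := by
      refine Real.exp_le_exp.2 (hMn.trans ?_)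
      exact mul_le_of_le_one_right (by positivity) hz1
    calc _ ≤ (2 * b * z) ^ 4 * exp (2 * b) :=
          mul_le_mul k1 k2 (exp_pos _).le (by positivity)
      _ = _ := by ring
  have e : ∀ a p q : BiMat n, a - q = (a - p) + (p - q) := fun a p q => by abel
  rw [e _ (1 + M + (1 / 2 : ℝ) • M ^ 2 + (1 / 6 : ℝ) • M ^ 3)]
  refine (norm_add_le _ _).trans ?_
  rw [add_mul]
  exact add_le_add ((by norm_num at h1 ⊢; exact h1.trans hR)) hQn

theorem exists_bound_parts (n : ℕ) (R : ℝ) : ∃ b : ℝ, 0 ≤ b ∧ ∀ A B C : Mat n,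
    ‖A‖ ≤ R → ‖B‖ ≤ R → ‖C‖ ≤ R → ‖diagPart A B‖ ≤ b ∧ ‖offPart C‖ ≤ b ∧ ‖effGen A C‖ ≤ b := by
  have : ProperSpace (Mat n) := FiniteDimensional.proper ℝ _
  have hK : IsCompact (Metric.closedBall (0 : Mat n × Mat n × Mat n) R) :=
    isCompact_closedBall _ _
  have hk : ∀ E : Matrix (Fin 2) (Fin 2) ℂ, Continuous fun A : Mat n => A ⊗ₖ E := fun E => by
    refine continuous_matrix fun a b => ?_
    simp only [kroneckerMap_apply]
    exact (continuous_id.matrix_elem _ _).mul continuous_const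
  have c1 : Continuous fun p : Mat n × Mat n × Mat n => diagPart p.1 p.2.1 := by
    unfold diagPart
    exact ((((hk _).comp continuous_fst).add
      ((hk _).comp (continuous_fst.comp continuous_snd))).const_smul Complex.I).neg
  have c2 : Continuous fun p : Mat n × Mat n × Mat n => offPart p.2.2 := by
    unfold offPart
    have h2 : Continuous fun p : Mat n × Mat n × Mat n => p.2.2ᴴ := by fun_prop
    exact ((hk _).comp (continuous_snd.comp continuous_snd)).sub ((hk _).comp h2)
  have c3 : Continuous fun p : Mat n × Mat n × Mat n => effGen p.1 p.2.2 := by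
    unfold effGen
    fun_prop
  obtain ⟨b1, h1⟩ := hK.exists_bound_of_continuousOn c1.continuousOn
  obtain ⟨b2, h2⟩ := hK.exists_bound_of_continuousOn c2.continuousOn
  obtain ⟨b3, h3⟩ := hK.exists_bound_of_continuousOn c3.continuousOn
  refine ⟨|b1| + |b2| + |b3|, by positivity, fun A B C hA hB hC => ?_⟩
  have hm : (A, B, C) ∈ Metric.closedBall (0 : Mat n × Mat n × Mat n) R := by
    rw [mem_closedBall_zero_iff]
    exact norm_prod_le_iff.2 ⟨hA, norm_prod_le_iff.2 ⟨hB, hC⟩⟩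
  refine ⟨(h1 _ hm).trans ?_, (h2 _ hm).trans ?_, (h3 _ hm).trans ?_⟩ <;>
  linarith [le_abs_self b1, le_abs_self b2, le_abs_self b3, abs_nonneg b1, abs_nonneg b2,
    abs_nonneg b3]

theorem kraus_eq_block (A B C : Mat n) (t : ℝ≥0) (j : Fin 2) :
    kraus A B C t j = block j (NormedSpace.exp
      ((√(t : ℝ)) ^ 2 • diagPart A B + √(t : ℝ) • offPart C)) := by
  rw [← neg_hamiltonian_eq A B C t]
  rfl

theorem exists_bound_kraus (n : ℕ) (R : ℝ) : ∃ c : ℝ, 0 ≤ c ∧ ∀ A B C : Mat n,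
    ‖A‖ ≤ R → ‖B‖ ≤ R → ‖C‖ ≤ R → ∀ t : ℝ≥0, 0 < t → t ≤ 1 →
      ‖kraus A B C t 0 - NormedSpace.exp ((t : ℝ) • effGen A C)‖ ≤ c * (t : ℝ) ^ 2 ∧
      ‖kraus A B C t 1 - √(t : ℝ) • C‖ ≤ c * √(t : ℝ) ^ 3 := by
  obtain ⟨b, hb, hbound⟩ := exists_bound_parts n R
  set c₀ := 16 * b ^ 4 * exp (2 * b) + (b ^ 2 + 2 * b ^ 3)
  have hc₀ : 0 ≤ c₀ := by positivity
  refine ⟨c₀ + b ^ 2 * exp b + b ^ 2 + b ^ 3, by positivity, fun A B C hA hB hC t ht ht1 => ?_⟩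
  obtain ⟨hD, hN, hG⟩ := hbound A B C hA hB hC
  set z := √(t : ℝ) with hz
  have hz0 : 0 ≤ z := Real.sqrt_nonneg _
  have hz1 : z ≤ 1 := Real.sqrt_le_one.2 (by exact_mod_cast ht1)
  have hzt : z ^ 2 = t := Real.sq_sqrt t.2
  have hmain := norm_exp_sub_third_order_le hD hN hz0 hz1
  have hDe := isEvenOp_diagPart A B
  have hNo := isOddOp_offPart C
  have z43 : z ^ 4 ≤ z ^ 3 := pow_le_pow_of_le_one hz0 hz1 (by norm_num)
  constructor
  · have h0 := (norm_block_le 0 _).trans hmain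
    rw [block_sub, ← kraus_eq_block A B C t] at h0
    simp only [block_add (j := 0), block_smul, block_zero_one, hNo.block_zero,
      (hDe.mul_odd hNo).block_zero, (hNo.mul_even hDe).block_zero,
      ((hNo.mul_odd hNo).mul_odd hNo).block_zero] at h0
    rw [← block_smul, ← block_add, block_zero_second_order, hzt] at h0
    simp only [smul_zero, add_zero] at h0
    have h1 := norm_exp_sub_sum_le ((t : ℝ) • effGen A C) (N := 2) (by norm_num)
    simp only [Finset.sum_range_succ, Finset.sum_range_zero, zero_add, Nat.factorial, pow_zero,
      pow_one] at h1
    norm_num at h1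
    have ht1' : (t : ℝ) ≤ 1 := by exact_mod_cast ht1
    have h2 : ‖(t : ℝ) • effGen A C‖ ≤ t * b := by
      rw [norm_smul, norm_of_nonneg t.coe_nonneg]
      exact mul_le_mul_of_nonneg_left hG t.coe_nonneg
    have h3 : ‖(t : ℝ) • effGen A C‖ ^ 2 * exp ‖(t : ℝ) • effGen A C‖
        ≤ (t * b) ^ 2 * exp b := by
      refine mul_le_mul (pow_le_pow_left₀ (norm_nonneg _) h2 2) ?_ (exp_pos _).le
        (by positivity)
      exact Real.exp_le_exp.2 (h2.trans (mul_le_of_le_one_left hb ht1'))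
    have e : ∀ a p q : Mat n, a - q = (a - p) - (q - p) := fun a p q => by abel
    rw [e _ (1 + (t : ℝ) • effGen A C)]
    refine (norm_sub_le _ _).trans ?_
    have h1' : ‖NormedSpace.exp ((t : ℝ) • effGen A C) - (1 + (t : ℝ) • effGen A C)‖
        ≤ ‖(t : ℝ) • effGen A C‖ ^ 2 * exp ‖(t : ℝ) • effGen A C‖ := h1
    have hz4 : z ^ 4 = (t : ℝ) ^ 2 := by rw [← hzt]; ring
    rw [hz4] at h0
    have h4 := h1'.trans h3
    nlinarith [mul_nonneg (sq_nonneg b) (sq_nonneg (t : ℝ)),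
      mul_nonneg (pow_nonneg hb 3) (sq_nonneg (t : ℝ))]
  · have h0 := (norm_block_le 1 _).trans hmain
    rw [block_sub, ← kraus_eq_block A B C t] at h0
    simp only [block_add (j := 1), block_smul, block_one_one, hDe.block_one,
      (hNo.mul_odd hNo).block_one, block_one_offPart, smul_zero, add_zero, zero_add] at h0
    set Y := (1 / 2 : ℝ) • (block 1 (diagPart A B * offPart C) + block 1 (offPart C * diagPart A B))
      + (1 / 6 : ℝ) • block 1 (offPart C * offPart C * offPart C) with hY
    have hYn : ‖Y‖ ≤ b ^ 2 + b ^ 3 := by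
      have m1 : ‖block 1 (diagPart A B * offPart C)‖ ≤ b * b := (norm_block_le _ _).trans
        ((norm_mul_le _ _).trans (mul_le_mul hD hN (norm_nonneg _) hb))
      have m2 : ‖block 1 (offPart C * diagPart A B)‖ ≤ b * b := (norm_block_le _ _).trans
        ((norm_mul_le _ _).trans (mul_le_mul hN hD (norm_nonneg _) hb))
      have m3 : ‖block 1 (offPart C * offPart C * offPart C)‖ ≤ b * b * b :=
        (norm_block_le _ _).trans ((norm_mul_le _ _).trans (mul_le_mul
          ((norm_mul_le _ _).trans (mul_le_mul hN hN (norm_nonneg _) hb)) hN (norm_nonneg _)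
          (by positivity)))
      refine (norm_add_le _ _).trans ?_
      rw [norm_smul, norm_smul]
      norm_num
      have := norm_add_le (block 1 (diagPart A B * offPart C)) (block 1 (offPart C * diagPart A B))
      nlinarith [pow_nonneg hb 3]
    have e : kraus A B C t 1 - z • C = (kraus A B C t 1 -
      (z • C + z ^ 3 • Y)) + z ^ 3 • Y := by abel
    rw [e]
    refine (norm_add_le _ _).trans ?_
    rw [norm_smul, norm_of_nonneg (by positivity : (0 : ℝ) ≤ z ^ 3)]
    have z3 : 0 ≤ z ^ 3 := by positivity
    have q1 := mul_le_mul_of_nonneg_left hYn z3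
    have q2 := mul_le_mul_of_nonneg_left z43 hc₀
    have q3 : 0 ≤ b ^ 2 * exp b * z ^ 3 := by positivity
    linarith

theorem exists_bound_kraus_one_conj (n : ℕ) (R : ℝ) : ∃ c : ℝ, 0 ≤ c ∧ ∀ A B C : Mat n,
    ‖A‖ ≤ R → ‖B‖ ≤ R → ‖C‖ ≤ R → ∀ t : ℝ≥0, 0 < t → t ≤ 1 → ∀ X : Mat n, ‖X‖ ≤ 1 →
      ‖kraus A B C t 1 * X * (kraus A B C t 1)ᴴ
        - (t : ℝ) • (C * X * Cᴴ)‖ ≤ c * (t : ℝ) ^ 2 := by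
  obtain ⟨c, hc, h⟩ := exists_bound_kraus n R
  refine ⟨2 * |R| * c + c ^ 2, by positivity, fun A B C hA hB hC t ht ht1 X hX => ?_⟩
  have h1 := (h A B C hA hB hC t ht ht1).2
  set z := √(t : ℝ) with hz
  have hz0 : 0 ≤ z := Real.sqrt_nonneg _
  have hz1 : z ≤ 1 := Real.sqrt_le_one.2 (by exact_mod_cast ht1)
  have hzt : z ^ 2 = t := Real.sq_sqrt t.2
  set V := kraus A B C t 1
  have e : V * X * Vᴴ - (t : ℝ) • (C * X * Cᴴ)
      = (V - z • C) * X * (z • C)ᴴ + (z • C) * X * (V - z • C)ᴴ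
        + (V - z • C) * X * (V - z • C)ᴴ := by
    have : (t : ℝ) • (C * X * Cᴴ) = (z • C) * X * (z • C)ᴴ := by
      rw [conjTranspose_smul, star_trivial, Matrix.smul_mul, Matrix.smul_mul,
        Matrix.mul_smul, smul_smul, ← sq, hzt]
    rw [this, conjTranspose_sub]
    noncomm_ring
  have hm : ∀ P Q : Mat n, ∀ p q : ℝ, ‖P‖ ≤ p → ‖Q‖ ≤ q → ‖P * X * Qᴴ‖ ≤ p * q := by
    intro P Q p q hP hQ
    have hp : 0 ≤ p := (norm_nonneg _).trans hP
    refine (norm_mul_le _ _).trans (mul_le_mul ?_ ?_ (norm_nonneg _) hp)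
    · exact (norm_mul_le _ _).trans ((mul_le_mul hP hX (norm_nonneg _) hp).trans (mul_one p).le)
    · rwa [frobenius_norm_conjTranspose]
  have hzC : ‖z • C‖ ≤ z * |R| := by
    rw [norm_smul, norm_of_nonneg hz0]
    exact mul_le_mul_of_nonneg_left (hC.trans (le_abs_self R)) hz0
  rw [e]
  refine norm_add₃_le.trans ?_
  have a1 := hm _ _ _ _ h1 hzC
  have a2 := hm _ _ _ _ hzC h1
  have a3 := hm _ _ _ _ h1 h1
  have z6 : z ^ 6 ≤ z ^ 4 := pow_le_pow_of_le_one hz0 hz1 (by norm_num)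
  have hz4 : z ^ 4 = (t : ℝ) ^ 2 := by rw [← hzt]; ring
  rw [← hz4]
  have a4 := mul_le_mul_of_nonneg_left z6 (sq_nonneg c)
  nlinarith

end Asymptotics

/-! ### Bounded perturbations of strongly continuous groups -/

section Perturbation

variable {E F : Type*} [NormedAddCommGroup E] [NormedSpace ℝ E] [CompleteSpace E]
  [NormedAddCommGroup F] [NormedSpace ℝ F]

theorem exists_norm_le_of_strong {B : ℝ → E →L[ℝ] F} (hB : ∀ x, Continuous fun t => B t x)
    (a b : ℝ) : ∃ k : ℝ, 0 ≤ k ∧ ∀ t ∈ Icc a b, ‖B t‖ ≤ k := by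
  obtain ⟨k, hk⟩ := banach_steinhaus (g := fun t : Icc a b => B t) fun x => by
    obtain ⟨c, hc⟩ := (isCompact_Icc (a := a) (b := b)).exists_bound_of_continuousOn
      (hB x).continuousOn
    exact ⟨c, fun t => hc t t.2⟩
  exact ⟨max k 0, le_max_right _ _, fun t ht => (hk ⟨t, ht⟩).trans (le_max_left _ _)⟩

theorem continuous_strong_apply {B : ℝ → E →L[ℝ] F} (hB : ∀ x, Continuous fun t => B t x)
    {x : ℝ → E} (hx : Continuous x) : Continuous fun t => B t (x t) := by
  rw [continuous_iff_continuousAt]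
  intro t₀
  obtain ⟨k, hk0, hk⟩ := exists_norm_le_of_strong hB (t₀ - 1) (t₀ + 1)
  have h1 : Tendsto (fun t => B t (x t - x t₀)) (𝓝 t₀) (𝓝 0) := by
    have h2 : Tendsto (fun t => k * ‖x t - x t₀‖) (𝓝 t₀) (𝓝 0) := by
      have := ((hx.tendsto t₀).sub_const (x t₀)).norm.const_mul k
      simpa using this
    refine squeeze_zero_norm' ?_ h2
    filter_upwards [Icc_mem_nhds (show t₀ - 1 < t₀ by linarith) (show t₀ < t₀ + 1 by linarith)]
      with t ht
    exact (B t).le_of_opNorm_le (hk t ht) _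
  have h3 := h1.add ((hB (x t₀)).tendsto t₀)
  simpa [ContinuousAt] using h3

theorem norm_le_of_integral_eq {B : ℝ → E →L[ℝ] E} (hB : ∀ x, Continuous fun t => B t x)
    {v : ℝ → E} (hv : Continuous v) {x : E}
    (h : ∀ t, 0 ≤ t → v t = x + ∫ s in (0 : ℝ)..t, B s (v s)) {k b : ℝ}
    (hk : ∀ t ∈ Icc 0 b, ‖B t‖ ≤ k) {t : ℝ} (ht : t ∈ Icc 0 b) :
    ‖v t‖ ≤ ‖x‖ * exp (k * t) := by
  have hc := continuous_strong_apply hB hv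
  have hd : ∀ t ∈ Ico 0 b, HasDerivWithinAt v (B t (v t)) (Ici t) t := fun t ht => by
    have h1 : HasDerivAt (fun t => x + ∫ s in (0 : ℝ)..t, B s (v s)) (B t (v t)) t :=
      (intervalIntegral.integral_hasDerivAt_right (hc.intervalIntegrable _ _)
        hc.stronglyMeasurable.stronglyMeasurableAtFilter hc.continuousAt).const_add x
    exact h1.hasDerivWithinAt.congr (fun s hs => h s (ht.1.trans hs)) (h t ht.1)
  have h0 : ‖v 0‖ ≤ ‖x‖ := by simp [h 0 le_rfl]
  have := norm_le_gronwallBound_of_norm_deriv_right_le (K := k) (ε := 0) hv.continuousOn hd h0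
    (fun s hs => by
      rw [add_zero]
      exact (B s).le_of_opNorm_le (hk s ⟨hs.1, hs.2.le⟩) _) t ht
  rwa [gronwallBound_ε0, sub_zero] at this

theorem eq_of_integral_eq {B : ℝ → E →L[ℝ] E} (hB : ∀ x, Continuous fun t => B t x)
    {u v : ℝ → E} (hu : Continuous u) (hv : Continuous v) {x : E}
    (h : ∀ t, 0 ≤ t → u t = x + ∫ s in (0 : ℝ)..t, B s (u s))
    (h' : ∀ t, 0 ≤ t → v t = x + ∫ s in (0 : ℝ)..t, B s (v s)) {t : ℝ} (ht : 0 ≤ t) :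
    u t = v t := by
  obtain ⟨k, -, hk⟩ := exists_norm_le_of_strong hB 0 t
  have := norm_le_of_integral_eq hB (hu.sub hv) (x := 0) (fun s hs => by
    simp only [Pi.sub_apply, map_sub]
    rw [intervalIntegral.integral_sub
      ((continuous_strong_apply hB hu).intervalIntegrable _ _)
      ((continuous_strong_apply hB hv).intervalIntegrable _ _), h s hs, h' s hs]
    abel) hk ⟨ht, le_rfl⟩
  rw [norm_zero, zero_mul, Pi.sub_apply] at this
  exact sub_eq_zero.1 (norm_le_zero_iff.1 this)

/-- Picard iterates of the linear integral equation `v(t) = x + ∫₀ᵗ B(s)v(s) ds`. -/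
def picardTerm (B : ℝ → E →L[ℝ] E) (x : E) : ℕ → ℝ → E
  | 0 => fun _ => x
  | k + 1 => fun t => ∫ s in (0 : ℝ)..t, B s (picardTerm B x k s)

theorem continuous_picardTerm {B : ℝ → E →L[ℝ] E} (hB : ∀ x, Continuous fun t => B t x) (x : E)
    (m : ℕ) : Continuous (picardTerm B x m) := by
  induction m with
  | zero => exact continuous_const
  | succ m ih =>
    exact intervalIntegral.continuous_primitive
      (fun _ _ => (continuous_strong_apply hB ih).intervalIntegrable _ _) 0

theorem norm_picardTerm_le {B : ℝ → E →L[ℝ] E} (x : E) {k b : ℝ} (hk0 : 0 ≤ k)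
    (hk : ∀ t ∈ Icc 0 b, ‖B t‖ ≤ k) (m : ℕ) :
    ∀ t ∈ Icc 0 b, ‖picardTerm B x m t‖ ≤ ‖x‖ * ((k * t) ^ m / m.factorial) := by
  induction m with
  | zero => intro t _; simp [picardTerm]
  | succ m ih =>
    intro t ht
    have h1 : ∀ s ∈ Ioc 0 t, ‖B s (picardTerm B x m s)‖
        ≤ ‖x‖ * (k ^ (m + 1) / m.factorial) * s ^ m := fun s hs => by
      have hs' : s ∈ Icc 0 b := ⟨hs.1.le, hs.2.trans ht.2⟩
      refine ((B s).le_of_opNorm_le (hk s hs') _).trans ?_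
      refine (mul_le_mul_of_nonneg_left (ih s hs') hk0).trans (le_of_eq ?_)
      rw [mul_pow]
      ring
    have h2 : IntervalIntegrable (fun s : ℝ => ‖x‖ * (k ^
      (m + 1) / m.factorial) * s ^ m) volume 0 t :=
      (by fun_prop : Continuous _).intervalIntegrable _ _
    refine (intervalIntegral.norm_integral_le_of_norm_le ht.1
      (Eventually.of_forall h1) h2).trans (le_of_eq ?_)
    rw [intervalIntegral.integral_const_mul, integral_pow, Nat.factorial_succ, mul_pow]
    have : (m.factorial : ℝ) ≠ 0 := by positivity
    push_cast
    field_simp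
    ring

theorem exists_integral_eq {B : ℝ → E →L[ℝ] E} (hB : ∀ x, Continuous fun t => B t x) (x : E) :
    ∃ v : ℝ → E, Continuous v ∧ ∀ t, 0 ≤ t → v t = x + ∫ s in (0 : ℝ)..t, B s (v s) := by
  set w : ℝ → E := fun t => ∑' m, picardTerm B x m t with hw
  have hbd : ∀ b : ℝ, ∃ u : ℕ → ℝ, Summable u ∧
      ∀ m, ∀ t ∈ Icc 0 b, ‖picardTerm B x m t‖ ≤ u m := fun b => by
    obtain ⟨k, hk0, hk⟩ := exists_norm_le_of_strong hB 0 b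
    refine ⟨fun m => ‖x‖ * ((k * b) ^ m / m.factorial),
      (Real.summable_pow_div_factorial _).mul_left _,
      fun m t ht => (norm_picardTerm_le x hk0 hk m t ht).trans ?_⟩
    refine mul_le_mul_of_nonneg_left (div_le_div_of_nonneg_right ?_ (by positivity)) (norm_nonneg _)
    exact pow_le_pow_left₀ (mul_nonneg hk0 ht.1) (mul_le_mul_of_nonneg_left ht.2 hk0) m
  have hsum : ∀ t, 0 ≤ t → HasSum (fun m => picardTerm B x m t) (w t) := fun t ht => by
    obtain ⟨u, hu, hle⟩ := hbd t
    exact (Summable.of_norm_bounded hu fun m => hle m t ⟨ht, le_rfl⟩).hasSum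
  have hwc : ContinuousOn w (Ici 0) := fun t ht => by
    obtain ⟨u, hu, hle⟩ := hbd (t + 1)
    have h1 : ContinuousOn w (Icc 0 (t + 1)) := continuousOn_tsum
      (fun m => (continuous_picardTerm hB x m).continuousOn) hu hle
    refine (h1 t ⟨ht, by linarith⟩).mono_of_mem_nhdsWithin ?_
    rw [← Ici_inter_Iic]
    exact inter_mem self_mem_nhdsWithin (mem_nhdsWithin_of_mem_nhds (Iic_mem_nhds (by linarith)))
  have hvc : Continuous fun t : ℝ => w (max t 0) :=
    hwc.comp_continuous (by fun_prop) fun t => mem_Ici.2 (le_max_right _ _)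
  refine ⟨fun t => w (max t 0), hvc, fun t ht => ?_⟩
  obtain ⟨u, hu, hle⟩ := hbd t
  obtain ⟨k, hk0, hk⟩ := exists_norm_le_of_strong hB 0 t
  have h1 : HasSum (fun m => picardTerm B x (m + 1) t) (∫ s in (0 : ℝ)..t, B s (w (max s 0))) := by
    refine intervalIntegral.hasSum_integral_of_dominated_convergence (fun m _ => k * u m)
      (fun m => (continuous_strong_apply hB (continuous_picardTerm hB x m)).aestronglyMeasurable)
      (fun m => Eventually.of_forall fun s hs => ?_)
      (Eventually.of_forall fun _ _ => hu.mul_left k) intervalIntegrable_const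
      (Eventually.of_forall fun s hs => ?_)
    · rw [uIoc_of_le ht] at hs
      have hs' : s ∈ Icc 0 t := ⟨hs.1.le, hs.2⟩
      exact ((B s).le_of_opNorm_le (hk s hs') _).trans (mul_le_mul_of_nonneg_left (hle m s hs') hk0)
    · rw [uIoc_of_le ht] at hs
      rw [max_eq_left hs.1.le]
      exact (B s).hasSum (hsum s hs.1.le)
  have h2 := (hasSum_nat_add_iff' 1).2 (hsum t ht)
  simp only [Finset.sum_range_one] at h2
  have h3 := h1.unique h2
  beta_reduce
  rw [max_eq_left ht, h3]
  change w t = x + (w t - x)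
  abel

/-- Strongly continuous one-parameter groups. -/
structure IsC0Group (S : ℝ → E →L[ℝ] E) : Prop where
  zero : S 0 = 1
  add : ∀ s t, S (s + t) = S s * S t
  cont : ∀ x, Continuous fun t => S t x

/-- The semigroup `T` is the perturbation of the group `S` by the bounded operator `K`. -/
structure IsPerturbation (S : ℝ → E →L[ℝ] E) (K : E →L[ℝ] E) (T : ℝ → E →L[ℝ] E) : Prop where
  cont : ∀ x, Continuous fun t => T t x
  duhamel : ∀ x t, 0 ≤ t → T t x = S t x + ∫ s in (0 : ℝ)..t, S (t - s) (K (T s x))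

namespace IsC0Group

variable {S : ℝ → E →L[ℝ] E} (hS : IsC0Group S) (K : E →L[ℝ] E)
include hS

theorem apply_add (s t : ℝ) (x : E) : S (s + t) x = S s (S t x) := by rw [hS.add]; rfl

theorem apply_neg_apply (t : ℝ) (x : E) : S (-t) (S t x) = x := by
  rw [← hS.apply_add, neg_add_cancel, hS.zero]; rfl

theorem apply_apply_neg (t : ℝ) (x : E) : S t (S (-t) x) = x := by
  rw [← hS.apply_add, add_neg_cancel, hS.zero]; rfl

theorem strong_interaction (x : E) : Continuous fun t => (S (-t) * K * S t) x :=
  continuous_strong_apply (B := fun t => S (-t)) (fun x => (hS.cont x).comp continuous_neg)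
    (K.continuous.comp (hS.cont x))

theorem interaction_of_duhamel {y : ℝ → E} (hy : Continuous y) {x : E}
    (h : ∀ t, 0 ≤ t → y t = S t x + ∫ s in (0 : ℝ)..t, S (t - s) (K (y s))) {t : ℝ} (ht : 0 ≤ t) :
    S (-t) (y t) = x + ∫ s in (0 : ℝ)..t, (S (-s) * K * S s) (S (-s) (y s)) := by
  have hc : Continuous fun s => S (t - s) (K (y s)) :=
    continuous_strong_apply (B := fun s => S (t - s))
      (fun x => (hS.cont x).comp (continuous_const.sub continuous_id)) (K.continuous.comp hy)
  rw [h t ht, map_add, hS.apply_neg_apply,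
    ← ContinuousLinearMap.intervalIntegral_comp_comm _ (hc.intervalIntegrable _ _)]
  congr 1
  refine intervalIntegral.integral_congr fun s _ => ?_
  change S (-t) (S (t - s) (K (y s))) = S (-s) (K (S s (S (-s) (y s))))
  rw [hS.apply_apply_neg, ← hS.apply_add]
  congr 2
  ring

theorem eq_of_duhamel {y z : ℝ → E} (hy : Continuous y) (hz : Continuous z) {x : E}
    (h : ∀ t, 0 ≤ t → y t = S t x + ∫ s in (0 : ℝ)..t, S (t - s) (K (y s)))
    (h' : ∀ t, 0 ≤ t → z t = S t x + ∫ s in (0 : ℝ)..t, S (t - s) (K (z s))) {t : ℝ} (ht : 0 ≤ t) :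
    y t = z t := by
  have hn : ∀ x, Continuous fun t => S (-t) x := fun x => (hS.cont x).comp continuous_neg
  have := eq_of_integral_eq (hS.strong_interaction K) (continuous_strong_apply hn hy)
    (continuous_strong_apply hn hz) (fun t ht => hS.interaction_of_duhamel K hy h ht)
    (fun t ht => hS.interaction_of_duhamel K hz h' ht) ht
  have h2 := congrArg (S t) this
  rwa [hS.apply_apply_neg, hS.apply_apply_neg] at h2

theorem exists_perturbation : ∃ T : ℝ → E →L[ℝ] E, IsPerturbation S K T := by
  have hB := hS.strong_interaction K
  choose v hvc hv using exists_integral_eq hB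
  have hadd : ∀ x y t, 0 ≤ t → v (x + y) t = v x t + v y t := fun x y t ht =>
    eq_of_integral_eq hB (hvc _) ((hvc x).add (hvc y)) (hv _) (fun s hs => by
      simp only [Pi.add_apply, map_add]
      rw [intervalIntegral.integral_add
        ((continuous_strong_apply hB (hvc x)).intervalIntegrable _ _)
        ((continuous_strong_apply hB (hvc y)).intervalIntegrable _ _), hv x s hs, hv y s hs]
      abel) ht
  have hsmul : ∀ (c : ℝ) x t, 0 ≤ t → v (c • x) t = c • v x t := fun c x t ht =>
    eq_of_integral_eq hB (hvc _) ((hvc x).const_smul c) (hv _) (fun s hs => by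
      simp only [Pi.smul_apply, map_smul]
      rw [intervalIntegral.integral_smul, ← smul_add, ← hv x s hs]) ht
  have hbd : ∀ t, 0 ≤ t → ∃ c, ∀ x, ‖v x t‖ ≤ c * ‖x‖ := fun t ht => by
    obtain ⟨k, -, hk⟩ := exists_norm_le_of_strong hB 0 t
    refine ⟨exp (k * t), fun x => ?_⟩
    rw [mul_comm]
    exact norm_le_of_integral_eq hB (hvc x) (hv x) hk ⟨ht, le_rfl⟩
  let R : ℝ → E →L[ℝ] E := fun t => LinearMap.mkContinuousOfExistsBound
    { toFun := fun x => v x (max t 0)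
      map_add' := fun x y => hadd x y _ (le_max_right _ _)
      map_smul' := fun c x => hsmul c x _ (le_max_right _ _) } (hbd _ (le_max_right _ _))
  have hR : ∀ t x, R t x = v x (max t 0) := fun _ _ => rfl
  have hRc : ∀ x, Continuous fun t => R t x := fun x =>
    (hvc x).comp (continuous_id.max continuous_const)
  refine ⟨fun t => S t * R t, fun x => continuous_strong_apply hS.cont (hRc x), fun x t ht => ?_⟩
  have hc : Continuous fun s => (S (-s) * K * S s) (R s x) := continuous_strong_apply hB (hRc x)
  have h1 : R t x = x + ∫ s in (0 : ℝ)..t, (S (-s) * K * S s) (R s x) := by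
    rw [hR, max_eq_left ht, hv x t ht]
    congr 1
    refine intervalIntegral.integral_congr fun s hs => ?_
    rw [uIcc_of_le ht] at hs
    simp only [hR, max_eq_left hs.1]
  change S t (R t x) = _
  rw [h1, map_add, ← ContinuousLinearMap.intervalIntegral_comp_comm _ (hc.intervalIntegrable _ _)]
  congr 1
  refine intervalIntegral.integral_congr fun s _ => ?_
  change S t (S (-s) (K (S s (R s x)))) = S (t - s) (K (S s (R s x)))
  rw [← hS.apply_add]
  rfl

end IsC0Group

namespace IsPerturbation

variable {S : ℝ → E →L[ℝ] E} (hS : IsC0Group S) {K : E →L[ℝ] E} {T : ℝ → E →L[ℝ] E}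
  (hT : IsPerturbation S K T)
include hS hT

theorem zero : T 0 = 1 := by
  ext x
  rw [hT.duhamel x 0 le_rfl, intervalIntegral.integral_same, add_zero, hS.zero]

theorem continuous_integrand (x : E) (t : ℝ) : Continuous fun s => S (t - s) (K (T s x)) :=
  continuous_strong_apply (B := fun s => S (t - s))
    (fun x => (hS.cont x).comp (continuous_const.sub continuous_id))
    (K.continuous.comp (hT.cont x))

theorem add {s t : ℝ} (hs : 0 ≤ s) (ht : 0 ≤ t) : T (s + t) = T s * T t := by
  ext x
  change T (s + t) x = T s (T t x)
  refine hS.eq_of_duhamel K (y := fun s => T (s + t) x) (z := fun s => T s (T t x))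
    ((hT.cont x).comp (continuous_id.add continuous_const)) (hT.cont _) (fun r hr => ?_)
    (hT.duhamel (T t x)) hs
  have hc := hT.continuous_integrand hS x (r + t)
  have hc' := hT.continuous_integrand hS x t
  rw [hT.duhamel x (r + t) (by positivity), hT.duhamel x t ht, map_add, ← hS.apply_add, add_assoc,
    ← intervalIntegral.integral_add_adjacent_intervals (hc.intervalIntegrable 0 t)
      (hc.intervalIntegrable t (r + t)),
    ← ContinuousLinearMap.intervalIntegral_comp_comm _ (hc'.intervalIntegrable _ _)]
  congr 2
  · refine intervalIntegral.integral_congr fun u _ => ?_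
    rw [← hS.apply_add, ← add_sub_assoc]
  · have := intervalIntegral.integral_comp_add_right (a := 0) (b := r)
      (fun u => S (r + t - u) (K (T u x))) t
    rw [zero_add] at this
    rw [← this]
    refine intervalIntegral.integral_congr fun u _ => ?_
    congr 2
    ring

/-- The derivatives at `0` of `T` and `S` differ by `K`. -/
theorem tendsto_slope_sub (x : E) :
    Tendsto (fun t : ℝ≥0 => (t : ℝ)⁻¹ • (T t x - S t x)) (𝓝[>] 0) (𝓝 (K x)) := by
  rw [Metric.tendsto_nhdsWithin_nhds]
  intro ε hε
  have hcont : Continuous fun p : ℝ => S p x := hS.cont x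
  obtain ⟨k, hk0, hk⟩ := exists_norm_le_of_strong hS.cont 0 1
  have h1 : Tendsto (fun s => k * ‖K (T s x) - K x‖) (𝓝 0) (𝓝 0) := by
    have := ((K.continuous.comp (hT.cont x)).tendsto 0).sub_const (K x)
    rw [Function.comp_apply, hT.zero hS] at this
    simpa using this.norm.const_mul k
  have h2 : Tendsto (fun s => ‖S s (K x) - K x‖) (𝓝 0) (𝓝 0) := by
    have := ((hS.cont (K x)).tendsto 0).sub_const (K x)
    rw [hS.zero] at this
    simpa using this.norm
  obtain ⟨δ₁, hδ₁, hd₁⟩ := Metric.tendsto_nhds_nhds.1 h1 (ε / 4) (by positivity)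
  obtain ⟨δ₂, hδ₂, hd₂⟩ := Metric.tendsto_nhds_nhds.1 h2 (ε / 4) (by positivity)
  refine ⟨min 1 (min δ₁ δ₂), by positivity, fun t ht htd => ?_⟩
  have ht0 : (0 : ℝ) < t := ht
  rw [NNReal.dist_eq, NNReal.coe_zero, sub_zero, abs_of_pos ht0] at htd
  have htd1 : (t : ℝ) < 1 := htd.trans_le (min_le_left _ _)
  have htd2 : (t : ℝ) < δ₁ := htd.trans_le ((min_le_right _ _).trans (min_le_left _ _))
  have htd3 : (t : ℝ) < δ₂ := htd.trans_le ((min_le_right _ _).trans (min_le_right _ _))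
  have hb : ∀ s ∈ uIoc (0 : ℝ) t, ‖S (t - s) (K (T s x)) - K x‖ ≤ ε / 2 := fun s hs => by
    rw [uIoc_of_le ht0.le] at hs
    have e : S (t - s) (K (T s x)) - K x
        = S (t - s) (K (T s x) - K x) + (S (t - s) (K x) - K x) := by
      rw [map_sub]; abel
    rw [e]
    have a1 := hd₁ (x := s) (by rw [Real.dist_eq, sub_zero, abs_of_pos hs.1]; linarith [hs.2])
    have a2 := hd₂ (x := t - s) (by
      rw [Real.dist_eq, sub_zero, abs_of_nonneg (by linarith [hs.2])]; linarith [hs.1])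
    rw [Real.dist_eq, sub_zero] at a1 a2
    have a3 := (S (t - s)).le_of_opNorm_le (hk (t - s) ⟨by linarith [hs.2], by linarith [hs.1]⟩)
      (K (T s x) - K x)
    have := norm_add_le (S (t - s) (K (T s x) - K x)) (S (t - s) (K x) - K x)
    linarith [le_abs_self (k * ‖K (T s x) - K x‖), le_abs_self ‖S (t - s) (K x) - K x‖]
  have hint := intervalIntegral.norm_integral_le_of_norm_le_const hb
  rw [intervalIntegral.integral_sub ((hT.continuous_integrand hS x t).intervalIntegrable _ _)
    intervalIntegrable_const, intervalIntegral.integral_const, sub_zero, abs_of_pos ht0] at hint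
  have e : (t : ℝ)⁻¹ • (T t x - S t x) - K x
      = (t : ℝ)⁻¹ • ((∫ s in (0 : ℝ)..t, S (t - s) (K (T s x))) - (t : ℝ) • K x) := by
    rw [hT.duhamel x t ht0.le, add_sub_cancel_left, smul_sub, smul_smul, inv_mul_cancel₀ ht0.ne',
      one_smul]
  rw [dist_eq_norm, e, norm_smul, norm_inv, norm_of_nonneg ht0.le, inv_mul_lt_iff₀ ht0]
  nlinarith

end IsPerturbation

omit [CompleteSpace E] in
/-- Perturbed semigroups are intertwined if the groups and the perturbations are. -/
theorem IsPerturbation.intertwine [CompleteSpace E] [CompleteSpace F] {S : ℝ → E →L[ℝ] E}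
    (hS : IsC0Group S) {K : E →L[ℝ] E} {T : ℝ → E →L[ℝ] E} (hT : IsPerturbation S K T)
    {S' : ℝ → F →L[ℝ] F} {K' : F →L[ℝ] F} {T' : ℝ → F →L[ℝ] F} (hS' : IsC0Group S')
    (hT' : IsPerturbation S' K' T') (π : F →L[ℝ] E) (h1 : ∀ t x, π (S' t x) = S t (π x))
    (h2 : ∀ x, π (K' x) = K (π x)) {t : ℝ} (ht : 0 ≤ t) (x : F) : π (T' t x) = T t (π x) := by
  refine hS.eq_of_duhamel K (y := fun t => π (T' t x)) (π.continuous.comp (hT'.cont x))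
    (hT.cont (π x)) (fun s hs => ?_) (hT.duhamel (π x)) ht
  rw [hT'.duhamel x s hs, map_add, h1, ← ContinuousLinearMap.intervalIntegral_comp_comm _
    ((hT'.continuous_integrand hS' x s).intervalIntegrable _ _)]
  congr 1
  refine intervalIntegral.integral_congr fun u _ => ?_
  change π (S' (s - u) (K' (T' u x))) = _
  rw [h1, h2]

end Perturbation

/-! ### Generators and cores -/

section Generators

variable {E : Type*} [NormedAddCommGroup E] [NormedSpace ℝ E]

/-- Strongly continuous one-parameter semigroups. -/
structure IsC0Semigroup (T : ℝ → E →L[ℝ] E) : Prop where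
  zero : T 0 = 1
  add : ∀ s t, 0 ≤ s → 0 ≤ t → T (s + t) = T s * T t
  cont : ∀ x, Continuous fun t => T t x

theorem IsC0Group.toSemigroup {S : ℝ → E →L[ℝ] E} (hS : IsC0Group S) : IsC0Semigroup S :=
  ⟨hS.zero, fun s t _ _ => hS.add s t, hS.cont⟩

theorem IsPerturbation.toSemigroup [CompleteSpace E] {S : ℝ → E →L[ℝ] E} (hS : IsC0Group S)
    {K : E →L[ℝ] E} {T : ℝ → E →L[ℝ] E} (hT : IsPerturbation S K T) : IsC0Semigroup T :=
  ⟨hT.zero hS, fun _ _ hs ht => hT.add hS hs ht, hT.cont⟩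

theorem integral_mem_of_closed_submodule [CompleteSpace E] {M : Submodule ℝ E}
    (hM : IsClosed (M : Set E)) {φ : ℝ → E} (hφ : Continuous φ) {t : ℝ} (ht : 0 ≤ t)
    (h : ∀ s, 0 ≤ s → φ s ∈ M) : ∫ s in (0 : ℝ)..t, φ s ∈ M := by
  rcases ht.eq_or_lt with rfl | ht
  · rw [intervalIntegral.integral_same]
    exact M.zero_mem
  rw [intervalIntegral.integral_of_le ht.le]
  have h1 : (⨍ s in Ioc 0 t, φ s) ∈ (M : Set E) := by
    refine Convex.set_average_mem M.convex hM (by simp [ht]) (by simp) ?_ ?_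
    · filter_upwards [ae_restrict_mem measurableSet_Ioc] with s hs using h s hs.1.le
    · exact hφ.integrableOn_Ioc
  rw [setAverage_eq] at h1
  have h2 := M.smul_mem (volume.real (Ioc 0 t)) h1
  rwa [smul_smul, mul_inv_cancel₀ (by simp [ht.le, ht.ne']), one_smul] at h2

theorem tendsto_coe_nhdsGT : Tendsto ((↑) : ℝ≥0 → ℝ) (𝓝[>] 0) (𝓝[>] 0) := by
  refine tendsto_nhdsWithin_iff.2 ⟨?_, ?_⟩
  · have := (continuous_coe.tendsto 0).mono_left (nhdsWithin_le_nhds (s := Ioi 0))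
    simpa using this
  · filter_upwards [self_mem_nhdsWithin] with t ht
    exact NNReal.coe_pos.2 ht

theorem tendsto_average {φ : ℝ → E} [CompleteSpace E] (hφ : Continuous φ) :
    Tendsto (fun t : ℝ≥0 => (t : ℝ)⁻¹ • ∫ s in (0 : ℝ)..t, φ s) (𝓝[>] 0) (𝓝 (φ 0)) := by
  have h1 : HasDerivAt (fun t => ∫ s in (0 : ℝ)..t, φ s) (φ 0) 0 :=
    intervalIntegral.integral_hasDerivAt_right (hφ.intervalIntegrable _ _)
      hφ.stronglyMeasurable.stronglyMeasurableAtFilter hφ.continuousAt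
  have h2 := hasDerivAt_iff_tendsto_slope_zero.1 h1
  simp only [zero_add, intervalIntegral.integral_same, sub_zero] at h2
  exact h2.comp (tendsto_coe_nhdsGT.mono_right (nhdsWithin_mono _ fun x (hx : 0 < x) => hx.ne'))

variable {X : Type*} [TopologicalSpace X]

/-- The restriction of a family of operators to nonnegative times. -/
def nnTime (T : ℝ → E →L[ℝ] E) (t : ℝ≥0) : E →L[ℝ] E := T t

namespace IsC0Semigroup

variable {T : ℝ → (X →ᵇ ℝ) →L[ℝ] (X →ᵇ ℝ)} (hT : IsC0Semigroup T)
include hT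

theorem hasDerivWithinAt {f g : X →ᵇ ℝ} (h : (f, g) ∈ generatorGraph (nnTime T)) {t : ℝ}
    (ht : 0 ≤ t) : HasDerivWithinAt (fun s => T s f) (T t g) (Ici t) t := by
  rw [← hasDerivWithinAt_Ioi_iff_Ici, hasDerivWithinAt_iff_tendsto_slope' self_notMem_Ioi]
  have h1 : Tendsto (fun s : ℝ => (s - t).toNNReal) (𝓝[>] t) (𝓝[>] 0) := by
    refine tendsto_nhdsWithin_iff.2 ⟨?_, ?_⟩
    · have : Continuous fun s : ℝ => (s - t).toNNReal := by fun_prop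
      have := (this.tendsto t).mono_left (nhdsWithin_le_nhds (s := Ioi t))
      simpa using this
    · filter_upwards [self_mem_nhdsWithin] with s hs
      exact Real.toNNReal_pos.2 (sub_pos.2 hs)
  have h2 := ((T t).continuous.tendsto g).comp ((show Tendsto _ _ _ from h).comp h1)
  refine h2.congr' ?_
  filter_upwards [self_mem_nhdsWithin] with s hs
  have hst : 0 ≤ s - t := (sub_pos.2 hs).le
  simp only [Function.comp_apply, slope, vsub_eq_sub, nnTime, Real.coe_toNNReal _ hst, map_smul,
    map_sub]
  rw [show T s f = T t (T (s - t) f) by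
    conv_lhs => rw [show s = t + (s - t) by ring, hT.add _ _ ht hst]
    rfl]

theorem mem_generatorGraph_iff {f g : X →ᵇ ℝ} : (f, g) ∈ generatorGraph (nnTime T) ↔
    ∀ t, 0 ≤ t → T t f - f = ∫ s in (0 : ℝ)..t, T s g := by
  constructor
  · intro h t ht
    rw [intervalIntegral.integral_eq_sub_of_hasDeriv_right (hT.cont f).continuousOn
      (fun s hs => ((hT.hasDerivWithinAt h
        ((le_min le_rfl ht).trans hs.1.le)).mono Ioi_subset_Ici_self))
      ((hT.cont g).intervalIntegrable _ _), hT.zero]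
    rfl
  · intro h
    have h1 := tendsto_average (hT.cont g)
    rw [hT.zero] at h1
    refine h1.congr fun t => ?_
    rw [← h t t.2]
    rfl

theorem exists_integral_clm (t : ℝ) : ∃ J : (X →ᵇ ℝ) →L[ℝ] (X →ᵇ ℝ),
    ∀ g, J g = ∫ s in (0 : ℝ)..t, T s g := by
  obtain ⟨k, hk0, hk⟩ := exists_norm_le_of_strong hT.cont (min 0 t) (max 0 t)
  refine ⟨LinearMap.mkContinuous
    { toFun := fun g => ∫ s in (0 : ℝ)..t, T s g
      map_add' := fun f g => by
        simp only [map_add]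
        exact intervalIntegral.integral_add ((hT.cont f).intervalIntegrable _ _)
          ((hT.cont g).intervalIntegrable _ _)
      map_smul' := fun c f => by
        simp only [map_smul]
        exact intervalIntegral.integral_smul _ _ } (k * |t|) (fun g => ?_), fun _ => rfl⟩
  have := intervalIntegral.norm_integral_le_of_norm_le_const (a := 0) (b := t) (C := k * ‖g‖)
    (f := fun s => T s g) fun s hs => (T s).le_of_opNorm_le
      (hk s (uIcc_of_le (α := ℝ) (min_le_max (a := 0) (b := t)) ▸ by
        rw [uIcc_of_le min_le_max]; exact ⟨hs.1.le, hs.2⟩)) g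
  rw [sub_zero] at this
  refine this.trans (le_of_eq ?_)
  ring

theorem isClosed_generatorGraph : IsClosed (generatorGraph (nnTime T)) := by
  have h : generatorGraph (nnTime T)
      = ⋂ t ∈ Ici (0 : ℝ), {p | T t p.1 - p.1 = ∫ s in (0 : ℝ)..t, T s p.2} := by
    ext ⟨f, g⟩
    rw [hT.mem_generatorGraph_iff]
    simp
  rw [h]
  refine isClosed_biInter fun t _ => ?_
  obtain ⟨J, hJ⟩ := hT.exists_integral_clm t
  simp only [← hJ]
  exact isClosed_eq (((T t).continuous.comp continuous_fst).sub continuous_fst)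
    (J.continuous.comp continuous_snd)

theorem generator_apply {f g : X →ᵇ ℝ} (h : (f, g) ∈ generatorGraph (nnTime T)) {s : ℝ}
    (hs : 0 ≤ s) : (T s f, T s g) ∈ generatorGraph (nnTime T) := by
  have h1 := ((T s).continuous.tendsto g).comp (show Tendsto _ _ _ from h)
  refine h1.congr fun t => ?_
  have e : T s (T t f) = T t (T s f) := by
    change (T s * T t) f = (T t * T s) f
    rw [← hT.add s t hs t.coe_nonneg, ← hT.add t s t.coe_nonneg hs, add_comm]
  simp only [Function.comp_apply, nnTime, map_smul, map_sub, e]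

/-- A dense invariant subspace of the domain is a core. -/
theorem isCore_of_dense {D : Submodule ℝ (X →ᵇ ℝ)} (hD : Dense (D : Set (X →ᵇ ℝ)))
    (hinv : ∀ t, 0 ≤ t → ∀ f ∈ D, T t f ∈ D)
    (hdom : ∀ f ∈ D, ∃ g, (f, g) ∈ generatorGraph (nnTime T)) :
    IsCore (nnTime T) (D : Set (X →ᵇ ℝ)) := by
  refine ⟨hdom, Subset.antisymm (closure_minimal (fun p hp => hp.1) hT.isClosed_generatorGraph) ?_⟩
  let M : Submodule ℝ ((X →ᵇ ℝ) × (X →ᵇ ℝ)) :=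
    { carrier := {p | p ∈ generatorGraph (nnTime T) ∧ p.1 ∈ D}
      add_mem' := fun {p q} hp hq => ⟨by
        have := (show Tendsto _ _ _ from hp.1).add (show Tendsto _ _ _ from hq.1)
        refine this.congr fun t => ?_
        rw [← smul_add, Prod.fst_add, map_add]
        congr 1
        abel, D.add_mem hp.2 hq.2⟩
      zero_mem' := ⟨by simp [generatorGraph], D.zero_mem⟩
      smul_mem' := fun c p hp => ⟨by
        have := (show Tendsto _ _ _ from hp.1).const_smul c
        refine this.congr fun t => ?_
        rw [smul_comm, Prod.smul_fst, map_smul, smul_sub], D.smul_mem c hp.2⟩ }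
  have hMc : (M.topologicalClosure : Set _)
      = closure {p | p ∈ generatorGraph (nnTime T) ∧ p.1 ∈ (D : Set (X →ᵇ ℝ))} := rfl
  rw [← hMc]
  have h1 : ∀ t, 0 ≤ t → ∀ f ∈ D, ((∫ s in (0 : ℝ)..t, T s f),
    T t f - f) ∈ M.topologicalClosure := by
    intro t ht f hf
    obtain ⟨g, hg⟩ := hdom f hf
    have h2 := integral_mem_of_closed_submodule M.isClosed_topologicalClosure
      ((hT.cont f).prodMk (hT.cont g)) ht (fun s hs => M.le_topologicalClosure
        (show (T s f, T s g) ∈ M from ⟨hT.generator_apply hg hs, hinv s hs f hf⟩))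
    have h3 : ∫ s in (0 : ℝ)..t, (T s f, T s g)
        = ((∫ s in (0 : ℝ)..t, T s f), ∫ s in (0 : ℝ)..t, T s g) := by
      have hi : IntervalIntegrable (fun s => (T s f, T s g)) volume 0 t :=
        ((hT.cont f).prodMk (hT.cont g)).intervalIntegrable _ _
      refine Prod.ext ?_ ?_
      · exact (ContinuousLinearMap.intervalIntegral_comp_comm
          (ContinuousLinearMap.fst ℝ (X →ᵇ ℝ) (X →ᵇ ℝ)) hi).symm
      · exact (ContinuousLinearMap.intervalIntegral_comp_comm
          (ContinuousLinearMap.snd ℝ (X →ᵇ ℝ) (X →ᵇ ℝ)) hi).symm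
    rw [h3, ← hT.mem_generatorGraph_iff.1 hg t ht] at h2
    exact h2
  have h2 : ∀ t, 0 ≤ t → ∀ f, ((∫ s in (0 : ℝ)..t, T s f), T t f - f) ∈ M.topologicalClosure := by
    intro t ht f
    obtain ⟨J, hJ⟩ := hT.exists_integral_clm t
    have hc : Continuous fun f => (J f, T t f - f) :=
      J.continuous.prodMk ((T t).continuous.sub continuous_id)
    have := (M.isClosed_topologicalClosure.preimage hc).closure_subset_iff.2
      (fun f hf => by
        change (J f, T t f - f) ∈ M.topologicalClosure
        rw [hJ]
        exact h1 t ht f hf) (hD f)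
    rw [← hJ]
    exact this
  rintro ⟨f, g⟩ hfg
  have h3 := tendsto_average (hT.cont f)
  rw [hT.zero] at h3
  refine M.isClosed_topologicalClosure.mem_of_tendsto (h3.prodMk_nhds (show Tendsto _ _ _ from hfg))
    (Eventually.of_forall fun t => ?_)
  exact M.topologicalClosure.smul_mem (t : ℝ)⁻¹ (h2 t t.2 f)

end IsC0Semigroup

theorem IsPerturbation.mem_generatorGraph_iff {S : ℝ → (X →ᵇ ℝ) →L[ℝ] (X →ᵇ ℝ)}
    (hS : IsC0Group S) {K : (X →ᵇ ℝ) →L[ℝ] (X →ᵇ ℝ)} {T : ℝ → (X →ᵇ ℝ) →L[ℝ] (X →ᵇ ℝ)}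
    (hT : IsPerturbation S K T) {f g : X →ᵇ ℝ} :
    (f, g + K f) ∈ generatorGraph (nnTime T) ↔ (f, g) ∈ generatorGraph (nnTime S) := by
  have h := hT.tendsto_slope_sub hS f
  have e : ∀ t : ℝ≥0, (t : ℝ)⁻¹ • (T t f - f) = (t : ℝ)⁻¹ • (S t f - f) + (t : ℝ)⁻¹ •
    (T t f - S t f) :=
    fun t => by rw [← smul_add]; congr 1; abel
  have e' : ∀ t : ℝ≥0, (t : ℝ)⁻¹ • (S t f - f) = (t : ℝ)⁻¹ • (T t f - f) - (t : ℝ)⁻¹ •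
    (T t f - S t f) :=
    fun t => eq_sub_of_add_eq (e t).symm
  constructor
  · intro h1
    have := (show Tendsto _ _ _ from h1).sub h
    rw [add_sub_cancel_right] at this
    exact this.congr fun t => (e' t).symm
  · intro h1
    exact ((show Tendsto _ _ _ from h1).add h).congr fun t => (e t).symm

theorem IsPerturbation.isCore {S : ℝ → (X →ᵇ ℝ) →L[ℝ] (X →ᵇ ℝ)}
    (hS : IsC0Group S) {K : (X →ᵇ ℝ) →L[ℝ] (X →ᵇ ℝ)} {T : ℝ → (X →ᵇ ℝ) →L[ℝ] (X →ᵇ ℝ)}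
    (hT : IsPerturbation S K T) {D : Set (X →ᵇ ℝ)} (h : IsCore (nnTime S) D) :
    IsCore (nnTime T) D := by
  refine ⟨fun f hf => (h.1 f hf).imp' (fun g => g + K f) fun g hg =>
    (hT.mem_generatorGraph_iff hS).2 hg, ?_⟩
  let Φ : (X →ᵇ ℝ) × (X →ᵇ ℝ) ≃ₜ (X →ᵇ ℝ) × (X →ᵇ ℝ) :=
    { toFun := fun p => (p.1, p.2 + K p.1)
      invFun := fun p => (p.1, p.2 - K p.1)
      left_inv := fun p => by simp
      right_inv := fun p => by simp
      continuous_toFun := by fun_prop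
      continuous_invFun := by fun_prop }
  have hmem : ∀ p, Φ p ∈ generatorGraph (nnTime T) ↔ p ∈ generatorGraph (nnTime S) := fun p =>
    hT.mem_generatorGraph_iff hS
  have h1 : generatorGraph (nnTime S) = Φ ⁻¹' generatorGraph (nnTime T) := by
    ext p
    exact (hmem p).symm
  have h2 : {p | p ∈ generatorGraph (nnTime S) ∧ p.1 ∈ D}
      = Φ ⁻¹' {p | p ∈ generatorGraph (nnTime T) ∧ p.1 ∈ D} := by
    ext p
    exact and_congr_left fun _ => (hmem p).symm
  have h3 := h.2
  rw [h2, h1, ← Φ.preimage_closure] at h3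
  exact Φ.surjective.preimage_injective h3

end Generators

/-! ### Affine coordinates -/

section Coordinates

attribute [local instance] frobeniusNormedRing frobeniusNormedAlgebra

variable {n : ℕ}

/-- The conjugate transpose as a continuous real-linear map. -/
def conjTransposeL (n : ℕ) : Mat n →L[ℝ] Mat n :=
  LinearMap.toContinuousLinearMap
    { toFun := fun M => Mᴴ
      map_add' := conjTranspose_add
      map_smul' := fun c M => by
        rw [conjTranspose_smul, star_trivial, RingHom.id_apply] }

theorem conjTransposeL_apply (M : Mat n) : conjTransposeL n M = Mᴴ := rfl

/-- The real part of the trace as a continuous real-linear map. -/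
def traceL (n : ℕ) : Mat n →L[ℝ] ℝ :=
  LinearMap.toContinuousLinearMap
    { toFun := fun M => M.trace.re
      map_add' := fun M N => by rw [trace_add, Complex.add_re]
      map_smul' := fun c M => trace_smul_re c M }

theorem traceL_apply (M : Mat n) : traceL n M = M.trace.re := rfl

theorem center_isHermitian (n : ℕ) : (center n).IsHermitian := by
  unfold center IsHermitian
  rw [conjTranspose_smul, conjTranspose_one, star_trivial]

theorem IsHermitian.trace_im {M : Mat n} (hM : M.IsHermitian) : M.trace.im = 0 := by
  have := Matrix.trace_conjTranspose M
  rw [hM.eq] at this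
  exact Complex.conj_eq_iff_im.1 this.symm

variable [NeZero n]

theorem trace_center : (center n).trace = 1 := by
  unfold center
  rw [trace_smul, Matrix.trace_one, Fintype.card_fin, Complex.real_smul]
  have : (n : ℂ) ≠ 0 := by exact_mod_cast NeZero.ne n
  push_cast
  rw [inv_mul_cancel₀ this]

/-- The projection onto the traceless Hermitian matrices. -/
def tracelessL (n : ℕ) [NeZero n] : Mat n →L[ℝ] TracelessHermitian n :=
  LinearMap.toContinuousLinearMap
    { toFun := fun M => ⟨(1 / 2 : ℝ) • (M + Mᴴ)
        - ((1 / 2 : ℝ) • (M + Mᴴ)).trace.re • center n, by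
          have h : ((1 / 2 : ℝ) • (M + Mᴴ)).IsHermitian := by
            unfold IsHermitian
            rw [conjTranspose_smul, conjTranspose_add,
              conjTranspose_conjTranspose, star_trivial, add_comm]
          refine ⟨h.sub ?_, ?_⟩
          · unfold IsHermitian
            rw [conjTranspose_smul, star_trivial, (center_isHermitian n).eq]
          · rw [trace_sub, trace_smul _ (center n), trace_center, Complex.real_smul,
              mul_one]
            exact sub_eq_zero.2 (Complex.ext rfl (IsHermitian.trace_im h))⟩
      map_add' := fun M N => by
        apply Subtype.ext
        simp only [Submodule.coe_add, conjTranspose_add, trace_smul, trace_add,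
          Complex.smul_re, Complex.add_re]
        module
      map_smul' := fun c M => by
        apply Subtype.ext
        simp only [SetLike.val_smul, conjTranspose_smul, star_trivial, trace_smul,
          trace_add, Complex.smul_re, Complex.add_re, RingHom.id_apply, smul_eq_mul]
        module }

theorem coe_tracelessL {M : Mat n} (hM : M.IsHermitian) :
    (tracelessL n M : Mat n) = M - M.trace.re • center n := by
  have h : (1 / 2 : ℝ) • (M + Mᴴ) = M := by
    rw [hM.eq]
    module
  change (1 / 2 : ℝ) • (M + Mᴴ)
        - ((1 / 2 : ℝ) • (M + Mᴴ)).trace.re • center n = _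
  rw [h]

omit [NeZero n] in
theorem coe_coord (ρ : State n) : (coord ρ : Mat n) = ρ.mat - center n := rfl

omit [NeZero n] in
theorem center_add_coord (ρ : State n) : center n + (coord ρ : Mat n) = ρ.mat := by
  rw [coe_coord]; abel

omit [NeZero n] in
theorem coord_mem (ρ : State n) : coord ρ ∈ coordDomain n := by
  change IsState (center n + (coord ρ : Mat n))
  rw [center_add_coord]
  exact ρ.2

omit [NeZero n] in
theorem inCoord_of_mem (f : State n →ᵇ ℝ) {x : TracelessHermitian n} (hx : x ∈ coordDomain n) :
    inCoord f x = f (State.mk _ hx) := dif_pos hx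

omit [NeZero n] in
theorem coord_mk {x : TracelessHermitian n} (hx : x ∈ coordDomain n) :
    coord (State.mk _ hx) = x := by
  apply Subtype.ext
  change center n + (x : Mat n) - center n = _
  abel

omit [NeZero n] in
theorem inCoord_coord (f : State n →ᵇ ℝ) (ρ : State n) : inCoord f (coord ρ) = f ρ := by
  rw [inCoord_of_mem f (coord_mem ρ)]
  congr 1
  exact State.ext (center_add_coord ρ)

omit [NeZero n] in
theorem continuous_coord : Continuous (coord : State n → TracelessHermitian n) :=
  Continuous.subtype_mk (State.continuous_mat.sub continuous_const) _

omit [NeZero n] in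
theorem range_coord : range (coord : State n → TracelessHermitian n) = coordDomain n :=
  Subset.antisymm (range_subset_iff.2 coord_mem) fun _ hx => ⟨_, coord_mk hx⟩

omit [NeZero n] in
theorem convex_coordDomain : Convex ℝ (coordDomain n) := by
  intro x hx y hy a b ha hb hab
  have h : center n + ((a • x + b • y : TracelessHermitian n) : Mat n)
      = a • (center n + (x : Mat n)) + b • (center n + (y : Mat n)) := by
    rw [Submodule.coe_add, SetLike.val_smul, SetLike.val_smul]
    have : center n = (a + b) • center n := by rw [hab, one_smul]
    conv_lhs => rw [this]
    module
  change IsState _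
  rw [h]
  refine ⟨(hx.1.smul ha).add (hy.1.smul hb), ?_⟩
  rw [trace_add, trace_smul, trace_smul, hx.2, hy.2, ← add_smul, hab, one_smul]

theorem uniqueDiffOn_coordDomain : UniqueDiffOn ℝ (coordDomain n) := by
  refine uniqueDiffOn_convex convex_coordDomain ⟨0, mem_interior_iff_mem_nhds.2 ?_⟩
  have hn : (0 : ℝ) < (n : ℝ)⁻¹ := inv_pos.2 (Nat.cast_pos.2 (NeZero.pos n))
  filter_upwards [Metric.closedBall_mem_nhds (0 : TracelessHermitian n) hn] with x hx
  rw [mem_closedBall_zero_iff] at hx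
  exact ⟨posSemidef_norm_smul_one_add x.2.1 hx, by
    rw [trace_add, x.2.2, trace_center, add_zero]⟩

theorem smul_tracelessL_mem {X : Mat n} (hX : X.PosSemidef) (h0 : 0 < X.trace.re) :
    ∃ ρ : State n, X.trace.re⁻¹ • tracelessL n X = coord ρ ∧ X = X.trace.re • ρ.mat := by
  obtain ⟨ρ, hρ⟩ := exists_smul_state hX h0
  refine ⟨ρ, Subtype.ext ?_, hρ⟩
  rw [SetLike.val_smul, coe_tracelessL hX.isHermitian, smul_sub, smul_smul, inv_mul_cancel₀ h0.ne',
    one_smul, coe_coord]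
  congr 1
  conv_lhs => rw [hρ]
  rw [trace_smul_re, ρ.trace_re, smul_smul, mul_one, inv_mul_cancel₀ h0.ne', one_smul]

theorem hom_eq_inCoord (f : State n →ᵇ ℝ) {X : Mat n} (hX : X.PosSemidef) (h0 : 0 < X.trace.re) :
    hom f X = X.trace.re * inCoord f (X.trace.re⁻¹ • tracelessL n X) := by
  obtain ⟨ρ, h1, h2⟩ := smul_tracelessL_mem hX h0
  rw [h1, inCoord_coord]
  conv_lhs => rw [h2]
  rw [hom_eq_of_smul f h0.le]

omit [NeZero n] in
theorem trace_conj_pos {W : Mat n} (hW : IsUnit W) (ρ : State n) :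
    0 < (W * ρ.mat * Wᴴ).trace.re := by
  refine (State.trace_re_nonneg (posSemidef_conj W ρ.posSemidef)).lt_of_ne' fun h => ?_
  have h1 := eq_zero_of_trace (posSemidef_conj W ρ.posSemidef) h
  have hW' : IsUnit Wᴴ := by
    rw [← Matrix.star_eq_conjTranspose]
    exact hW.star
  rw [hW'.mul_left_eq_zero, hW.mul_right_eq_zero] at h1
  have := ρ.trace_re
  rw [h1] at this
  simp at this

theorem contDiffOn_inCoord_conjOp {P : Type*} [NormedAddCommGroup P] [NormedSpace ℝ P]
    {W : P → Mat n} {k : ℕ} (hW : ContDiff ℝ k W) (hu : ∀ p, IsUnit (W p)) {f : State n →ᵇ ℝ}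
    (hf : f ∈ Ck n k) :
    ContDiffOn ℝ k (fun q : P × TracelessHermitian n => inCoord (conjOp (W q.1) f) q.2)
      (univ ×ˢ coordDomain n) := by
  set Y : P × TracelessHermitian n → Mat n := fun q =>
    W q.1 * (center n + (q.2 : Mat n)) * (W q.1)ᴴ with hY
  have hYd : ContDiff ℝ k Y := by
    have h1 : ContDiff ℝ k fun q : P × TracelessHermitian n => W q.1 := hW.comp contDiff_fst
    have h2 : ContDiff ℝ k fun q : P × TracelessHermitian n => center n + (q.2 : Mat n) :=
      contDiff_const.add ((TracelessHermitian n).subtypeL.contDiff.comp contDiff_snd)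
    have h3 : ContDiff ℝ k fun q : P × TracelessHermitian n => (W q.1)ᴴ :=
      (conjTransposeL n).contDiff.comp h1
    exact (h1.mul h2).mul h3
  have hp : ∀ q ∈ (univ : Set P) ×ˢ coordDomain n, (Y q).PosSemidef ∧ 0 < (Y q).trace.re :=
    fun q hq => ⟨posSemidef_conj _ hq.2.1, trace_conj_pos (hu q.1) (State.mk _ hq.2)⟩
  have hm : ContDiff ℝ k fun q => (Y q).trace.re := (traceL n).contDiff.comp hYd
  have hN : ContDiffOn ℝ k (fun q => (Y q).trace.re⁻¹ • tracelessL n (Y q))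
      (univ ×ˢ coordDomain n) :=
    (hm.contDiffOn.inv fun q hq => (hp q hq).2.ne').smul
      ((tracelessL n).contDiff.comp hYd).contDiffOn
  have hmaps : MapsTo (fun q => (Y q).trace.re⁻¹ • tracelessL n (Y q)) (univ ×ˢ coordDomain n)
      (coordDomain n) := fun q hq => by
    obtain ⟨ρ, h1, -⟩ := smul_tracelessL_mem (hp q hq).1 (hp q hq).2
    change _ • _ ∈ _
    rw [h1]
    exact coord_mem ρ
  refine (hm.contDiffOn.mul (hf.comp hN hmaps)).congr fun q hq => ?_
  rw [inCoord_of_mem _ hq.2, conjOp_apply]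
  exact hom_eq_inCoord f (hp q hq).1 (hp q hq).2

theorem conjOp_mem_Ck {W : Mat n} (hW : IsUnit W) {k : ℕ} {f : State n →ᵇ ℝ} (hf : f ∈ Ck n k) :
    conjOp W f ∈ Ck n k := by
  have h := contDiffOn_inCoord_conjOp (P := ℝ) (W := fun _ => W) contDiff_const (fun _ => hW) hf
  exact h.comp (contDiff_prodMk_right (0 : ℝ)).contDiffOn fun x hx => ⟨mem_univ _, hx⟩

/-- `Cᵏ(S)` as a subspace of `C(S)`. -/
def ckSubmodule (n k : ℕ) : Submodule ℝ (State n →ᵇ ℝ) where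
  carrier := Ck n k
  add_mem' := fun {f g} hf hg => (ContDiffOn.add hf hg).congr fun x hx => by
    simp [inCoord_of_mem _ hx]
  zero_mem' := contDiffOn_const (c := (0 : ℝ)).congr fun x hx => by simp [inCoord_of_mem _ hx]
  smul_mem' := fun c f hf => (ContDiffOn.const_smul c hf).congr fun x hx => by
    simp [inCoord_of_mem _ hx]

omit [NeZero n] in
theorem linear_mem_Ck (ℓ : Mat n →L[ℝ] ℝ) (k : ℕ) :
    mkOfCompact ⟨fun ρ : State n => ℓ ρ.mat,
      ℓ.continuous.comp State.continuous_mat⟩ ∈ Ck n k := by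
  have h : ContDiff ℝ k fun x : TracelessHermitian n => ℓ (center n + (x : Mat n)) :=
    ℓ.contDiff.comp (contDiff_const.add (TracelessHermitian n).subtypeL.contDiff)
  exact h.contDiffOn.congr fun x hx => by
    rw [inCoord_of_mem _ hx]
    rfl

/-- A matrix entry, composed with a real-linear functional. -/
def entryL (φ : ℂ →L[ℝ] ℝ) (i j : Fin n) : Mat n →L[ℝ] ℝ :=
  LinearMap.toContinuousLinearMap
    { toFun := fun M => φ (M i j)
      map_add' := fun M N => by rw [Matrix.add_apply, map_add]
      map_smul' := fun c M => by rw [Matrix.smul_apply, map_smul, RingHom.id_apply] }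

omit [NeZero n] in
theorem dense_Ck (n k : ℕ) : Dense (ckSubmodule n k : Set (State n →ᵇ ℝ)) := by
  let A : Subalgebra ℝ C(State n, ℝ) :=
    { carrier := {f | mkOfCompact f ∈ Ck n k}
      add_mem' := fun {f g} hf hg => (ContDiffOn.add hf hg).congr fun x hx => by
        simp [inCoord_of_mem _ hx]
      mul_mem' := fun {f g} hf hg => (ContDiffOn.mul hf hg).congr fun x hx => by
        simp [inCoord_of_mem _ hx]
      algebraMap_mem' := fun r => contDiffOn_const (c := r).congr fun x hx => by
        simp [inCoord_of_mem _ hx] }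
  have hsep : A.SeparatesPoints := by
    intro ρ σ hne
    by_contra hcon
    push Not at hcon
    refine hne (State.ext (Matrix.ext fun i j => Complex.ext ?_ ?_))
    · exact hcon _ ⟨_, linear_mem_Ck (entryL Complex.reCLM i j) k, rfl⟩
    · exact hcon _ ⟨_, linear_mem_Ck (entryL Complex.imCLM i j) k, rfl⟩
  have htop := ContinuousMap.subalgebra_topologicalClosure_eq_top_of_separatesPoints A hsep
  have hd : Dense (A : Set C(State n, ℝ)) := fun f => by
    have : f ∈ A.topologicalClosure := htop ▸ Algebra.mem_top
    exact this
  refine Dense.mono ?_ ((ContinuousMap.isometryEquivBoundedOfCompact (State n)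
    ℝ).toHomeomorph.surjective.denseRange.dense_image
    (ContinuousMap.isometryEquivBoundedOfCompact (State n) ℝ).toHomeomorph.continuous hd)
  rintro _ ⟨f, hf, rfl⟩
  exact hf

end Coordinates

/-! ### The flow between jumps -/

section Flow

attribute [local instance] frobeniusNormedRing frobeniusNormedAlgebra

variable {n : ℕ}

/-- The propagator `exp(tG)`, `G = -iA - C*C/2`, between jumps. -/
def flowMat (A C : Mat n) (t : ℝ) : Mat n := NormedSpace.exp (t • effGen A C)

theorem flowMat_zero (A C : Mat n) : flowMat A C 0 = 1 := by
  unfold flowMat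
  rw [zero_smul, NormedSpace.exp_zero]

theorem flowMat_add (A C : Mat n) (s t : ℝ) :
    flowMat A C (s + t) = flowMat A C s * flowMat A C t := by
  unfold flowMat
  rw [add_smul]
  exact Matrix.exp_add_of_commute _ _ (((Commute.refl _).smul_left s).smul_right t)

theorem isUnit_flowMat (A C : Mat n) (t : ℝ) : IsUnit (flowMat A C t) := by
  refine IsUnit.of_mul_eq_one (flowMat A C (-t)) ?_
  rw [← flowMat_add, add_neg_cancel, flowMat_zero]

theorem hasDerivAt_flowMat (A C : Mat n) (t : ℝ) :
    HasDerivAt (flowMat A C) (effGen A C * flowMat A C t) t :=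
  hasDerivAt_exp_smul_const' (𝕂 := ℝ) (effGen A C) t

theorem continuous_flowMat (A C : Mat n) : Continuous (flowMat A C) :=
  continuous_iff_continuousAt.2 fun t => (hasDerivAt_flowMat A C t).continuousAt

theorem contDiff_flowMat (A C : Mat n) (k : ℕ) : ContDiff ℝ k (flowMat A C) := by
  have h : ContDiff ℝ k (NormedSpace.exp : Mat n → Mat n) :=
    contDiff_iff_contDiffAt.2 fun x => (NormedSpace.exp_analytic (𝕂 := ℝ) x).contDiffAt
  exact h.comp (contDiff_id.smul contDiff_const)

/-- The group `f ↦ (ρ ↦ tr(VρV*) f(VρV*/tr(VρV*)))`, `V = exp(tG)`. -/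
def flowOp (A C : Mat n) (t : ℝ) : (State n →ᵇ ℝ) →L[ℝ] (State n →ᵇ ℝ) := conjOp (flowMat A C t)

theorem isC0Group_flowOp (A C : Mat n) : IsC0Group (flowOp A C) where
  zero := by
    unfold flowOp
    rw [flowMat_zero, conjOp_one]
  add s t := by
    unfold flowOp
    rw [conjOp_mul, ← flowMat_add, add_comm]
  cont f := continuous_conjOp (continuous_flowMat A C) f

/-- The derivative of `VρV*` at time `0`. -/
theorem hasDerivAt_flowMat_conj (A C X : Mat n) :
    HasDerivAt (fun t => flowMat A C t * X * (flowMat A C t)ᴴ)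
      (effGen A C * X + X * (effGen A C)ᴴ) 0 := by
  have h1 := hasDerivAt_flowMat A C 0
  have h2 := (conjTransposeL n).hasFDerivAt.comp_hasDerivAt (0 : ℝ) h1
  have h3 := (h1.mul_const X).mul h2
  simp only [flowMat_zero, mul_one, Function.comp_apply, conjTransposeL_apply,
    conjTranspose_one, one_mul] at h3
  exact h3

theorem trace_effGen (A : Mat n) (hA : A.IsHermitian) (C : Mat n) (ρ : State n) :
    effGen A C * ρ.mat + ρ.mat * (effGen A C)ᴴ
      = drift A C ρ - jumpRate C ρ • ρ.mat := by
  unfold effGen drift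
  simp only [conjTranspose_sub, Matrix.conjTranspose_neg, conjTranspose_smul,
    conjTranspose_mul, conjTranspose_conjTranspose, hA.eq, star_trivial,
    sub_mul, mul_sub, neg_mul, mul_neg, smul_mul_assoc, mul_smul_comm]
  have h1 : star Complex.I = -Complex.I := by simp
  rw [h1]
  module

theorem jumpRate_eq (C : Mat n) (ρ : State n) :
    jumpRate C ρ = (C * ρ.mat * Cᴴ).trace.re := by
  unfold jumpRate
  rw [trace_mul_comm (C * ρ.mat), ← Matrix.mul_assoc]

theorem jumpRate_nonneg (C : Mat n) (ρ : State n) : 0 ≤ jumpRate C ρ := by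
  rw [jumpRate_eq]
  exact State.trace_re_nonneg (posSemidef_conj C ρ.posSemidef)

theorem jumpRate_le (C : Mat n) (ρ : State n) : jumpRate C ρ ≤ ‖C‖ ^ 2 := by
  rw [jumpRate_eq]
  have := trace_conj_le C ρ.posSemidef
  rwa [ρ.trace_re, mul_one] at this

theorem continuous_jumpRate (C : Mat n) : Continuous (jumpRate C) :=
  Complex.continuous_re.comp (continuous_const.matrix_mul State.continuous_mat).matrix_trace

theorem continuous_drift (A C : Mat n) : Continuous (drift A C) := by
  have h := State.continuous_mat (n := n)
  have h' := continuous_jumpRate C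
  unfold drift
  fun_prop

variable [NeZero n]

variable {A : Mat n} (hA : A.IsHermitian) (C : Mat n)

/-- The derivation part of the generator: `f'(ρ) b(ρ) - tr(C*Cρ) f(ρ)`. -/
def flowGen (f : State n →ᵇ ℝ) (ρ : State n) : ℝ :=
  fderivWithin ℝ (inCoord f) (coordDomain n) (coord ρ) ⟨drift A C ρ, drift_mem hA C ρ⟩
    - jumpRate C ρ * f ρ

omit [NeZero n] in
theorem continuousOn_fderivWithin_of_Ck_one {f : State n →ᵇ ℝ} (hf : f ∈ Ck n 1) [NeZero n] :
    ContinuousOn (fderivWithin ℝ (inCoord f) (coordDomain n)) (coordDomain n) :=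
  ContDiffOn.continuousOn_fderivWithin hf uniqueDiffOn_coordDomain (by simp)

theorem continuous_flowGen {f : State n →ᵇ ℝ}
    (hf : f ∈ Ck n 1) : Continuous (flowGen hA C f) := by
  have h1 : Continuous fun ρ : State n =>
      fderivWithin ℝ (inCoord f) (coordDomain n) (coord ρ) :=
    (continuousOn_fderivWithin_of_Ck_one hf).comp_continuous continuous_coord coord_mem
  have h2 : Continuous fun ρ : State n =>
      (⟨drift A C ρ, drift_mem hA C ρ⟩ : TracelessHermitian n) :=
    (continuous_drift A C).subtype_mk _
  exact (h1.clm_apply h2).sub ((continuous_jumpRate C).mul f.continuous)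

theorem hasDerivAt_flowOp_zero {f : State n →ᵇ ℝ}
    (hf : f ∈ Ck n 1) (ρ : State n) :
    HasDerivAt (fun t => flowOp A C t f ρ) (flowGen hA C f ρ) 0 := by
  set X : ℝ → Mat n := fun t => flowMat A C t * ρ.mat * (flowMat A C t)ᴴ with hXdef
  have hX0 : X 0 = ρ.mat := by simp [hXdef, flowMat_zero]
  have hX := hasDerivAt_flowMat_conj A C ρ.mat
  rw [trace_effGen A hA] at hX
  have hpos : ∀ t, 0 < (X t).trace.re := fun t => trace_conj_pos (isUnit_flowMat A C t) ρ
  have hpsd : ∀ t, (X t).PosSemidef := fun t => posSemidef_conj _ ρ.posSemidef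
  have hm : HasDerivAt (fun t => (X t).trace.re) (-jumpRate C ρ) 0 := by
    have := (traceL n).hasFDerivAt.comp_hasDerivAt (0 : ℝ) hX
    refine this.congr_deriv ?_
    change (drift A C ρ - jumpRate C ρ • ρ.mat).trace.re = _
    rw [trace_sub, (drift_mem hA C ρ).2, zero_sub, Complex.neg_re, trace_smul_re,
      ρ.trace_re, mul_one]
  have hy : HasDerivAt (fun t => (X t).trace.re⁻¹ • tracelessL n (X t))
      (⟨drift A C ρ, drift_mem hA C ρ⟩ : TracelessHermitian n) 0 := by
    have h1 := (tracelessL n).hasFDerivAt.comp_hasDerivAt (0 : ℝ) hX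
    have h2 := (hm.inv (hpos 0).ne').smul h1
    refine h2.congr_deriv ?_
    have e1 : tracelessL n (drift A C ρ - jumpRate C ρ • ρ.mat)
        = ⟨drift A C ρ, drift_mem hA C ρ⟩ - jumpRate C ρ • coord ρ := by
      apply Subtype.ext
      have hh : (drift A C ρ - jumpRate C ρ • ρ.mat).IsHermitian :=
        (drift_mem hA C ρ).1.sub (ρ.posSemidef.isHermitian.smul (IsSelfAdjoint.all _))
      rw [coe_tracelessL hh, trace_sub, (drift_mem hA C ρ).2, zero_sub, Complex.neg_re,
        trace_smul_re, ρ.trace_re, mul_one, AddSubgroupClass.coe_sub, SetLike.val_smul, coe_coord]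
      module
    change (X 0).trace.re⁻¹ • tracelessL n (drift A C ρ - jumpRate C ρ • ρ.mat)
      + (- -jumpRate C ρ / (X 0).trace.re ^ 2) • tracelessL n (X 0) = _
    have e2 : tracelessL n ρ.mat = coord ρ := by
      apply Subtype.ext
      rw [coe_tracelessL ρ.posSemidef.isHermitian, ρ.trace_re, one_smul, coe_coord]
    rw [hX0, ρ.trace_re, e1, e2]
    module
  have hy0 : (X 0).trace.re⁻¹ • tracelessL n (X 0) = coord ρ := by
    rw [hX0, ρ.trace_re, inv_one, one_smul]
    apply Subtype.ext
    rw [coe_tracelessL ρ.posSemidef.isHermitian, ρ.trace_re, one_smul, coe_coord]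
  have hmem : ∀ t, (X t).trace.re⁻¹ • tracelessL n (X t) ∈ coordDomain n := fun t => by
    obtain ⟨σ, h1, -⟩ := smul_tracelessL_mem (hpsd t) (hpos t)
    rw [h1]
    exact coord_mem σ
  have hF : HasFDerivWithinAt (inCoord f)
      (fderivWithin ℝ (inCoord f) (coordDomain n) (coord ρ)) (coordDomain n)
      ((X 0).trace.re⁻¹ • tracelessL n (X 0)) := by
    rw [hy0]
    exact ((ContDiffOn.differentiableOn hf (by simp)) _ (coord_mem ρ)).hasFDerivWithinAt
  have hc : HasDerivAt (fun t => inCoord f ((X t).trace.re⁻¹ • tracelessL n (X t)))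
      (fderivWithin ℝ (inCoord f) (coordDomain n) (coord ρ)
        ⟨drift A C ρ, drift_mem hA C ρ⟩) 0 := by
    have h := HasFDerivWithinAt.comp_hasDerivAt (0 : ℝ) hF hy (Eventually.of_forall hmem)
    exact h
  have hfin := hm.mul hc
  have heq : (fun t => flowOp A C t f ρ)
      = fun t => (X t).trace.re * inCoord f ((X t).trace.re⁻¹ • tracelessL n (X t)) := by
    funext t
    exact hom_eq_inCoord f (hpsd t) (hpos t)
  rw [heq]
  refine hfin.congr_deriv ?_
  rw [hy0, inCoord_coord, hX0, ρ.trace_re]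
  unfold flowGen
  ring

/-- `flowGen` as an element of `C(S)`. -/
def flowGenC {f : State n →ᵇ ℝ}
    (hf : f ∈ Ck n 1) : State n →ᵇ ℝ :=
  mkOfCompact ⟨flowGen hA C f, continuous_flowGen hA C hf⟩

theorem hasDerivAt_flowOp {f : State n →ᵇ ℝ}
    (hf : f ∈ Ck n 1) (ρ : State n) (t : ℝ) :
    HasDerivAt (fun t => flowOp A C t f ρ) (flowOp A C t (flowGenC hA C hf) ρ) t := by
  obtain ⟨σ, hσ⟩ := exists_smul_state (posSemidef_conj (flowMat A C t) ρ.posSemidef)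
    (trace_conj_pos (isUnit_flowMat A C t) ρ)
  set c := (flowMat A C t * ρ.mat * (flowMat A C t)ᴴ).trace.re
  have hc : 0 ≤ c := (trace_conj_pos (isUnit_flowMat A C t) ρ).le
  have key : ∀ g : State n →ᵇ ℝ, flowOp A C t g ρ = c * g σ := fun g => by
    unfold flowOp
    rw [conjOp_apply, hσ, hom_eq_of_smul g hc]
  have h1 : (fun s => flowOp A C s f ρ) = fun s => c * flowOp A C (s - t) f σ := by
    funext s
    rw [← key, ← (isC0Group_flowOp A C).apply_add, add_sub_cancel t s]
  rw [h1, key]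
  have h2 := hasDerivAt_flowOp_zero hA C hf σ
  rw [← sub_self t] at h2
  exact (h2.comp_sub_const t t).const_mul c

theorem flowGenC_mem {f : State n →ᵇ ℝ}
    (hf : f ∈ Ck n 1) : (f, flowGenC hA C hf) ∈ generatorGraph (nnTime (flowOp A C)) := by
  rw [(isC0Group_flowOp A C).toSemigroup.mem_generatorGraph_iff]
  intro t ht
  have hcont := (isC0Group_flowOp A C).cont (flowGenC hA C hf)
  ext ρ
  set e : (State n →ᵇ ℝ) →L[ℝ] ℝ := evalCLM ℝ ρ
  have h1 := (e.intervalIntegral_comp_comm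
    (hcont.intervalIntegrable (μ := volume) 0 t))
  change _ = e (∫ s in (0 : ℝ)..t, flowOp A C s (flowGenC hA C hf))
  rw [← h1]
  change _ = ∫ s in (0 : ℝ)..t, flowOp A C s (flowGenC hA C hf) ρ
  rw [intervalIntegral.integral_eq_sub_of_hasDerivAt
    (fun s _ => hasDerivAt_flowOp hA C hf ρ s)
    ((e.continuous.comp hcont).intervalIntegrable 0 t),
    (isC0Group_flowOp A C).zero]
  rfl

theorem flowOp_mem_Ck (A C : Mat n) (t : ℝ) {k : ℕ} {f : State n →ᵇ ℝ} (hf : f ∈ Ck n k) :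
    flowOp A C t f ∈ Ck n k := conjOp_mem_Ck (isUnit_flowMat A C t) hf

omit [NeZero n] in
theorem Ck_anti {k l : ℕ} (h : k ≤ l) : Ck n l ⊆ Ck n k := fun _ hf =>
  ContDiffOn.of_le hf (by exact_mod_cast h)

include hA in
theorem isCore_flowOp {k : ℕ} (hk : 1 ≤ k) :
    IsCore (nnTime (flowOp A C)) (Ck n k) :=
  (isC0Group_flowOp A C).toSemigroup.isCore_of_dense (D := ckSubmodule n k) (dense_Ck n k)
    (fun t _ _ hf => flowOp_mem_Ck A C t hf)
    (fun _ hf => ⟨_, flowGenC_mem hA C (Ck_anti hk hf)⟩)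

theorem countGenerator_eq (f : State n →ᵇ ℝ)
    (ρ : State n) : countGenerator hA C f ρ = flowGen hA C f ρ + conjOp C f ρ := by
  rw [conjOp_apply, ← hom_eq_normalize f (posSemidef_conj C ρ.posSemidef) ρ, ← jumpRate_eq]
  unfold countGenerator flowGen jumpState
  ring

end Flow

/-! ### The counting semigroup and the error of the approximations -/

section Approximation

attribute [local instance] frobeniusNormedRing frobeniusNormedAlgebra

variable {n : ℕ}

theorem norm_conj_sub_le (V W : Mat n) {X : Mat n} (hX : ‖X‖ ≤ 1) :
    ‖V * X * Vᴴ - W * X * Wᴴ‖ ≤ (‖V‖ + ‖W‖) * ‖V - W‖ := by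
  have e : V * X * Vᴴ - W * X * Wᴴ
      = (V - W) * X * Vᴴ + W * X * (V - W)ᴴ := by
    rw [conjTranspose_sub]
    noncomm_ring
  have h1 : ∀ P Q : Mat n, ‖P * X * Qᴴ‖ ≤ ‖P‖ * ‖Q‖ := fun P Q => by
    refine (norm_mul_le _ _).trans ?_
    rw [frobenius_norm_conjTranspose]
    exact mul_le_mul_of_nonneg_right
      ((norm_mul_le _ _).trans (mul_le_of_le_one_right (norm_nonneg _) hX)) (norm_nonneg _)
  rw [e]
  refine (norm_add_le _ _).trans ?_
  linarith [h1 (V - W) V, h1 W (V - W)]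

theorem HLip.norm_conjOp_sub_le {K : ℝ} {f : State n →ᵇ ℝ} (hf : HLip K f) (hK : 0 ≤ K)
    (V W : Mat n) :
    ‖QFilter.conjOp V f - QFilter.conjOp W f‖ ≤ 3 * n * K * ((‖V‖ + ‖W‖) * ‖V - W‖) := by
  refine (BoundedContinuousFunction.norm_le (by positivity)).2 fun ρ => ?_
  refine (hf.abs_sub_le hK (posSemidef_conj V ρ.posSemidef)
    (posSemidef_conj W ρ.posSemidef)).trans ?_
  exact mul_le_mul_of_nonneg_left (norm_conj_sub_le V W ρ.norm_mat_le) (by positivity)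

theorem exists_bound_flow (n : ℕ) (R : ℝ) : ∃ c : ℝ, 1 ≤ c ∧ ∀ A C : Mat n, ‖A‖ ≤ R → ‖C‖ ≤ R →
    ‖C‖ ≤ c ∧ ∀ t : ℝ, 0 ≤ t → t ≤ 1 → ‖flowMat A C t‖ ≤ c ∧ ‖flowMat A C t - 1‖ ≤ c * t := by
  obtain ⟨b, hb, h⟩ := exists_bound_parts n R
  refine ⟨‖(1 : Mat n)‖ + b * exp b + |R| + 1, ?_, fun A C hA hC => ⟨?_, fun t h0 h1 => ?_⟩⟩
  · have : 0 ≤ b * exp b := by positivity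
    linarith [norm_nonneg (1 : Mat n), abs_nonneg R]
  · have : 0 ≤ b * exp b := by positivity
    linarith [norm_nonneg (1 : Mat n), le_abs_self R]
  have hG := (h A A C hA hA hC).2.2
  have hx : ‖t • effGen A C‖ ≤ b * t := by
    rw [norm_smul, norm_of_nonneg h0, mul_comm]
    exact mul_le_mul_of_nonneg_right hG h0
  have hx' : ‖t • effGen A C‖ ≤ b := hx.trans (mul_le_of_le_one_right hb h1)
  have key : ‖flowMat A C t - 1‖ ≤ b * exp b * t := by
    have h2 := norm_exp_sub_sum_le (t • effGen A C) one_pos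
    simp only [Finset.range_one, Finset.sum_singleton, Nat.factorial_zero, Nat.cast_one, inv_one,
      one_smul, pow_zero, pow_one] at h2
    refine h2.trans ?_
    calc ‖t • effGen A C‖ * exp ‖t • effGen A C‖ ≤ (b * t) * exp b := by gcongr
      _ = b * exp b * t := by ring
  constructor
  · have h3 : ‖flowMat A C t‖ ≤ ‖flowMat A C t - 1‖ + ‖(1 : Mat n)‖ := by
      have := norm_add_le (flowMat A C t - 1) 1
      rwa [sub_add_cancel] at this
    have h4 : b * exp b * t ≤ b * exp b := mul_le_of_le_one_right (by positivity) h1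
    linarith [abs_nonneg R]
  · refine key.trans (mul_le_mul_of_nonneg_right ?_ h0)
    linarith [norm_nonneg (1 : Mat n), abs_nonneg R]

/-- The semigroup of the counting filtering process, as the perturbation of the flow between jumps
by the jump operator. -/
def countOp (A C : Mat n) : ℝ → (State n →ᵇ ℝ) →L[ℝ] (State n →ᵇ ℝ) :=
  ((isC0Group_flowOp A C).exists_perturbation (conjOp C)).choose

theorem isPerturbation_countOp (A C : Mat n) :
    IsPerturbation (flowOp A C) (conjOp C) (countOp A C) :=
  ((isC0Group_flowOp A C).exists_perturbation (conjOp C)).choose_spec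

theorem isC0Semigroup_countOp (A C : Mat n) : IsC0Semigroup (countOp A C) :=
  (isPerturbation_countOp A C).toSemigroup (isC0Group_flowOp A C)

theorem norm_integral_le_of_forall {E : Type*} [NormedAddCommGroup E] [NormedSpace ℝ E]
    {φ : ℝ → E} {t c : ℝ} (ht : 0 ≤ t) (h : ∀ s, 0 ≤ s → s ≤ t → ‖φ s‖ ≤ c) :
    ‖∫ s in (0 : ℝ)..t, φ s‖ ≤ c * t := by
  have := intervalIntegral.norm_integral_le_of_norm_le_const (a := 0) (b := t) (C := c) (f := φ)
    fun s hs => by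
      rw [uIoc_of_le ht] at hs
      exact h s hs.1.le hs.2
  rwa [sub_zero, abs_of_nonneg ht] at this

/-- First-order estimates for the flow and the semigroup. -/
theorem exists_bound_countOp_sub (n : ℕ) (R : ℝ) : ∃ c : ℝ, 1 ≤ c ∧ ∀ A C : Mat n, ‖A‖ ≤ R →
    ‖C‖ ≤ R → ∀ M : ℝ, 1 ≤ M → (∀ s, 0 ≤ s → s ≤ 1 → ‖countOp A C s‖ ≤ M) →
    ∀ K, 0 ≤ K → ∀ f, HLip K f → ∀ t, 0 ≤ t → t ≤ 1 →
      ‖countOp A C t f - f‖ ≤ c * M * K * t ∧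
      ‖countOp A C t f - (flowOp A C t f + t • conjOp C f)‖ ≤ c * M * K * t ^ 2 := by
  obtain ⟨c, hc1, hc⟩ := exists_bound_flow n R
  have hc0 : 0 ≤ c := zero_le_one.trans hc1
  refine ⟨1 + (6 * n * c ^ 2 + c ^ 4) * (c ^ 4 + c ^ 2 + 1), ?_, ?_⟩
  · have : 0 ≤ (6 * n * c ^ 2 + c ^ 4) * (c ^ 4 + c ^ 2 + 1) := by positivity
    linarith
  intro A C hA hC M hM1 hM K hK f hf
  obtain ⟨hCc, hfl⟩ := hc A C hA hC
  have hM0 : 0 ≤ M := zero_le_one.trans hM1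
  have hC2 : ‖C‖ ^ 2 ≤ c ^ 2 := by gcongr
  have hS : ∀ u, 0 ≤ u → u ≤ 1 → ‖flowOp A C u‖ ≤ c ^ 2 := fun u h0 h1 =>
    (norm_conjOp_le _).trans (by gcongr; exact (hfl u h0 h1).1)
  have hKop : ‖conjOp C‖ ≤ c ^ 2 := (norm_conjOp_le C).trans hC2
  have hflow : ∀ L, 0 ≤ L → ∀ g, HLip L g → ∀ u, 0 ≤ u → u ≤ 1 →
      ‖flowOp A C u g - g‖ ≤ 6 * n * c ^ 2 * L * u := fun L hL g hg u h0 h1 => by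
    have h2 := hg.norm_conjOp_sub_le hL (flowMat A C u) 1
    rw [conjOp_one] at h2
    have h10 := (hfl 0 le_rfl zero_le_one).1
    rw [flowMat_zero] at h10
    refine h2.trans ?_
    have h3 : (‖flowMat A C u‖ + ‖(1 : Mat n)‖) * ‖flowMat A C u - 1‖ ≤ (c + c) * (c * u) :=
      mul_le_mul (add_le_add (hfl u h0 h1).1 h10) (hfl u h0 h1).2 (norm_nonneg _) (by positivity)
    calc _ ≤ 3 * n * L * ((c + c) * (c * u)) := by gcongr
      _ = _ := by ring
  have hTf : ∀ s, 0 ≤ s → s ≤ 1 → ‖countOp A C s f‖ ≤ M * K := fun s h0 h1 =>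
    (ContinuousLinearMap.le_of_opNorm_le_of_le _ (hM s h0 h1) (hf.norm_le hK))
  set a : ℝ := 6 * n * c ^ 2 + c ^ 4 with ha
  have ha0 : 0 ≤ a := by positivity
  have first : ∀ t, 0 ≤ t → t ≤ 1 → ‖countOp A C t f - f‖ ≤ a * M * K * t := by
    intro t h0 h1
    rw [(isPerturbation_countOp A C).duhamel f t h0, add_sub_right_comm]
    have hI : ‖∫ s in (0 : ℝ)..t, flowOp A C (t - s) (conjOp C (countOp A C s f))‖
        ≤ c ^ 2 * (c ^ 2 * (M * K)) * t := norm_integral_le_of_forall h0 fun s hs0 hst =>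
      ContinuousLinearMap.le_of_opNorm_le_of_le _ (hS _ (by linarith) (by linarith))
        (ContinuousLinearMap.le_of_opNorm_le_of_le _ hKop (hTf s hs0 (by linarith)))
    have h3 : K * t ≤ M * K * t := by
      rw [mul_assoc]
      exact le_mul_of_one_le_left (by positivity) hM1
    calc _ ≤ 6 * n * c ^ 2 * (K * t) + c ^ 2 * (c ^ 2 * (M * K)) * t :=
          (norm_add_le _ _).trans (add_le_add
            (by simpa [mul_assoc] using hflow K hK f hf t h0 h1) hI)
      _ ≤ 6 * n * c ^ 2 * (M * K * t) + c ^ 2 * (c ^ 2 * (M * K)) * t := by gcongr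
      _ = a * M * K * t := by rw [ha]; ring
  intro t h0 h1
  constructor
  · refine (first t h0 h1).trans ?_
    have : a ≤ 1 + a * (c ^ 4 + c ^ 2 + 1) := by
      nlinarith [pow_nonneg hc0 4, mul_nonneg ha0 (pow_nonneg hc0 4), mul_nonneg ha0 (pow_nonneg hc0 2)]
    gcongr
  have hKf : HLip (K * c ^ 2) (conjOp C f) := (hf.conjOp hK C).mono (by gcongr)
  have e : countOp A C t f - (flowOp A C t f + t • conjOp C f)
      = ∫ s in (0 : ℝ)..t, (flowOp A C (t - s) (conjOp C (countOp A C s f)) - conjOp C f) := by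
    rw [intervalIntegral.integral_sub (((isPerturbation_countOp A C).continuous_integrand
      (isC0Group_flowOp A C) f t).intervalIntegrable 0 t)
      (continuous_const.intervalIntegrable 0 t), intervalIntegral.integral_const, sub_zero,
      (isPerturbation_countOp A C).duhamel f t h0]
    abel
  rw [e]
  have hI := norm_integral_le_of_forall (c := (a * (c ^ 4 + c ^ 2 + 1)) * M * K * t)
      (φ := fun s => flowOp A C (t - s) (conjOp C (countOp A C s f)) - conjOp C f) h0
      fun s hs0 hst => by
    have e2 : flowOp A C (t - s) (conjOp C (countOp A C s f)) - conjOp C f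
        = flowOp A C (t - s) (conjOp C (countOp A C s f - f))
          + (flowOp A C (t - s) (conjOp C f) - conjOp C f) := by
      rw [map_sub, map_sub]
      abel
    rw [e2]
    have h3 : ‖flowOp A C (t - s) (conjOp C (countOp A C s f - f))‖
        ≤ c ^ 2 * (c ^ 2 * (a * M * K * s)) :=
      ContinuousLinearMap.le_of_opNorm_le_of_le _ (hS _ (by linarith) (by linarith))
        (ContinuousLinearMap.le_of_opNorm_le_of_le _ hKop (first s hs0 (by linarith)))
    have h4 := hflow _ (by positivity) _ hKf (t - s) (by linarith) (by linarith)
    have h5 : c ^ 2 * (c ^ 2 * (a * M * K * s)) ≤ c ^ 4 * a * M * K * t := by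
      calc _ = c ^ 4 * a * M * K * s := by ring
        _ ≤ _ := by gcongr
    have h6 : 6 * n * c ^ 2 * (K * c ^ 2) * (t - s) ≤ 6 * n * c ^ 4 * (M * K) * t := by
      calc _ ≤ 6 * n * c ^ 2 * (K * c ^ 2) * t := by gcongr; linarith
        _ = 6 * n * c ^ 4 * K * t := by ring
        _ ≤ _ := by
          gcongr
          exact le_mul_of_one_le_left hK hM1
    have h7 : 6 * n * c ^ 4 * (M * K) * t ≤ c ^ 2 * a * M * K * t := by
      have : 6 * n * c ^ 2 ≤ a := by rw [ha]; linarith [pow_nonneg hc0 4]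
      calc _ = c ^ 2 * (6 * n * c ^ 2) * M * K * t := by ring
        _ ≤ _ := by gcongr
    refine (norm_add_le _ _).trans ((add_le_add h3 h4).trans ?_)
    have h8 : 0 ≤ a * M * K * t := by positivity
    linarith
  refine hI.trans (le_of_eq_of_le (by ring : _ = (a * (c ^ 4 + c ^ 2 + 1)) * M * K * t ^ 2) ?_)
  gcongr
  linarith

/-- The local error of the measurement chain. -/
theorem exists_bound_local_error (n : ℕ) (R : ℝ) : ∃ c : ℝ, 1 ≤ c ∧ ∀ A B C : Mat n, ‖A‖ ≤ R →
    ‖B‖ ≤ R → ‖C‖ ≤ R → ∀ (hA : A.IsHermitian) (hB : B.IsHermitian) (M : ℝ), 1 ≤ M →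
    (∀ s, 0 ≤ s → s ≤ 1 → ‖countOp A C s‖ ≤ M) → ∀ K, 0 ≤ K → ∀ f, HLip K f → ∀ h : ℝ≥0, 0 < h →
      h ≤ 1 → ‖transitionOp hA hB C h f - countOp A C h f‖ ≤ c * M * K * (h : ℝ) ^ 2 := by
  obtain ⟨c1, hc1, h1⟩ := exists_bound_countOp_sub n R
  obtain ⟨c2, hc2, h2⟩ := exists_bound_kraus n R
  obtain ⟨c3, hc3, h3⟩ := exists_bound_kraus_one_conj n R
  obtain ⟨c4, hc4, h4⟩ := exists_bound_flow n R
  refine ⟨c1 + 3 * n * ((2 * c4 + c2) * c2) + 3 * n * c3, ?_, ?_⟩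
  · have : 0 ≤ 3 * n * ((2 * c4 + c2) * c2) + 3 * n * c3 := by positivity
    linarith
  intro A B C hAR hBR hCR hA hB M hM1 hM K hK f hf h hh0 hh1
  have hh0' : (0 : ℝ) ≤ h := h.coe_nonneg
  have hh1' : (h : ℝ) ≤ 1 := by exact_mod_cast hh1
  have hM0 : 0 ≤ M := zero_le_one.trans hM1
  have hcount := (h1 A C hAR hCR M hM1 hM K hK f hf h hh0' hh1').2
  have hV0 := (h2 A B C hAR hBR hCR h hh0 hh1).1
  have hflow := ((h4 A C hAR hCR).2 h hh0' hh1').1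
  have e0 : ‖conjOp (kraus A B C h 0) f - flowOp A C h f‖
      ≤ 3 * n * K * ((2 * c4 + c2) * c2 * (h : ℝ) ^ 2) := by
    refine (hf.norm_conjOp_sub_le hK _ _).trans ?_
    have h5 : ‖kraus A B C h 0‖ ≤ c4 + c2 := by
      have h6 := norm_add_le (kraus A B C h 0 - flowMat A C h) (flowMat A C h)
      rw [sub_add_cancel] at h6
      have h7 : c2 * (h : ℝ) ^ 2 ≤ c2 := mul_le_of_le_one_right hc2 (pow_le_one₀ hh0' hh1')
      have h8 : ‖kraus A B C h 0 - flowMat A C h‖ ≤ c2 * (h : ℝ) ^ 2 := hV0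
      linarith
    have h9 : (‖kraus A B C h 0‖ + ‖flowMat A C h‖) * ‖kraus A B C h 0 - flowMat A C h‖
        ≤ (c4 + c2 + c4) * (c2 * (h : ℝ) ^ 2) :=
      mul_le_mul (add_le_add h5 hflow) hV0 (norm_nonneg _) (by positivity)
    calc _ ≤ 3 * n * K * ((c4 + c2 + c4) * (c2 * (h : ℝ) ^ 2)) := by gcongr
      _ = _ := by ring
  have e1 : ‖conjOp (kraus A B C h 1) f - (h : ℝ) • conjOp C f‖
      ≤ 3 * n * K * (c3 * (h : ℝ) ^ 2) := by
    refine (BoundedContinuousFunction.norm_le (by positivity)).2 fun ρ => ?_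
    have h5 : (conjOp (kraus A B C h 1) f - (h : ℝ) • conjOp C f) ρ
        = hom f (kraus A B C h 1 * ρ.mat * (kraus A B C h 1)ᴴ)
          - hom f ((h : ℝ) • (C * ρ.mat * Cᴴ)) := by
      rw [hom_smul f hh0' (posSemidef_conj C ρ.posSemidef)]
      rfl
    rw [h5]
    refine (hf.abs_sub_le hK (posSemidef_conj _ ρ.posSemidef)
      ((posSemidef_conj C ρ.posSemidef).smul hh0')).trans ?_
    exact mul_le_mul_of_nonneg_left (h3 A B C hAR hBR hCR h hh0 hh1 _ ρ.norm_mat_le)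
      (by positivity)
  have e : transitionOp hA hB C h f - countOp A C h f
      = (conjOp (kraus A B C h 0) f - flowOp A C h f)
        + (conjOp (kraus A B C h 1) f - (h : ℝ) • conjOp C f)
        - (countOp A C h f - (flowOp A C h f + (h : ℝ) • conjOp C f)) := by
    rw [transitionOp_eq hA hB C h, add_apply]
    abel
  rw [e]
  refine (norm_sub_le _ _).trans ((add_le_add (norm_add_le _ _) le_rfl).trans
    ((add_le_add (add_le_add e0 e1) hcount).trans ?_))
  have h10 : K * (h : ℝ) ^ 2 ≤ M * K * (h : ℝ) ^ 2 := by
    rw [mul_assoc]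
    exact le_mul_of_one_le_left (by positivity) hM1
  have h11 : 0 ≤ 3 * n * ((2 * c4 + c2) * c2) + 3 * n * c3 := by positivity
  nlinarith [mul_le_mul_of_nonneg_left h10 h11]

theorem norm_pow_sub_le {E : Type*} [NormedAddCommGroup E] [NormedSpace ℝ E] {U : E →L[ℝ] E}
    {T : ℝ → E →L[ℝ] E} (hT : IsC0Semigroup T) {h b M : ℝ} (hh : 0 ≤ h) {D : Set E}
    (hD : ∀ f ∈ D, U f ∈ D) (hloc : ∀ f ∈ D, ‖U f - T h f‖ ≤ b) (m : ℕ)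
    (hTM : ∀ j < m, ‖T (j * h)‖ ≤ M) : ∀ f ∈ D, ‖(U ^ m) f - T (m * h) f‖ ≤ m * (M * b) := by
  induction m with
  | zero =>
    intro f _
    simp [hT.zero]
  | succ m ih =>
    intro f hf
    have e : (U ^ (m + 1)) f - T ((m + 1 : ℕ) * h) f
        = ((U ^ m) (U f) - T (m * h) (U f)) + T (m * h) (U f - T h f) := by
      have : ((m + 1 : ℕ) : ℝ) * h = m * h + h := by push_cast; ring
      rw [this, hT.add _ _ (by positivity) hh, pow_succ, map_sub]
      simp
    rw [e]
    refine (norm_add_le _ _).trans ?_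
    have h1 := ih (fun j hj => hTM j (hj.trans m.lt_succ_self)) (U f) (hD f hf)
    have h2 : ‖T (m * h) (U f - T h f)‖ ≤ M * b :=
      ContinuousLinearMap.le_of_opNorm_le_of_le _ (hTM m m.lt_succ_self) (hloc f hf)
    rw [Nat.cast_succ]
    linarith

end Approximation

/-! ### The Feller property -/

section Feller

section Convex

variable {E F : Type*} [NormedAddCommGroup E] [NormedSpace ℝ E] [NormedAddCommGroup F]
  [NormedSpace ℝ F] {s : Set E} {f : E → F}

theorem norm_fderivWithin_apply_le (hs : UniqueDiffOn ℝ s) {x : E} (hx : x ∈ s) (v : E) :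
    ‖fderivWithin ℝ f s x v‖ ≤ ‖iteratedFDerivWithin ℝ 1 f s x‖ * ‖v‖ := by
  rw [norm_iteratedFDerivWithin_one f (hs x hx)]
  exact (fderivWithin ℝ f s x).le_opNorm v

theorem norm_sub_le_of_iteratedFDerivWithin (hc : Convex ℝ s) (hs : UniqueDiffOn ℝ s)
    (hf : ContDiffOn ℝ 1 f s) {L : ℝ} (hL : ∀ x ∈ s, ‖iteratedFDerivWithin ℝ 1 f s x‖ ≤ L) {x y : E}
    (hx : x ∈ s) (hy : y ∈ s) : ‖f x - f y‖ ≤ L * ‖x - y‖ :=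
  Convex.norm_image_sub_le_of_norm_fderivWithin_le (𝕜 := ℝ)
    (hf.differentiableOn (by simp)) (fun z hz => by
      rw [← norm_iteratedFDerivWithin_one f (hs z hz)]
      exact hL z hz) hc hy hx

theorem norm_fderivWithin_apply_sub_le (hc : Convex ℝ s) (hs : UniqueDiffOn ℝ s)
    (hf : ContDiffOn ℝ 2 f s) {L : ℝ} (hL : ∀ x ∈ s, ‖iteratedFDerivWithin ℝ 2 f s x‖ ≤ L) {x y : E}
    (hx : x ∈ s) (hy : y ∈ s) (v : E) :
    ‖fderivWithin ℝ f s x v - fderivWithin ℝ f s y v‖ ≤ L * ‖x - y‖ * ‖v‖ := by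
  have h1 : ContDiffOn ℝ 1 (fderivWithin ℝ f s) s := hf.fderivWithin hs (by norm_num)
  have h2 := norm_sub_le_of_iteratedFDerivWithin hc hs h1 (L := L) (fun z hz => by
    rw [norm_iteratedFDerivWithin_fderivWithin hs hz]
    exact hL z hz) hx hy
  rw [← sub_apply]
  exact ContinuousLinearMap.le_of_opNorm_le _ h2 v

end Convex

variable {n : ℕ}

theorem State.lipschitz_coord (ρ σ : State n) : ‖coord ρ - coord σ‖ = ‖ρ.mat - σ.mat‖ := by
  change ‖((coord ρ - coord σ : TracelessHermitian n) : Mat n)‖ = _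
  rw [AddSubgroupClass.coe_sub, coe_coord, coe_coord, sub_sub_sub_cancel_right]

theorem HLip.of_coord [NeZero n] {f : State n →ᵇ ℝ} {M L : ℝ}
    (hf : f ∈ Ck n 1) (hM : ∀ ρ, |f ρ| ≤ M)
    (hL : ∀ ρ : State n, ‖iteratedFDerivWithin ℝ 1 (inCoord f) (coordDomain n) (coord ρ)‖ ≤ L)
    (hL0 : 0 ≤ L) : HLip (M + 2 * L) f := by
  refine HLip.of_lipschitz hM (fun ρ σ => ?_) hL0
  have h := norm_sub_le_of_iteratedFDerivWithin convex_coordDomain uniqueDiffOn_coordDomain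
    (f := inCoord f) (L := L) hf (fun x hx => by
      have := hL (State.mk _ hx)
      rwa [coord_mk] at this) (coord_mem ρ) (coord_mem σ)
  rw [inCoord_coord, inCoord_coord, State.lipschitz_coord] at h
  exact h

theorem bddAbove_iteratedFDerivWithin [NeZero n] {f : State n →ᵇ ℝ} {k j : ℕ} (hf : f ∈ Ck n k)
    (hj : j ≤ k) : BddAbove (range fun ρ : State n =>
      ‖iteratedFDerivWithin ℝ j (inCoord f) (coordDomain n) (coord ρ)‖) := by
  have h1 : ContinuousOn (iteratedFDerivWithin ℝ j (inCoord f) (coordDomain n)) (coordDomain n) :=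
    ContDiffOn.continuousOn_iteratedFDerivWithin hf (by exact_mod_cast hj) uniqueDiffOn_coordDomain
  exact (isCompact_range (h1.comp_continuous continuous_coord coord_mem).norm).bddAbove

theorem norm_iteratedFDerivWithin_le_ckNorm [NeZero n] {f : State n →ᵇ ℝ} {k j : ℕ}
    (hf : f ∈ Ck n k) (hj : j ≤ k) (ρ : State n) :
    ‖iteratedFDerivWithin ℝ j (inCoord f) (coordDomain n) (coord ρ)‖ ≤ ckNorm k f := by
  refine (le_ciSup (bddAbove_iteratedFDerivWithin hf hj) ρ).trans ?_
  exact Finset.single_le_sum (f := fun j => ⨆ ρ : State n,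
    ‖iteratedFDerivWithin ℝ j (inCoord f) (coordDomain n) (coord ρ)‖)
    (fun i _ => Real.iSup_nonneg fun _ => norm_nonneg _) (Finset.mem_range.2 (by omega))

theorem ckNorm_nonneg (k : ℕ) (f : State n →ᵇ ℝ) : 0 ≤ ckNorm k f :=
  Finset.sum_nonneg fun _ _ => Real.iSup_nonneg fun _ => norm_nonneg _

theorem abs_le_ckNorm [NeZero n] {f : State n →ᵇ ℝ} {k : ℕ} (hf : f ∈ Ck n k) (ρ : State n) :
    |f ρ| ≤ ckNorm k f := by
  have := norm_iteratedFDerivWithin_le_ckNorm hf (Nat.zero_le k) ρ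
  rwa [norm_iteratedFDerivWithin_zero, inCoord_coord] at this

theorem hLip_ckNorm [NeZero n] {f : State n →ᵇ ℝ} {k : ℕ} (hk : 1 ≤ k) (hf : f ∈ Ck n k) :
    HLip (3 * ckNorm k f) f :=
  (HLip.of_coord (Ck_anti hk hf) (abs_le_ckNorm hf) (norm_iteratedFDerivWithin_le_ckNorm hf hk)
    (ckNorm_nonneg k f)).mono (by linarith)

theorem exists_hLip_near [NeZero n] (f : State n →ᵇ ℝ) {ε : ℝ} (hε : 0 < ε) :
    ∃ g : State n →ᵇ ℝ, g ∈ Ck n 2 ∧ ‖f - g‖ < ε := by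
  obtain ⟨g, hg, h⟩ := Metric.dense_iff.1 (dense_Ck n 2) f ε hε
  refine ⟨g, h, ?_⟩
  rwa [← dist_eq_norm, dist_comm]

/-- A uniformly bounded family of operators converges strongly if it does on `C²(S)`. -/
theorem tendsto_of_tendsto_on_Ck [NeZero n] {ι : Type*} {l : Filter ι}
    {V : ι → (State n →ᵇ ℝ) →L[ℝ] (State n →ᵇ ℝ)} {T : (State n →ᵇ ℝ) →L[ℝ] (State n →ᵇ ℝ)}
    (hV : ∀ᶠ i in l, ‖V i‖ ≤ 1) (h : ∀ f ∈ Ck n 2, Tendsto (fun i => V i f) l (𝓝 (T f)))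
    (f : State n →ᵇ ℝ) : Tendsto (fun i => V i f) l (𝓝 (T f)) := by
  rw [Metric.tendsto_nhds]
  intro ε hε
  obtain ⟨g, hg, hfg⟩ := exists_hLip_near f (ε := ε / (2 + ‖T‖)) (by positivity)
  have h1 := (Metric.tendsto_nhds.1 (h g hg)) (ε / (2 + ‖T‖)) (by positivity)
  filter_upwards [hV, h1] with i hi hgi
  rw [dist_eq_norm] at hgi ⊢
  have e : V i f - T f = V i (f - g) + (V i g - T g) - T (f - g) := by
    rw [map_sub, map_sub]
    abel
  have h2 : ‖V i (f - g)‖ ≤ ‖f - g‖ := by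
    simpa using (V i).le_of_opNorm_le hi (f - g)
  have h3 := T.le_opNorm (f - g)
  rw [e]
  have h4 : ‖T‖ * ‖f - g‖ ≤ ‖T‖ * (ε / (2 + ‖T‖)) := by gcongr
  calc _ ≤ ‖V i (f - g)‖ + ‖V i g - T g‖ + ‖T (f - g)‖ :=
        (norm_sub_le _ _).trans (add_le_add (norm_add_le _ _) le_rfl)
    _ < ε / (2 + ‖T‖) + ε / (2 + ‖T‖) + ‖T‖ * (ε / (2 + ‖T‖)) := by linarith
    _ = ε := by field_simp; ring

variable {A B : Mat n} (hA : A.IsHermitian) (hB : B.IsHermitian) (C : Mat n)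

theorem norm_transitionOp_pow_le (t : ℝ≥0) (m : ℕ) : ‖transitionOp hA hB C t ^ m‖ ≤ 1 := by
  induction m with
  | zero => exact ContinuousLinearMap.norm_id_le
  | succ m ih =>
    rw [pow_succ]
    exact (ContinuousLinearMap.opNorm_comp_le _ _).trans
      (mul_le_one₀ ih (norm_nonneg _) (norm_transitionOp_le hA hB C t))

theorem tendsto_of_hLip_aux {ι : Type*} {l : Filter ι} {h : ι → ℝ≥0} {m : ι → ℕ} {s : ℝ} (hs :
    0 ≤ s)
    (hh : Tendsto h l (𝓝[>] 0))
    (hm : Tendsto (fun i => (m i : ℝ) * h i) l (𝓝 s)) {K : ℝ} (hK : 0 ≤ K) {f : State n →ᵇ ℝ}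
    (hf : HLip K f) :
    Tendsto (fun i => (transitionOp hA hB C (h i) ^ m i) f) l (𝓝 (countOp A C s f)) := by
  obtain ⟨c, hc, hloc⟩ := exists_bound_local_error n (max ‖A‖ (max ‖B‖ ‖C‖))
  obtain ⟨k, hk0, hk⟩ := exists_norm_le_of_strong (isC0Semigroup_countOp A C).cont 0 (s + 1)
  set M := max k 1
  have hM1 : 1 ≤ M := le_max_right _ _
  have hTM : ∀ u, 0 ≤ u → u ≤ s + 1 → ‖countOp A C u‖ ≤ M := fun u h0 h1 =>
    (hk u ⟨h0, h1⟩).trans (le_max_left _ _)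
  have hlim0 : Tendsto (fun i => (h i : ℝ)) l (𝓝 0) :=
    (continuous_coe.tendsto 0).comp (hh.mono_right nhdsWithin_le_nhds)
  have hbound : Tendsto (fun i => ((m i : ℝ) * h i) * (M * (c * M * K)) * h i) l (𝓝 0) := by
    have := (hm.mul_const (M * (c * M * K))).mul hlim0
    simpa using this
  have hcont : Tendsto (fun i => countOp A C ((m i : ℝ) * h i) f) l (𝓝 (countOp A C s f)) :=
    ((isC0Semigroup_countOp A C).cont f).continuousAt.tendsto.comp hm
  have hdiff : Tendsto (fun i => (transitionOp hA hB C (h i) ^ m i) f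
      - countOp A C ((m i : ℝ) * h i) f) l (𝓝 0) := by
    refine squeeze_zero_norm' ?_ hbound
    filter_upwards [hlim0.eventually (gt_mem_nhds one_pos),
      hh.eventually self_mem_nhdsWithin,
      hm.eventually (gt_mem_nhds (lt_add_one s))] with i h1 h2 h3
    have h4 := norm_pow_sub_le (isC0Semigroup_countOp A C) (U := transitionOp hA hB C (h i))
      (h := h i) (b := c * M * K * (h i : ℝ) ^ 2) (M := M) (h i).coe_nonneg
      (D := {g | HLip K g}) (fun g hg => hg.transitionOp hA hB C (h i))
      (fun g hg => hloc A B C (le_max_left _ _) ((le_max_left _ _).trans (le_max_right _ _))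
        ((le_max_right _ _).trans (le_max_right _ _)) hA hB M hM1
        (fun u h0 h1 => hTM u h0 (by linarith)) K hK g hg (h i) h2 (by exact_mod_cast h1.le))
      (m i) (fun j hj => hTM _ (by positivity) (by
        have : (j : ℝ) * h i ≤ m i * h i := by
          have : (j : ℝ) ≤ m i := by exact_mod_cast hj.le
          gcongr
        linarith)) f hf
    refine h4.trans (le_of_eq (by ring))
  have := hdiff.add hcont
  simpa using this

theorem tendsto_floor_mul {ι : Type*} {l : Filter ι} {h : ι → ℝ≥0} (hh : Tendsto h l (𝓝[>] 0))
    (s : ℝ≥0) : Tendsto (fun i => (⌊s / h i⌋₊ : ℝ≥0) * h i) l (𝓝 s) := by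
  have h1 : Tendsto (fun i => s - h i) l (𝓝 s) := by
    simpa using (tendsto_const_nhds (x := s)).sub (hh.mono_right nhdsWithin_le_nhds)
  have h0 := hh.eventually self_mem_nhdsWithin
  refine tendsto_of_tendsto_of_tendsto_of_le_of_le' h1 tendsto_const_nhds
    (h0.mono fun i hi => ?_) (h0.mono fun i hi => (le_div_iff₀ hi).1 (Nat.floor_le zero_le))
  have h2 := (div_lt_iff₀ hi).1 (Nat.lt_floor_add_one (s / h i))
  rw [add_mul, one_mul] at h2
  exact tsub_le_iff_right.2 h2.le

theorem floor_mul_tendsto {ι : Type*} {l : Filter ι} {h : ι → ℝ≥0} (hh : Tendsto h l (𝓝[>] 0))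
    (s : ℝ≥0) : Tendsto (fun i => (⌊s / h i⌋₊ : ℝ) * h i) l (𝓝 s) := by
  simpa using NNReal.tendsto_coe.2 (tendsto_floor_mul hh s)

include hA in
theorem exists_approximation {s : ℝ} (hs : 0 ≤ s) :
    ∃ V : ℕ → (State n →ᵇ ℝ) →L[ℝ] (State n →ᵇ ℝ), (∀ i, ‖V i‖ ≤ 1) ∧
      (∀ i (f : State n →ᵇ ℝ), 0 ≤ f → 0 ≤ V i f) ∧ (∀ i, V i 1 = 1) ∧ (∀ i K f, HLip K f → HLip K
        (V i f)) ∧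
      ∀ K f, 0 ≤ K → HLip K f → Tendsto (fun i => V i f) atTop (𝓝 (countOp A C s f)) := by
  have h0 : IsHermitian (0 : Mat n) := Matrix.isHermitian_zero
  let h : ℕ → ℝ≥0 := fun i => 1 / ((i : ℝ≥0) + 1)
  have hh : Tendsto h atTop (𝓝[>] 0) := by
    refine tendsto_nhdsWithin_iff.2 ⟨?_, Eventually.of_forall fun i => ?_⟩
    · rw [← NNReal.tendsto_coe]
      simpa [h] using tendsto_one_div_add_atTop_nhds_zero_nat (𝕜 := ℝ)
    · change (0 : ℝ≥0) < 1 / ((i : ℝ≥0) + 1)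
      positivity
  refine ⟨fun i => transitionOp hA h0 C (h i) ^ ⌊s.toNNReal / h i⌋₊,
    fun i => norm_transitionOp_pow_le hA h0 C _ _, fun i f hf => ?_, fun i => ?_,
    fun i K f hf => hf.transitionOp_pow hA h0 C _ _, fun K f hK hf => ?_⟩
  · dsimp only
    induction ⌊s.toNNReal / h i⌋₊ with
    | zero => exact hf
    | succ m ih =>
      rw [pow_succ']
      exact transitionOp_nonneg hA h0 C _ ih
  · dsimp only
    induction ⌊s.toNNReal / h i⌋₊ with
    | zero => rfl
    | succ m ih =>
      rw [pow_succ', mul_apply_eq_comp, ih, transitionOp_one]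
  · refine tendsto_of_hLip_aux hA h0 C hs hh ?_ hK hf
    have := floor_mul_tendsto hh s.toNNReal
    rwa [Real.coe_toNNReal s hs] at this

variable [NeZero n]

include hA in
theorem norm_countOp_le {s : ℝ} (hs : 0 ≤ s) :
    ‖countOp A C s‖ ≤ 1 := by
  obtain ⟨V, hV1, -, -, -, hV⟩ := exists_approximation hA C hs
  refine ContinuousLinearMap.opNorm_le_bound _ zero_le_one fun f => ?_
  have h1 : ∀ g ∈ Ck n 2, ‖countOp A C s g‖ ≤ 1 * ‖g‖ := fun g hg =>
    le_of_tendsto (hV _ g (by linarith [ckNorm_nonneg 2 g]) (hLip_ckNorm one_le_two hg)).norm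
      (Eventually.of_forall fun i => (V i).le_of_opNorm_le (hV1 i) g)
  have h2 : IsClosed {g | ‖countOp A C s g‖ ≤ 1 * ‖g‖} :=
    isClosed_le (countOp A C s).continuous.norm (continuous_const.mul continuous_norm)
  exact h2.closure_subset_iff.2 h1 (dense_Ck n 2 f)

include hA in
theorem HLip.countOp {s : ℝ} (hs : 0 ≤ s) {K : ℝ}
    (hK : 0 ≤ K) {f : State n →ᵇ ℝ} (hf : HLip K f) : HLip K (QFilter.countOp A C s f) := by
  obtain ⟨V, -, -, -, hL, hV⟩ := exists_approximation hA C hs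
  exact HLip.of_tendsto (fun i => hL i K f hf) (hV K f hK hf)

theorem tendsto_transitionOp_pow {ι : Type*} {l : Filter ι} {h : ι → ℝ≥0} {m : ι → ℕ} {s : ℝ} (hs :
    0 ≤ s)
    (hh : Tendsto h l (𝓝[>] 0)) (hm : Tendsto (fun i => (m i : ℝ) * h i) l (𝓝 s))
    (f : State n →ᵇ ℝ) :
    Tendsto (fun i => (transitionOp hA hB C (h i) ^ m i) f) l (𝓝 (countOp A C s f)) := by
  refine tendsto_of_tendsto_on_Ck
    (Eventually.of_forall fun i => norm_transitionOp_pow_le hA hB C _ _) (fun g hg => ?_) f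
  exact tendsto_of_hLip_aux hA hB C hs hh hm (by linarith [ckNorm_nonneg 2 g])
    (hLip_ckNorm one_le_two hg)

include hA in
theorem exists_approximation' {s : ℝ} (hs : 0 ≤ s) :
    ∃ V : ℕ → (State n →ᵇ ℝ) →L[ℝ] (State n →ᵇ ℝ),
      (∀ i (f : State n →ᵇ ℝ), 0 ≤ f → 0 ≤ V i f) ∧ (∀ i, V i 1 = 1) ∧
      ∀ f, Tendsto (fun i => V i f) atTop (𝓝 (countOp A C s f)) := by
  obtain ⟨V, hV1, hp, h1, -, hV⟩ := exists_approximation hA C hs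
  refine ⟨V, hp, h1, fun f => tendsto_of_tendsto_on_Ck (Eventually.of_forall hV1)
    (fun g hg => hV _ g (by linarith [ckNorm_nonneg 2 g]) (hLip_ckNorm one_le_two hg)) f⟩

include hA in
theorem isFellerSemigroup_countOp :
    IsFellerSemigroup (nnTime (countOp A C)) where
  zero := (isC0Semigroup_countOp A C).zero
  add s t := (isC0Semigroup_countOp A C).add s t s.coe_nonneg t.coe_nonneg
  nonneg t f hf := by
    obtain ⟨V, hp, -, hV⟩ := exists_approximation' hA C t.coe_nonneg
    intro ρ
    have h1 : Tendsto (fun i => V i f ρ) atTop (𝓝 (countOp A C t f ρ)) :=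
      ((evalCLM ℝ ρ :
        (State n →ᵇ ℝ) →L[ℝ] ℝ).continuous.tendsto _).comp (hV f)
    exact ge_of_tendsto' h1 fun i => hp i f hf ρ
  const_one t := by
    obtain ⟨V, -, h1, hV⟩ := exists_approximation' hA C t.coe_nonneg
    refine tendsto_nhds_unique (hV 1) ?_
    simp only [h1]
    exact tendsto_const_nhds
  continuous f := by
    have h1 : Tendsto (fun t : ℝ≥0 => countOp A C t f) (𝓝 0) (𝓝 (countOp A C (0 : ℝ≥0) f)) :=
      (((isC0Semigroup_countOp A C).cont f).comp continuous_coe).continuousAt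
    rwa [NNReal.coe_zero, (isC0Semigroup_countOp A C).zero] at h1

end Feller

/-! ### Rates of convergence -/

section Rates

variable {n : ℕ}

section Ring

attribute [local instance] frobeniusNormedRing frobeniusNormedAlgebra

theorem norm_conjTranspose_mul_mul_le (C X : Mat n) :
    ‖Cᴴ * C * X‖ ≤ ‖C‖ ^ 2 * ‖X‖ := by
  have h1 := norm_mul_le Cᴴ C
  rw [frobenius_norm_conjTranspose, ← sq] at h1
  exact (norm_mul_le _ _).trans (mul_le_mul_of_nonneg_right h1 (norm_nonneg _))

theorem jumpRate_sub (C : Mat n) (ρ σ : State n) : jumpRate C ρ - jumpRate C σ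
    = (Cᴴ * C * (ρ.mat - σ.mat)).trace.re := by
  unfold jumpRate
  rw [mul_sub, trace_sub, Complex.sub_re]

theorem abs_jumpRate_sub_le (C : Mat n) (ρ σ : State n) :
    |jumpRate C ρ - jumpRate C σ| ≤ n * (‖C‖ ^ 2 * ‖ρ.mat - σ.mat‖) := by
  rw [jumpRate_sub]
  exact (abs_trace_re_le _).trans
    (mul_le_mul_of_nonneg_left (norm_conjTranspose_mul_mul_le C _) (Nat.cast_nonneg n))

theorem exists_bound_drift (n : ℕ) (R : ℝ) : ∃ b : ℝ, 0 ≤ b ∧ ∀ A C : Mat n, ‖A‖ ≤ R → ‖C‖ ≤ R →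
    A.IsHermitian → ‖C‖ ^ 2 ≤ b ∧ (∀ ρ : State n, ‖drift A C ρ‖ ≤ b) ∧
      ∀ ρ σ : State n, ‖drift A C ρ - drift A C σ‖ ≤ b * ‖ρ.mat - σ.mat‖ := by
  obtain ⟨g, hg0, hg⟩ := exists_bound_parts n R
  refine ⟨2 * g + (n + 1) * R ^ 2, by positivity, fun A C hAR hCR hA => ?_⟩
  have hG := (hg A A C hAR hAR hCR).2.2
  have hC2 : ‖C‖ ^ 2 ≤ R ^ 2 := by gcongr
  have hlin : ∀ X : Mat n, ‖effGen A C * X + X * (effGen A C)ᴴ‖ ≤ 2 * g * ‖X‖ := by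
    intro X
    have h1 : ‖effGen A C * X‖ ≤ g * ‖X‖ :=
      (norm_mul_le _ _).trans (mul_le_mul_of_nonneg_right hG (norm_nonneg _))
    have h2 : ‖X * (effGen A C)ᴴ‖ ≤ ‖X‖ * g := by
      refine (norm_mul_le _ _).trans ?_
      rw [frobenius_norm_conjTranspose]
      exact mul_le_mul_of_nonneg_left hG (norm_nonneg _)
    exact (norm_add_le _ _).trans (by linarith)
  have hrate : ∀ ρ : State n, ‖jumpRate C ρ‖ ≤ R ^ 2 := fun ρ => by
    rw [norm_of_nonneg (jumpRate_nonneg C ρ)]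
    exact (jumpRate_le C ρ).trans hC2
  have hd : ∀ ρ : State n, drift A C ρ
      = effGen A C * ρ.mat + ρ.mat * (effGen A C)ᴴ + jumpRate C ρ • ρ.mat := fun ρ => by
    rw [trace_effGen A hA]
    abel
  have hn : (0 : ℝ) ≤ n * R ^ 2 := by positivity
  refine ⟨by nlinarith, fun ρ => ?_, fun ρ σ => ?_⟩
  · rw [hd]
    have h1 := (hlin ρ.mat).trans (mul_le_of_le_one_right (by positivity) ρ.norm_mat_le)
    have h2 : ‖jumpRate C ρ • ρ.mat‖ ≤ R ^ 2 * 1 := by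
      rw [norm_smul]
      exact mul_le_mul (hrate ρ) ρ.norm_mat_le (norm_nonneg _) (sq_nonneg R)
    exact (norm_add_le _ _).trans (by linarith)
  · have e : drift A C ρ - drift A C σ
        = effGen A C * (ρ.mat - σ.mat) + (ρ.mat - σ.mat) * (effGen A C)ᴴ
          + (jumpRate C ρ • (ρ.mat - σ.mat) + (jumpRate C ρ - jumpRate C σ) • σ.mat) := by
      rw [hd, hd, mul_sub, sub_mul, smul_sub, sub_smul]
      abel
    rw [e]
    have h1 : ‖jumpRate C ρ • (ρ.mat - σ.mat)‖ ≤ R ^ 2 * ‖ρ.mat - σ.mat‖ := by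
      rw [norm_smul]
      exact mul_le_mul_of_nonneg_right (hrate ρ) (norm_nonneg _)
    have h2 : ‖(jumpRate C ρ - jumpRate C σ) • σ.mat‖ ≤ n * R ^ 2 * ‖ρ.mat - σ.mat‖ * 1 := by
      rw [norm_smul]
      refine mul_le_mul ((abs_jumpRate_sub_le C ρ σ).trans ?_) σ.norm_mat_le (norm_nonneg _)
        (by positivity)
      rw [_root_.mul_assoc]
      gcongr
    refine (norm_add_le _ _).trans ((add_le_add (hlin _) (norm_add_le _ _)).trans ?_)
    linarith

end Ring

variable [NeZero n]

theorem exists_bound_generator_hLip (n : ℕ) [NeZero n] (R : ℝ) : ∃ c : ℝ, 0 ≤ c ∧ ∀ A C : Mat n,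
    ‖A‖ ≤ R → ‖C‖ ≤ R → ∀ (hA : A.IsHermitian) (f : State n →ᵇ ℝ) (hf : f ∈ Ck n 2),
      HLip (c * ckNorm 2 f) (flowGenC hA C (Ck_anti one_le_two hf) + conjOp C f) := by
  obtain ⟨b, hb0, hb⟩ := exists_bound_drift n R
  refine ⟨(2 * b + 2 * ((3 + n) * b)) + 3 * b, by positivity, fun A C hAR hCR hA f hf => ?_⟩
  obtain ⟨hCb, hd, hdL⟩ := hb A C hAR hCR hA
  set N := ckNorm 2 f
  have hN : 0 ≤ N := ckNorm_nonneg 2 f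
  have hsup : ∀ j ≤ 2, ∀ x ∈ coordDomain n,
      ‖iteratedFDerivWithin ℝ j (inCoord f) (coordDomain n) x‖ ≤ N := fun j hj x hx => by
    have := norm_iteratedFDerivWithin_le_ckNorm hf hj (State.mk _ hx)
    rwa [coord_mk] at this
  have hrate : ∀ ρ : State n, |jumpRate C ρ| ≤ b := fun ρ => by
    rw [abs_of_nonneg (jumpRate_nonneg C ρ)]
    exact (jumpRate_le C ρ).trans hCb
  have hflip : ∀ ρ σ : State n, |f ρ - f σ| ≤ N * ‖ρ.mat - σ.mat‖ := fun ρ σ => by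
    have h := norm_sub_le_of_iteratedFDerivWithin convex_coordDomain uniqueDiffOn_coordDomain
      (f := inCoord f) (L := N) (Ck_anti one_le_two hf) (hsup 1 one_le_two)
      (coord_mem ρ) (coord_mem σ)
    rw [inCoord_coord, inCoord_coord, State.lipschitz_coord] at h
    exact h
  set v : State n → TracelessHermitian n := fun ρ => ⟨drift A C ρ, drift_mem hA C ρ⟩
  have hvn : ∀ ρ, ‖v ρ‖ ≤ b := hd
  have hvL : ∀ ρ σ, ‖v ρ - v σ‖ ≤ b * ‖ρ.mat - σ.mat‖ := hdL
  have h1 : HLip ((2 * b * N) + 2 * ((3 + n) * b * N)) (flowGenC hA C (Ck_anti one_le_two hf)) := by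
    refine HLip.of_lipschitz (fun ρ => ?_) (fun ρ σ => ?_) (by positivity)
    · change |fderivWithin ℝ (inCoord f) (coordDomain n) (coord ρ) (v ρ) - jumpRate C ρ * f ρ| ≤ _
      have h2 : |fderivWithin ℝ (inCoord f) (coordDomain n) (coord ρ) (v ρ)| ≤ N * b :=
        (norm_fderivWithin_apply_le uniqueDiffOn_coordDomain (coord_mem ρ) (v ρ)).trans
          (mul_le_mul (hsup 1 one_le_two _ (coord_mem ρ)) (hvn ρ) (norm_nonneg _) hN)
      have h3 : |jumpRate C ρ * f ρ| ≤ b * N := by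
        rw [abs_mul]
        exact mul_le_mul (hrate ρ) (abs_le_ckNorm hf ρ) (abs_nonneg _) hb0
      exact (abs_sub _ _).trans (by linarith)
    · change |(fderivWithin ℝ (inCoord f) (coordDomain n) (coord ρ) (v ρ) - jumpRate C ρ * f ρ)
        - (fderivWithin ℝ (inCoord f) (coordDomain n) (coord σ) (v σ) - jumpRate C σ * f σ)| ≤ _
      set δ := ‖ρ.mat - σ.mat‖
      have hδ : 0 ≤ δ := norm_nonneg _
      have h2 : |fderivWithin ℝ (inCoord f) (coordDomain n) (coord ρ) (v ρ - v σ)|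
          ≤ N * (b * δ) :=
        (norm_fderivWithin_apply_le uniqueDiffOn_coordDomain (coord_mem ρ) _).trans
          (mul_le_mul (hsup 1 one_le_two _ (coord_mem ρ)) (hvL ρ σ) (norm_nonneg _) hN)
      have h3 : |fderivWithin ℝ (inCoord f) (coordDomain n) (coord ρ) (v σ)
          - fderivWithin ℝ (inCoord f) (coordDomain n) (coord σ) (v σ)| ≤ N * δ * b := by
        have h := norm_fderivWithin_apply_sub_le convex_coordDomain uniqueDiffOn_coordDomain
          (f := inCoord f) (L := N) hf (hsup 2 le_rfl) (coord_mem ρ) (coord_mem σ) (v σ)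
        rw [State.lipschitz_coord] at h
        exact h.trans (mul_le_mul_of_nonneg_left (hvn σ) (by positivity))
      have h4 : |jumpRate C ρ * (f ρ - f σ)| ≤ b * (N * δ) := by
        rw [abs_mul]
        exact mul_le_mul (hrate ρ) (hflip ρ σ) (abs_nonneg _) hb0
      have h5 : |(jumpRate C ρ - jumpRate C σ) * f σ| ≤ n * b * δ * N := by
        rw [abs_mul]
        refine mul_le_mul ((abs_jumpRate_sub_le C ρ σ).trans ?_) (abs_le_ckNorm hf σ)
          (abs_nonneg _) (by positivity)
        rw [_root_.mul_assoc]
        gcongr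
      rw [map_sub] at h2
      have h6 := abs_le.1 h2
      have h7 := abs_le.1 h3
      have h8 := abs_le.1 h4
      have h9 := abs_le.1 h5
      refine abs_le.2 ⟨?_, ?_⟩ <;> linarith
  have h2 := (hLip_ckNorm one_le_two hf).conjOp (by positivity) C
  refine (h1.add h2).mono ?_
  have : 3 * N * ‖C‖ ^ 2 ≤ 3 * N * b := by gcongr
  change _ + 3 * N * ‖C‖ ^ 2 ≤ _
  linarith

theorem exists_bound_countOp_sub_one (n : ℕ) [NeZero n] (R : ℝ) : ∃ c : ℝ, 1 ≤ c ∧ ∀ A C : Mat n,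
    ‖A‖ ≤ R → ‖C‖ ≤ R → A.IsHermitian → ∀ K, 0 ≤ K → ∀ f, HLip K f → ∀ t, 0 ≤ t →
      ‖countOp A C t f - f‖ ≤ c * K * t := by
  obtain ⟨c, hc, h⟩ := exists_bound_countOp_sub n R
  refine ⟨c + 1, by linarith, fun A C hAR hCR hA K hK f hf t ht => ?_⟩
  have hKt : 0 ≤ K * t := by positivity
  rcases le_or_gt t 1 with h1 | h1
  · have := (h A C hAR hCR 1 le_rfl (fun s hs _ => norm_countOp_le hA C hs) K hK f hf t ht h1).1
    rw [mul_one] at this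
    refine this.trans ?_
    linarith
  · have h2 : ‖countOp A C t f‖ ≤ K := by
      have := (countOp A C t).le_of_opNorm_le_of_le (norm_countOp_le hA C ht) (hf.norm_le hK)
      rwa [one_mul] at this
    have h3 := hf.norm_le hK
    refine (norm_sub_le _ _).trans ?_
    nlinarith

theorem exists_rate_chain (n : ℕ) [NeZero n] (R : ℝ) : ∃ c : ℝ, 0 ≤ c ∧ ∀ A B C : Mat n, ‖A‖ ≤ R →
    ‖B‖ ≤ R → ‖C‖ ≤ R → ∀ (hA : A.IsHermitian) (hB : B.IsHermitian), ∀ f ∈ Ck n 2,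
      ∀ s h : ℝ≥0, 0 < h → ‖(transitionOp hA hB C h ^ ⌊s / h⌋₊) f - countOp A C s f‖
        ≤ (√(h : ℝ) * s + ((s : ℝ) - h * (⌊s / h⌋₊ : ℝ))) * c * ckNorm 2 f := by
  obtain ⟨c1, hc1, h1⟩ := exists_bound_countOp_sub_one n R
  obtain ⟨c2, hc2, h2⟩ := exists_bound_local_error n R
  refine ⟨3 * (c1 + c2 + 2), by positivity, fun A B C hAR hBR hCR hA hB f hf s h hh => ?_⟩
  set K := 3 * ckNorm 2 f with hKdef
  have hK : 0 ≤ K := by linarith [ckNorm_nonneg 2 f]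
  have hfK : HLip K f := hLip_ckNorm one_le_two hf
  set m := ⌊s / h⌋₊
  have hh' : (0 : ℝ) < h := by exact_mod_cast hh
  have hs0 : (0 : ℝ) ≤ s := s.coe_nonneg
  have hms : (h : ℝ) * m ≤ s := by
    have h3 : h * m ≤ s := by
      rw [← le_div_iff₀' hh]
      exact Nat.floor_le zero_le
    exact_mod_cast h3
  suffices h3 : ‖(transitionOp hA hB C h ^ m) f - countOp A C s f‖
      ≤ (√(h : ℝ) * s + ((s : ℝ) - h * m)) * ((c1 + c2 + 2) * K) by
    refine h3.trans (le_of_eq ?_)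
    rw [hKdef]
    ring
  have hr : 0 ≤ (s : ℝ) - h * m := by linarith
  have hsplit : ‖countOp A C s f - countOp A C (m * h) f‖ ≤ c1 * K * (s - h * m) := by
    have e : countOp A C s f - countOp A C (m * h) f
        = countOp A C (m * h) (countOp A C (s - h * m) f - f) := by
      rw [map_sub, ← mul_apply_eq_comp,
        ← (isC0Semigroup_countOp A C).add _ _ (by positivity) hr]
      congr 3
      ring_nf
    rw [e]
    have := (countOp A C (m * h)).le_of_opNorm_le_of_le
      (norm_countOp_le hA C (by positivity)) (h1 A C hAR hCR hA K hK f hfK _ hr)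
    rwa [one_mul] at this
  rcases le_or_gt (h : ℝ) 1 with hle | hgt
  · have h4 := norm_pow_sub_le (isC0Semigroup_countOp A C) (U := transitionOp hA hB C h)
      (h := h) (b := c2 * 1 * K * (h : ℝ) ^ 2) (M := 1) hh'.le
      (D := {g | HLip K g}) (fun g hg => hg.transitionOp hA hB C h)
      (fun g hg => h2 A B C hAR hBR hCR hA hB 1 le_rfl (fun u h0 _ => norm_countOp_le hA C h0)
        K hK g hg h hh (by exact_mod_cast hle)) m
      (fun j _ => norm_countOp_le hA C (by positivity)) f hfK
    have h5 : (h : ℝ) ≤ √(h : ℝ) := by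
      have := Real.sq_sqrt hh'.le
      nlinarith [Real.sqrt_nonneg (h : ℝ), Real.sqrt_le_one.2 hle]
    have h6 : (m : ℝ) * (1 * (c2 * 1 * K * (h : ℝ) ^ 2)) ≤ √(h : ℝ) * s * (c2 * K) := by
      have : (h : ℝ) * (h * m) ≤ √(h : ℝ) * s := mul_le_mul h5 hms (by positivity) (by positivity)
      calc _ = (h : ℝ) * (h * m) * (c2 * K) := by ring
        _ ≤ _ := by gcongr
    have h7 : 0 ≤ √(h : ℝ) * s * K := by positivity
    have h8 : 0 ≤ (s - h * m) * K := by positivity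
    have h9 := norm_sub_le_norm_sub_add_norm_sub ((transitionOp hA hB C h ^ m) f)
      (countOp A C (m * h) f) (countOp A C s f)
    rw [norm_sub_rev (countOp A C (m * h) f)] at h9
    have h10 := mul_nonneg (by linarith : 0 ≤ c1 + 2) h7
    have h11 := mul_nonneg (by linarith : 0 ≤ c2 + 2) h8
    nlinarith
  · have hsq : 1 ≤ √(h : ℝ) := Real.one_le_sqrt.2 hgt.le
    rcases Nat.eq_zero_or_pos m with hm | hm
    · rw [hm, pow_zero, Nat.cast_zero, mul_zero, sub_zero]
      have h4 := h1 A C hAR hCR hA K hK f hfK s hs0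
      rw [norm_sub_rev] at h4
      refine h4.trans ?_
      have h5 : 0 ≤ (s : ℝ) * K := by positivity
      have h6 : 0 ≤ √(h : ℝ) * s * ((c1 + c2 + 2) * K) := by positivity
      nlinarith
    · have h4 : ‖(transitionOp hA hB C h ^ m) f‖ ≤ K := by
        have := (transitionOp hA hB C h ^ m).le_of_opNorm_le_of_le
          (norm_transitionOp_pow_le hA hB C h m) (hfK.norm_le hK)
        rwa [one_mul] at this
      have h5 : ‖countOp A C s f‖ ≤ K := by
        have := (countOp A C s).le_of_opNorm_le_of_le (norm_countOp_le hA C hs0) (hfK.norm_le hK)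
        rwa [one_mul] at this
      have h6 : (1 : ℝ) ≤ s := by
        have : (1 : ℝ) ≤ m := by exact_mod_cast hm
        nlinarith
      have h7 : 1 ≤ √(h : ℝ) * s := one_le_mul_of_one_le_of_one_le hsq h6
      refine (norm_sub_le _ _).trans ((add_le_add h4 h5).trans ?_)
      have h8 : 2 * K ≤ (c1 + c2 + 2) * K := by nlinarith
      have h9 : (1 : ℝ) * ((c1 + c2 + 2) * K)
          ≤ (√(h : ℝ) * s + (s - h * m)) * ((c1 + c2 + 2) * K) := by
        refine mul_le_mul_of_nonneg_right ?_ (by positivity)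
        linarith
      linarith

variable {A B : Mat n} (hA : A.IsHermitian) (hB : B.IsHermitian) (C : Mat n)

/-- The generator of the continuous-time chain. -/
def poissonGen (τ : ℝ≥0) :
    (State n →ᵇ ℝ) →L[ℝ] (State n →ᵇ ℝ) := (τ : ℝ)⁻¹ • (transitionOp hA hB C τ - 1)

section Exp

variable {E : Type*} [NormedAddCommGroup E] [NormedSpace ℝ E] [CompleteSpace E]

/-- The group generated by a bounded operator. -/
def expOp (L : E →L[ℝ] E) (s : ℝ) : E →L[ℝ] E := NormedSpace.exp (s • L)

theorem expOp_zero (L : E →L[ℝ] E) : expOp L 0 = 1 := by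
  unfold expOp
  rw [zero_smul, NormedSpace.exp_zero]

theorem hasDerivAt_expOp (L : E →L[ℝ] E) (s : ℝ) : HasDerivAt (expOp L) (expOp L s * L) s :=
  hasDerivAt_exp_smul_const (𝕂 := ℝ) L s

theorem norm_opPow_le_one {U : E →L[ℝ] E} (hU : ‖U‖ ≤ 1) (k : ℕ) : ‖U ^ k‖ ≤ 1 := by
  induction k with
  | zero => exact ContinuousLinearMap.norm_id_le
  | succ k ih =>
    rw [pow_succ]
    exact (ContinuousLinearMap.opNorm_comp_le _ _).trans (mul_le_one₀ ih (norm_nonneg _) hU)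

theorem norm_expOp_sub_one_le {U : E →L[ℝ] E} (hU : ‖U‖ ≤ 1) {a : ℝ} (ha : 0 ≤ a) :
    ‖expOp (U - 1) a‖ ≤ 1 := by
  let _ : NormedAlgebra ℚ (E →L[ℝ] E) := NormedAlgebra.restrictScalars ℚ ℝ _
  have e : expOp (U - 1) a = exp (-a) • NormedSpace.exp (a • U) := by
    have h1 : a • (U - 1) = algebraMap ℝ (E →L[ℝ] E) (-a) + a • U := by
      rw [Algebra.algebraMap_eq_smul_one, smul_sub, neg_smul]
      abel
    unfold expOp
    rw [h1, NormedSpace.exp_add_of_commute (Algebra.commutes _ _),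
      ← NormedSpace.algebraMap_exp_comm, ← Real.exp_eq_exp_ℝ, ← Algebra.smul_def]
  have h2 : ‖NormedSpace.exp (a • U)‖ ≤ exp a := by
    have h3 : ∀ k : ℕ, ‖(k.factorial : ℝ)⁻¹ • (a • U) ^ k‖ ≤ (k.factorial : ℝ)⁻¹ • a ^ k := by
      intro k
      rw [norm_smul, smul_pow, norm_smul, norm_of_nonneg (by positivity),
        norm_of_nonneg (by positivity), smul_eq_mul]
      have := mul_le_of_le_one_right (pow_nonneg ha k) (norm_opPow_le_one hU k)
      gcongr
    have h5 := NormedSpace.exp_series_hasSum_exp' (𝕂 := ℝ) a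
    rw [NormedSpace.exp_eq_tsum ℝ, Real.exp_eq_exp_ℝ]
    exact tsum_of_norm_bounded h5 h3
  rw [e, norm_smul, norm_of_nonneg (exp_pos _).le]
  calc exp (-a) * ‖NormedSpace.exp (a • U)‖ ≤ exp (-a) * exp a := by gcongr
    _ = 1 := by rw [← exp_add, neg_add_cancel, Real.exp_zero]

theorem norm_expOp_smul_le {U : E →L[ℝ] E} (hU : ‖U‖ ≤ 1) {b a : ℝ} (hb : 0 ≤ b) (ha : 0 ≤ a) :
    ‖expOp (b • (U - 1)) a‖ ≤ 1 := by
  have := norm_expOp_sub_one_le hU (mul_nonneg ha hb)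
  unfold expOp at this ⊢
  rwa [smul_smul]

/-- The Duhamel estimate comparing a bounded generator with the generator of a semigroup. -/
theorem IsC0Semigroup.norm_expOp_sub_le {T : ℝ → E →L[ℝ] E} (hT : IsC0Semigroup T) {L : E →L[ℝ] E}
    {f g : E} (hfg : ∀ r, 0 ≤ r → HasDerivWithinAt (fun s => T s f) (T r g) (Ici r) r) {s b : ℝ}
    (hs : 0 ≤ s) (hL : ∀ r, 0 ≤ r → ‖expOp L r‖ ≤ 1)
    (hb : ∀ r, 0 ≤ r → ‖L (T r f) - T r g‖ ≤ b) : ‖expOp L s f - T s f‖ ≤ b * s := by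
  have hPd : ∀ r, HasDerivAt (fun r => expOp L (s - r)) (-(expOp L (s - r) * L)) r := fun r => by
    have h1 := (hasDerivAt_expOp L (s - r)).scomp r ((hasDerivAt_id r).const_sub s)
    simpa using! h1
  have hcont : ContinuousOn (fun r => expOp L (s - r) (T r f)) (Icc 0 s) := by
    have h1 : Continuous fun r => expOp L (s - r) :=
      continuous_iff_continuousAt.2 fun r => (hPd r).continuousAt
    exact (h1.clm_apply (hT.cont f)).continuousOn
  have hderiv : ∀ r ∈ Ico 0 s, HasDerivWithinAt (fun r => expOp L (s - r) (T r f))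
      (expOp L (s - r) (T r g - L (T r f))) (Ici r) r := fun r hr => by
    have h1 := ((hPd r).hasDerivWithinAt (s := Ici r)).clm_apply (hfg r hr.1)
    refine h1.congr_deriv ?_
    rw [map_sub, neg_apply, mul_apply_eq_comp]
    abel
  have h2 := norm_image_sub_le_of_norm_deriv_right_le_segment hcont hderiv (C := b) (fun r hr => by
    have h4 : ‖T r g - L (T r f)‖ ≤ b := by
      rw [norm_sub_rev]
      exact hb r hr.1
    have h3 := (expOp L (s - r)).le_of_opNorm_le_of_le (hL (s - r) (by linarith [hr.2])) h4
    rwa [one_mul] at h3) s ⟨hs, le_rfl⟩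
  simp only [sub_self, expOp_zero, sub_zero, hT.zero, one_apply_eq_self] at h2
  rwa [norm_sub_rev] at h2

end Exp

omit [NeZero n] in
theorem norm_expOp_poissonGen_le (τ : ℝ≥0) {s : ℝ} (hs : 0 ≤ s) : ‖expOp
    (poissonGen hA hB C τ) s‖ ≤ 1 :=
  norm_expOp_smul_le (norm_transitionOp_le hA hB C τ) (by positivity) hs

theorem mem_generatorGraph_countOp {f : State n →ᵇ ℝ}
    (hf : f ∈ Ck n 1) :
    (f, flowGenC hA C hf + conjOp C f) ∈ generatorGraph (nnTime (countOp A C)) :=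
  ((isPerturbation_countOp A C).mem_generatorGraph_iff (isC0Group_flowOp A C)).2
    (flowGenC_mem hA C hf)

theorem exists_rate_poisson (n : ℕ) [NeZero n] (R : ℝ) : ∃ c : ℝ, 0 ≤ c ∧ ∀ A B C : Mat n,
    ‖A‖ ≤ R → ‖B‖ ≤ R → ‖C‖ ≤ R → ∀ (hA : A.IsHermitian) (hB : B.IsHermitian), ∀ f ∈ Ck n 2,
      ∀ s τ : ℝ≥0, 0 < τ → ‖poissonSemigroup hA hB C τ s f - countOp A C s f‖
        ≤ √(τ : ℝ) * s * c * ckNorm 2 f := by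
  obtain ⟨c1, hc1, h1⟩ := exists_bound_countOp_sub_one n R
  obtain ⟨c2, hc2, h2⟩ := exists_bound_local_error n R
  obtain ⟨c3, hc3, h3⟩ := exists_bound_generator_hLip n R
  refine ⟨3 * (c1 + c2 + 2) + c1 * c3, by positivity,
    fun A B C hAR hBR hCR hA hB f hf s τ hτ => ?_⟩
  set N := ckNorm 2 f
  have hN : 0 ≤ N := ckNorm_nonneg 2 f
  set K := 3 * N with hKdef
  have hK : 0 ≤ K := by positivity
  have hfK : HLip K f := hLip_ckNorm one_le_two hf
  have hτ' : (0 : ℝ) < τ := by exact_mod_cast hτ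
  have hs0 : (0 : ℝ) ≤ s := s.coe_nonneg
  set U := transitionOp hA hB C τ
  set T := countOp A C
  set L := poissonGen hA hB C τ with hL
  have hT := isC0Semigroup_countOp A C
  set g := flowGenC hA C (Ck_anti one_le_two hf) + conjOp C f
  have hgraph : (f, g) ∈ generatorGraph (nnTime T) := mem_generatorGraph_countOp hA C _
  have hT1 : ∀ r, 0 ≤ r → ‖T r‖ ≤ 1 := fun r hr => norm_countOp_le hA C hr
  change ‖expOp L s f - T s f‖ ≤ _
  have hP1 : ∀ r, 0 ≤ r → ‖expOp L r‖ ≤ 1 := fun r hr =>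
    norm_expOp_poissonGen_le hA hB C τ hr
  rcases le_or_gt (τ : ℝ) 1 with hle | hgt
  · have hτsq : (τ : ℝ) ≤ √(τ : ℝ) := by
      have := Real.sq_sqrt hτ'.le
      nlinarith [Real.sqrt_nonneg (τ : ℝ), Real.sqrt_le_one.2 hle]
    have hb : ∀ r, 0 ≤ r → ‖L (T r f) - T r g‖ ≤ (c2 * K + c1 * (c3 * N)) * τ := by
      intro r hr
      have e : L (T r f) - T r g = (τ : ℝ)⁻¹ • (U (T r f) - T τ (T r f))
          + T r ((τ : ℝ)⁻¹ • ((T τ f - f) - (τ : ℝ) • g)) := by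
        have hc : T τ (T r f) = T r (T τ f) := by
          rw [← mul_apply_eq_comp, ← mul_apply_eq_comp,
            ← hT.add _ _ hτ'.le hr, ← hT.add _ _ hr hτ'.le, add_comm]
        rw [hc, map_smul, map_sub, map_sub, map_smul]
        change (τ : ℝ)⁻¹ • (U (T r f) - T r f) - T r g = _
        rw [smul_sub, smul_sub, smul_sub, smul_sub, inv_smul_smul₀ hτ'.ne']
        abel
      have hTr : HLip K (T r f) := hfK.countOp hA C hr hK
      have e1 := h2 A B C hAR hBR hCR hA hB 1 le_rfl (fun u h0 _ => hT1 u h0) K hK _ hTr τ hτ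
        (by exact_mod_cast hle)
      have e2 : ‖(T τ f - f) - (τ : ℝ) • g‖ ≤ c1 * (c3 * N) * τ * τ := by
        rw [hT.mem_generatorGraph_iff.1 hgraph τ hτ'.le]
        have e3 : (τ : ℝ) • g = ∫ s in (0 : ℝ)..τ, g := by
          rw [intervalIntegral.integral_const, sub_zero]
        rw [e3, ← intervalIntegral.integral_sub ((hT.cont g).intervalIntegrable 0 _)
          (continuous_const.intervalIntegrable 0 _)]
        refine norm_integral_le_of_forall hτ'.le fun u hu0 hu => ?_
        refine (h1 A C hAR hCR hA (c3 * N) (by positivity) g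
          (h3 A C hAR hCR hA f hf) u hu0).trans ?_
        gcongr
      have e4 : ‖(τ : ℝ)⁻¹ • ((T τ f - f) - (τ : ℝ) • g)‖ ≤ c1 * (c3 * N) * τ := by
        rw [norm_smul, norm_inv, norm_of_nonneg hτ'.le, inv_mul_le_iff₀ hτ']
        linarith
      have e5 : ‖(τ : ℝ)⁻¹ • (U (T r f) - T τ (T r f))‖ ≤ c2 * K * τ := by
        rw [norm_smul, norm_inv, norm_of_nonneg hτ'.le, inv_mul_le_iff₀ hτ']
        linarith
      have e6 := (T r).le_of_opNorm_le_of_le (hT1 r hr) e4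
      rw [e]
      refine (norm_add_le _ _).trans ((add_le_add e5 e6).trans ?_)
      linarith
    refine (hT.norm_expOp_sub_le (fun r hr => hT.hasDerivWithinAt hgraph hr) hs0 hP1 hb).trans ?_
    have e7 : (c2 * K + c1 * (c3 * N)) * τ * s ≤ (c2 * K + c1 * (c3 * N)) * √(τ : ℝ) * s := by
      gcongr
    refine e7.trans ?_
    have e8 : 0 ≤ √(τ : ℝ) * s * (3 * (c1 + 2)) * N := by positivity
    rw [hKdef]
    linarith
  · have hsq : 1 ≤ √(τ : ℝ) := Real.one_le_sqrt.2 hgt.le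
    have e1 : ‖expOp L s f - f‖ ≤ 2 * K * s := by
      have h0 : IsC0Semigroup (fun _ : ℝ => (1 : (State n →ᵇ ℝ) →L[ℝ] (State n →ᵇ ℝ))) :=
        ⟨rfl, fun _ _ _ _ => rfl, fun _ => continuous_const⟩
      refine h0.norm_expOp_sub_le (f := f) (g := 0) (fun r _ => ?_) hs0 hP1 fun r _ => ?_
      · simpa using! hasDerivWithinAt_const r (Ici r) f
      simp only [one_apply_eq_self, sub_zero]
      change ‖(τ : ℝ)⁻¹ • (U f - f)‖ ≤ _
      rw [norm_smul, norm_inv, norm_of_nonneg hτ'.le, inv_mul_le_iff₀ hτ']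
      have e2 := U.le_of_opNorm_le_of_le (norm_transitionOp_le hA hB C τ) (hfK.norm_le hK)
      have e3 := hfK.norm_le hK
      refine (norm_sub_le _ _).trans ?_
      nlinarith
    have e4 := h1 A C hAR hCR hA K hK f hfK s hs0
    rw [norm_sub_rev] at e4
    have e5 := norm_sub_le_norm_sub_add_norm_sub (expOp L s f) f (T s f)
    refine e5.trans ((add_le_add e1 e4).trans ?_)
    have e6 : (c1 + 2) * K * s ≤ √(τ : ℝ) * ((c1 + 2) * K * s) :=
      le_mul_of_one_le_left (by positivity) hsq
    have e8 : 0 ≤ √(τ : ℝ) * s * (3 * c2 + c1 * c3) * N := by positivity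
    rw [hKdef] at *
    linarith

theorem tendsto_poissonSemigroup (s : ℝ≥0) (f : State n →ᵇ ℝ) :
    Tendsto (fun τ : ℝ≥0 => poissonSemigroup hA hB C τ s f) (𝓝[>] 0) (𝓝 (countOp A C s f)) := by
  obtain ⟨c, hc, h⟩ := exists_rate_poisson n (max ‖A‖ (max ‖B‖ ‖C‖))
  refine tendsto_of_tendsto_on_Ck (V := fun τ : ℝ≥0 => poissonSemigroup hA hB C τ s)
    (Eventually.of_forall fun τ => norm_expOp_poissonGen_le hA hB C τ s.coe_nonneg) (fun g hg =>
      ?_) f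
  rw [tendsto_iff_norm_sub_tendsto_zero]
  have hlim : Tendsto (fun τ : ℝ≥0 => √(τ : ℝ) * s * c * ckNorm 2 g) (𝓝[>] 0) (𝓝 0) := by
    have h1 : Continuous fun τ : ℝ≥0 => √(τ : ℝ) * s * c * ckNorm 2 g := by fun_prop
    have h2 := (h1.tendsto 0).mono_left (nhdsWithin_le_nhds (s := Ioi 0))
    simpa using h2
  refine squeeze_zero' (Eventually.of_forall fun τ => norm_nonneg _) ?_ hlim
  filter_upwards [self_mem_nhdsWithin] with τ hτ
  exact h A B C (le_max_left _ _) ((le_max_left _ _).trans (le_max_right _ _))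
    ((le_max_right _ _).trans (le_max_right _ _)) hA hB g hg s τ hτ

end Rates

/-! ### Invariance of spaces of smooth functions -/

section Jets

variable {V F : Type*} [NormedAddCommGroup V] [NormedSpace ℝ V] [NormedAddCommGroup F]
  [NormedSpace ℝ F] {D : Set V}

/-- Uniform convergence of the derivatives on a convex set (not necessarily open). -/
theorem hasFDerivWithinAt_of_forall_near (hD : Convex ℝ D) {g : V → F} {G : V → V →L[ℝ] F} {x : V}
    (hx : x ∈ D) (hG : ContinuousWithinAt G D x)
    (h : ∀ ε > 0, ∃ (u : V → F) (U : V → V →L[ℝ] F), (∀ y ∈ D, HasFDerivWithinAt u (U y) D y) ∧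
      (∀ y ∈ D, ‖u y - g y‖ ≤ ε) ∧ ∀ y ∈ D, ‖U y - G y‖ ≤ ε) : HasFDerivWithinAt g (G x) D x := by
  rw [hasFDerivWithinAt_iff_isLittleO, Asymptotics.isLittleO_iff]
  intro η hη
  obtain ⟨δ, hδ, hδG⟩ := Metric.continuousWithinAt_iff.1 hG (η / 2) (by positivity)
  filter_upwards [self_mem_nhdsWithin, mem_nhdsWithin_of_mem_nhds (Metric.ball_mem_nhds x hδ)]
    with y hy hyb
  have key : ∀ ε > 0, ‖g y - g x - G x (y - x)‖ ≤ (η / 2 + ε) * ‖y - x‖ + 2 * ε := by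
    intro ε hε
    obtain ⟨u, U, hU, h1, h2⟩ := h ε hε
    have h3 := Convex.norm_image_sub_le_of_norm_hasFDerivWithin_le' (f := u) (f' := U) (φ := G x)
      (s := D ∩ Metric.ball x δ) (C := η / 2 + ε)
      (fun z hz => (hU z hz.1).mono inter_subset_left) (fun z hz => by
        have h4 := hδG hz.1 hz.2
        rw [dist_eq_norm] at h4
        have h5 := norm_add_le (U z - G z) (G z - G x)
        rw [sub_add_sub_cancel] at h5
        linarith [h2 z hz.1]) (hD.inter (convex_ball x δ)) ⟨hx, Metric.mem_ball_self hδ⟩ ⟨hy, hyb⟩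
    have e : g y - g x - G x (y - x) = (u y - u x - G x (y - x)) - (u y - g y) + (u x - g x) := by
      abel
    rw [e]
    refine (norm_add_le _ _).trans ((add_le_add (norm_sub_le _ _) le_rfl).trans ?_)
    linarith [h1 y hy, h1 x hx]
  refine le_of_forall_pos_le_add fun ε hε => ?_
  have h6 := key (min (η / 2) (ε / 2)) (by positivity)
  have h7 := min_le_left (η / 2) (ε / 2)
  have h8 := min_le_right (η / 2) (ε / 2)
  have h9 : (η / 2 + min (η / 2) (ε / 2)) * ‖y - x‖ ≤ η * ‖y - x‖ :=
    mul_le_mul_of_nonneg_right (by linarith) (norm_nonneg _)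
  linarith

open scoped Pointwise in
/-- The iterated derivatives in the second variable of a jointly smooth function. -/
theorem continuousOn_iteratedFDerivWithin_slice (hD : UniqueDiffOn ℝ D) {k : ℕ} {Φ : ℝ × V → F}
    (hΦ : ContDiffOn ℝ k Φ (univ ×ˢ D)) {j : ℕ} (hj : j ≤ k) :
    ContinuousOn (fun q : ℝ × V => iteratedFDerivWithin ℝ j (fun y => Φ (q.1, y)) D q.2)
      (univ ×ˢ D) := by
  have hs : UniqueDiffOn ℝ ((univ : Set ℝ) ×ˢ D) := uniqueDiffOn_univ.prod hD
  have hpre : (ContinuousLinearMap.inr ℝ ℝ V) ⁻¹' (univ ×ˢ D) = D := by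
    ext y
    simp
  have key : ∀ q ∈ (univ : Set ℝ) ×ˢ D, iteratedFDerivWithin ℝ j (fun y => Φ (q.1, y)) D q.2
      = (iteratedFDerivWithin ℝ j Φ (univ ×ˢ D) q).compContinuousLinearMap
        fun _ => ContinuousLinearMap.inr ℝ ℝ V := by
    intro q hq
    have hshift : ((q.1, 0) : ℝ × V) +ᵥ ((univ : Set ℝ) ×ˢ D) = univ ×ˢ D := by
      ext z
      rw [mem_vadd_set_iff_neg_vadd_mem]
      simp
    have hΦ' : ContDiffOn ℝ k (fun z => Φ ((q.1, 0) + z)) (univ ×ˢ D) :=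
      hΦ.comp (contDiff_const.add contDiff_id).contDiffOn fun z hz => by
        simpa using! hz
    have h1 := (ContinuousLinearMap.inr ℝ ℝ V).iteratedFDerivWithin_comp_right hΦ' hs
      (hpre.symm ▸ hD) (x := q.2) (by simpa using! hq) (i := j) (by exact_mod_cast hj)
    rw [hpre, iteratedFDerivWithin_comp_add_left, hshift] at h1
    have h2 : ((fun z => Φ ((q.1, 0) + z)) ∘ ContinuousLinearMap.inr ℝ ℝ V)
        = fun y => Φ (q.1, y) := by
      funext y
      simp
    rw [h2] at h1
    simpa using! h1
  refine ContinuousOn.congr ?_ key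
  have hc := hΦ.continuousOn_iteratedFDerivWithin (m := j) (by exact_mod_cast hj) hs
  exact (ContinuousMultilinearMap.compContinuousLinearMapL (𝕜 := ℝ) (F := F)
    fun _ : Fin j => ContinuousLinearMap.inr ℝ ℝ V).continuous.comp_continuousOn hc

variable {X : Type*} [TopologicalSpace X] [CompactSpace X]

omit [CompactSpace X] [TopologicalSpace X] in
theorem norm_curryLeft_sub {m : ℕ} (p q : V[×(m + 1)]→L[ℝ] ℝ) :
    ‖p.curryLeft - q.curryLeft‖ = ‖p - q‖ := by
  have h : p.curryLeft - q.curryLeft = (p - q).curryLeft := rfl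
  rw [h, ContinuousMultilinearMap.curryLeft_norm]

/-- Families of continuous multilinear-form-valued functions of the orders `0, …, k`. -/
def JetSpace (V X : Type*) [NormedAddCommGroup V] [NormedSpace ℝ V] [TopologicalSpace X]
    [CompactSpace X] (k : ℕ) : Type _ := (j : Fin (k + 1)) → (X →ᵇ (V[×(j : ℕ)]→L[ℝ] ℝ))

set_option synthInstance.maxHeartbeats 200000 in
instance (k : ℕ) : NormedAddCommGroup (JetSpace V X k) :=
  inferInstanceAs (NormedAddCommGroup ((j : Fin (k + 1)) → (X →ᵇ (V[×(j : ℕ)]→L[ℝ] ℝ))))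

set_option synthInstance.maxHeartbeats 200000 in
instance (k : ℕ) : NormedSpace ℝ (JetSpace V X k) :=
  inferInstanceAs (NormedSpace ℝ ((j : Fin (k + 1)) → (X →ᵇ (V[×(j : ℕ)]→L[ℝ] ℝ))))

set_option synthInstance.maxHeartbeats 200000 in
instance (k : ℕ) : CompleteSpace (JetSpace V X k) :=
  inferInstanceAs (CompleteSpace ((j : Fin (k + 1)) → (X →ᵇ (V[×(j : ℕ)]→L[ℝ] ℝ))))

/-- `c` parametrizes the convex set `D`, and `e f` is `f` in this parametrization. -/
structure IsChart (c : X → V) (D : Set V) (e : (X →ᵇ ℝ) → V → ℝ) : Prop where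
  cont : Continuous c
  inj : Function.Injective c
  range_eq : range c = D
  apply : ∀ f x, e f (c x) = f x
  convex : Convex ℝ D
  uniqueDiff : UniqueDiffOn ℝ D

namespace IsChart

variable {c : X → V} {e : (X →ᵇ ℝ) → V → ℝ} (h : IsChart c D e) {k : ℕ}
include h

theorem mem (x : X) : c x ∈ D := h.range_eq ▸ mem_range_self x

theorem eqOn_add (f g : X →ᵇ ℝ) : EqOn (e (f + g)) (e f + e g) D := by
  intro y hy
  rw [← h.range_eq] at hy
  obtain ⟨x, rfl⟩ := hy
  rw [Pi.add_apply, h.apply, h.apply, h.apply]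
  rfl

theorem eqOn_smul (a : ℝ) (f : X →ᵇ ℝ) : EqOn (e (a • f)) (a • e f) D := by
  intro y hy
  rw [← h.range_eq] at hy
  obtain ⟨x, rfl⟩ := hy
  rw [Pi.smul_apply, h.apply, h.apply]
  rfl

variable {M : Submodule ℝ (X →ᵇ ℝ)} (hM : ∀ f, f ∈ M ↔ ContDiffOn ℝ k (e f) D)

/-- The derivatives of order at most `k` of a function in `Cᵏ`. -/
def jet : M →ₗ[ℝ] JetSpace V X k where
  toFun f j := mkOfCompact
    ⟨fun x => iteratedFDerivWithin ℝ j (e f) D (c x),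
      (((hM f).1 f.2).continuousOn_iteratedFDerivWithin (by exact_mod_cast j.is_le)
        h.uniqueDiff).comp_continuous h.cont h.mem⟩
  map_add' f g := by
    refine funext fun j => BoundedContinuousFunction.ext fun x => ?_
    change iteratedFDerivWithin ℝ j (e (f + g)) D (c x)
      = iteratedFDerivWithin ℝ j (e f) D (c x) + iteratedFDerivWithin ℝ j (e g) D (c x)
    have hj : ((j : ℕ) : WithTop ℕ∞) ≤ k := by exact_mod_cast j.is_le
    rw [iteratedFDerivWithin_congr (h.eqOn_add f g) (h.mem x)]
    exact iteratedFDerivWithin_add_apply ((((hM f).1 f.2).of_le hj) _ (h.mem x))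
      ((((hM g).1 g.2).of_le hj) _ (h.mem x)) h.uniqueDiff (h.mem x)
  map_smul' a f := by
    refine funext fun j => BoundedContinuousFunction.ext fun x => ?_
    change iteratedFDerivWithin ℝ j (e (a • (f : X →ᵇ ℝ))) D (c x)
      = a • iteratedFDerivWithin ℝ j (e f) D (c x)
    have hj : ((j : ℕ) : WithTop ℕ∞) ≤ k := by exact_mod_cast j.is_le
    rw [iteratedFDerivWithin_congr (h.eqOn_smul a f) (h.mem x)]
    exact iteratedFDerivWithin_const_smul_apply ((((hM f).1 f.2).of_le hj) _ (h.mem x))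
      h.uniqueDiff (h.mem x)

theorem jet_apply (f : M) (j : Fin (k + 1)) (x : X) :
    h.jet hM f j x = iteratedFDerivWithin ℝ j (e f) D (c x) := rfl

theorem norm_le_norm_jet (f : M) : ‖(f : X →ᵇ ℝ)‖ ≤ ‖h.jet hM f‖ := by
  refine (BoundedContinuousFunction.norm_le (norm_nonneg _)).2 fun x => ?_
  have h1 := ((h.jet hM f 0).norm_coe_le_norm x).trans (norm_le_pi_norm (h.jet hM f) 0)
  rwa [jet_apply, Fin.val_zero, norm_iteratedFDerivWithin_zero, h.apply] at h1

theorem isClosed_range_jet : IsClosed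
    (LinearMap.range (h.jet hM) : Set (JetSpace V X k)) := by
  refine isClosed_of_closure_subset fun p hp => ?_
  rw [Metric.mem_closure_iff] at hp
  have hmap : ∀ x, map c (𝓝 x) = 𝓝[D] (c x) := fun x => by
    rw [← h.range_eq]
    exact (h.cont.isClosedEmbedding h.inj).isInducing.map_nhds_eq x
  let P : V → FormalMultilinearSeries ℝ V ℝ := fun y m =>
    if hm : m < k + 1 then Function.extend c (p ⟨m, hm⟩) 0 y else 0
  have hP : ∀ m (hm : m < k + 1) x, P (c x) m = p ⟨m, hm⟩ x := fun m hm x => by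
    simp only [P, dif_pos hm]
    exact h.inj.extend_apply _ _ x
  have hPc : ∀ m, m < k + 1 → ContinuousOn (P · m) D := fun m hm y hy => by
    rw [← h.range_eq] at hy
    obtain ⟨x, rfl⟩ := hy
    rw [ContinuousWithinAt, ← hmap, tendsto_map'_iff, hP m hm]
    exact ((p ⟨m, hm⟩).continuous.tendsto x).congr fun z => (hP m hm z).symm
  let f : X →ᵇ ℝ := mkOfCompact ⟨fun x => (p 0 x).curry0,
    (continuousMultilinearCurryFin0 ℝ V ℝ).continuous.comp (p 0).continuous⟩
  have hT : HasFTaylorSeriesUpToOn k (e f) P D := by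
    refine ⟨fun y hy => ?_, fun m hm y hy => ?_, fun m hm => hPc m (by
      have : m ≤ k := by exact_mod_cast hm
      omega)⟩
    · rw [← h.range_eq] at hy
      obtain ⟨x, rfl⟩ := hy
      rw [h.apply, hP 0 (Nat.succ_pos k)]
      rfl
    · have hmk : m < k := by exact_mod_cast hm
      refine hasFDerivWithinAt_of_forall_near h.convex (g := (P · m))
        (G := fun y => (P y (m + 1)).curryLeft) hy ?_ fun ε hε => ?_
      · exact (continuousMultilinearCurryLeftEquiv ℝ (fun _ : Fin (m + 1) => V)
          ℝ).continuous.continuousAt.comp_continuousWithinAt (hPc (m + 1) (by omega) y hy)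
      · obtain ⟨_, ⟨u, rfl⟩, hu⟩ := hp ε hε
        have hnear : ∀ (i : ℕ) (hi : i < k + 1), ∀ z ∈ D,
            ‖iteratedFDerivWithin ℝ i (e u) D z - P z i‖ ≤ ε := fun i hi z hz => by
          rw [← h.range_eq] at hz
          obtain ⟨x, rfl⟩ := hz
          rw [hP i hi, ← dist_eq_norm, dist_comm]
          exact ((BoundedContinuousFunction.dist_coe_le_dist x).trans
            (dist_le_pi_dist p (h.jet hM u) ⟨i, hi⟩)).trans hu.le
        have hu' := ((hM u).1 u.2).ftaylorSeriesWithin h.uniqueDiff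
        refine ⟨iteratedFDerivWithin ℝ m (e u) D,
          fun z => (iteratedFDerivWithin ℝ (m + 1) (e u) D z).curryLeft,
          fun z hz => hu'.fderivWithin m hm z hz, hnear m (by omega), fun z hz => ?_⟩
        exact (norm_curryLeft_sub _ _).trans_le (hnear (m + 1) (by omega) z hz)
  refine ⟨⟨f, (hM f).2 hT.contDiffOn⟩, ?_⟩
  refine funext fun j => BoundedContinuousFunction.ext fun x => ?_
  rw [jet_apply, ← hP j j.is_lt]
  exact (hT.eq_iteratedFDerivWithin_of_uniqueDiffOn (by exact_mod_cast j.is_le) h.uniqueDiff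
    (h.mem x)).symm

/-- A perturbed semigroup leaves `Cᵏ` invariant, with bounds uniform on bounded time intervals, if
the group and the perturbation leave it invariant. -/
theorem exists_bound_perturbation {S : ℝ → (X →ᵇ ℝ) →L[ℝ] (X →ᵇ ℝ)} (hS : IsC0Group S)
    {K : (X →ᵇ ℝ) →L[ℝ] (X →ᵇ ℝ)} {T : ℝ → (X →ᵇ ℝ) →L[ℝ] (X →ᵇ ℝ)} (hT : IsPerturbation S K T)
    (hSM : ∀ f ∈ M, ContDiffOn ℝ k (fun q : ℝ × V => e (S q.1 f) q.2) (univ ×ˢ D))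
    (hKM : ∀ f ∈ M, K f ∈ M) : (∀ t, 0 ≤ t → ∀ f ∈ M, T t f ∈ M) ∧ ∀ b : ℝ, ∃ a : ℝ, 0 ≤ a ∧
      ∀ t ∈ Icc 0 b, ∀ f (hf : f ∈ M) (hf' : T t f ∈ M),
        ‖h.jet hM ⟨T t f, hf'⟩‖ ≤ a * ‖h.jet hM ⟨f, hf⟩‖ := by
  have hinj : Function.Injective (h.jet hM) := by
    rw [injective_iff_map_eq_zero]
    intro f hf
    have := h.norm_le_norm_jet hM f
    rw [hf, norm_zero, norm_le_zero_iff] at this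
    exact Subtype.ext this
  let E := LinearMap.range (h.jet hM)
  have : CompleteSpace E := (h.isClosed_range_jet hM).completeSpace_coe
  let J : M ≃ₗ[ℝ] E := LinearEquiv.ofInjective (h.jet hM) hinj
  have hJn : ∀ f, ‖J f‖ = ‖h.jet hM f‖ := fun f => rfl
  let π : E →L[ℝ] (X →ᵇ ℝ) := (M.subtype ∘ₗ J.symm.toLinearMap).mkContinuous 1 fun p => by
    rw [one_mul]
    have := h.norm_le_norm_jet hM (J.symm p)
    rwa [← hJn, J.apply_symm_apply] at this
  have hπ : ∀ p, π p = (J.symm p : X →ᵇ ℝ) := fun p => rfl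
  have hlift : ∀ O : (X →ᵇ ℝ) →L[ℝ] (X →ᵇ ℝ), (∀ f ∈ M, O f ∈ M) →
      ∃ O' : E →L[ℝ] E, ∀ p, π (O' p) = O (π p) := by
    intro O hO
    let O₁ : M →ₗ[ℝ] M := O.toLinearMap.restrict hO
    let g : E →ₗ[ℝ] E := J.toLinearMap ∘ₗ O₁ ∘ₗ J.symm.toLinearMap
    have hg : ∀ p, π (g p) = O (π p) := fun p => by
      rw [hπ, hπ]
      simp [g, O₁]
    refine ⟨⟨g, g.continuous_of_seq_closed_graph fun u x y hu hgu => ?_⟩, hg⟩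
    have h1 : Tendsto (fun i => O (π (u i))) atTop (𝓝 (π y)) := by
      simp only [← hg]
      exact (π.continuous.tendsto y).comp hgu
    have h2 : Tendsto (fun i => O (π (u i))) atTop (𝓝 (O (π x))) :=
      ((O.continuous.comp π.continuous).tendsto x).comp hu
    have h3 := tendsto_nhds_unique h1 h2
    rw [← hg, hπ, hπ] at h3
    exact J.symm.injective (Subtype.ext h3)
  have hπinj : Function.Injective π := fun p q hpq => J.symm.injective (Subtype.ext hpq)
  have hSM' : ∀ t, ∀ f ∈ M, S t f ∈ M := fun t f hf => (hM _).2
    ((hSM f hf).comp (contDiff_prodMk_right t).contDiffOn fun y hy => ⟨mem_univ _, hy⟩)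
  choose S' hS' using fun t => hlift (S t) (hSM' t)
  obtain ⟨K', hK'⟩ := hlift K hKM
  have hS'g : IsC0Group S' := by
    refine ⟨?_, fun s t => ?_, fun p => ?_⟩
    · ext1 p
      refine hπinj ?_
      rw [hS', hS.zero]
      rfl
    · ext1 p
      refine hπinj ?_
      rw [hS', hS.add, mul_apply_eq_comp, mul_apply_eq_comp, hS', hS']
    · rw [continuous_induced_rng]
      refine continuous_pi fun j => ?_
      set f := J.symm p with hf
      have hj : (j : ℕ) ≤ k := j.is_le
      have h1 : Continuous fun q : ℝ × X =>
          iteratedFDerivWithin ℝ j (fun y => e (S q.1 f) y) D (c q.2) :=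
        (continuousOn_iteratedFDerivWithin_slice h.uniqueDiff (hSM f f.2) hj).comp_continuous
          (continuous_fst.prodMk (h.cont.comp continuous_snd)) fun q => ⟨mem_univ _, h.mem _⟩
      have h2 := (ContinuousMap.isometryEquivBoundedOfCompact X
        (V[×(j : ℕ)]→L[ℝ] ℝ)).continuous.comp (ContinuousMap.curry ⟨_, h1⟩).continuous
      refine h2.congr fun t => BoundedContinuousFunction.ext fun x => ?_
      have h3 : S' t p = J ⟨S t f, hSM' t f f.2⟩ := hπinj (by
        rw [hS', hπ, hπ, J.symm_apply_apply])
      change _ = (S' t p : JetSpace V X k) j x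
      rw [h3]
      rfl
  obtain ⟨T', hT'⟩ := hS'g.exists_perturbation K'
  have hTT : ∀ t, 0 ≤ t → ∀ p, π (T' t p) = T t (π p) := fun t ht p =>
    IsPerturbation.intertwine hS hT hS'g hT' π hS' hK' ht p
  have hπJ : ∀ f, π (J f) = f := fun f => by rw [hπ, J.symm_apply_apply]
  refine ⟨fun t ht f hf => ?_, fun b => ?_⟩
  · have h1 := hTT t ht (J ⟨f, hf⟩)
    rw [hπJ] at h1
    rw [← h1]
    exact (J.symm _).2
  · obtain ⟨a, ha, hb⟩ := exists_norm_le_of_strong hT'.cont 0 b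
    refine ⟨a, ha, fun t ht f hf hf' => ?_⟩
    have h1 := hTT t ht.1 (J ⟨f, hf⟩)
    rw [hπJ] at h1
    have h2 : T' t (J ⟨f, hf⟩) = J ⟨T t f, hf'⟩ := hπinj (by rw [h1, hπJ])
    rw [← hJn, ← hJn, ← h2]
    exact (T' t).le_of_opNorm_le (hb t ht) _

end IsChart

end Jets

section Smoothness

variable {n : ℕ} [NeZero n]

section Ring

attribute [local instance] frobeniusNormedRing frobeniusNormedAlgebra

omit [NeZero n] in
theorem contDiff_conj (C : Mat n) (k : ℕ) : ContDiff ℝ k fun x : TracelessHermitian n =>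
    C * (center n + (x : Mat n)) * Cᴴ := by
  have h5 : ContDiff ℝ k fun x : TracelessHermitian n => center n + (x : Mat n) :=
    contDiff_const.add (TracelessHermitian n).subtypeL.contDiff
  exact (contDiff_const.mul h5).mul contDiff_const

end Ring

theorem isChart_coord : IsChart (coord : State n → TracelessHermitian n)
    (coordDomain n) inCoord where
  cont := continuous_coord
  inj ρ σ h := State.ext (by rw [← center_add_coord, h, center_add_coord])
  range_eq := range_coord
  apply := inCoord_coord
  convex := convex_coordDomain
  uniqueDiff := uniqueDiffOn_coordDomain

omit [NeZero n] in
theorem exists_eq_vecMulVec_of_rank_le_one {C : Mat n} (hC : C.rank ≤ 1) :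
    ∃ a b : Fin n → ℂ, C = vecMulVec a b := by
  rw [Matrix.rank] at hC
  obtain ⟨a, ha⟩ := finrank_le_one_iff.1 hC
  choose b hb using fun j => ha ⟨C.mulVecLin (Pi.single j 1), LinearMap.mem_range_self _ _⟩
  refine ⟨a, b, Matrix.ext fun i j => ?_⟩
  have h1 := congrFun (congrArg Subtype.val (hb j)) i
  simp only [Matrix.mulVecLin_apply, Matrix.mulVec_single_one, SetLike.val_smul, Pi.smul_apply,
    smul_eq_mul] at h1
  rw [Matrix.vecMulVec_apply, mul_comm, h1]
  rfl

theorem conjOp_mem_Ck_of_rank_le_one {C : Mat n} (hC : C.rank ≤ 1) (k : ℕ) (f : State n →ᵇ ℝ) :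
    conjOp C f ∈ Ck n k := by
  obtain ⟨a, b, rfl⟩ := exists_eq_vecMulVec_of_rank_le_one hC
  set C := vecMulVec a b
  set Y : Mat n := vecMulVec a (star a) with hY
  have hconj : ∀ X : Mat n, ∃ z : ℂ, C * X * Cᴴ = z • Y := fun X => by
    refine ⟨dotProduct (Matrix.vecMul b X) (star b), ?_⟩
    simp only [C, hY]
    rw [Matrix.conjTranspose_vecMulVec, Matrix.vecMulVec_mul, Matrix.vecMulVec_mul_vecMulVec,
      Matrix.vecMulVec_smul]
  have hYp : Y.PosSemidef := Matrix.posSemidef_vecMulVec_self_star a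
  have hconst : ∃ r : ℝ, ∀ ρ : State n,
      conjOp C f ρ = r * (C * ρ.mat * Cᴴ).trace.re := by
    rcases (State.trace_re_nonneg hYp).eq_or_lt with h0 | h0
    · refine ⟨0, fun ρ => ?_⟩
      obtain ⟨z, hz⟩ := hconj ρ.mat
      rw [conjOp_apply, hz, eq_zero_of_trace hYp h0.symm, smul_zero, hom_zero, zero_mul]
    · obtain ⟨σ, hσ⟩ := exists_smul_state hYp h0
      refine ⟨f σ, fun ρ => ?_⟩
      obtain ⟨z, hz⟩ := hconj ρ.mat
      have hp := posSemidef_conj C ρ.posSemidef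
      have h1 : C * ρ.mat * Cᴴ
          = (C * ρ.mat * Cᴴ).trace.re • σ.mat := by
        have h2 : ((C * ρ.mat * Cᴴ).trace.re : ℂ) = z * Y.trace := by
          rw [← trace_eq_ofReal hp, hz, trace_smul, smul_eq_mul]
        rw [← Complex.coe_smul, h2, hz, trace_eq_ofReal hYp, mul_smul, Complex.coe_smul, ← hσ]
      rw [conjOp_apply]
      conv_lhs => rw [h1]
      rw [hom_eq_of_smul f (State.trace_re_nonneg hp), mul_comm]
  obtain ⟨r, hr⟩ := hconst
  have h3 : ContDiff ℝ k fun x : TracelessHermitian n =>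
      r * traceL n (C * (center n + (x : Mat n)) * Cᴴ) := by
    exact contDiff_const.mul ((traceL n).contDiff.comp (contDiff_conj C k))
  refine h3.contDiffOn.congr fun x hx => ?_
  rw [inCoord_of_mem _ hx, hr]
  rfl

theorem countOp_mem_Ck_and_bound (A : Mat n) {C : Mat n} (hC : IsUnit C ∨ C.rank ≤ 1) (k : ℕ) :
    (∀ s : ℝ≥0, ∀ f ∈ Ck n k, countOp A C s f ∈ Ck n k) ∧
      ∀ t : ℝ≥0, ∃ c : ℝ, ∀ s ≤ t, ∀ f ∈ Ck n k, ckNorm k (countOp A C s f) ≤ c * ckNorm k f := by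
  have hKM : ∀ f ∈ ckSubmodule n k, conjOp C f ∈ ckSubmodule n k := fun f hf =>
    hC.elim (fun h => conjOp_mem_Ck h hf) fun h => conjOp_mem_Ck_of_rank_le_one h k f
  have hM : ∀ f, f ∈ ckSubmodule n k ↔ ContDiffOn ℝ k (inCoord f) (coordDomain n) := fun f =>
    Iff.rfl
  obtain ⟨h1, h2⟩ := isChart_coord.exists_bound_perturbation hM (isC0Group_flowOp A C)
    (isPerturbation_countOp A C)
    (fun f hf => contDiffOn_inCoord_conjOp (contDiff_flowMat A C k) (isUnit_flowMat A C) hf) hKM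
  refine ⟨fun s f hf => h1 s s.coe_nonneg f hf, fun t => ?_⟩
  obtain ⟨a, ha, hb⟩ := h2 t
  have hle : ∀ f (hf : f ∈ ckSubmodule n k), ‖isChart_coord.jet hM ⟨f, hf⟩‖ ≤ ckNorm k f :=
    fun f hf => (pi_norm_le_iff_of_nonneg (ckNorm_nonneg k f)).2 fun j =>
      (BoundedContinuousFunction.norm_le (ckNorm_nonneg k f)).2 fun ρ =>
        norm_iteratedFDerivWithin_le_ckNorm hf j.is_le ρ
  have hge : ∀ f (hf : f ∈ ckSubmodule n k),
      ckNorm k f ≤ (k + 1) * ‖isChart_coord.jet hM ⟨f, hf⟩‖ := fun f hf => by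
    have h3 : ∀ j ∈ Finset.range (k + 1),
        (⨆ ρ : State n, ‖iteratedFDerivWithin ℝ j (inCoord f) (coordDomain n) (coord ρ)‖)
          ≤ ‖isChart_coord.jet hM ⟨f, hf⟩‖ := fun j hj =>
      Real.iSup_le (fun ρ => ((isChart_coord.jet hM ⟨f, hf⟩
        ⟨j, Finset.mem_range.1 hj⟩).norm_coe_le_norm ρ).trans
          (norm_le_pi_norm (f := isChart_coord.jet hM ⟨f, hf⟩) _)) (norm_nonneg _)
    have h4 := Finset.sum_le_card_nsmul _ _ _ h3
    rw [Finset.card_range, nsmul_eq_mul, Nat.cast_succ] at h4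
    exact h4
  refine ⟨(k + 1) * a, fun s hs f hf => ?_⟩
  refine (hge _ (h1 s s.coe_nonneg f hf)).trans ?_
  rw [mul_assoc]
  refine mul_le_mul_of_nonneg_left ?_ (by positivity)
  exact (hb s ⟨s.coe_nonneg, by exact_mod_cast hs⟩ f hf _).trans
    (mul_le_mul_of_nonneg_left (hle f hf) ha)

end Smoothness

/-! ### Independent noise -/

section Noise

/-- The exponential distribution of mean one. -/
def expo : Measure ℝ≥0 :=
  ((volume.restrict (Ici (0 : ℝ))).withDensity fun x => ofReal (exp (-x))).map
    Real.toNNReal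

theorem lintegral_expo {H : ℝ≥0 → ENNReal} (hH : Measurable H) :
    ∫⁻ w, H w ∂expo = ∫⁻ x in Ici (0 : ℝ), ofReal (exp (-x)) * H x.toNNReal := by
  unfold expo
  rw [lintegral_map hH (by fun_prop), lintegral_withDensity_eq_lintegral_mul _ (by fun_prop)
    (by fun_prop)]
  rfl

theorem lintegral_expo_exp_neg {a : ℝ} (ha : -1 < a) :
    ∫⁻ w : ℝ≥0, ofReal (exp (-(a * w))) ∂expo = ofReal (1 / (1 + a)) := by
  rw [lintegral_expo (by fun_prop)]
  have h1 : ∀ x ∈ Ici (0 : ℝ), ofReal (exp (-x))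
      * ofReal (exp (-(a * (x.toNNReal : ℝ)))) = ofReal
        (exp (-(1 + a) * x)) := by
    intro x hx
    rw [← ofReal_mul (exp_nonneg _), ← exp_add, Real.coe_toNNReal _ hx]
    congr 2
    ring
  rw [setLIntegral_congr_fun measurableSet_Ici h1,
    ← Measure.restrict_congr_set (Ioi_ae_eq_Ici (μ := volume) (a := (0 : ℝ))),
    ← ofReal_integral_eq_lintegral_ofReal (integrableOn_exp_mul_Ioi (by linarith) 0)
      (Eventually.of_forall fun x => exp_nonneg _), integral_exp_mul_Ioi (by linarith) 0]
  congr 1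
  rw [mul_zero, Real.exp_zero, neg_div_neg_eq]

instance isProbabilityMeasure_expo : IsProbabilityMeasure expo := by
  constructor
  have := lintegral_expo_exp_neg (a := 0) (by norm_num)
  simpa using this

theorem expo_memoryless (δ : ℝ≥0) {H : ℝ≥0 → ENNReal} (hH : Measurable H) :
    ∫⁻ w in Ici δ, H (w - δ) ∂expo = ofReal (exp (-δ)) * ∫⁻ w, H w ∂expo := by
  have hm : Measurable fun w : ℝ≥0 => H (w - δ) := hH.comp (measurable_id.sub_const δ)
  rw [← lintegral_indicator measurableSet_Ici,
    lintegral_expo (hm.indicator measurableSet_Ici), lintegral_expo hH,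
    ← lintegral_const_mul _ (by fun_prop), ← lintegral_indicator measurableSet_Ici,
    ← lintegral_indicator measurableSet_Ici]
  conv_rhs => rw [← lintegral_sub_right_eq_self _ (δ : ℝ)]
  refine lintegral_congr fun x => ?_
  by_cases hx : (δ : ℝ) ≤ x
  · have hx0 : 0 ≤ x := δ.coe_nonneg.trans hx
    rw [indicator_of_mem (mem_Ici.2 hx0), indicator_of_mem (mem_Ici.2 (sub_nonneg.2 hx)),
      indicator_of_mem (mem_Ici.2 (NNReal.le_toNNReal_of_coe_le hx)), ← mul_assoc,
      ← ofReal_mul (exp_nonneg _), ← exp_add,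
      show (x - δ).toNNReal = x.toNNReal - δ by
        rw [NNReal.sub_def, Real.coe_toNNReal x hx0]]
    congr 3
    ring
  · rw [indicator_of_notMem (s := Ici (0 : ℝ)) (a := x - δ)
      fun h => hx (sub_nonneg.1 (mem_Ici.1 h))]
    by_cases h0 : 0 ≤ x
    · rw [indicator_of_mem (mem_Ici.2 h0), indicator_of_notMem, mul_zero]
      intro h
      refine hx ?_
      rw [← Real.coe_toNNReal x h0]
      exact_mod_cast mem_Ici.1 h
    · rw [indicator_of_notMem fun h => h0 (mem_Ici.1 h)]

theorem expo_Iio (δ : ℝ≥0) : expo (Iio δ) = ofReal (1 - exp (-δ)) := by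
  have h := expo_memoryless δ (H := fun _ => 1) measurable_const
  simp only [lintegral_const, measure_univ, mul_one, Measure.restrict_apply_univ, one_mul] at h
  have h2 := measure_compl (μ := expo) (s := Ici δ) measurableSet_Ici (measure_ne_top _ _)
  rw [compl_Ici, h, measure_univ] at h2
  rw [h2, ENNReal.ofReal_sub _ (exp_nonneg _), ofReal_one]

instance nullSingletonClass_expo : NullSingletonClass expo := by
  refine ⟨fun a => ?_⟩
  have h := expo_Iio a
  have h2 : expo (Iic a) ≤ ofReal (1 - exp (-a)) := by
    have h3 : Tendsto (fun b : ℝ≥0 => ofReal (1 - exp (-b))) (𝓝[>] a)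
        (𝓝 (ofReal (1 - exp (-a)))) := by
      have : Continuous fun b : ℝ≥0 => ofReal (1 - exp (-b)) :=
        ENNReal.continuous_ofReal.comp (by fun_prop)
      exact this.continuousAt.tendsto.mono_left nhdsWithin_le_nhds
    refine ge_of_tendsto h3 ?_
    filter_upwards [self_mem_nhdsWithin] with b hb
    rw [← expo_Iio]
    exact measure_mono (Iic_subset_Iio.2 hb)
  have h4 : expo (Iic a) = expo (Iio a) + expo {a} := by
    rw [← Iio_union_right, measure_union (by simp) (measurableSet_singleton a)]
  rw [h4, h] at h2
  exact le_antisymm (by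
    simpa using (ENNReal.add_le_add_iff_left (ofReal_ne_top)).1
      (h2.trans_eq (add_zero _).symm)) zero_le

theorem integrable_expo : Integrable (fun w : ℝ≥0 => (w : ℝ)) expo ∧
    ∫ w : ℝ≥0, (w : ℝ) ∂expo = 1 := by
  have h : ∫⁻ w : ℝ≥0, ofReal (w : ℝ) ∂expo = 1 := by
    have h1 : ∀ x ∈ Ioi (0 : ℝ), ofReal (exp (-x))
        * ofReal (x.toNNReal : ℝ) = ofReal
          (exp (-x) * x ^ ((2 : ℝ) - 1)) := by
      intro x hx
      rw [← ofReal_mul (exp_nonneg _), Real.coe_toNNReal _ (le_of_lt hx)]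
      norm_num
    rw [lintegral_expo (by fun_prop),
      ← Measure.restrict_congr_set (Ioi_ae_eq_Ici (μ := volume) (a := (0 : ℝ))),
      setLIntegral_congr_fun measurableSet_Ioi h1,
      ← ofReal_integral_eq_lintegral_ofReal (Real.GammaIntegral_convergent (by norm_num)),
      ← Real.Gamma_eq_integral (by norm_num), Real.Gamma_two, ofReal_one]
    filter_upwards [ae_restrict_mem measurableSet_Ioi] with x hx
    exact mul_nonneg (exp_nonneg _) (Real.rpow_nonneg (le_of_lt hx) _)
  have hm : AEStronglyMeasurable (fun w : ℝ≥0 => (w : ℝ)) expo :=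
    (by fun_prop : Measurable fun w : ℝ≥0 => (w : ℝ)).aestronglyMeasurable
  refine ⟨⟨hm, ?_⟩, ?_⟩
  · rw [hasFiniteIntegral_iff_ofReal (Eventually.of_forall fun w => w.coe_nonneg), h]
    exact ENNReal.one_lt_top
  · rw [integral_eq_lintegral_of_nonneg_ae (Eventually.of_forall fun w => w.coe_nonneg) hm, h]
    rfl

/-- The law of a sequence of independent random variables with law `m`. -/
abbrev iid {X : Type*} [MeasurableSpace X] (m : Measure X) [IsProbabilityMeasure m] :
    Measure (ℕ → X) :=
  Measure.infinitePi fun _ => m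

/-- The sequence without its first term. -/
def shift {X : Type*} (w : ℕ → X) : ℕ → X := fun i => w (i + 1)

/-- The sequence with an additional first term. -/
def consSeq {X : Type*} (p : X × (ℕ → X)) : ℕ → X := fun i => Nat.casesOn i p.1 p.2

@[fun_prop]
theorem measurable_shift {X : Type*} [MeasurableSpace X] :
    Measurable (shift : (ℕ → X) → ℕ → X) :=
  measurable_pi_lambda _ fun i => measurable_pi_apply (i + 1)

@[fun_prop]
theorem measurable_consSeq {X : Type*} [MeasurableSpace X] :
    Measurable (consSeq : X × (ℕ → X) → ℕ → X) := by
  refine measurable_pi_lambda _ fun i => ?_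
  cases i with
  | zero => exact measurable_fst
  | succ i => exact (measurable_pi_apply i).comp measurable_snd

theorem map_consSeq_iid {X : Type*} [MeasurableSpace X] (m : Measure X) [IsProbabilityMeasure m] :
    (m.prod (iid m)).map consSeq = iid m := by
  classical
  refine Measure.eq_infinitePi _ fun s t ht => ?_
  obtain ⟨N, hN⟩ : ∃ N, s ⊆ Finset.range (N + 1) :=
    ⟨s.sup id, fun i hi => Finset.mem_range_succ_iff.2 (Finset.le_sup (f := id) hi)⟩
  let t' : ℕ → Set X := fun i => if i ∈ s then t i else univ
  have ht' : ∀ i, MeasurableSet (t' i) := fun i => by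
    by_cases hi : i ∈ s <;> simp [t', hi, ht i]
  have h1 : Set.pi (s : Set ℕ) t = Set.pi (Finset.range (N + 1) : Set ℕ) t' := by
    ext w
    simp only [Set.mem_pi, Finset.mem_coe]
    refine ⟨fun h i _ => ?_, fun h i hi => ?_⟩
    · by_cases hi : i ∈ s
      · simpa [t', hi] using h i hi
      · simp [t', hi]
    · simpa [t', hi] using h i (hN hi)
  have h2 : ∏ i ∈ s, m (t i) = ∏ i ∈ Finset.range (N + 1), m (t' i) := by
    rw [← Finset.prod_subset hN fun i _ hi => by simp [t', hi]]
    exact Finset.prod_congr rfl fun i hi => by simp [t', hi]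
  have h3 : consSeq ⁻¹' Set.pi (Finset.range (N + 1) : Set ℕ) t'
      = t' 0 ×ˢ Set.pi (Finset.range N : Set ℕ) fun i => t' (i + 1) := by
    ext p
    simp only [mem_preimage, Set.mem_pi, Finset.mem_coe, Finset.mem_range, mem_prod]
    refine ⟨fun h => ⟨h 0 (Nat.succ_pos _), fun i hi => h (i + 1) (by omega)⟩, ?_⟩
    rintro ⟨h, h'⟩ (_ | i) hi
    · exact h
    · exact h' i (by omega)
  rw [h1, h2, Measure.map_apply measurable_consSeq
    (MeasurableSet.pi (Finset.countable_toSet _) fun i _ => ht' i), h3, Measure.prod_prod,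
    Measure.infinitePi_pi _ fun i _ => ht' (i + 1), Finset.prod_range_succ', mul_comm]

theorem lintegral_iid {X : Type*} [MeasurableSpace X] (m : Measure X) [IsProbabilityMeasure m]
    {H : (ℕ → X) → ENNReal} (hH : Measurable H) :
    ∫⁻ w, H w ∂(iid m) = ∫⁻ a, ∫⁻ w, H (consSeq (a, w)) ∂(iid m) ∂m := by
  rw [← map_consSeq_iid m, lintegral_map hH measurable_consSeq, map_consSeq_iid,
    lintegral_prod _ (by fun_prop)]

@[simp]
theorem shift_consSeq {X : Type*} (p : X × (ℕ → X)) : shift (consSeq p) = p.2 := rfl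

@[simp]
theorem consSeq_zero {X : Type*} (p : X × (ℕ → X)) : consSeq p 0 = p.1 := rfl

/-- The partial sums of a sequence. -/
def partialSum (e : ℕ → ℝ≥0) (i : ℕ) : ℝ≥0 := ∑ l ∈ Finset.range i, e l

@[fun_prop]
theorem measurable_partialSum (i : ℕ) : Measurable fun e => partialSum e i :=
  Finset.measurable_sum _ fun l _ => measurable_pi_apply l

theorem partialSum_succ' (e : ℕ → ℝ≥0) (i : ℕ) :
    partialSum e (i + 1) = partialSum (shift e) i + e 0 :=
  Finset.sum_range_succ' _ _

theorem ae_tendsto_partialSum_div :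
    ∀ᵐ e ∂(iid expo), Tendsto (fun i : ℕ => (partialSum e i : ℝ) / i) atTop (𝓝 1) := by
  have hm : ∀ i : ℕ, MeasurePreserving (Function.eval i) (iid expo) expo := fun i =>
    measurePreserving_eval_infinitePi (fun _ : ℕ => expo) i
  have hc : Measurable fun w : ℝ≥0 => (w : ℝ) := by fun_prop
  have h0 : ∫ e : ℕ → ℝ≥0, (e 0 : ℝ) ∂(iid expo) = 1 := by
    have := integral_map (hm 0).aemeasurable (f := fun w : ℝ≥0 => (w : ℝ))
      hc.aestronglyMeasurable
    rw [(hm 0).map_eq, integrable_expo.2] at this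
    exact this.symm
  have h := strong_law_ae_real (μ := iid expo) (fun i e => ((e i : ℝ≥0) : ℝ))
    ((hm 0).integrable_comp_of_integrable integrable_expo.1)
    (fun i j hij => (iIndepFun_infinitePi (P := fun _ : ℕ => expo)
      (X := fun _ w => (w : ℝ)) fun _ => hc).indepFun hij)
    (fun i => ⟨(hc.comp (measurable_pi_apply i)).aemeasurable,
      (hc.comp (measurable_pi_apply 0)).aemeasurable, by
      have h1 : ∀ j : ℕ, (iid expo).map (fun e : ℕ → ℝ≥0 => ((e j : ℝ≥0) : ℝ))
          = expo.map fun w : ℝ≥0 => (w : ℝ) := fun j => by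
        have h2 := Measure.map_map (μ := iid expo) hc (hm j).measurable
        rw [(hm j).map_eq] at h2
        exact h2.symm
      rw [h1, h1]⟩)
  rw [h0] at h
  filter_upwards [h] with e he
  simpa [partialSum] using he

theorem ae_pos_of_iid : ∀ᵐ e ∂(iid expo), ∀ i, 0 < e i := by
  rw [ae_all_iff]
  intro i
  have h : ∀ᵐ w ∂expo, 0 < w := by
    filter_upwards [compl_mem_ae_iff.2 (measure_singleton (μ := expo) 0)] with w hw
    exact pos_iff_ne_zero.2 hw
  exact (measurePreserving_eval_infinitePi (fun _ : ℕ => expo) i).quasiMeasurePreserving.ae h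

theorem ae_partialSum_ne (i : ℕ) (t : ℝ≥0) :
    ∀ᵐ e ∂(iid expo), partialSum e (i + 1) ≠ t := by
  have hS : MeasurableSet {e : ℕ → ℝ≥0 | partialSum e (i + 1) = t} :=
    (measurable_partialSum (i + 1)) (measurableSet_singleton t)
  have hT : MeasurableSet {p : ℝ≥0 × (ℕ → ℝ≥0) | partialSum p.2 i + p.1 = t} :=
    (((measurable_partialSum i).comp measurable_snd).add measurable_fst)
      (measurableSet_singleton t)
  rw [ae_iff]
  simp only [ne_eq, not_not]
  rw [← map_consSeq_iid, Measure.map_apply measurable_consSeq hS]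
  have h1 : consSeq ⁻¹' {e : ℕ → ℝ≥0 | partialSum e (i + 1) = t}
      = {p | partialSum p.2 i + p.1 = t} := by
    ext p
    simp [partialSum_succ']
  rw [h1, Measure.prod_apply_symm hT, lintegral_eq_zero_iff (measurable_measure_prodMk_right hT)]
  refine Eventually.of_forall fun e => ?_
  refine Set.Subsingleton.measure_zero (fun a ha b hb => ?_) _
  exact add_left_cancel ((show partialSum e i + a = t from ha).trans (show _ = t from hb).symm)

theorem lintegral_exp_neg_partialSum (i : ℕ) :
    ∫⁻ e, ofReal (exp (-(partialSum e i : ℝ))) ∂(iid expo) = (2⁻¹ : ENNReal) ^ i := by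
  induction i with
  | zero => simp [partialSum]
  | succ i ih =>
    have h1 : ∀ (a : ℝ≥0) (w : ℕ → ℝ≥0),
        ofReal (exp (-(partialSum (consSeq (a, w)) (i + 1) : ℝ)))
          = ofReal (exp (-(1 * a)))
            * ofReal (exp (-(partialSum w i : ℝ))) := fun a w => by
      rw [partialSum_succ', ← ofReal_mul (exp_nonneg _), ← exp_add]
      congr 2
      simp only [shift_consSeq, consSeq_zero, NNReal.coe_add]
      ring
    rw [lintegral_iid _ (by fun_prop)]
    simp_rw [h1]
    simp_rw [lintegral_const_mul _ (show Measurable fun w : ℕ → ℝ≥0 =>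
      ofReal (exp (-(partialSum w i : ℝ))) by fun_prop), ih]
    rw [lintegral_mul_const _ (by fun_prop), lintegral_expo_exp_neg (by norm_num), pow_succ',
      show (1 : ℝ) / (1 + 1) = 2⁻¹ by norm_num, ENNReal.ofReal_inv_of_pos (by norm_num)]
    simp

/-- The uniform distribution on the unit interval. -/
def unif : Measure ℝ := volume.restrict (Icc 0 1)

instance isProbabilityMeasure_unif : IsProbabilityMeasure unif :=
  ⟨by simp [unif]⟩

instance nullSingletonClass_unif : NullSingletonClass unif := by
  unfold unif
  infer_instance

theorem unif_Iio {q : ℝ} (h1 : q ≤ 1) : unif (Iio q) = ofReal q := by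
  unfold unif
  rw [Measure.restrict_apply measurableSet_Iio]
  have : Iio q ∩ Icc 0 1 = Ico 0 q := by
    ext x
    simp only [mem_inter_iff, mem_Iio, mem_Icc, mem_Ico]
    constructor
    · exact fun h => ⟨h.2.1, h.1⟩
    · exact fun h => ⟨h.2, h.1, by linarith [h.2]⟩
  rw [this, Real.volume_Ico, sub_zero]

end Noise

/-! ### Random dynamical systems driven by noise -/

section Driven

variable {E Ω : Type*} [MeasurableSpace E] [MeasurableSpace Ω]

/-- A map `G` of pairs of a state and a noise that moves the state according to the kernel `k` and
leaves fresh noise behind. -/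
structure IsDriven (μ : Measure Ω) (k : E → Measure E) (G : E × Ω → E × Ω) : Prop where
  measurable : Measurable G
  sfinite : ∀ x, SFinite (k x)
  lintegral : ∀ (x : E) (H : E × Ω → ENNReal), Measurable H →
    ∫⁻ ω, H (G (x, ω)) ∂μ = ∫⁻ y, ∫⁻ ω, H (y, ω) ∂μ ∂(k x)

/-- The successive states. -/
def orbit (G : E × Ω → E × Ω) (j : ℕ) (p : E × Ω) : E := (G^[j] p).1

theorem IsDriven.measurable_orbit {μ : Measure Ω} {k : E → Measure E} {G : E × Ω → E × Ω}
    (hG : IsDriven μ k G) (j : ℕ) : Measurable (orbit G j) :=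
  measurable_fst.comp (hG.measurable.iterate j)

theorem IsDriven.lintegral_stopped {μ : Measure Ω} [IsProbabilityMeasure μ] {k : E → Measure E}
    {G : E × Ω → E × Ω} (hG : IsDriven μ k G) (K : ℕ) (x : E) {Φ : (ℕ → E) → ENNReal}
    (hΦ : Measurable Φ) {H : E × Ω → ENNReal} (hH : Measurable H) :
    ∫⁻ ω, Φ (fun j => orbit G (min j K) (x, ω)) * H (G^[K] (x, ω)) ∂μ
      = ∫⁻ ω, Φ (fun j => orbit G (min j K) (x, ω))
          * ∫⁻ ω', H (orbit G K (x, ω), ω') ∂μ ∂μ := by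
  induction K generalizing x Φ with
  | zero =>
    have h1 : ∀ ω : Ω, (fun j => orbit G (min j 0) (x, ω)) = fun _ => x := fun ω => by
      funext j
      simp [orbit]
    simp only [h1]
    simp only [orbit, Function.iterate_zero, id]
    rw [lintegral_const_mul _ (by fun_prop), lintegral_const]
    simp
  | succ K ih =>
    have h1 : ∀ ω, (fun j => orbit G (min j (K + 1)) (x, ω))
        = consSeq (x, fun j => orbit G (min j K) (G (x, ω))) := fun ω => by
      funext j
      cases j with
      | zero => simp [orbit, consSeq]
      | succ j =>
        rw [Nat.succ_min_succ]
        simp [orbit, consSeq]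
    have hst : Measurable fun p : E × Ω => fun j => orbit G (min j K) p :=
      measurable_pi_lambda _ fun j => hG.measurable_orbit _
    have hΦ' : Measurable fun q : ℕ → E => Φ (consSeq (x, q)) := by fun_prop
    have hH' : Measurable fun y : E => ∫⁻ ω', H (y, ω') ∂μ := hH.lintegral_prod_right'
    have h2 := hG.lintegral x (fun p => Φ (consSeq (x, fun j => orbit G (min j K) p))
      * H (G^[K] p)) ((hΦ'.comp hst).mul (hH.comp (hG.measurable.iterate K)))
    have h3 := hG.lintegral x (fun p => Φ (consSeq (x, fun j => orbit G (min j K) p))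
      * ∫⁻ ω', H (orbit G K p, ω') ∂μ)
      ((hΦ'.comp hst).mul (hH'.comp (hG.measurable_orbit K)))
    simp only [h1]
    simp only [orbit, Function.iterate_succ_apply] at h2 h3 ih ⊢
    rw [h2, h3]
    exact lintegral_congr fun y => ih y hΦ'

/-- The process `x` is a Markov chain with transition operator `U` started at `a`. -/
structure IsChain {X : Type*} [TopologicalSpace X] [MeasurableSpace X] (μ : Measure Ω)
    (U : (X →ᵇ ℝ) →L[ℝ] (X →ᵇ ℝ)) (a : X) (x : ℕ → Ω → X) : Prop where
  measurable : ∀ j, Measurable (x j)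
  start : ∀ ω, x 0 ω = a
  lintegral : ∀ (k m : ℕ) (Φ : (ℕ → X) → ENNReal), Measurable Φ → ∀ f : X →ᵇ ℝ, 0 ≤ f →
    ∫⁻ ω, Φ (fun j => x (min j k) ω) * ofReal (f (x (k + m) ω)) ∂μ
      = ∫⁻ ω, Φ (fun j => x (min j k) ω) * ofReal ((U ^ m) f (x k ω)) ∂μ

theorem IsDriven.isChain {X : Type*} [TopologicalSpace X] [MeasurableSpace X]
    [OpensMeasurableSpace X] {μ : Measure Ω} [IsProbabilityMeasure μ]
    {k : E → Measure E} {G : E × Ω → E × Ω} (hG : IsDriven μ k G) {p : E → X} (hp : Measurable p)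
    {U : (X →ᵇ ℝ) →L[ℝ] (X →ᵇ ℝ)} (hU : ∀ f, 0 ≤ f → 0 ≤ U f)
    (hk : ∀ (f : X →ᵇ ℝ), 0 ≤ f → ∀ y, ∫⁻ z, ofReal (f (p z)) ∂(k y)
      = ofReal (U f (p y))) (x : E) :
    IsChain μ U (p x) fun j ω => p (orbit G j (x, ω)) where
  measurable j := hp.comp ((hG.measurable_orbit j).comp (by fun_prop))
  start ω := rfl
  lintegral K m Φ hΦ f hf := by
    induction m generalizing f with
    | zero => simp
    | succ m ih =>
      have hm : Measurable fun z => ofReal (f (p z)) :=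
        (f.continuous.measurable.comp hp).ennreal_ofReal
      have hΦ' : Measurable fun q : ℕ → E => Φ fun j => p (q (min j K)) :=
        hΦ.comp (measurable_pi_lambda _ fun j => hp.comp (measurable_pi_apply _))
      have h1 := hG.lintegral_stopped (K + m) x hΦ'
        (H := fun q => ofReal (f (p (G q).1))) (hm.comp (measurable_fst.comp hG.measurable))
      have h2 : ∀ j, min (min j K) (K + m) = min j K := fun j => by omega
      have h3 : ∀ y, ∫⁻ ω', ofReal (f (p (G (y, ω')).1)) ∂μ
          = ofReal (U f (p y)) := fun y => by
        rw [hG.lintegral y (fun q => ofReal (f (p q.1))) (hm.comp measurable_fst),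
          ← hk f hf y]
        simp
      simp only [h2, h3] at h1
      have h4 := ih (U f) (hU f hf)
      rw [pow_succ]
      refine Eq.trans ?_ h4
      refine Eq.trans ?_ h1
      refine lintegral_congr fun ω => ?_
      rw [← add_assoc]
      simp only [orbit, Function.iterate_succ_apply']

/-- The system that chooses at random between two moves. -/
def choiceStep (q : E → ℝ) (a b : E → E) (p : E × (ℕ → ℝ)) : E × (ℕ → ℝ) :=
  (open Classical in if p.2 0 < q p.1 then a p.1 else b p.1, shift p.2)

/-- The kernel of a random choice. -/
def choiceKernel (q : E → ℝ) (a b : E → E) (x : E) : Measure E :=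
  ofReal (q x) • Measure.dirac (a x) + ofReal (1 - q x) • Measure.dirac (b x)

theorem lintegral_choiceKernel (q : E → ℝ) (a b : E → E) (x : E) {f : E → ENNReal}
    (hf : Measurable f) : ∫⁻ y, f y ∂(choiceKernel q a b x)
      = ofReal (q x) * f (a x) + ofReal (1 - q x) * f (b x) := by
  unfold choiceKernel
  rw [lintegral_add_measure, lintegral_smul_measure, lintegral_smul_measure,
    lintegral_dirac' _ hf, lintegral_dirac' _ hf]
  rfl

theorem isDriven_choice {q : E → ℝ} {a b : E → E} (hq : Measurable q) (ha : Measurable a)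
    (hb : Measurable b) (h0 : ∀ x, 0 ≤ q x) (h1 : ∀ x, q x ≤ 1) :
    IsDriven (iid unif) (choiceKernel q a b) (choiceStep q a b) where
  measurable := by
    classical
    unfold choiceStep
    refine Measurable.prodMk ?_ (by fun_prop)
    exact Measurable.ite (measurableSet_lt (by fun_prop) (by fun_prop)) (by fun_prop) (by fun_prop)
  sfinite x := by
    unfold choiceKernel
    have : IsFiniteMeasure (ofReal (q x) • Measure.dirac (a x)) :=
      Measure.smul_finite _ ofReal_ne_top
    have : IsFiniteMeasure (ofReal (1 - q x) • Measure.dirac (b x)) :=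
      Measure.smul_finite _ ofReal_ne_top
    infer_instance
  lintegral x H hH := by
    classical
    have hm : Measurable (choiceStep q a b) := by
      unfold choiceStep
      refine Measurable.prodMk ?_ (by fun_prop)
      exact Measurable.ite (measurableSet_lt (by fun_prop) (by fun_prop)) (by fun_prop)
        (by fun_prop)
    rw [lintegral_iid _ (by fun_prop), lintegral_choiceKernel _ _ _ _ hH.lintegral_prod_right',
      ← lintegral_add_compl _ (measurableSet_Iio (a := q x)),
      setLIntegral_congr_fun (g := fun _ => ∫⁻ w, H (a x, w) ∂(iid unif)) measurableSet_Iio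
        (fun v hv => lintegral_congr fun w => by
          rw [choiceStep, if_pos (by exact mem_Iio.1 hv)]
          rfl),
      setLIntegral_congr_fun (g := fun _ => ∫⁻ w, H (b x, w) ∂(iid unif)) measurableSet_Iio.compl
        (fun v hv => lintegral_congr fun w => by
          rw [choiceStep, if_neg (by exact fun h => hv (mem_Iio.2 h))]
          rfl),
      setLIntegral_const, setLIntegral_const, measure_compl measurableSet_Iio (measure_ne_top _ _),
      unif_Iio (h1 x), measure_univ, ENNReal.ofReal_sub _ (h0 x), ofReal_one,
      mul_comm, mul_comm (∫⁻ w, H (b x, w) ∂(iid unif))]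

/-- The system with additional noise that is not used. -/
def liftStep {Ω' : Type*} (G : E × Ω → E × Ω) (p : E × (Ω' × Ω)) : E × (Ω' × Ω) :=
  ((G (p.1, p.2.2)).1, (p.2.1, (G (p.1, p.2.2)).2))

theorem IsDriven.lift {Ω' : Type*} [MeasurableSpace Ω'] {μ' : Measure Ω'} [SFinite μ']
    {μ : Measure Ω} [SFinite μ] {k : E → Measure E} {G : E × Ω → E × Ω} (hG : IsDriven μ k G) :
    IsDriven (μ'.prod μ) k (liftStep (Ω' := Ω') G) where
  measurable := by
    have := hG.measurable
    unfold liftStep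
    fun_prop
  sfinite := hG.sfinite
  lintegral x H hH := by
    have := hG.measurable
    have := hG.sfinite x
    rw [lintegral_prod _ (by unfold liftStep; fun_prop)]
    simp only [liftStep]
    rw [lintegral_congr fun e => hG.lintegral x (fun q => H (q.1, (e, q.2))) (by fun_prop),
      lintegral_lintegral_swap (by
        exact Measurable.aemeasurable (Measurable.lintegral_prod_right'
          (f := fun q : (Ω' × E) × Ω => H (q.1.2, (q.1.1, q.2))) (by fun_prop)))]
    refine lintegral_congr fun y => ?_
    rw [lintegral_prod _ (by fun_prop)]

/-- The system that waits, following `D`, until the first of a sequence of gaps is used up, and then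
performs a step of `G`. -/
def lazyStep (δ : ℝ≥0) (D : E → E) (G : E × Ω → E × Ω) (p : E × ((ℕ → ℝ≥0) × Ω)) :
    E × ((ℕ → ℝ≥0) × Ω) :=
  if p.2.1 0 < δ then ((G (p.1, p.2.2)).1, (shift p.2.1, (G (p.1, p.2.2)).2))
  else (D p.1, (consSeq (p.2.1 0 - δ, shift p.2.1), p.2.2))

/-- The kernel of the lazy system. -/
def lazyKernel (δ : ℝ≥0) (D : E → E) (k : E → Measure E) (x : E) : Measure E :=
  ofReal (1 - exp (-δ)) • k x + ofReal (exp (-δ)) • Measure.dirac (D x)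

theorem lintegral_lazyKernel (δ : ℝ≥0) (D : E → E) (k : E → Measure E) (x : E) {f : E → ENNReal}
    (hf : Measurable f) : ∫⁻ y, f y ∂(lazyKernel δ D k x)
      = ofReal (1 - exp (-δ)) * ∫⁻ y, f y ∂(k x)
        + ofReal (exp (-δ)) * f (D x) := by
  unfold lazyKernel
  rw [lintegral_add_measure, lintegral_smul_measure, lintegral_smul_measure,
    lintegral_dirac' _ hf]
  rfl

theorem IsDriven.lazy {μ : Measure Ω} [SFinite μ] {k : E → Measure E} {G : E × Ω → E × Ω}
    (hG : IsDriven μ k G) (δ : ℝ≥0) {D : E → E} (hD : Measurable D) :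
    IsDriven ((iid expo).prod μ) (lazyKernel δ D k) (lazyStep δ D G) := by
  have hGm := hG.measurable
  have hm : Measurable (lazyStep δ D G) := by
    unfold lazyStep
    exact Measurable.ite (measurableSet_lt (by fun_prop) measurable_const) (by fun_prop)
      (by fun_prop)
  refine ⟨hm, fun x => ?_, fun x H hH => ?_⟩
  · have := hG.sfinite x
    unfold lazyKernel
    infer_instance
  · have := hG.sfinite x
    have hH1 : Measurable fun q : E × ((ℕ → ℝ≥0) × Ω) => H q := hH
    have h1 : ∀ e : ℕ → ℝ≥0, ∫⁻ w, H ((G (x, w)).1, (e, (G (x, w)).2)) ∂μ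
        = ∫⁻ y, ∫⁻ w, H (y, (e, w)) ∂μ ∂(k x) := fun e =>
      hG.lintegral x (fun q => H (q.1, (e, q.2))) (by fun_prop)
    have h2 : ∫⁻ e, ∫⁻ w, H ((G (x, w)).1, (e, (G (x, w)).2)) ∂μ ∂(iid expo)
        = ∫⁻ y, ∫⁻ r, H (y, r) ∂((iid expo).prod μ) ∂(k x) := by
      rw [lintegral_congr h1, lintegral_lintegral_swap (by
        exact Measurable.aemeasurable (Measurable.lintegral_prod_right'
          (f := fun q : ((ℕ → ℝ≥0) × E) × Ω => H (q.1.2, (q.1.1, q.2))) (by fun_prop)))]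
      refine lintegral_congr fun y => ?_
      rw [lintegral_prod _ (by fun_prop)]
    have h3 : Measurable fun e : ℕ → ℝ≥0 => ∫⁻ w, H (D x, (e, w)) ∂μ :=
      Measurable.lintegral_prod_right' (f := fun q : (ℕ → ℝ≥0) × Ω => H (D x, q)) (by fun_prop)
    have h4 : Measurable fun a : ℝ≥0 => ∫⁻ e, ∫⁻ w, H (D x, (consSeq (a, e), w)) ∂μ ∂(iid expo) :=
      Measurable.lintegral_prod_right' (h3.comp measurable_consSeq)
    have h5 : ∫⁻ r, H (D x, r) ∂((iid expo).prod μ)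
        = ∫⁻ a, ∫⁻ e, ∫⁻ w, H (D x, (consSeq (a, e), w)) ∂μ ∂(iid expo) ∂expo := by
      rw [lintegral_prod _ (by fun_prop), lintegral_iid _ h3]
    have h6 : Measurable fun e : ℕ → ℝ≥0 => ∫⁻ w, H (lazyStep δ D G (x, (e, w))) ∂μ :=
      Measurable.lintegral_prod_right'
        (f := fun q : (ℕ → ℝ≥0) × Ω => H (lazyStep δ D G (x, q))) (by fun_prop)
    rw [lintegral_prod _ (by fun_prop), lintegral_iid _ h6,
      ← lintegral_add_compl _ (measurableSet_Iio (a := δ)),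
      setLIntegral_congr_fun (g := fun _ =>
        ∫⁻ e, ∫⁻ w, H ((G (x, w)).1, (e, (G (x, w)).2)) ∂μ ∂(iid expo)) measurableSet_Iio
        (fun a ha => lintegral_congr fun e => lintegral_congr fun w => by
          rw [lazyStep, if_pos (by exact mem_Iio.1 ha)]
          rfl),
      compl_Iio, setLIntegral_congr_fun (g := fun a =>
        ∫⁻ e, ∫⁻ w, H (D x, (consSeq (a - δ, e), w)) ∂μ ∂(iid expo)) measurableSet_Ici
        (fun a ha => lintegral_congr fun e => lintegral_congr fun w => by
          rw [lazyStep, if_neg (by exact not_lt.2 (mem_Ici.1 ha))]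
          rfl),
      expo_memoryless δ h4, setLIntegral_const, expo_Iio, h2, ← h5,
      lintegral_lazyKernel _ _ _ _ hH.lintegral_prod_right', mul_comm]


end Driven

section LazyOrbit

variable {E Ω : Type*}

/-- The system that follows `D` for the time given by the first gap, and then performs a step of
`G`. -/
def gapStep (D : ℝ≥0 → E → E) (G : E × Ω → E × Ω) (p : E × ((ℕ → ℝ≥0) × Ω)) :
    E × ((ℕ → ℝ≥0) × Ω) :=
  liftStep G (D (p.2.1 0) p.1, (shift p.2.1, p.2.2))

/-- The waiting time of the lazy system and its next step, taken together. -/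
abbrev macroStep (δ : ℝ≥0) (D : E → E) (G : E × Ω → E × Ω) :
    E × ((ℕ → ℝ≥0) × Ω) → E × ((ℕ → ℝ≥0) × Ω) :=
  gapStep (fun e => D^[⌊e / δ⌋₊]) G

theorem gapStep_iterate_gaps (D : ℝ≥0 → E → E) (G : E × Ω → E × Ω)
    (p : E × ((ℕ → ℝ≥0) × Ω)) (i j : ℕ) :
    ((gapStep D G)^[i] p).2.1 j = p.2.1 (j + i) := by
  induction i generalizing j with
  | zero => rfl
  | succ i ih =>
    rw [Function.iterate_succ_apply']
    change ((gapStep D G)^[i] p).2.1 (j + 1) = _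
    rw [ih]
    ring_nf

theorem gapStep_choice_iterate_coins (D : ℝ≥0 → E → E) (q : E → ℝ) (a b : E → E)
    (p : E × ((ℕ → ℝ≥0) × (ℕ → ℝ))) (i j : ℕ) :
    ((gapStep D (choiceStep q a b))^[i] p).2.2 j = p.2.2 (j + i) := by
  induction i generalizing j with
  | zero => rfl
  | succ i ih =>
    rw [Function.iterate_succ_apply']
    change ((gapStep D (choiceStep q a b))^[i] p).2.2 (j + 1) = _
    rw [ih]
    ring_nf

theorem orbit_gapStep_choice (D : ℝ≥0 → E → E) (q : E → ℝ) (a b : E → E)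
    (p : E × ((ℕ → ℝ≥0) × (ℕ → ℝ))) (i : ℕ) :
    orbit (gapStep D (choiceStep q a b)) (i + 1) p
      = open Classical in
        if p.2.2 i < q (D (p.2.1 i) (orbit (gapStep D (choiceStep q a b)) i p))
        then a (D (p.2.1 i) (orbit (gapStep D (choiceStep q a b)) i p))
        else b (D (p.2.1 i) (orbit (gapStep D (choiceStep q a b)) i p)) := by
  have h2 := gapStep_iterate_gaps D (choiceStep q a b) p i 0
  have h3 := gapStep_choice_iterate_coins D q a b p i 0
  rw [zero_add] at h2 h3
  rw [orbit, Function.iterate_succ_apply', ← h2, ← h3]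
  rfl

/-- The number of steps of the lazy system that use up `i` gaps. -/
def lazyTime (δ : ℝ≥0) (e : ℕ → ℝ≥0) (i : ℕ) : ℕ := ∑ l ∈ Finset.range i, (⌊e l / δ⌋₊ + 1)

theorem lazyStep_iterate {δ : ℝ≥0} (hδ : 0 < δ) (D : E → E) (G : E × Ω → E × Ω)
    (p : E × ((ℕ → ℝ≥0) × Ω)) {r : ℕ} (hr : r ≤ ⌊p.2.1 0 / δ⌋₊) :
    (lazyStep δ D G)^[r] p = (D^[r] p.1, (consSeq (p.2.1 0 - r * δ, shift p.2.1), p.2.2)) := by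
  induction r with
  | zero =>
    have : consSeq (p.2.1 0, shift p.2.1) = p.2.1 := by
      funext i
      cases i <;> rfl
    simp [this]
  | succ r ih =>
    have h1 : ((r + 1 : ℕ) : ℝ≥0) * δ ≤ p.2.1 0 := by
      rw [← le_div_iff₀ hδ]
      exact (Nat.le_floor_iff zero_le).1 hr
    have h2 : ¬ p.2.1 0 - r * δ < δ := by
      rw [not_lt]
      refine le_tsub_of_add_le_left ?_
      push_cast at h1
      rwa [add_mul, one_mul] at h1
    rw [Function.iterate_succ_apply', ih (Nat.le_of_succ_le hr), lazyStep,
      if_neg (by exact h2), Function.iterate_succ_apply']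
    change (_, (consSeq (p.2.1 0 - r * δ - δ, _), _)) = _
    rw [tsub_tsub]
    push_cast
    rw [add_mul, one_mul]
    rfl

theorem lazyStep_iterate_floor {δ : ℝ≥0} (hδ : 0 < δ) (D : E → E) (G : E × Ω → E × Ω)
    (p : E × ((ℕ → ℝ≥0) × Ω)) :
    (lazyStep δ D G)^[⌊p.2.1 0 / δ⌋₊ + 1] p = macroStep δ D G p := by
  have h2 : p.2.1 0 - ⌊p.2.1 0 / δ⌋₊ * δ < δ := by
    have h1 := Nat.lt_floor_add_one (p.2.1 0 / δ)
    rw [div_lt_iff₀ hδ, add_mul, one_mul] at h1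
    exact tsub_lt_iff_left ((le_div_iff₀ hδ).1 (Nat.floor_le zero_le)) |>.2 h1
  rw [Function.iterate_succ_apply', lazyStep_iterate hδ D G p le_rfl, lazyStep,
    if_pos (by exact h2)]
  rfl

theorem orbit_lazyStep {δ : ℝ≥0} (hδ : 0 < δ) (D : E → E) (G : E × Ω → E × Ω)
    (p : E × ((ℕ → ℝ≥0) × Ω)) (i : ℕ) {r : ℕ} (hr : r ≤ ⌊p.2.1 i / δ⌋₊) :
    orbit (lazyStep δ D G) (lazyTime δ p.2.1 i + r) p = D^[r] (orbit (macroStep δ D G) i p) := by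
  have h1 : ∀ i, (lazyStep δ D G)^[lazyTime δ p.2.1 i] p = (macroStep δ D G)^[i] p := by
    intro i
    induction i with
    | zero => rfl
    | succ i ih =>
      have h2 := gapStep_iterate_gaps (fun e => D^[⌊e / δ⌋₊]) G p i 0
      rw [zero_add] at h2
      rw [lazyTime, Finset.sum_range_succ, add_comm, Function.iterate_add_apply]
      change (lazyStep δ D G)^[_] ((lazyStep δ D G)^[lazyTime δ p.2.1 i] p) = _
      rw [ih, ← h2, lazyStep_iterate_floor hδ, Function.iterate_succ_apply']
  have h2 := gapStep_iterate_gaps (fun e => D^[⌊e / δ⌋₊]) G p i 0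
  rw [zero_add] at h2
  unfold orbit
  rw [add_comm, Function.iterate_add_apply, h1, lazyStep_iterate hδ D G _ (by rwa [h2])]

end LazyOrbit

theorem IsDriven.gap {E Ω : Type*} [MeasurableSpace E] [MeasurableSpace Ω] {μ : Measure Ω}
    [IsProbabilityMeasure μ] {k : E → Measure E} {G : E × Ω → E × Ω} (hG : IsDriven μ k G)
    {D : ℝ≥0 → E → E} (hD : Measurable fun p : ℝ≥0 × E => D p.1 p.2) :
    IsDriven ((iid expo).prod μ)
      (fun x => ((iid expo).prod μ).map fun w => (gapStep D G (x, w)).1) (gapStep D G) := by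
  have hGm := hG.measurable
  have hm : Measurable (gapStep D G) := by
    have : Measurable fun p : E × ((ℕ → ℝ≥0) × Ω) => D (p.2.1 0) p.1 :=
      hD.comp (f := fun p : E × ((ℕ → ℝ≥0) × Ω) => (p.2.1 0, p.1)) (by fun_prop)
    unfold gapStep liftStep
    fun_prop
  have hm1 : ∀ x, Measurable fun w => (gapStep D G (x, w)).1 := fun x => by fun_prop
  refine ⟨hm, fun x => ?_, fun x H hH => ?_⟩
  · have := Measure.isProbabilityMeasure_map (μ := (iid expo).prod μ) (hm1 x).aemeasurable
    infer_instance
  have key : ∀ F : E × ((ℕ → ℝ≥0) × Ω) → ENNReal, Measurable F →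
      ∫⁻ w, F (gapStep D G (x, w)) ∂((iid expo).prod μ)
        = ∫⁻ a, ∫⁻ y, ∫⁻ w, F (y, w) ∂((iid expo).prod μ) ∂(k (D a x)) ∂expo := by
    intro F hF
    have h6 : Measurable fun e : ℕ → ℝ≥0 => ∫⁻ w, F (gapStep D G (x, (e, w))) ∂μ :=
      Measurable.lintegral_prod_right'
        (f := fun q : (ℕ → ℝ≥0) × Ω => F (gapStep D G (x, q))) (by fun_prop)
    rw [lintegral_prod _ (by fun_prop), lintegral_iid _ h6]
    refine lintegral_congr fun a => ?_
    have := hG.sfinite (D a x)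
    have h1 : ∀ e : ℕ → ℝ≥0, ∫⁻ w, F (gapStep D G (x, (consSeq (a, e), w))) ∂μ
        = ∫⁻ y, ∫⁻ w, F (y, (e, w)) ∂μ ∂(k (D a x)) := fun e =>
      hG.lintegral (D a x) (fun q => F (q.1, (e, q.2))) (by fun_prop)
    rw [lintegral_congr h1, lintegral_lintegral_swap (by
      exact Measurable.aemeasurable (Measurable.lintegral_prod_right'
        (f := fun q : ((ℕ → ℝ≥0) × E) × Ω => F (q.1.2, (q.1.1, q.2))) (by fun_prop)))]
    refine lintegral_congr fun y => ?_
    rw [lintegral_prod _ (by fun_prop)]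
  have hH' : Measurable fun y : E => ∫⁻ w, H (y, w) ∂((iid expo).prod μ) :=
    hH.lintegral_prod_right'
  rw [lintegral_map hH' (hm1 x), key H hH, key (fun q => ∫⁻ w, H (q.1, w) ∂((iid expo).prod μ))
    (hH'.comp measurable_fst)]
  simp

/-! ### Markov laws from identities for integrals -/

section CondExp

variable {ι Ω X : Type*} [MeasurableSpace Ω] [TopologicalSpace X]
  [TopologicalSpace.PseudoMetrizableSpace X] [SecondCountableTopology X] [MeasurableSpace X]
  [BorelSpace X]

theorem pi_measure_ext {J : Type*} [Fintype J] {ν₁ ν₂ : Measure (J → X)} [IsFiniteMeasure ν₁]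
    (h : ∀ g : J → X →ᵇ ℝ≥0, ∫⁻ p, ∏ i, (g i (p i) : ENNReal) ∂ν₁
      = ∫⁻ p, ∏ i, (g i (p i) : ENNReal) ∂ν₂) : ν₁ = ν₂ := by
  let e : (J → X) → (J → X) × (Fin 0 → X) := fun p => (p, finZeroElim)
  have he : Measurable e := measurable_id.prodMk (measurable_pi_lambda _ fun k => k.elim0)
  have h1 : ν₁.map e = ν₂.map e := by
    refine Measure.ext_of_lintegral_prod_mul_prod_boundedContinuousFunction fun f g => ?_
    simp only [Finset.univ_eq_empty, Finset.prod_empty, ENNReal.coe_one, mul_one,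
      ENNReal.ofNNReal_finsetProd]
    have hm : Measurable fun p : (J → X) × (Fin 0 → X) => ∏ i, (f i (p.1 i) : ENNReal) :=
      Finset.measurable_prod _ fun i _ => ((f i).continuous.measurable.comp
        ((measurable_pi_apply i).comp measurable_fst)).coe_nnreal_ennreal
    rw [lintegral_map hm he, lintegral_map hm he]
    exact h f
  have h2 : ∀ ν : Measure (J → X), (ν.map e).map Prod.fst = ν := fun ν => by
    rw [Measure.map_map measurable_fst he]
    exact Measure.map_id
  rw [← h2 ν₁, h1, h2]

theorem measure_eq_of_forall_prod {Y : ι → Ω → X} (hY : ∀ i, Measurable (Y i))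
    {ν₁ ν₂ : Measure Ω} [IsFiniteMeasure ν₁]
    (h : ∀ (J : Finset ι) (g : ι → X →ᵇ ℝ≥0), ∫⁻ ω, ∏ i ∈ J, (g i (Y i ω) : ENNReal) ∂ν₁
      = ∫⁻ ω, ∏ i ∈ J, (g i (Y i ω) : ENNReal) ∂ν₂)
    {S : Set Ω} (hS : MeasurableSet[⨆ i, MeasurableSpace.comap (Y i) inferInstance] S) :
    ν₁ S = ν₂ S := by
  classical
  let y : Ω → ι → X := fun ω i => Y i ω
  have hy : Measurable y := measurable_pi_lambda _ hY
  have hpi : (⨆ i, MeasurableSpace.comap (Y i) inferInstance)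
      = MeasurableSpace.comap y MeasurableSpace.pi := by
    unfold MeasurableSpace.pi
    rw [MeasurableSpace.comap_iSup]
    simp only [MeasurableSpace.comap_comp]
    rfl
  rw [hpi] at hS
  obtain ⟨S', hS', rfl⟩ := hS
  have hfin : ∀ J : Finset ι, (ν₂.map y).map J.restrict = (ν₁.map y).map J.restrict := by
    intro J
    refine (pi_measure_ext fun g => ?_).symm
    have hm : Measurable fun p : J → X => ∏ i, (g i (p i) : ENNReal) :=
      Finset.measurable_prod _ fun i _ => ((g i).continuous.measurable.comp
        (measurable_pi_apply i)).coe_nnreal_ennreal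
    have hr := Finset.measurable_restrict (X := fun _ : ι => X) J
    have h2 := h J fun i => if hi : i ∈ J then g ⟨i, hi⟩ else 1
    rw [lintegral_map hm hr, lintegral_map hm hr, lintegral_map (by exact hm.comp hr) hy,
      lintegral_map (by exact hm.comp hr) hy]
    have h3 : ∀ ω, ∏ i ∈ J, ((if hi : i ∈ J then g ⟨i, hi⟩ else 1 : X →ᵇ ℝ≥0) (Y i ω) : ENNReal)
        = ∏ i, (g i (J.restrict (y ω) i) : ENNReal) := fun ω => by
      rw [← Finset.prod_coe_sort]
      exact Finset.prod_congr rfl fun i _ => by rw [dif_pos i.2]; rfl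
    simpa only [h3] using h2
  have hlim : ν₁.map y = ν₂.map y :=
    IsProjectiveLimit.unique (P := fun J => (ν₁.map y).map J.restrict) (fun J => rfl) hfin
  rw [← Measure.map_apply hy hS', hlim, Measure.map_apply hy hS']

theorem setIntegral_eq_of_forall_prod {μ : Measure Ω} {Y : ι → Ω → X}
    (hY : ∀ i, Measurable (Y i)) {Z W : Ω → ℝ} (hZm : Measurable Z) (hWm : Measurable W)
    (hZ : Integrable Z μ) (hZ0 : 0 ≤ Z) (hW0 : 0 ≤ W)
    (h : ∀ (J : Finset ι) (g : ι → X →ᵇ ℝ≥0),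
      ∫⁻ ω, (∏ i ∈ J, (g i (Y i ω) : ENNReal)) * ofReal (Z ω) ∂μ
      = ∫⁻ ω, (∏ i ∈ J, (g i (Y i ω) : ENNReal)) * ofReal (W ω) ∂μ)
    {S : Set Ω} (hS : MeasurableSet[⨆ i, MeasurableSpace.comap (Y i) inferInstance] S) :
    ∫ ω in S, Z ω ∂μ = ∫ ω in S, W ω ∂μ := by
  have hle : (⨆ i, MeasurableSpace.comap (Y i) inferInstance) ≤ ‹MeasurableSpace Ω› :=
    iSup_le fun i => (hY i).comap_le
  have hfin : IsFiniteMeasure (μ.withDensity fun ω => ofReal (Z ω)) :=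
    isFiniteMeasure_withDensity_ofReal hZ.2
  have hm : ∀ (J : Finset ι) (g : ι → X →ᵇ ℝ≥0),
      Measurable fun ω => ∏ i ∈ J, (g i (Y i ω) : ENNReal) := fun J g =>
    Finset.measurable_prod _ fun i _ => ((g i).continuous.measurable.comp
        (hY i)).coe_nnreal_ennreal
  have h1 := measure_eq_of_forall_prod hY (ν₁ := μ.withDensity fun ω => ofReal (Z ω))
    (ν₂ := μ.withDensity fun ω => ofReal (W ω)) (fun J g => by
      rw [lintegral_withDensity_eq_lintegral_mul _ hZm.ennreal_ofReal (hm J g),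
        lintegral_withDensity_eq_lintegral_mul _ hWm.ennreal_ofReal (hm J g)]
      simp only [Pi.mul_apply, mul_comm (ofReal _)]
      exact h J g) hS
  rw [withDensity_apply _ (hle S hS), withDensity_apply _ (hle S hS)] at h1
  rw [integral_eq_lintegral_of_nonneg_ae (Eventually.of_forall hZ0) hZm.aestronglyMeasurable,
    integral_eq_lintegral_of_nonneg_ae (Eventually.of_forall hW0) hWm.aestronglyMeasurable, h1]

theorem condExp_eq_of_forall_prod {μ : Measure Ω} [IsFiniteMeasure μ] {Y : ι → Ω → X}
    (hY : ∀ i, Measurable (Y i)) {Z : Ω → ℝ} (hZm : Measurable Z) (i₀ : ι) (w : X →ᵇ ℝ)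
    (hZ : Integrable Z μ) (hZ0 : 0 ≤ Z) (hw : 0 ≤ w)
    (h : ∀ (J : Finset ι) (g : ι → X →ᵇ ℝ≥0),
      ∫⁻ ω, (∏ i ∈ J, (g i (Y i ω) : ENNReal)) * ofReal (Z ω) ∂μ
      = ∫⁻ ω, (∏ i ∈ J, (g i (Y i ω) : ENNReal)) * ofReal (w (Y i₀ ω)) ∂μ) :
    μ[Z | ⨆ i, MeasurableSpace.comap (Y i) inferInstance] =ᵐ[μ] fun ω => w (Y i₀ ω) := by
  have hle : (⨆ i, MeasurableSpace.comap (Y i) inferInstance) ≤ ‹MeasurableSpace Ω› :=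
    iSup_le fun i => (hY i).comap_le
  have hwm : Measurable fun ω => w (Y i₀ ω) := w.continuous.measurable.comp (hY i₀)
  have hwi : Integrable (fun ω => w (Y i₀ ω)) μ :=
    Integrable.of_bound hwm.aestronglyMeasurable ‖w‖
      (Eventually.of_forall fun ω => w.norm_coe_le_norm _)
  refine (ae_eq_condExp_of_forall_setIntegral_eq hle hZ (fun S _ _ => hwi.integrableOn)
    (fun S hS _ => (setIntegral_eq_of_forall_prod hY hZm hwm hZ hZ0 (fun ω => hw _) h hS).symm)
    ?_).symm
  have h1 : Measurable[⨆ i, MeasurableSpace.comap (Y i) inferInstance] (Y i₀) :=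
    (comap_measurable (Y i₀)).mono (le_iSup (fun i => MeasurableSpace.comap (Y i) inferInstance) i₀)
      le_rfl
  exact (w.continuous.measurable.comp h1).stronglyMeasurable.aestronglyMeasurable

/-- The conditional expectation of `f (Y)` is found from the case of nonnegative `f`. -/
theorem condExp_comp_of_nonneg {Ω : Type*} {m m0 : MeasurableSpace Ω} {μ : Measure Ω}
    [IsProbabilityMeasure μ] (hm : m ≤ m0) {V W : Ω → X} (hV : Measurable V)
    (T : (X →ᵇ ℝ) →L[ℝ] (X →ᵇ ℝ)) (h1 : T 1 = 1)
    (h : ∀ f : X →ᵇ ℝ, 0 ≤ f → μ[fun ω => f (V ω) | m] =ᵐ[μ] fun ω => T f (W ω)) (f : X →ᵇ ℝ) :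
    μ[fun ω => f (V ω) | m] =ᵐ[μ] fun ω => T f (W ω) := by
  have hf : 0 ≤ f + ‖f‖ • (1 : X →ᵇ ℝ) := fun x => by
    have := (abs_le.1 (f.norm_coe_le_norm x)).1
    simpa using by linarith
  have h2 := h _ hf
  have hfi : Integrable (fun ω => f (V ω)) μ :=
    Integrable.of_bound (f.continuous.measurable.comp hV).aestronglyMeasurable ‖f‖
      (Eventually.of_forall fun ω => f.norm_coe_le_norm _)
  have h3 : μ[fun ω => (f + ‖f‖ • (1 : X →ᵇ ℝ)) (V ω) | m]
      =ᵐ[μ] fun ω => (μ[fun ω => f (V ω) | m]) ω + ‖f‖ := by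
    have := condExp_add hfi (integrable_const ‖f‖) m
    rw [condExp_const hm ‖f‖] at this
    refine EventuallyEq.trans (Eq.eventuallyEq ?_) this
    congr 1
    funext ω
    simp
  filter_upwards [h2, h3] with ω h4 h5
  rw [h5, map_add, map_smul, h1] at h4
  simpa using h4

end CondExp

section MarkovLaws

variable {Ω X : Type*} [MeasurableSpace Ω] [TopologicalSpace X]
  [TopologicalSpace.PseudoMetrizableSpace X] [SecondCountableTopology X] [MeasurableSpace X]
  [BorelSpace X]

theorem IsChain.isChainLaw [MeasurableSingletonClass X] {μ : Measure Ω} [IsProbabilityMeasure μ]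
    {U : (X →ᵇ ℝ) →L[ℝ] (X →ᵇ ℝ)} {a : X} {x : ℕ → Ω → X} (hx : IsChain μ U a x)
    (hU : ∀ f, 0 ≤ f → 0 ≤ U f) (h1 : U 1 = 1) :
    IsChainLaw U a (μ.map fun ω j => x j ω) := by
  have hm : Measurable fun ω j => x j ω := measurable_pi_lambda _ hx.measurable
  have hp : IsProbabilityMeasure (μ.map fun ω j => x j ω) :=
    Measure.isProbabilityMeasure_map hm.aemeasurable
  refine ⟨hp, ?_, fun k f => ?_⟩
  · refine (ae_map_iff (p := fun q : ℕ → X => q 0 = a) hm.aemeasurable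
      ((measurable_pi_apply (X := fun _ : ℕ => X) 0) (measurableSet_singleton a))).2 ?_
    exact Eventually.of_forall hx.start
  · refine condExp_comp_of_nonneg (V := fun q : ℕ → X => q (k + 1)) (W := fun q => q k)
      (iSup_le fun j => (measurable_pi_apply (X := fun _ : ℕ => X) _).comap_le)
      (measurable_pi_apply (X := fun _ : ℕ => X) (k + 1)) U h1 (fun f hf => ?_) f
    have hfm : Measurable fun q : ℕ → X => f (q (k + 1)) :=
      f.continuous.measurable.comp (measurable_pi_apply _)
    refine condExp_eq_of_forall_prod (Y := fun (j : Iic k) (q : ℕ → X) => q j)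
      (fun j => measurable_pi_apply (X := fun _ : ℕ => X) _) hfm ⟨k, mem_Iic.2 le_rfl⟩ (U f)
      (Integrable.of_bound hfm.aestronglyMeasurable ‖f‖
        (Eventually.of_forall fun ω => f.norm_coe_le_norm _)) (fun q => hf _) (hU f hf)
      fun J g => ?_
    have hΦ : Measurable fun q : ℕ → X => ∏ i ∈ J, (g i (q i) : ENNReal) :=
      Finset.measurable_prod _ fun i _ => ((g i).continuous.measurable.comp
        (measurable_pi_apply _)).coe_nnreal_ennreal
    have hfm' : Measurable fun q : ℕ → X => U f (q k) :=
      (U f).continuous.measurable.comp (measurable_pi_apply _)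
    rw [lintegral_map (by exact hΦ.mul hfm.ennreal_ofReal) hm,
      lintegral_map (by exact hΦ.mul hfm'.ennreal_ofReal) hm]
    have h2 := hx.lintegral k 1 _ hΦ f hf
    have h3 : ∀ i : Iic k, min (i : ℕ) k = i := fun i => min_eq_left i.2
    simpa only [h3, pow_one] using h2

theorem tendsto_lintegral_prod_mul {ι : Type*} {μ : Measure Ω} (J : Finset ι) (g : ι → X →ᵇ ℝ≥0)
    {Y : ℕ → ι → Ω → X} (hYm : ∀ k i, Measurable (Y k i)) {Z : ι → Ω → X}
    (hY : ∀ i, ∀ᵐ ω ∂μ, Tendsto (fun k => Y k i ω) atTop (𝓝 (Z i ω))) {V : ℕ → Ω → ℝ}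
    (hVm : ∀ k, Measurable (V k)) {v W : Ω → ℝ}
    (hV : ∀ᵐ ω ∂μ, Tendsto (fun k => V k ω) atTop (𝓝 (v ω)))
    (hW : ∫⁻ ω, ofReal (W ω) ∂μ ≠ ⊤) (hVW : ∀ k, ∀ᵐ ω ∂μ, V k ω ≤ W ω) :
    Tendsto (fun k => ∫⁻ ω, (∏ i ∈ J, (g i (Y k i ω) : ENNReal)) * ofReal (V k ω) ∂μ) atTop
      (𝓝 (∫⁻ ω, (∏ i ∈ J, (g i (Z i ω) : ENNReal)) * ofReal (v ω) ∂μ)) := by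
  let c : ENNReal := ∏ i ∈ J, (nndist (g i) 0 : ENNReal)
  have hc : c ≠ ⊤ := ENNReal.prod_ne_top fun i _ => ENNReal.coe_ne_top
  refine tendsto_lintegral_of_dominated_convergence' (fun ω => c * ofReal (W ω))
    (fun k => Measurable.aemeasurable ?_) (fun k => (hVW k).mono fun ω hω => mul_le_mul' ?_
      (ofReal_le_ofReal hω)) ?_ ?_
  · exact (Finset.measurable_prod _ fun i _ => ((g i).continuous.measurable.comp
      (hYm k i)).coe_nnreal_ennreal).mul (hVm k).ennreal_ofReal
  · exact Finset.prod_le_prod' fun i _ => by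
      exact_mod_cast BoundedContinuousFunction.NNReal.upper_bound (g i) _
  · rw [lintegral_const_mul' _ _ hc]
    exact ENNReal.mul_ne_top hc hW
  · have h1 : ∀ᵐ ω ∂μ, ∀ i ∈ J, Tendsto (fun k => Y k i ω) atTop (𝓝 (Z i ω)) := by
      rw [Finset.eventually_all]
      exact fun i _ => hY i
    filter_upwards [h1, hV] with ω h2 h3
    refine ENNReal.Tendsto.mul ?_ (Or.inr ofReal_ne_top)
      ((ENNReal.continuous_ofReal.tendsto _).comp h3)
      (Or.inr (ENNReal.prod_ne_top fun i _ => ENNReal.coe_ne_top))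
    simp only [← ENNReal.ofNNReal_finsetProd]
    rw [ENNReal.tendsto_coe]
    exact tendsto_finsetProd _ fun i hi => ((g i).continuous.tendsto _).comp (h2 i hi)

theorem isMarkovLaw_of_tendsto [MeasurableSingletonClass X] [T2Space X] {μ : Measure Ω}
    [IsProbabilityMeasure μ]
    {T : ℝ≥0 → (X →ᵇ ℝ) →L[ℝ] (X →ᵇ ℝ)} (hT0 : ∀ t f, 0 ≤ f → 0 ≤ T t f) (hT1 : ∀ t, T t 1 = 1)
    {a : X} {Z : Ω → CadlagPath X} (hZ : Measurable Z) {U : ℕ → (X →ᵇ ℝ) →L[ℝ] (X →ᵇ ℝ)}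
    {h : ℕ → ℝ≥0} (hh : ∀ k, 0 < h k) (hh0 : Tendsto h atTop (𝓝 0)) {x : ℕ → ℕ → Ω → X}
    (hx : ∀ k, IsChain μ (U k) a (x k))
    (hlim : ∀ t, ∀ᵐ ω ∂μ, Tendsto (fun k => x k ⌊t / h k⌋₊ ω) atTop (𝓝 ((Z ω).1 t)))
    (hU : ∀ (m : ℕ → ℕ) (t : ℝ≥0) (f : X →ᵇ ℝ), Tendsto (fun k => (m k : ℝ≥0) * h k) atTop (𝓝 t) →
      Tendsto (fun k => (U k ^ m k) f) atTop (𝓝 (T t f))) :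
    IsMarkovLaw T a (μ.map Z) := by
  have hp : IsProbabilityMeasure (μ.map Z) := Measure.isProbabilityMeasure_map hZ.aemeasurable
  have hev : ∀ t : ℝ≥0, Measurable fun z : CadlagPath X => z.1 t := fun t =>
    (measurable_pi_apply t).comp measurable_subtype_coe
  refine ⟨hp, ?_, fun s t f => ?_⟩
  · refine (ae_map_iff (p := fun q : CadlagPath X => q.1 0 = a) hZ.aemeasurable
      (hev 0 (measurableSet_singleton a))).2 ?_
    filter_upwards [hlim 0] with ω hω
    refine tendsto_nhds_unique hω (tendsto_const_nhds.congr fun k => ?_)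
    rw [zero_div, Nat.floor_zero, (hx k).start]
  refine condExp_comp_of_nonneg (V := fun q : CadlagPath X => q.1 (s + t))
    (W := fun q => q.1 s) (iSup_le fun j => (hev _).comap_le)
    (hev _) (T t) (hT1 t) (fun f hf => ?_) f
  have hfm : ∀ (f : X →ᵇ ℝ) u, Measurable fun q : CadlagPath X => f (q.1 u) := fun f u =>
    f.continuous.measurable.comp (hev u)
  refine condExp_eq_of_forall_prod (Y := fun (j : Iic s) (q : CadlagPath X) => q.1 j)
    (fun j => hev _) (hfm f _) ⟨s, mem_Iic.2 le_rfl⟩ (T t f)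
    (Integrable.of_bound (hfm f _).aestronglyMeasurable ‖f‖
      (Eventually.of_forall fun ω => f.norm_coe_le_norm _)) (fun q => hf _) (hT0 t f hf)
    fun J g => ?_
  have hΦ : Measurable fun q : CadlagPath X => ∏ i ∈ J, (g i (q.1 i) : ENNReal) :=
    Finset.measurable_prod _ fun i _ => ((g i).continuous.measurable.comp
      (hev _)).coe_nnreal_ennreal
  rw [lintegral_map (by exact hΦ.mul (hfm f _).ennreal_ofReal) hZ,
    lintegral_map (by exact hΦ.mul (hfm (T t f) _).ennreal_ofReal) hZ]
  have hfl : ∀ k {u v : ℝ≥0}, u ≤ v → ⌊u / h k⌋₊ ≤ ⌊v / h k⌋₊ := fun k u v huv =>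
    Nat.floor_mono (div_le_div_of_nonneg_right huv zero_le)
  let Ψ : ℕ → Ω → ENNReal := fun k ω => ∏ i ∈ J, (g i (x k ⌊(i : ℝ≥0) / h k⌋₊ ω) : ENNReal)
  have hid : ∀ k, ∫⁻ ω, Ψ k ω * ofReal (f (x k ⌊(s + t) / h k⌋₊ ω)) ∂μ
      = ∫⁻ ω, Ψ k ω * ofReal
          ((U k ^ (⌊(s + t) / h k⌋₊ - ⌊s / h k⌋₊)) f (x k ⌊s / h k⌋₊ ω)) ∂μ := by
    intro k
    have h2 := (hx k).lintegral ⌊s / h k⌋₊ (⌊(s + t) / h k⌋₊ - ⌊s / h k⌋₊)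
      (fun q => ∏ i ∈ J, (g i (q ⌊(i : ℝ≥0) / h k⌋₊) : ENNReal))
      (Finset.measurable_prod _ fun i _ => ((g i).continuous.measurable.comp
        (measurable_pi_apply _)).coe_nnreal_ennreal) f hf
    have h3 : ∀ i : Iic s, min ⌊(i : ℝ≥0) / h k⌋₊ ⌊s / h k⌋₊ = ⌊(i : ℝ≥0) / h k⌋₊ := fun i =>
      min_eq_left (hfl k i.2)
    rw [Nat.add_sub_of_le (hfl k le_self_add)] at h2
    simpa only [h3] using h2
  have hL := tendsto_lintegral_prod_mul (μ := μ) J g (Y := fun k i => x k ⌊(i : ℝ≥0) / h k⌋₊)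
    (fun k i => (hx k).measurable _) (Z := fun i ω => (Z ω).1 i) (fun i => hlim i)
    (V := fun k ω => f (x k ⌊(s + t) / h k⌋₊ ω)) (v := fun ω => f ((Z ω).1 (s + t)))
    (fun k => f.continuous.measurable.comp ((hx k).measurable _))
    ((hlim (s + t)).mono fun ω h5 => (f.continuous.tendsto _).comp h5) (W := fun _ => ‖f‖)
    (by simp) fun k => Eventually.of_forall fun ω => (le_abs_self _).trans (f.norm_coe_le_norm _)
  have hUt : Tendsto (fun k => (U k ^ (⌊(s + t) / h k⌋₊ - ⌊s / h k⌋₊)) f) atTop (𝓝 (T t f)) := by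
    refine hU _ t f ?_
    have h5 := tendsto_floor_mul (tendsto_nhdsWithin_iff.2 ⟨hh0, Eventually.of_forall hh⟩)
    have h6 := (h5 (s + t)).sub (h5 s)
    rw [add_tsub_cancel_left] at h6
    refine h6.congr fun k => ?_
    rw [← tsub_mul, Nat.cast_tsub]
  obtain ⟨b, hb⟩ := hUt.norm.bddAbove_range
  have hR := tendsto_lintegral_prod_mul (μ := μ) J g (Y := fun k i => x k ⌊(i : ℝ≥0) / h k⌋₊)
    (fun k i => (hx k).measurable _) (Z := fun i ω => (Z ω).1 i) (fun i => hlim i)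
    (V := fun k ω => (U k ^ (⌊(s + t) / h k⌋₊ - ⌊s / h k⌋₊)) f (x k ⌊s / h k⌋₊ ω))
    (v := fun ω => T t f ((Z ω).1 s))
    (fun k => ContinuousMap.measurable _ |>.comp ((hx k).measurable _))
    ((hlim s).mono fun ω h5 => ?_) (W := fun _ => b) (by simp)
    fun k => Eventually.of_forall fun ω => (le_abs_self _).trans
      ((BoundedContinuousFunction.norm_coe_le_norm _ _).trans (hb (mem_range_self k)))
  swap
  · have h6 := (tendsto_iff_norm_sub_tendsto_zero.1 hUt)
    have h7 := ((T t f).continuous.tendsto _).comp h5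
    refine tendsto_of_tendsto_of_dist h7 (squeeze_zero (fun _ => dist_nonneg) (fun k => ?_) h6)
    rw [dist_comm, Real.dist_eq]
    exact ((U k ^ (⌊(s + t) / h k⌋₊ - ⌊s / h k⌋₊)) f - T t f).norm_coe_le_norm _
  exact tendsto_nhds_unique hL (hR.congr fun k => (hid k).symm)

end MarkovLaws

/-! ### Clocks and the Skorokhod topology -/

section Clocks

/-- The sequence of the times of a clock. -/
structure IsClock (s : ℕ → ℝ≥0) : Prop where
  strictMono : StrictMono s
  zero : s 0 = 0
  tendsto : Tendsto s atTop atTop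

/-- The last index of a clock up to time `t`. -/
def idx (s : ℕ → ℝ≥0) (t : ℝ≥0) : ℕ := sInf {i | t < s (i + 1)}

namespace IsClock

variable {s s' : ℕ → ℝ≥0}

theorem lt_idx_succ (hs : IsClock s) (t : ℝ≥0) : t < s (idx s t + 1) := by
  have h : {i | t < s (i + 1)}.Nonempty :=
    (((tendsto_add_atTop_iff_nat 1).2 hs.tendsto).eventually_gt_atTop t).exists
  exact Nat.sInf_mem h

theorem idx_le (hs : IsClock s) (t : ℝ≥0) : s (idx s t) ≤ t := by
  rcases Nat.eq_zero_or_pos (idx s t) with h | h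
  · rw [h, hs.zero]
    exact zero_le
  · by_contra h2
    have h3 : idx s t - 1 ∈ {i | t < s (i + 1)} := by
      rw [mem_ofPred_eq, Nat.sub_add_cancel h]
      exact not_le.1 h2
    have := Nat.sInf_le h3
    change idx s t ≤ idx s t - 1 at this
    omega

theorem le_iff (hs : IsClock s) {i : ℕ} {t : ℝ≥0} : s i ≤ t ↔ i ≤ idx s t := by
  constructor
  · intro h
    exact Nat.lt_succ_iff.1 (hs.strictMono.lt_iff_lt.1 (h.trans_lt (hs.lt_idx_succ t)))
  · exact fun h => (hs.strictMono.monotone h).trans (hs.idx_le t)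

theorem idx_eq (hs : IsClock s) {i : ℕ} {t : ℝ≥0} (h1 : s i ≤ t) (h2 : t < s (i + 1)) :
    idx s t = i := by
  refine le_antisymm ?_ (hs.le_iff.1 h1)
  by_contra h3
  exact (not_le.2 h2) (hs.le_iff.2 (not_le.1 h3))

theorem idx_mono (hs : IsClock s) : Monotone (idx s) := fun _ _ h =>
  hs.le_iff.1 ((hs.idx_le _).trans h)

theorem tendsto_left {X : Type*} [TopologicalSpace X] (hs : IsClock s) {a : ℕ → ℝ≥0 → X}
    (ha : ∀ i, Continuous (a i)) {i : ℕ} {t : ℝ≥0} (h1 : s i < t) (h2 : t ≤ s (i + 1)) :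
    Tendsto (fun t => a (idx s t) t) (𝓝[<] t) (𝓝 (a i t)) := by
  refine (((ha i).tendsto t).mono_left nhdsWithin_le_nhds).congr' ?_
  filter_upwards [self_mem_nhdsWithin, mem_nhdsWithin_of_mem_nhds (Ioi_mem_nhds h1)] with u hu hu'
  rw [hs.idx_eq (le_of_lt hu') ((mem_Iio.1 hu).trans_le h2)]

theorem tendsto_right {X : Type*} [TopologicalSpace X] (hs : IsClock s) {a : ℕ → ℝ≥0 → X}
    (ha : ∀ i, Continuous (a i)) (t : ℝ≥0) :
    ContinuousWithinAt (fun t => a (idx s t) t) (Ici t) t := by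
  refine (ha (idx s t)).continuousWithinAt.congr_of_eventuallyEq ?_ rfl
  filter_upwards [self_mem_nhdsWithin, mem_nhdsWithin_of_mem_nhds (Iio_mem_nhds (hs.lt_idx_succ t))]
    with u hu hu'
  rw [hs.idx_eq ((hs.idx_le t).trans hu) hu']

theorem exists_lt_le (hs : IsClock s) {t : ℝ≥0} (ht : 0 < t) : ∃ i, s i < t ∧ t ≤ s (i + 1) := by
  rcases (hs.idx_le t).lt_or_eq with h | h
  · exact ⟨_, h, (hs.lt_idx_succ t).le⟩
  · obtain ⟨i, hi⟩ := Nat.exists_eq_succ_of_ne_zero (n := idx s t) fun h0 => by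
      rw [h0, hs.zero] at h
      exact ht.ne h
    refine ⟨i, ?_, ?_⟩
    · rw [← h, hi]
      exact hs.strictMono i.lt_succ_self
    · rw [← h, hi]

theorem isCadlag {X : Type*} [TopologicalSpace X] (hs : IsClock s) {a : ℕ → ℝ≥0 → X}
    (ha : ∀ i, Continuous (a i)) : IsCadlag fun t => a (idx s t) t := by
  refine ⟨hs.tendsto_right ha, fun t ht => ?_⟩
  obtain ⟨i, h1, h2⟩ := hs.exists_lt_le ht
  exact ⟨_, hs.tendsto_left ha h1 h2⟩

theorem continuousAt {X : Type*} [TopologicalSpace X] (hs : IsClock s) {a : ℕ → ℝ≥0 → X}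
    (ha : ∀ i, Continuous (a i)) {t : ℝ≥0} (ht : ∀ i, s (i + 1) ≠ t) :
    ContinuousAt (fun t => a (idx s t) t) t := by
  refine (ha (idx s t)).continuousAt.congr ?_
  rcases (hs.idx_le t).lt_or_eq with h | h
  · filter_upwards [Ioo_mem_nhds h (hs.lt_idx_succ t)] with u hu
    rw [hs.idx_eq hu.1.le hu.2]
  · have h0 : idx s t = 0 := by
      by_contra h0
      obtain ⟨i, hi⟩ := Nat.exists_eq_succ_of_ne_zero h0
      rw [hi] at h
      exact ht i h
    filter_upwards [Iio_mem_nhds (hs.lt_idx_succ t)] with u hu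
    rw [hs.idx_eq (by rw [h0, hs.zero]; exact zero_le) hu]

/-- The piecewise linear map of the times of one clock to those of another. -/
def map (s s' : ℕ → ℝ≥0) (t : ℝ≥0) : ℝ≥0 :=
  s' (idx s t) + (t - s (idx s t)) / (s (idx s t + 1) - s (idx s t))
    * (s' (idx s t + 1) - s' (idx s t))

theorem gap_pos (hs : IsClock s) (i : ℕ) : 0 < s (i + 1) - s i :=
  tsub_pos_of_lt (hs.strictMono i.lt_succ_self)

theorem le_map (t : ℝ≥0) : s' (idx s t) ≤ map s s' t := le_self_add

theorem map_lt (hs : IsClock s) (hs' : IsClock s') (t : ℝ≥0) :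
    map s s' t < s' (idx s t + 1) := by
  have h1 : (t - s (idx s t)) / (s (idx s t + 1) - s (idx s t)) < 1 := by
    rw [div_lt_one (hs.gap_pos _)]
    exact (tsub_lt_tsub_iff_right (hs.idx_le t)).2 (hs.lt_idx_succ t)
  have h2 := mul_lt_mul_of_pos_right h1 (hs'.gap_pos (idx s t))
  rw [one_mul] at h2
  calc map s s' t < s' (idx s t) + (s' (idx s t + 1) - s' (idx s t)) := by
        unfold map
        gcongr
    _ = _ := add_tsub_cancel_of_le (hs'.strictMono.monotone (Nat.le_succ _))

theorem idx_map (hs : IsClock s) (hs' : IsClock s') (t : ℝ≥0) :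
    idx s' (map s s' t) = idx s t :=
  hs'.idx_eq (le_map t) (hs.map_lt hs' t)

theorem map_map (hs : IsClock s) (hs' : IsClock s') (t : ℝ≥0) :
    map s' s (map s s' t) = t := by
  have h1 : map s' s (map s s' t) = s (idx s t) + (map s s' t - s' (idx s t))
      / (s' (idx s t + 1) - s' (idx s t)) * (s (idx s t + 1) - s (idx s t)) := by
    conv_lhs => rw [map, hs.idx_map hs']
  rw [h1, map, add_tsub_cancel_left, mul_div_assoc, div_self (hs'.gap_pos _).ne', mul_one,
    div_mul_cancel₀ _ (hs.gap_pos _).ne', add_tsub_cancel_of_le (hs.idx_le t)]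

theorem strictMono_map (hs : IsClock s) (hs' : IsClock s') : StrictMono (map s s') := by
  intro t u htu
  rcases (hs.idx_mono htu.le).lt_or_eq with h | h
  · calc map s s' t < s' (idx s t + 1) := hs.map_lt hs' t
      _ ≤ s' (idx s u) := hs'.strictMono.monotone h
      _ ≤ _ := le_map u
  · unfold map
    rw [← h]
    have h1 : t - s (idx s t) < u - s (idx s t) := (tsub_lt_tsub_iff_right (hs.idx_le t)).2 htu
    have h2 := mul_lt_mul_of_pos_right ((div_lt_div_iff_of_pos_right (hs.gap_pos (idx s t))).2 h1)
      (hs'.gap_pos (idx s t))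
    gcongr

/-- The piecewise linear time change between two clocks. -/
def iso (hs : IsClock s) (hs' : IsClock s') : ℝ≥0 ≃o ℝ≥0 :=
  StrictMono.orderIsoOfRightInverse (map s s') (hs.strictMono_map hs') (map s' s) (hs'.map_map hs)

theorem dist_map_le (hs : IsClock s) (hs' : IsClock s') {ε : ℝ} (h : ∀ i, dist (s' i) (s i) ≤ ε)
    (t : ℝ≥0) : dist (map s s' t) t ≤ ε := by
  set i := idx s t with hi
  have h1 := hs.idx_le t
  have h2 := hs.lt_idx_succ t
  rw [← hi] at h1 h2
  have h3 := h i
  have h4 := h (i + 1)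
  have h5 : s' i ≤ s' (i + 1) := hs'.strictMono.monotone (Nat.le_succ _)
  have h6 : 0 < (s (i + 1) : ℝ) - s i := sub_pos.2 (by exact_mod_cast h1.trans_lt h2)
  rw [NNReal.dist_eq, abs_le] at h3 h4 ⊢
  set θ : ℝ := ((t : ℝ) - s i) / (s (i + 1) - s i) with hθ
  have h7 : (map s s' t : ℝ) = s' i + θ * (s' (i + 1) - s' i) := by
    unfold map
    rw [← hi, NNReal.coe_add, NNReal.coe_mul, NNReal.coe_div, NNReal.coe_sub h1,
      NNReal.coe_sub (h1.trans h2.le), NNReal.coe_sub h5]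
  have h8 : (t : ℝ) = s i + θ * (s (i + 1) - s i) := by
    rw [hθ, div_mul_cancel₀ _ h6.ne']
    ring
  have h9 : 0 ≤ θ := div_nonneg (sub_nonneg.2 (by exact_mod_cast h1)) h6.le
  have h10 : θ ≤ 1 := (div_le_one h6).2 (by
    have : (t : ℝ) ≤ s (i + 1) := by exact_mod_cast h2.le
    linarith)
  have h11 : (map s s' t : ℝ) - t
      = (1 - θ) * ((s' i : ℝ) - s i) + θ * ((s' (i + 1) : ℝ) - s (i + 1)) := by
    rw [h7]
    conv_lhs => rw [h8]
    ring
  rw [h11]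
  constructor <;> nlinarith

/-- The clock `s'`, continued with the gaps of `s` after `M` ticks. -/
def trunc (s s' : ℕ → ℝ≥0) (M i : ℕ) : ℝ≥0 := s' (min i M) + (s i - s (min i M))

theorem trunc_of_le {M i : ℕ} (h : i ≤ M) : trunc s s' M i = s' i := by
  rw [trunc, min_eq_left h, tsub_self, add_zero]

theorem isClock_trunc (hs : IsClock s) (hs' : IsClock s') (M : ℕ) : IsClock (trunc s s' M) where
  strictMono := by
    refine strictMono_nat_of_lt_succ fun i => ?_
    rcases lt_or_ge i M with h | h
    · rw [trunc_of_le h.le, trunc_of_le h]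
      exact hs'.strictMono i.lt_succ_self
    · unfold trunc
      rw [min_eq_right h, min_eq_right (h.trans (Nat.le_succ i))]
      have := (tsub_lt_tsub_iff_right (hs.strictMono.monotone h)).2 (hs.strictMono i.lt_succ_self)
      gcongr
  zero := by rw [trunc_of_le zero_le, hs'.zero]
  tendsto := by
    refine tendsto_atTop.2 fun b => ?_
    filter_upwards [eventually_ge_atTop M, hs.tendsto.eventually_ge_atTop (b + s M)] with i hi hi'
    rw [trunc, min_eq_right hi]
    exact (le_tsub_of_add_le_right hi').trans le_add_self

theorem dist_trunc_le (hs : IsClock s) {M : ℕ} {ε : ℝ} (h : ∀ i ≤ M, dist (s' i) (s i) ≤ ε)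
    (i : ℕ) : dist (trunc s s' M i) (s i) ≤ ε := by
  have h1 : s (min i M) ≤ s i := hs.strictMono.monotone (min_le_left _ _)
  have h2 := h (min i M) (min_le_right _ _)
  rw [NNReal.dist_eq] at h2 ⊢
  rw [trunc, NNReal.coe_add, NNReal.coe_sub h1]
  convert h2 using 2
  ring

end IsClock

theorem exists_diagonal {P : ℕ → ℕ → Prop} (h : ∀ p, ∀ᶠ k in atTop, P p k) :
    ∃ β : ℕ → ℕ, Tendsto β atTop atTop ∧ ∀ᶠ k in atTop, P (β k) k := by
  classical
  choose N hN using fun p => eventually_atTop.1 (h p)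
  refine ⟨fun k => Nat.findGreatest (fun p => N p ≤ k) k, tendsto_atTop.2 fun p => ?_, ?_⟩
  · filter_upwards [eventually_ge_atTop (max p (N p))] with k hk
    exact Nat.le_findGreatest ((le_max_left _ _).trans hk) ((le_max_right _ _).trans hk)
  · filter_upwards [eventually_ge_atTop (N 0)] with k hk
    exact hN _ k (Nat.findGreatest_spec (P := fun p => N p ≤ k) zero_le hk)

section Skorokhod

variable {X : Type*} [UniformSpace X]

theorem skorokhodTendsto_of_eventually [(uniformity X).IsCountablyGenerated]
    {x : ℕ → CadlagPath X} {y : CadlagPath X}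
    (h : ∀ (b : ℝ≥0) (ε : ℝ), 0 < ε → ∀ V ∈ uniformity X, ∀ᶠ k in atTop,
      ∃ φ : ℝ≥0 ≃o ℝ≥0, (∀ t, dist (φ t) t ≤ ε) ∧ ∀ t ≤ b, (y.1 t, (x k).1 (φ t)) ∈ V) :
    SkorokhodTendsto x y := by
  classical
  obtain ⟨V, hV⟩ := (uniformity X).exists_antitone_basis
  obtain ⟨β, hβ, hP⟩ := exists_diagonal fun p : ℕ =>
    h p (1 / ((p : ℝ) + 1)) (by positivity) (V p) (hV.1.mem_of_mem trivial)
  let Q : ℕ → (ℝ≥0 ≃o ℝ≥0) → Prop := fun k φ => (∀ t, dist (φ t) t ≤ 1 / ((β k : ℝ) + 1)) ∧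
    ∀ t ≤ (β k : ℝ≥0), (y.1 t, (x k).1 (φ t)) ∈ V (β k)
  refine ⟨fun k => if hk : ∃ φ, Q k φ then hk.choose else OrderIso.refl _, ?_, fun b => ?_⟩
  · rw [Metric.tendstoUniformly_iff]
    intro ε hε
    filter_upwards [hP, hβ.eventually (tendsto_one_div_add_atTop_nhds_zero_nat.eventually_lt_const
      hε)] with k hk hk' t
    rw [dif_pos hk, dist_comm]
    exact (hk.choose_spec.1 t).trans_lt hk'
  · intro W hW
    obtain ⟨p, -, hp⟩ := hV.1.mem_iff.1 hW
    filter_upwards [hP, hβ.eventually_ge_atTop p, hβ.eventually_ge_atTop ⌈b⌉₊] with k hk h1 h2 t ht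
    rw [dif_pos hk]
    refine hp (hV.2 h1 (hk.choose_spec.2 t ?_))
    exact (mem_Iic.1 ht).trans ((Nat.le_ceil b).trans (by exact_mod_cast h2))

theorem SkorokhodTendsto.tendsto_apply {x : ℕ → CadlagPath X} {y : CadlagPath X}
    (h : SkorokhodTendsto x y) {t : ℝ≥0} (ht : ContinuousAt y.1 t) :
    Tendsto (fun k => (x k).1 t) atTop (𝓝 (y.1 t)) := by
  obtain ⟨φ, h1, h2⟩ := h
  have h3 : Tendsto (fun k => (φ k).symm t) atTop (𝓝 t) := by
    rw [Metric.tendsto_nhds]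
    intro ε hε
    filter_upwards [Metric.tendstoUniformly_iff.1 h1 ε hε] with k hk
    simpa using hk ((φ k).symm t)
  have h4 : Tendsto (fun k => y.1 ((φ k).symm t)) atTop (𝓝 (y.1 t)) := ht.tendsto.comp h3
  rw [Uniform.tendsto_nhds_right, tendsto_def] at h4 ⊢
  intro V hV
  obtain ⟨W, hW, hWV⟩ := comp_mem_uniformity_sets hV
  have h5 : ∀ᶠ k in atTop, (φ k).symm t ≤ t + 1 :=
    h3.eventually (ge_mem_nhds (lt_add_one t))
  filter_upwards [h4 W hW, h2 (t + 1) W hW, h5] with k h6 h7 h8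
  refine hWV ⟨_, h6, ?_⟩
  simpa using h7 _ (mem_Iic.2 h8)

theorem SkorokhodTendsto.comp {X' : Type*} [UniformSpace X'] {x : ℕ → CadlagPath X}
    {y : CadlagPath X} (h : SkorokhodTendsto x y) {g : X → X'} (hg : UniformContinuous g)
    {x' : ℕ → CadlagPath X'} {y' : CadlagPath X'} (hx : ∀ k t, (x' k).1 t = g ((x k).1 t))
    (hy : ∀ t, y'.1 t = g (y.1 t)) : SkorokhodTendsto x' y' := by
  obtain ⟨φ, h1, h2⟩ := h
  refine ⟨φ, h1, fun b => ?_⟩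
  have h3 := hg.comp_tendstoUniformlyOn (h2 b)
  have h4 : y'.1 = g ∘ y.1 := funext hy
  rw [h4]
  refine h3.congr (Eventually.of_forall fun k t _ => ?_)
  simp [hx]

theorem isClock_mul {h : ℝ≥0} (hh : 0 < h) {s : ℕ → ℝ≥0} (hs : IsClock s) :
    IsClock fun i => h * s i where
  strictMono i j hij := mul_lt_mul_of_pos_left (hs.strictMono hij) hh
  zero := by rw [hs.zero, mul_zero]
  tendsto := hs.tendsto.const_mul_atTop hh

theorem isClock_natCast {K : ℕ → ℕ} (hK : StrictMono K) (h0 : K 0 = 0) :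
    IsClock fun i => (K i : ℝ≥0) where
  strictMono i j hij := Nat.cast_lt.2 (hK hij)
  zero := by simp [h0]
  tendsto := tendsto_natCast_atTop_atTop.comp hK.tendsto_atTop

/-- Pairs of an index `k` and a number of steps of length `h k` that take the time `u`. -/
def stepFilter (h : ℕ → ℝ≥0) (u : ℝ≥0) : Filter (ℕ × ℕ) :=
  comap Prod.fst atTop ⊓ comap (fun p => (p.2 : ℝ≥0) * h p.1) (𝓝 u)

theorem tendsto_stepFilter {ι : Type*} {l : Filter ι} {h : ℕ → ℝ≥0} {u : ℝ≥0} {p : ι → ℕ × ℕ}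
    (h1 : Tendsto (fun i => (p i).1) l atTop)
    (h2 : Tendsto (fun i => ((p i).2 : ℝ≥0) * h (p i).1) l (𝓝 u)) :
    Tendsto p l (stepFilter h u) :=
  tendsto_inf.2 ⟨tendsto_comap_iff.2 h1, tendsto_comap_iff.2 h2⟩

theorem skorokhodTendsto_stepPath [(uniformity X).IsCountablyGenerated] {h : ℕ → ℝ≥0}
    (hh : ∀ k, 0 < h k) (hh0 : Tendsto h atTop (𝓝 0)) {s : ℕ → ℝ≥0} (hs : IsClock s)
    {K : ℕ → ℕ → ℕ} (hK : ∀ k, StrictMono (K k)) (hK0 : ∀ k, K k 0 = 0)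
    (hKs : ∀ i, Tendsto (fun k => h k * K k i) atTop (𝓝 (s i))) {x : ℕ → ℕ → X}
    {y : ℕ → ℝ≥0 → X} (hy : ∀ i, Continuous (y i)) {b : ℕ → ℕ → ℕ → X}
    (hxb : ∀ k i r, K k i + r < K k (i + 1) → x k (K k i + r) = b k i r)
    (hb : ∀ i u, Tendsto (fun p : ℕ × ℕ => b p.1 i p.2) (stepFilter h u) (𝓝 (y i (s i + u)))) :
    SkorokhodTendsto (fun k => stepPath (h k) (x k)) ⟨fun t => y (idx s t) t, hs.isCadlag hy⟩ := by
  refine skorokhodTendsto_of_eventually fun c ε hε V hV => ?_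
  obtain ⟨M, hM⟩ := (hs.tendsto.eventually_gt_atTop c).exists
  have hcl : ∀ k, IsClock fun i => h k * (K k i : ℝ≥0) := fun k =>
    isClock_mul (hh k) (isClock_natCast (hK k) (hK0 k))
  let σ : ℕ → ℕ → ℝ≥0 := fun k => IsClock.trunc s (fun i => h k * (K k i : ℝ≥0)) M
  have hσ : ∀ k, IsClock (σ k) := fun k => hs.isClock_trunc (hcl k) M
  have hdist : ∀ η : ℝ, 0 < η → ∀ᶠ k in atTop, ∀ t, dist (IsClock.map s (σ k) t) t ≤ η := by
    intro η hη
    have : ∀ᶠ k in atTop, ∀ i ∈ Finset.range (M + 1), dist (h k * (K k i : ℝ≥0)) (s i) ≤ η := by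
      rw [Finset.eventually_all]
      intro i _
      filter_upwards [Metric.tendsto_nhds.1 (hKs i) η hη] with k hk using hk.le
    filter_upwards [this] with k hk t
    exact hs.dist_map_le (hσ k) (hs.dist_trunc_le fun i hi =>
      hk i (Finset.mem_range_succ_iff.2 hi)) t
  have hloc : ∀ i ∈ Finset.range M, ∀ᶠ k in atTop, ∀ t ∈ Icc (s i) (s (i + 1)),
      t < s (i + 1) → (y i t, (stepPath (h k) (x k)).1 (IsClock.map s (σ k) t)) ∈ V := by
    intro i hi
    have hiM := Finset.mem_range.1 hi
    have hP : ∀ t₀ ∈ Icc (s i) (s (i + 1)), ∀ᶠ p : ℕ × ℝ≥0 in atTop ×ˢ 𝓝 t₀,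
        p.2 ∈ Icc (s i) (s (i + 1)) → p.2 < s (i + 1) →
          (y i p.2, (stepPath (h p.1) (x p.1)).1 (IsClock.map s (σ p.1) p.2)) ∈ V := by
      intro t₀ ht₀
      let m : ℕ × ℝ≥0 → ℕ := fun p => ⌊IsClock.map s (σ p.1) p.2 / h p.1⌋₊ - K p.1 i
      have hfl : ∀ k (u : ℝ≥0), dist ((⌊u / h k⌋₊ : ℝ≥0) * h k) u ≤ h k := by
        intro k u
        have h1 := (le_div_iff₀ (hh k)).1 (Nat.floor_le (zero_le : 0 ≤ u / h k))
        have h2 := (div_lt_iff₀ (hh k)).1 (Nat.lt_floor_add_one (u / h k))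
        rw [add_mul, one_mul] at h2
        have h1' : ((⌊u / h k⌋₊ : ℝ≥0) * h k : ℝ≥0) ≤ (u : ℝ) := by exact_mod_cast h1
        have h2' : (u : ℝ) < ((⌊u / h k⌋₊ : ℝ≥0) * h k : ℝ≥0) + h k := by exact_mod_cast h2
        rw [NNReal.dist_eq, abs_le]
        constructor <;> linarith
      have h1 : Tendsto (fun p : ℕ × ℝ≥0 => (⌊IsClock.map s (σ p.1) p.2 / h p.1⌋₊ : ℝ≥0) * h p.1)
          (atTop ×ˢ 𝓝 t₀) (𝓝 t₀) := by
        rw [Metric.tendsto_nhds]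
        intro η hη
        have h3 := (hdist (η / 3) (by positivity)).prod_inl (𝓝 t₀)
        have h4 := (Metric.tendsto_nhds.1 hh0 (η / 3) (by positivity)).prod_inl (𝓝 t₀)
        have h5 : ∀ᶠ p : ℕ × ℝ≥0 in atTop ×ˢ 𝓝 t₀, dist p.2 t₀ < η / 3 :=
          tendsto_snd.eventually (Metric.ball_mem_nhds t₀ (by positivity))
        filter_upwards [h3, h4, h5] with p h6 h7 h8
        rw [NNReal.dist_eq, NNReal.coe_zero, sub_zero, abs_of_nonneg (h p.1).coe_nonneg] at h7
        have h9 := dist_triangle4 ((⌊IsClock.map s (σ p.1) p.2 / h p.1⌋₊ : ℝ≥0) * h p.1)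
          (IsClock.map s (σ p.1) p.2) p.2 t₀
        have := hfl p.1 (IsClock.map s (σ p.1) p.2)
        have := h6 p.2
        linarith
      have h2 : Tendsto (fun p : ℕ × ℝ≥0 => (p.1, m p)) (atTop ×ˢ 𝓝 t₀)
          (stepFilter h (t₀ - s i)) := by
        refine tendsto_stepFilter tendsto_fst ?_
        refine (h1.sub ((hKs i).comp tendsto_fst)).congr fun p => ?_
        simp only [m, Function.comp_apply]
        rw [Nat.cast_tsub, tsub_mul, mul_comm (h p.1)]
      have h3 := (hb i (t₀ - s i)).comp h2
      rw [add_tsub_cancel_of_le ht₀.1] at h3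
      have h4 : Tendsto (fun p : ℕ × ℝ≥0 => y i p.2) (atTop ×ˢ 𝓝 t₀) (𝓝 (y i t₀)) :=
        ((hy i).tendsto t₀).comp tendsto_snd
      have h5 := (h4.prodMk_nhds h3).eventually (nhds_le_uniformity _ hV)
      filter_upwards [h5] with p h6 h7 h8
      have h9 : idx s p.2 = i := hs.idx_eq h7.1 h8
      have h10 := IsClock.le_map (s := s) (s' := σ p.1) p.2
      have h11 := hs.map_lt (hσ p.1) p.2
      rw [h9] at h10 h11
      simp only [σ] at h10 h11
      rw [IsClock.trunc_of_le hiM.le, mul_comm] at h10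
      rw [IsClock.trunc_of_le hiM, mul_comm] at h11
      have h12 : K p.1 i ≤ ⌊IsClock.map s (σ p.1) p.2 / h p.1⌋₊ :=
        Nat.le_floor ((le_div_iff₀ (hh _)).2 h10)
      have h13 : ⌊IsClock.map s (σ p.1) p.2 / h p.1⌋₊ < K p.1 (i + 1) :=
        (Nat.floor_lt zero_le).2 ((div_lt_iff₀ (hh _)).2 h11)
      have h14 : K p.1 i + m p = ⌊IsClock.map s (σ p.1) p.2 / h p.1⌋₊ := Nat.add_sub_of_le h12
      have h15 := hxb p.1 i (m p) (by rwa [h14])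
      rw [h14] at h15
      change (y i p.2, x p.1 ⌊IsClock.map s (σ p.1) p.2 / h p.1⌋₊) ∈ V
      rw [h15]
      exact h6
    have h6 : ∀ᶠ p : ℕ × ℝ≥0 in atTop ×ˢ 𝓝ˢ (Icc (s i) (s (i + 1))),
        p.2 ∈ Icc (s i) (s (i + 1)) → p.2 < s (i + 1) →
          (y i p.2, (stepPath (h p.1) (x p.1)).1 (IsClock.map s (σ p.1) p.2)) ∈ V := by
      rw [isCompact_Icc.prod_nhdsSet_eq_biSup]
      simpa only [eventually_iSup] using hP
    filter_upwards [h6.curry] with k hk t ht ht'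
    exact hk.self_of_nhdsSet t ht ht ht'
  filter_upwards [hdist ε hε, (Finset.eventually_all _).2 hloc] with k h1 h2
  refine ⟨hs.iso (hσ k), h1, fun t ht => ?_⟩
  have h3 : idx s t < M := hs.strictMono.lt_iff_lt.1 ((hs.idx_le t).trans_lt (ht.trans_lt hM))
  exact h2 _ (Finset.mem_range.2 h3) t ⟨hs.idx_le t, (hs.lt_idx_succ t).le⟩ (hs.lt_idx_succ t)

theorem exists_bound_of_tendsto_div {S : ℕ → ℝ≥0}
    (hS : Tendsto (fun i : ℕ => (S i : ℝ) / i) atTop (𝓝 1)) {η : ℝ} (hη : 0 < η) :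
    ∃ c : ℝ, 0 ≤ c ∧ ∀ i : ℕ, |(S i : ℝ) - i| ≤ η * i + c := by
  obtain ⟨N, hN⟩ := eventually_atTop.1 (Metric.tendsto_nhds.1 hS η hη)
  refine ⟨∑ i ∈ Finset.range (N + 1), |(S i : ℝ) - i|,
    Finset.sum_nonneg fun i _ => abs_nonneg _, fun i => ?_⟩
  have h0 : 0 ≤ ∑ i ∈ Finset.range (N + 1), |(S i : ℝ) - i| :=
    Finset.sum_nonneg fun i _ => abs_nonneg _
  rcases le_or_gt i N with h | h
  · have := Finset.single_le_sum (f := fun i : ℕ => |(S i : ℝ) - i|) (fun i _ => abs_nonneg _)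
      (Finset.mem_range_succ_iff.2 h)
    have : 0 ≤ η * i := by positivity
    linarith
  · have h1 := hN i h.le
    have hi : (0 : ℝ) < i := by exact_mod_cast (Nat.zero_le N).trans_lt h
    rw [Real.dist_eq] at h1
    have h2 : |(S i : ℝ) - i| = |(S i : ℝ) / i - 1| * i := by
      nth_rewrite 3 [← abs_of_pos hi]
      rw [← abs_mul, sub_mul, div_mul_cancel₀ _ hi.ne', one_mul]
    rw [h2]
    nlinarith

theorem SkorokhodTendsto.comp_clock [(uniformity X).IsCountablyGenerated] {h : ℕ → ℝ≥0}
    (hh : ∀ k, 0 < h k) (hh0 : Tendsto h atTop (𝓝 0)) {x : ℕ → ℕ → X} {y : CadlagPath X}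
    (hxy : SkorokhodTendsto (fun k => stepPath (h k) (x k)) y) {S : ℕ → ℝ≥0} (hS : IsClock S)
    (hS1 : Tendsto (fun i : ℕ => (S i : ℝ) / i) atTop (𝓝 1)) :
    SkorokhodTendsto (fun k => ⟨fun t => x k (idx (fun i => h k * S i) t),
      (isClock_mul (hh k) hS).isCadlag fun _ => continuous_const⟩) y := by
  refine skorokhodTendsto_of_eventually fun c ε hε V hV => ?_
  obtain ⟨φ, hφ1, hφ2⟩ := hxy
  obtain ⟨C, hC0, hC⟩ := exists_bound_of_tendsto_div hS1
    (η := ε / (4 * (c + ε + 3))) (by positivity)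
  have hn : ∀ k, IsClock fun i : ℕ => h k * (i : ℝ≥0) := fun k =>
    isClock_mul (hh k) (isClock_natCast strictMono_id rfl)
  have hb : Tendsto (fun k => (h k : ℝ) * C) atTop (𝓝 0) := by
    have := ((continuous_coe.tendsto 0).comp hh0).mul_const C
    simpa using this
  filter_upwards [Metric.tendstoUniformly_iff.1 hφ1 (ε / 2) (by positivity), hφ2 c V hV,
    hb.eventually_le_const (by positivity : 0 < ε / 4),
    hh0.eventually_le_const (zero_lt_one)] with k h1 h2 h3 h4
  let M : ℕ := ⌊(c + ε.toNNReal) / h k⌋₊ + 1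
  have hM : (M : ℝ) * h k ≤ c + ε + 3 := by
    have h5 := (le_div_iff₀ (hh k)).1 (Nat.floor_le (zero_le : 0 ≤ (c + ε.toNNReal) / h k))
    have h6 : ((⌊(c + ε.toNNReal) / h k⌋₊ : ℝ)) * h k ≤ c + ε := by
      have h7 : (((⌊(c + ε.toNNReal) / h k⌋₊ : ℝ≥0) * h k : ℝ≥0) : ℝ) ≤ (c + ε.toNNReal : ℝ≥0) :=
        NNReal.coe_le_coe.2 h5
      rw [NNReal.coe_add, Real.coe_toNNReal _ hε.le] at h7
      exact_mod_cast h7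
    have h8 : (h k : ℝ) ≤ 1 := by exact_mod_cast h4
    simp only [M]
    push_cast
    linarith
  let σ : ℕ → ℝ≥0 := IsClock.trunc (fun i : ℕ => h k * (i : ℝ≥0)) (fun i => h k * S i) M
  have hσ : IsClock σ := (hn k).isClock_trunc (isClock_mul (hh k) hS) M
  have hd : ∀ t, dist (IsClock.map (fun i : ℕ => h k * (i : ℝ≥0)) σ t) t ≤ ε / 2 := by
    refine (hn k).dist_map_le hσ ((hn k).dist_trunc_le fun i hi => ?_)
    rw [NNReal.dist_eq]
    push_cast
    rw [← mul_sub, abs_mul, abs_of_nonneg (h k).coe_nonneg]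
    have h5 : (i : ℝ) ≤ M := by exact_mod_cast hi
    have h6 : 0 < (c : ℝ) + ε + 3 := by positivity
    calc (h k : ℝ) * |(S i : ℝ) - i| ≤ h k * (ε / (4 * (c + ε + 3)) * i + C) :=
          mul_le_mul_of_nonneg_left (hC i) (h k).coe_nonneg
      _ = ε / (4 * (c + ε + 3)) * (i * h k) + h k * C := by ring
      _ ≤ ε / (4 * (c + ε + 3)) * (c + ε + 3) + ε / 4 := by
          refine add_le_add (mul_le_mul_of_nonneg_left ?_ (by positivity)) h3
          exact (mul_le_mul_of_nonneg_right h5 (h k).coe_nonneg).trans hM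
      _ = ε / 2 := by
          field_simp
          ring
  refine ⟨(φ k).trans ((hn k).iso hσ), fun t => ?_, fun t ht => ?_⟩
  · have h5 := hd (φ k t)
    have h6 := h1 t
    rw [dist_comm] at h6
    refine (dist_triangle _ (φ k t) _).trans ((add_le_add h5 h6.le).trans_eq (add_halves ε))
  · have h5 := h2 t ht
    convert! h5 using 2
    change x k (idx _ (IsClock.map _ σ (φ k t))) = x k ⌊φ k t / h k⌋₊
    congr 1
    set u := φ k t
    have hu : u ≤ c + ε.toNNReal := by
      have h6 := h1 t
      rw [id, NNReal.dist_eq, abs_lt] at h6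
      rw [← NNReal.coe_le_coe, NNReal.coe_add, Real.coe_toNNReal _ hε.le]
      have : (t : ℝ) ≤ c := by exact_mod_cast ht
      linarith
    have h7 : idx (fun i : ℕ => h k * (i : ℝ≥0)) u = ⌊u / h k⌋₊ := by
      refine (hn k).idx_eq ?_ ?_
      · rw [mul_comm]
        exact (le_div_iff₀ (hh k)).1 (Nat.floor_le zero_le)
      · rw [mul_comm]
        exact (div_lt_iff₀ (hh k)).1 (by exact_mod_cast Nat.lt_floor_add_one _)
    have h8 : ⌊u / h k⌋₊ + 1 ≤ M :=
      Nat.succ_le_succ (Nat.floor_mono (div_le_div_of_nonneg_right hu zero_le))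
    have h9 := IsClock.le_map (s := fun i : ℕ => h k * (i : ℝ≥0)) (s' := σ) u
    have h10 := (hn k).map_lt hσ u
    rw [h7] at h9 h10
    refine (isClock_mul (hh k) hS).idx_eq ?_ ?_
    · rwa [show σ ⌊u / h k⌋₊ = h k * S ⌊u / h k⌋₊ from
        IsClock.trunc_of_le (Nat.le_of_succ_le h8)] at h9
    · rwa [show σ (⌊u / h k⌋₊ + 1) = h k * S (⌊u / h k⌋₊ + 1) from IsClock.trunc_of_le h8] at h10

end Skorokhod

end Clocks

/-! ### The paths of the chains and of the limit process -/

section States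

variable {n : ℕ}

/-- The normalized state `WρW*`. -/
def conjState (W : Mat n) (ρ : State n) : State n :=
  State.normalize (W * ρ.mat * Wᴴ) ρ

theorem conjState_mat {W : Mat n} {ρ : State n}
    (h : 0 < (W * ρ.mat * Wᴴ).trace.re) :
    (conjState W ρ).mat = (W * ρ.mat * Wᴴ).trace.re⁻¹
      • (W * ρ.mat * Wᴴ) :=
  State.normalize_mat (posSemidef_conj W ρ.posSemidef) h ρ

theorem State.tendsto_iff {ι : Type*} {l : Filter ι} {x : ι → State n} {ρ : State n} :
    Tendsto x l (𝓝 ρ) ↔ Tendsto (fun i => (x i).mat) l (𝓝 ρ.mat) :=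
  State.isInducing_mat.tendsto_nhds_iff

theorem tendsto_conj {ι : Type*} {l : Filter ι} {W : ι → Mat n} {W₀ : Mat n}
    {x : ι → State n} {ρ : State n} (hW : Tendsto W l (𝓝 W₀)) (hx : Tendsto x l (𝓝 ρ)) :
    Tendsto (fun i => W i * (x i).mat * (W i)ᴴ) l
      (𝓝 (W₀ * ρ.mat * W₀ᴴ)) := by
  have h1 : Tendsto (fun i => (x i).mat) l (𝓝 ρ.mat) := State.tendsto_iff.1 hx
  have h2 : Tendsto (fun i => (W i)ᴴ) l (𝓝 W₀ᴴ) :=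
    (continuous_id.matrix_conjTranspose.tendsto W₀).comp hW
  exact (hW.mul h1).mul h2

theorem tendsto_trace_conj {ι : Type*} {l : Filter ι} {W : ι → Mat n} {W₀ : Mat n}
    {x : ι → State n} {ρ : State n} (hW : Tendsto W l (𝓝 W₀)) (hx : Tendsto x l (𝓝 ρ)) :
    Tendsto (fun i => (W i * (x i).mat * (W i)ᴴ).trace.re) l
      (𝓝 (W₀ * ρ.mat * W₀ᴴ).trace.re) := by
  have hc : Continuous fun X : Mat n => X.trace.re :=
    Complex.continuous_re.comp continuous_id.matrix_trace
  exact (hc.tendsto _).comp (tendsto_conj hW hx)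

theorem tendsto_conjState {ι : Type*} {l : Filter ι} {W : ι → Mat n} {W₀ : Mat n}
    {x : ι → State n} {ρ : State n} (hW : Tendsto W l (𝓝 W₀)) (hx : Tendsto x l (𝓝 ρ))
    (h : 0 < (W₀ * ρ.mat * W₀ᴴ).trace.re) :
    Tendsto (fun i => conjState (W i) (x i)) l (𝓝 (conjState W₀ ρ)) := by
  have h1 := tendsto_conj hW hx
  have h2 := tendsto_trace_conj hW hx
  rw [State.tendsto_iff, conjState_mat h]
  refine ((h2.inv₀ h.ne').smul h1).congr' ?_
  filter_upwards [h2.eventually (lt_mem_nhds h)] with i hi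
  rw [conjState_mat hi]

theorem trace_conj_conjState (V W : Mat n) {ρ : State n}
    (h : 0 < (V * ρ.mat * Vᴴ).trace.re) :
    W * (conjState V ρ).mat * Wᴴ = (V * ρ.mat * Vᴴ).trace.re⁻¹
      • ((W * V) * ρ.mat * (W * V)ᴴ) := by
  rw [conjState_mat h, Matrix.mul_smul, Matrix.smul_mul, conjTranspose_mul]
  simp only [Matrix.mul_assoc]

theorem trace_conj_pos_of_mul {V W : Mat n} {ρ : State n}
    (h : 0 < ((W * V) * ρ.mat * (W * V)ᴴ).trace.re) :
    0 < (V * ρ.mat * Vᴴ).trace.re := by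
  refine (State.trace_re_nonneg (posSemidef_conj V ρ.posSemidef)).lt_of_ne' fun h0 => ?_
  have h1 := eq_zero_of_trace (posSemidef_conj V ρ.posSemidef) h0
  have h2 : (W * V) * ρ.mat * (W * V)ᴴ
      = W * (V * ρ.mat * Vᴴ) * Wᴴ := by
    rw [conjTranspose_mul]
    simp only [Matrix.mul_assoc]
  rw [h2, h1] at h
  simp at h

theorem conjState_conjState {V W : Mat n} {ρ : State n}
    (h : 0 < ((W * V) * ρ.mat * (W * V)ᴴ).trace.re) :
    conjState W (conjState V ρ) = conjState (W * V) ρ := by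
  have h0 := trace_conj_pos_of_mul h
  have h1 := trace_conj_conjState V W h0
  have h2 : 0 < (W * (conjState V ρ).mat * Wᴴ).trace.re := by
    rw [h1, trace_smul_re]
    positivity
  refine State.ext ?_
  rw [conjState_mat h2, conjState_mat h, h1, trace_smul_re, smul_smul, mul_inv, inv_inv,
    mul_right_comm, mul_inv_cancel₀ h0.ne', one_mul]

theorem conjState_iterate (W : Mat n) (ρ : State n) (m : ℕ)
    (h : 0 < (W ^ m * ρ.mat * (W ^ m)ᴴ).trace.re) :
    (conjState W)^[m] ρ = conjState (W ^ m) ρ := by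
  induction m with
  | zero =>
    refine State.ext ?_
    rw [conjState_mat h]
    simp [ρ.trace_eq]
  | succ m ih =>
    rw [pow_succ'] at h ⊢
    rw [Function.iterate_succ_apply', ih (trace_conj_pos_of_mul h), conjState_conjState h]

theorem conjState_smul {c : ℝ} (hc : c ≠ 0) (W : Mat n) {ρ : State n}
    (h : 0 < (W * ρ.mat * Wᴴ).trace.re) : conjState (c • W) ρ = conjState W ρ := by
  have h1 : c • W * ρ.mat * (c • W)ᴴ = (c * c) • (W * ρ.mat * Wᴴ) := by
    rw [conjTranspose_smul, star_trivial, Matrix.smul_mul, Matrix.smul_mul, Matrix.mul_smul,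
      smul_smul]
  have h2 : 0 < c * c := mul_self_pos.2 hc
  refine State.ext ?_
  rw [conjState_mat h, conjState_mat (by rw [h1, trace_smul_re]; positivity), h1, trace_smul_re,
    smul_smul, mul_inv, mul_comm (c * c)⁻¹, mul_assoc, inv_mul_cancel₀ h2.ne', mul_one]

end States

section Limits

variable {n : ℕ} [NeZero n]

theorem trace_conj_flowMat_pos (A C : Mat n) (t : ℝ) (ρ : State n) :
    0 < (flowMat A C t * ρ.mat * (flowMat A C t)ᴴ).trace.re :=
  trace_conj_pos (isUnit_flowMat A C t) ρ

/-- The flow of the drift on the states. -/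
def flowState (A C : Mat n) (t : ℝ≥0) (ρ : State n) : State n := conjState (flowMat A C t) ρ

theorem continuous_flowState (A C : Mat n) :
    Continuous fun p : ℝ≥0 × State n => flowState A C p.1 p.2 := by
  rw [continuous_iff_continuousAt]
  intro p
  refine tendsto_conjState (W := fun p : ℝ≥0 × State n => flowMat A C p.1)
    (W₀ := flowMat A C p.1) ?_ continuous_snd.continuousAt (trace_conj_flowMat_pos A C _ _)
  exact ((continuous_flowMat A C).comp (continuous_coe.comp continuous_fst)).continuousAt

theorem flowState_zero (A C : Mat n) (ρ : State n) : flowState A C 0 ρ = ρ := by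
  refine State.ext ?_
  rw [flowState, conjState_mat (trace_conj_flowMat_pos A C _ _), NNReal.coe_zero, flowMat_zero]
  simp [ρ.trace_eq]

variable {A B : Mat n} (hA : A.IsHermitian) (hB : B.IsHermitian) (C : Mat n)

include hA hB in
theorem norm_kraus_pow_le (t : ℝ≥0) (m : ℕ) : ‖kraus A B C t 0 ^ m‖ ^ 2 ≤ n := by
  set W := kraus A B C t 0
  have hstep : ∀ X : Mat n, X.PosSemidef → (W * X * Wᴴ).trace.re ≤ X.trace.re := by
    intro X hX
    rcases eq_zero_or_exists_smul_state hX with rfl | ⟨d, ρ, hd, rfl⟩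
    · simp
    · have h1 := sum_outcomeProb A B C t ρ
      have h2 := outcomeProb_nonneg hA hB C t 1 ρ
      rw [Fin.sum_univ_two] at h1
      have h3 : outcomeProb A B C t 0 ρ = (W * ρ.mat * Wᴴ).trace.re := by
        unfold outcomeProb
        rw [outcome_eq hA hB]
      rw [Matrix.mul_smul, Matrix.smul_mul, trace_smul_re, trace_smul_re, ρ.trace_re]
      exact mul_le_mul_of_nonneg_left (by linarith) hd.le
  have h : ∀ m : ℕ, (W ^ m * 1 * (W ^ m)ᴴ).trace.re ≤ (n : ℝ) := by
    intro m
    induction m with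
    | zero => simp
    | succ m ih =>
      have h1 : W ^ (m + 1) * 1 * (W ^ (m + 1))ᴴ
          = W * (W ^ m * 1 * (W ^ m)ᴴ) * Wᴴ := by
        rw [pow_succ', conjTranspose_mul]
        simp only [Matrix.mul_assoc]
      rw [h1]
      exact (hstep _ (posSemidef_conj _ PosSemidef.one)).trans ih
  rw [← frobenius_norm_conjTranspose, norm_sq_eq_trace, conjTranspose_conjTranspose]
  simpa using h m

include hA hB in
/-- Powers of the no-click operators converge to the flow. -/
theorem tendsto_kraus_pow {ι : Type*} {l : Filter ι} {h : ι → ℝ≥0} {m : ι → ℕ} {u : ℝ} (hh :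
    Tendsto h l (𝓝[>] 0))
    (hm : Tendsto (fun i => (m i : ℝ) * h i) l (𝓝 u)) :
    Tendsto (fun i => kraus A B C (h i) 0 ^ m i) l (𝓝 (flowMat A C u)) := by
  obtain ⟨c, hc, hk⟩ := exists_bound_kraus n (max ‖A‖ (max ‖B‖ ‖C‖))
  have hh0 : Tendsto (fun i => (h i : ℝ)) l (𝓝 0) :=
    (continuous_coe.tendsto 0).comp (hh.mono_right nhdsWithin_le_nhds)
  obtain ⟨b, hb⟩ := (isCompact_Icc (a := (0 : ℝ)) (b := u + 1)).exists_bound_of_continuousOn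
    (continuous_flowMat A C).continuousOn
  have hb0 : ∀ᶠ i in l, 0 ≤ b ∧ ‖kraus A B C (h i) 0 ^ m i - flowMat A C (m i * h i)‖
      ≤ (m i * h i) * (√n * (c * b) * h i) := by
    filter_upwards [hh.eventually self_mem_nhdsWithin, hh0.eventually_le_const zero_lt_one,
      hm.eventually_le_const (lt_add_one u)] with i hi hi1 hi2
    have h0 : 0 ≤ b := by
      have := hb ((m i : ℝ) * h i) ⟨by positivity, hi2⟩
      exact (norm_nonneg _).trans this
    refine ⟨h0, ?_⟩
    set W := kraus A B C (h i) 0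
    have h1 : ‖W - flowMat A C (h i)‖ ≤ c * (h i : ℝ) ^ 2 :=
      (hk A B C (le_max_left _ _) ((le_max_left _ _).trans (le_max_right _ _))
        ((le_max_right _ _).trans (le_max_right _ _)) (h i) hi (by exact_mod_cast hi1)).1
    have key : ∀ k j : ℕ, ((k + j : ℕ) : ℝ) * h i ≤ u + 1 →
        ‖W ^ k * flowMat A C (j * h i) - flowMat A C ((k + j : ℕ) * h i)‖
          ≤ k * (√n * (c * (h i : ℝ) ^ 2 * b)) := by
      intro k
      induction k with
      | zero =>
        intro j _
        simp
      | succ k ih =>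
        intro j hj
        have h2 := ih (j + 1) (by
          rw [show k + (j + 1) = k + 1 + j by ring]
          exact hj)
        have h3 : flowMat A C ((j + 1 : ℕ) * h i) = flowMat A C (h i) * flowMat A C (j * h i) := by
          rw [← flowMat_add]
          congr 1
          push_cast
          ring
        have h4 : W ^ (k + 1) * flowMat A C (j * h i) - flowMat A C ((k + 1 + j : ℕ) * h i)
            = W ^ k * ((W - flowMat A C (h i)) * flowMat A C (j * h i))
              + (W ^ k * flowMat A C ((j + 1 : ℕ) * h i)
                - flowMat A C ((k + (j + 1) : ℕ) * h i)) := by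
          rw [h3, show k + (j + 1) = k + 1 + j by ring, pow_succ, Matrix.sub_mul, Matrix.mul_sub]
          simp only [Matrix.mul_assoc]
          abel
        have h5 : ‖W ^ k‖ ≤ √n := Real.le_sqrt_of_sq_le (norm_kraus_pow_le hA hB C (h i) k)
        have h6 : ‖flowMat A C (j * h i)‖ ≤ b := by
          refine hb _ ⟨by positivity, le_trans ?_ hj⟩
          push_cast
          nlinarith [(h i).coe_nonneg, (Nat.cast_nonneg k : (0 : ℝ) ≤ k)]
        have h7 : ‖W ^ k * ((W - flowMat A C (h i)) * flowMat A C (j * h i))‖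
            ≤ √n * (c * (h i : ℝ) ^ 2 * b) := by
          refine (frobenius_norm_mul _ _).trans (mul_le_mul h5 ?_ (norm_nonneg _)
            (Real.sqrt_nonneg _))
          exact (frobenius_norm_mul _ _).trans (mul_le_mul h1 h6 (norm_nonneg _)
            (by positivity))
        rw [h4]
        refine (norm_add_le _ _).trans ((add_le_add h7 h2).trans_eq ?_)
        push_cast
        ring
    have h8 := key (m i) 0 (by simpa using hi2)
    simp only [Nat.cast_zero, zero_mul, add_zero] at h8
    rw [flowMat_zero, mul_one] at h8
    refine h8.trans_eq ?_
    ring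
  have h9 : Tendsto (fun i => (m i * h i) * (√n * (c * b) * h i)) l (𝓝 0) := by
    have := hm.mul (hh0.const_mul (√n * (c * b)))
    simpa using this
  have h10 : Tendsto (fun i => kraus A B C (h i) 0 ^ m i - flowMat A C (m i * h i)) l (𝓝 0) :=
    squeeze_zero_norm' (hb0.mono fun i hi => hi.2) h9
  have h11 := h10.add (((continuous_flowMat A C).tendsto u).comp hm)
  simpa using h11

include hA hB in
theorem outcomeState_eq (t : ℝ≥0) (j : Fin 2) : outcomeState A B C t j = conjState
    (kraus A B C t j) := by
  funext ρ
  unfold outcomeState conjState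
  rw [outcome_eq hA hB]

include hA hB in
theorem tendsto_outcomeState_iterate {ι : Type*} {l : Filter ι} {h : ι → ℝ≥0} {m : ι → ℕ} {u : ℝ≥0}
    {x : ι → State n} {ρ : State n} (hh : Tendsto h l (𝓝[>] 0))
    (hm : Tendsto (fun i => (m i : ℝ≥0) * h i) l (𝓝 u)) (hx : Tendsto x l (𝓝 ρ)) :
    Tendsto (fun i => (outcomeState A B C (h i) 0)^[m i] (x i)) l (𝓝 (flowState A C u ρ)) := by
  have hm' : Tendsto (fun i => (m i : ℝ) * h i) l (𝓝 u) := by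
    simpa using! (continuous_coe.tendsto u).comp hm
  have h1 := tendsto_kraus_pow hA hB C hh hm'
  have h0 := trace_conj_flowMat_pos A C u ρ
  refine (tendsto_conjState h1 hx h0).congr' ?_
  filter_upwards [(tendsto_trace_conj h1 hx).eventually (lt_mem_nhds h0)] with i hi
  rw [outcomeState_eq hA hB, conjState_iterate _ _ _ hi]

include hA hB in
theorem tendsto_outcomeState_one {ι : Type*} {l : Filter ι} {h : ι → ℝ≥0}
    {x : ι → State n} {ρ : State n} (hh : Tendsto h l (𝓝[>] 0)) (hx : Tendsto x l (𝓝 ρ))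
    (h0 : 0 < jumpRate C ρ) :
    Tendsto (fun i => outcomeState A B C (h i) 1 (x i)) l (𝓝 (jumpState C ρ)) := by
  obtain ⟨c, hc, hk⟩ := exists_bound_kraus n (max ‖A‖ (max ‖B‖ ‖C‖))
  have hh0 : Tendsto (fun i => (h i : ℝ)) l (𝓝 0) :=
    (continuous_coe.tendsto 0).comp (hh.mono_right nhdsWithin_le_nhds)
  have h1 : Tendsto (fun i => (√(h i : ℝ))⁻¹ • kraus A B C (h i) 1) l (𝓝 C) := by
    refine (tendsto_iff_norm_sub_tendsto_zero (E := Mat n)).2 ?_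
    refine squeeze_zero' (Eventually.of_forall fun _ => norm_nonneg _) ?_
      (by simpa using hh0.const_mul c)
    filter_upwards [hh.eventually self_mem_nhdsWithin, hh0.eventually_le_const zero_lt_one]
      with i hi hi1
    have h2 := (hk A B C (le_max_left _ _) ((le_max_left _ _).trans (le_max_right _ _))
        ((le_max_right _ _).trans (le_max_right _ _)) (h i) hi (by exact_mod_cast hi1)).2
    have h3 : 0 < √(h i : ℝ) := Real.sqrt_pos.2 (by exact_mod_cast hi)
    have h4 : (√(h i : ℝ))⁻¹ • kraus A B C (h i) 1 - C
        = (√(h i : ℝ))⁻¹ • (kraus A B C (h i) 1 - √(h i : ℝ) • C) := by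
      rw [smul_sub, smul_smul, inv_mul_cancel₀ h3.ne', one_smul]
    rw [h4, norm_smul, norm_inv, norm_of_nonneg h3.le, inv_mul_le_iff₀ h3]
    refine h2.trans_eq ?_
    have h5 : √(h i : ℝ) ^ 3 = √(h i : ℝ) * h i := by
      rw [pow_succ, Real.sq_sqrt (h i).coe_nonneg, mul_comm]
    rw [h5]
    ring
  rw [jumpRate_eq] at h0
  refine (tendsto_conjState h1 hx h0).congr' ?_
  filter_upwards [(tendsto_trace_conj h1 hx).eventually (lt_mem_nhds h0),
    hh.eventually self_mem_nhdsWithin] with i hi hi'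
  have h3 : 0 < √(h i : ℝ) := Real.sqrt_pos.2 (by exact_mod_cast hi')
  rw [outcomeState_eq hA hB, ← conjState_smul h3.ne' _ hi, smul_smul, mul_inv_cancel₀ h3.ne',
    one_smul]

theorem abs_outcomeProb_one_sub_le (A B C : Mat n) (hA : A.IsHermitian) (hB : B.IsHermitian) :
    ∃ c : ℝ, 0 ≤ c ∧ ∀ h : ℝ≥0, 0 < h → h ≤ 1 → ∀ ρ : State n,
      |outcomeProb A B C h 1 ρ - h * jumpRate C ρ| ≤ c * (h : ℝ) ^ 2 := by
  obtain ⟨c, hc, hk⟩ := exists_bound_kraus_one_conj n (max ‖A‖ (max ‖B‖ ‖C‖))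
  refine ⟨n * c, by positivity, fun h h0 h1 ρ => ?_⟩
  have h2 := hk A B C (le_max_left _ _) ((le_max_left _ _).trans (le_max_right _ _))
    ((le_max_right _ _).trans (le_max_right _ _)) h h0 h1 ρ.mat ρ.norm_mat_le
  have h3 := (abs_trace_re_le _).trans (mul_le_mul_of_nonneg_left h2 (Nat.cast_nonneg n))
  rw [trace_sub, Complex.sub_re, trace_smul_re, ← jumpRate_eq C] at h3
  unfold outcomeProb
  rw [outcome_eq hA hB, mul_assoc (n : ℝ)]
  exact h3

end Limits

section CleanSum

open Classical in
/-- The partial sums of a sequence of gaps, replaced by the natural numbers on the null set where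
they violate the law of large numbers. -/
def cleanSum (e : ℕ → ℝ≥0) (i : ℕ) : ℝ≥0 :=
  if (∀ i, 0 < e i) ∧ Tendsto (fun i : ℕ => (partialSum e i : ℝ) / i) atTop (𝓝 1)
    then partialSum e i else i

theorem tendsto_cleanSum_div (e : ℕ → ℝ≥0) :
    Tendsto (fun i : ℕ => (cleanSum e i : ℝ) / i) atTop (𝓝 1) := by
  unfold cleanSum
  split_ifs with h
  · exact h.2
  · refine tendsto_const_nhds.congr' ?_
    filter_upwards [eventually_gt_atTop 0] with i hi
    have : (i : ℝ) ≠ 0 := by exact_mod_cast hi.ne'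
    simp [this]

theorem isClock_cleanSum (e : ℕ → ℝ≥0) : IsClock (cleanSum e) where
  strictMono := by
    refine strictMono_nat_of_lt_succ fun i => ?_
    unfold cleanSum
    split_ifs with h
    · unfold partialSum
      rw [Finset.sum_range_succ]
      exact lt_add_of_pos_right _ (h.1 i)
    · exact_mod_cast i.lt_succ_self
  zero := by
    unfold cleanSum
    split_ifs <;> simp [partialSum]
  tendsto := by
    have h1 := (tendsto_cleanSum_div e).pos_mul_atTop one_pos tendsto_natCast_atTop_atTop
    rw [← NNReal.tendsto_coe_atTop]
    refine h1.congr' ?_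
    filter_upwards [eventually_gt_atTop 0] with i hi
    have : (i : ℝ) ≠ 0 := by exact_mod_cast hi.ne'
    field_simp

theorem measurable_cleanSum (i : ℕ) : Measurable fun e => cleanSum e i := by
  refine Measurable.ite (MeasurableSet.inter ?_ ?_) (measurable_partialSum i) measurable_const
  · have h : MeasurableSet (⋂ i, {e : ℕ → ℝ≥0 | 0 < e i}) :=
      MeasurableSet.iInter fun i => measurableSet_lt measurable_const (measurable_pi_apply i)
    rw [← ofPred_forall] at h
    exact h
  · exact measurableSet_tendsto _ fun i =>
      (measurable_coe_nnreal_real.comp (measurable_partialSum i)).div_const _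

theorem ae_cleanSum_eq : ∀ᵐ e ∂(iid expo), cleanSum e = partialSum e := by
  filter_upwards [ae_tendsto_partialSum_div, ae_pos_of_iid] with e h1 h2
  funext i
  exact if_pos ⟨h2, h1⟩

end CleanSum

section ChainPaths

variable {n : ℕ} [NeZero n]

/-- The gaps between potential clicks and the coins that decide whether they take place. -/
abbrev Noise : Type := (ℕ → ℝ≥0) × (ℕ → ℝ)

/-- The law of the noise. -/
abbrev noise : Measure Noise := (iid expo).prod (iid unif)

theorem measurable_conjState (W : Mat n) : Measurable (conjState W) := by
  classical
  let s : Set (State n) := {ρ | 0 < (W * ρ.mat * Wᴴ).trace.re}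
  have hc : Continuous fun ρ : State n => (W * ρ.mat * Wᴴ).trace.re := by
    rw [continuous_iff_continuousAt]
    exact fun ρ => tendsto_trace_conj tendsto_const_nhds tendsto_id
  have h : conjState W = s.piecewise (conjState W) id := by
    funext ρ
    by_cases hρ : ρ ∈ s
    · rw [piecewise_eq_of_mem _ _ _ hρ]
    · rw [piecewise_eq_of_notMem _ _ _ hρ]
      have h0 : (W * ρ.mat * Wᴴ).trace.re = 0 :=
        le_antisymm (not_lt.1 hρ) (State.trace_re_nonneg (posSemidef_conj W ρ.posSemidef))
      refine dif_neg fun h1 => ?_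
      have := h1.2
      rw [h0, inv_zero, zero_smul, Matrix.trace_zero] at this
      exact zero_ne_one this
  rw [h]
  refine ContinuousOn.measurable_piecewise (fun ρ hρ => ?_) continuousOn_id
    (isOpen_lt continuous_const hc).measurableSet
  have h1 : ContinuousAt (conjState W) ρ :=
    tendsto_conjState (x := id) tendsto_const_nhds tendsto_id hρ
  exact h1.continuousWithinAt

/-- The rate of potential clicks. -/
def rateBound (C : Mat n) : ℝ≥0 := ‖C‖₊ ^ 2 + 2

theorem rateBound_pos (C : Mat n) : 0 < rateBound C := by
  unfold rateBound
  positivity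

theorem coe_rateBound (C : Mat n) : (rateBound C : ℝ) = ‖C‖ ^ 2 + 2 := by
  simp [rateBound]

/-- A step of the chain without a click; the second component counts the clicks. -/
def noClick (A B C : Mat n) (h : ℝ≥0) (y : State n × ℕ) : State n × ℕ :=
  (outcomeState A B C h 0 y.1, y.2)

/-- A step of the chain with a click. -/
def click (A B C : Mat n) (h : ℝ≥0) (y : State n × ℕ) : State n × ℕ :=
  (outcomeState A B C h 1 y.1, y.2 + 1)

/-- The probability of a click in a step that contains a potential click. -/
def clickProb (A B C : Mat n) (h : ℝ≥0) (y : State n × ℕ) : ℝ :=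
  outcomeProb A B C h 1 y.1 / (1 - exp (-(rateBound C * h : ℝ≥0)))

/-- The step is short enough for the thinning of the potential clicks. -/
def IsFine (A B C : Mat n) (h : ℝ≥0) : Prop :=
  ∀ ρ, outcomeProb A B C h 1 ρ ≤ 1 - exp (-(rateBound C * h : ℝ≥0))

open Classical in
/-- A step of the counted chain, driven by the noise. -/
def chainStep (A B C : Mat n) (h : ℝ≥0) : (State n × ℕ) × Noise → (State n × ℕ) × Noise :=
  if IsFine A B C h then
    lazyStep (rateBound C * h) (noClick A B C h)
      (choiceStep (clickProb A B C h) (click A B C h) (noClick A B C h))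
  else liftStep (choiceStep (fun y => outcomeProb A B C h 1 y.1) (click A B C h) (noClick A B C h))

/-- The transition kernel of the counted chain. -/
def chainKernel (A B C : Mat n) (h : ℝ≥0) : State n × ℕ → Measure (State n × ℕ) :=
  choiceKernel (fun y => outcomeProb A B C h 1 y.1) (click A B C h) (noClick A B C h)

theorem outcomeProb_zero (A B C : Mat n) (h : ℝ≥0) (ρ : State n) :
    outcomeProb A B C h 0 ρ = 1 - outcomeProb A B C h 1 ρ := by
  have := sum_outcomeProb A B C h ρ
  rw [Fin.sum_univ_two] at this
  linarith

variable {A B : Mat n} (hA : A.IsHermitian) (hB : B.IsHermitian) (C : Mat n)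

include hA hB in
theorem outcomeProb_le_one (h : ℝ≥0) (ρ : State n) : outcomeProb A B C h 1 ρ ≤ 1 := by
  have := outcomeProb_nonneg hA hB C h 0 ρ
  rw [outcomeProb_zero] at this
  linarith

theorem one_sub_exp_pos {δ : ℝ≥0} (hδ : 0 < δ) : 0 < 1 - exp (-δ) := by
  have : exp (-δ) < 1 := by simpa using hδ
  linarith

include hA hB in
theorem isDriven_chainStep {h : ℝ≥0} (hh : 0 < h) : IsDriven noise (chainKernel A B C h)
    (chainStep A B C h) := by
  have hst : ∀ j, Measurable (outcomeState A B C h j) := fun j => by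
    rw [outcomeState_eq hA hB]
    exact measurable_conjState _
  have hD : Measurable (noClick A B C h) := ((hst 0).comp measurable_fst).prodMk measurable_snd
  have ha : Measurable (click A B C h) :=
    ((hst 1).comp measurable_fst).prodMk (measurable_snd.add_const 1)
  have hp : Measurable fun y : State n × ℕ => outcomeProb A B C h 1 y.1 :=
    (Complex.continuous_re.comp (continuous_outcome A B C h 1).matrix_trace).measurable.comp
      measurable_fst
  have hp0 := outcomeProb_nonneg hA hB C h 1
  unfold chainStep
  split_ifs with hf
  · have hε := one_sub_exp_pos (mul_pos (rateBound_pos C) hh)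
    have h1 := (isDriven_choice (q := clickProb A B C h) (hp.div_const _) ha hD
      (fun y => div_nonneg (hp0 y.1) hε.le) (fun y => (div_le_one hε).2 (hf y.1))).lazy
        (rateBound C * h) hD
    convert h1 using 1
    funext y
    unfold lazyKernel chainKernel choiceKernel clickProb
    rw [smul_add, smul_smul, smul_smul, ← ofReal_mul hε.le, ← ofReal_mul hε.le,
      mul_div_cancel₀ _ hε.ne', mul_sub, mul_div_cancel₀ _ hε.ne', mul_one, add_assoc, ← add_smul,
      ← ofReal_add (sub_nonneg.2 (hf y.1)) (exp_pos _).le]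
    congr 3
    ring
  · exact (isDriven_choice hp ha hD (fun y => hp0 y.1)
      fun y => outcomeProb_le_one hA hB C h y.1).lift

/-- The chain started at `y`, together with the number of clicks. -/
def chainPath (A B C : Mat n) (h : ℝ≥0) (y : State n × ℕ) (j : ℕ) (ω : Noise) : State n × ℕ :=
  orbit (chainStep A B C h) j (y, ω)

theorem lintegral_chainKernel (h : ℝ≥0) {f : State n →ᵇ ℝ} (hf : 0 ≤ f) (z : State n × ℕ) :
    ∫⁻ w, ofReal (f w.1) ∂(chainKernel A B C h z)
      = ofReal (transitionOp hA hB C h f z.1) := by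
  have hm : Measurable fun z : State n × ℕ => ofReal (f z.1) :=
    (f.continuous.measurable.comp measurable_fst).ennreal_ofReal
  have h0 := outcomeProb_nonneg hA hB C h
  have hf0 : ∀ ρ, 0 ≤ f ρ := hf
  rw [chainKernel, lintegral_choiceKernel _ _ _ _ hm, ← outcomeProb_zero,
    ← ofReal_mul (h0 _ _), ← ofReal_mul (h0 _ _),
    ← ofReal_add (mul_nonneg (h0 _ _) (hf0 _)) (mul_nonneg (h0 _ _) (hf0 _)), add_comm]
  congr 1
  exact (Fin.sum_univ_two fun j => outcomeProb A B C h j z.1 * f (outcomeState A B C h j z.1)).symm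

theorem isChain_chainPath {h : ℝ≥0} (hh : 0 < h) (y : State n × ℕ) :
    IsChain noise (transitionOp hA hB C h) y.1 fun j ω => (chainPath A B C h y j ω).1 :=
  (isDriven_chainStep hA hB C hh).isChain measurable_fst
    (fun _ hf => transitionOp_nonneg hA hB C h hf)
    (fun _ hf z => lintegral_chainKernel hA hB C h hf z) y

end ChainPaths

section Coupling

variable {n : ℕ} [NeZero n]

theorem tendsto_slope_zero {F : Type*} [NormedAddCommGroup F] [NormedSpace ℝ F] {g : ℝ → F} {g' : F}
    (hg : HasDerivAt g g' 0) {ι : Type*} {l : Filter ι} {h : ι → ℝ≥0}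
    (hh : Tendsto h l (𝓝[>] 0)) :
    Tendsto (fun i => (h i : ℝ)⁻¹ • (g (h i) - g 0)) l (𝓝 g') := by
  have h2 : Tendsto (fun i => (h i : ℝ)) l (𝓝[>] 0) := by
    refine tendsto_nhdsWithin_iff.2 ⟨(continuous_coe.tendsto 0).comp
      (hh.mono_right nhdsWithin_le_nhds), ?_⟩
    filter_upwards [hh.eventually self_mem_nhdsWithin] with i hi
    exact_mod_cast hi
  have h3 := (hg.tendsto_slope.mono_left
    (nhdsWithin_mono _ fun x (hx : 0 < x) => hx.ne')).comp h2
  refine h3.congr fun i => ?_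
  simp [slope_def_module]

theorem tendsto_one_sub_exp_div {r : ℝ≥0} {ι : Type*} {l : Filter ι} {h : ι → ℝ≥0}
    (hh : Tendsto h l (𝓝[>] 0)) :
    Tendsto (fun i => (1 - exp (-(r * h i : ℝ≥0))) / h i) l (𝓝 r) := by
  have h1 : HasDerivAt (fun t : ℝ => 1 - exp (-(r * t))) r 0 := by
    have := (((hasDerivAt_id (0 : ℝ)).const_mul (r : ℝ)).neg.exp).const_sub 1
    simpa using! this
  refine (tendsto_slope_zero h1 hh).congr fun i => ?_
  simp [div_eq_inv_mul]

omit [NeZero n] in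
theorem IsFine.outcomeProb_le {A B C : Mat n} {h : ℝ≥0} (hf : IsFine A B C h) (ρ : State n) :
    outcomeProb A B C h 1 ρ ≤ rateBound C * h := by
  have := Real.add_one_le_exp (-((rateBound C * h : ℝ≥0) : ℝ))
  have := hf ρ
  push_cast at *
  linarith

variable {A B : Mat n} (hA : A.IsHermitian) (hB : B.IsHermitian) (C : Mat n)

include hA hB in
/-- The click probabilities are of the order of the step. -/
theorem tendsto_outcomeProb_div {ι : Type*} {l : Filter ι} {h : ι → ℝ≥0} {x : ι → State n} {ρ :
    State n}
    (hh : Tendsto h l (𝓝[>] 0)) (hx : Tendsto x l (𝓝 ρ)) :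
    Tendsto (fun i => outcomeProb A B C (h i) 1 (x i) / h i) l (𝓝 (jumpRate C ρ)) := by
  obtain ⟨c, hc, hk⟩ := abs_outcomeProb_one_sub_le A B C hA hB
  have hh0 : Tendsto (fun i => (h i : ℝ)) l (𝓝 0) :=
    (continuous_coe.tendsto 0).comp (hh.mono_right nhdsWithin_le_nhds)
  have h1 : Tendsto (fun i => outcomeProb A B C (h i) 1 (x i) / h i - jumpRate C (x i)) l
      (𝓝 0) := by
    refine squeeze_zero_norm' ?_ (by simpa using hh0.const_mul c)
    filter_upwards [hh.eventually self_mem_nhdsWithin, hh0.eventually_le_const zero_lt_one]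
      with i hi hi1
    have hi' : (0 : ℝ) < h i := by exact_mod_cast hi
    rw [Real.norm_eq_abs, div_sub' hi'.ne', abs_div, abs_of_pos hi', div_le_iff₀ hi', mul_assoc,
      ← sq]
    exact hk (h i) hi (by exact_mod_cast hi1) (x i)
  simpa using! h1.add (((continuous_jumpRate C).tendsto ρ).comp hx)

include hA hB in
theorem eventually_isFine :
    ∀ᶠ h in 𝓝[>] (0 : ℝ≥0), IsFine A B C h := by
  obtain ⟨c, hc, hk⟩ := abs_outcomeProb_one_sub_le A B C hA hB
  have h1 := tendsto_one_sub_exp_div (r := rateBound C) (tendsto_id (α := ℝ≥0) (x := 𝓝[>] 0))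
  have hh0 : Tendsto (fun h : ℝ≥0 => (h : ℝ)) (𝓝[>] 0) (𝓝 0) :=
    (continuous_coe.tendsto 0).mono_left nhdsWithin_le_nhds
  have h2 : Tendsto (fun h : ℝ≥0 => ‖C‖ ^ 2 + c * (h : ℝ)) (𝓝[>] 0) (𝓝 (‖C‖ ^ 2)) := by
    simpa using (hh0.const_mul c).const_add (‖C‖ ^ 2)
  filter_upwards [self_mem_nhdsWithin, hh0.eventually_le_const zero_lt_one,
    h2.eventually_lt h1 (by rw [coe_rateBound]; linarith)] with h hi hi1 h3 ρ
  have hi' : (0 : ℝ) < h := by exact_mod_cast hi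
  have h4 := (abs_le.1 (hk h hi (by exact_mod_cast hi1) ρ)).2
  have h5 := mul_le_mul_of_nonneg_left (jumpRate_le C ρ) hi'.le
  rw [id, lt_div_iff₀ hi'] at h3
  nlinarith

include hA hB in
theorem tendsto_clickProb {ι : Type*} {l : Filter ι} {h : ι → ℝ≥0} {x : ι → State n × ℕ} {y :
    State n × ℕ}
    (hh : Tendsto h l (𝓝[>] 0)) (hx : Tendsto x l (𝓝 y)) :
    Tendsto (fun i => clickProb A B C (h i) (x i)) l (𝓝 (jumpRate C y.1 / rateBound C)) := by
  have h1 := (tendsto_outcomeProb_div hA hB C hh ((continuous_fst.tendsto y).comp hx)).div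
    (tendsto_one_sub_exp_div (r := rateBound C) hh) (NNReal.coe_ne_zero.2 (rateBound_pos C).ne')
  refine h1.congr' ?_
  filter_upwards [hh.eventually self_mem_nhdsWithin] with i hi
  have hi' : (0 : ℝ) < h i := by exact_mod_cast hi
  exact div_div_div_cancel_right₀ hi'.ne' _ _

include hA hB in
theorem tendsto_noClick_iterate {ι : Type*} {l : Filter ι} {h : ι → ℝ≥0} {m : ι → ℕ} {u : ℝ≥0} {x :
    ι → State n × ℕ}
    {y : State n × ℕ} (hh : Tendsto h l (𝓝[>] 0))
    (hm : Tendsto (fun i => (m i : ℝ≥0) * h i) l (𝓝 u)) (hx : Tendsto x l (𝓝 y)) :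
    Tendsto (fun i => (noClick A B C (h i))^[m i] (x i)) l (𝓝 (flowState A C u y.1, y.2)) := by
  have h1 : ∀ h m, (noClick A B C h)^[m] = Prod.map (outcomeState A B C h 0)^[m] id := by
    intro h m
    rw [← Function.iterate_id m, ← Prod.map_iterate]
    rfl
  simp only [h1]
  exact (tendsto_outcomeState_iterate hA hB C hh hm
    ((continuous_fst.tendsto y).comp hx)).prodMk_nhds
    ((continuous_snd.tendsto y).comp hx)

/-- One potential click of the limit process. -/
def limitStep (A C : Mat n) : (State n × ℕ) × Noise → (State n × ℕ) × Noise :=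
  gapStep (fun e y => (flowState A C (e / rateBound C) y.1, y.2))
    (choiceStep (fun y => jumpRate C y.1 / rateBound C) (fun y => (jumpState C y.1, y.2 + 1)) id)

/-- The state of the limit process after `i` potential clicks. -/
def mark (A C : Mat n) (y : State n × ℕ) (i : ℕ) (ω : Noise) : State n × ℕ :=
  orbit (limitStep A C) i (y, ω)

/-- The state of the limit process just before a potential click. -/
def preMark (A C : Mat n) (y : State n × ℕ) (i : ℕ) (ω : Noise) : State n × ℕ :=
  (flowState A C (ω.1 i / rateBound C) (mark A C y i ω).1, (mark A C y i ω).2)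

open Classical in
theorem mark_succ (A C : Mat n) (y : State n × ℕ) (i : ℕ) (ω : Noise) :
    mark A C y (i + 1) ω = if ω.2 i < jumpRate C (preMark A C y i ω).1 / rateBound C
      then (jumpState C (preMark A C y i ω).1, (preMark A C y i ω).2 + 1)
      else preMark A C y i ω :=
  orbit_gapStep_choice _ _ _ _ (y, ω) i

theorem tendsto_floor_div_mul (r e : ℝ≥0) (c : ℕ) {ι : Type*} {l : Filter ι}
    {h : ι → ℝ≥0} (hh : Tendsto h l (𝓝[>] 0)) :
    Tendsto (fun i => ((⌊e / (r * h i)⌋₊ + c : ℕ) : ℝ≥0) * h i) l (𝓝 (e / r)) := by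
  simpa [add_mul, div_div] using (tendsto_floor_mul hh (e / r)).add
    ((hh.mono_right nhdsWithin_le_nhds).const_mul (c : ℝ≥0))

include hA hB in
/-- The marks of the chains converge to those of the limit process. -/
theorem tendsto_mark {h : ℕ → ℝ≥0} (hh : Tendsto h atTop (𝓝[>] 0)) (y : State n × ℕ) (ω : Noise)
    (h0 : ∀ i, 0 ≤ ω.2 i)
    (hne : ∀ i, ω.2 i ≠ jumpRate C (preMark A C y i ω).1 / rateBound C) (i : ℕ) :
    Tendsto (fun k => orbit (macroStep (rateBound C * h k) (noClick A B C (h k))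
      (choiceStep (clickProb A B C (h k)) (click A B C (h k)) (noClick A B C (h k)))) i (y, ω))
      atTop (𝓝 (mark A C y i ω)) := by
  induction i with
  | zero => exact tendsto_const_nhds
  | succ i ih =>
    simp only [orbit_gapStep_choice]
    have h1 := tendsto_noClick_iterate hA hB C hh
      (tendsto_floor_div_mul (rateBound C) (ω.1 i) 0 hh) ih
    have h2 := tendsto_noClick_iterate hA hB C hh
      (tendsto_floor_div_mul (rateBound C) (ω.1 i) 1 hh) ih
    have h3 := tendsto_clickProb hA hB C hh h1
    simp only [Function.iterate_succ_apply'] at h2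
    rw [mark_succ]
    rcases (hne i).lt_or_gt with hlt | hlt
    · rw [if_pos hlt]
      have h4 : 0 < jumpRate C (preMark A C y i ω).1 := by
        refine lt_of_le_of_ne (jumpRate_nonneg _ _) fun h => ?_
        rw [← h, zero_div] at hlt
        exact (h0 i).not_gt hlt
      have h5 := (tendsto_outcomeState_one hA hB C hh ((continuous_fst.tendsto _).comp h1)
        h4).prodMk_nhds (((continuous_snd.tendsto _).comp h1).add_const 1)
      refine h5.congr' ?_
      filter_upwards [h3.eventually (lt_mem_nhds hlt)] with k hk
      exact (if_pos hk).symm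
    · rw [if_neg hlt.not_gt]
      refine h2.congr' ?_
      filter_upwards [h3.eventually (gt_mem_nhds hlt)] with k hk
      exact (if_neg hk.not_gt).symm

end Coupling

section LimitPath

variable {n : ℕ} [NeZero n]

/-- The times of the potential clicks. -/
def clickClock (C : Mat n) (e : ℕ → ℝ≥0) (i : ℕ) : ℝ≥0 := (rateBound C)⁻¹ * cleanSum e i

theorem isClock_clickClock (C : Mat n) (e : ℕ → ℝ≥0) : IsClock (clickClock C e) :=
  isClock_mul (inv_pos.2 (rateBound_pos C)) (isClock_cleanSum e)

/-- The motion of the limit process after the `i`-th potential click. -/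
def branch (A C : Mat n) (y : State n × ℕ) (ω : Noise) (i : ℕ) (t : ℝ≥0) : State n × ℕ :=
  (flowState A C (t - clickClock C ω.1 i) (mark A C y i ω).1, (mark A C y i ω).2)

theorem continuous_branch (A C : Mat n) (y : State n × ℕ) (ω : Noise) (i : ℕ) :
    Continuous (branch A C y ω i) :=
  ((continuous_flowState A C).comp
    ((continuous_id.sub continuous_const).prodMk continuous_const)).prodMk continuous_const

/-- The limit process together with the number of clicks. -/
def limitPath (A C : Mat n) (y : State n × ℕ) (ω : Noise) : CadlagPath (State n × ℕ) :=
  ⟨fun t => branch A C y ω (idx (clickClock C ω.1) t) t,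
    (isClock_clickClock C ω.1).isCadlag (continuous_branch A C y ω)⟩

theorem isDriven_limitChoice (C : Mat n) : IsDriven (iid unif)
    (choiceKernel (fun y : State n × ℕ => jumpRate C y.1 / rateBound C)
      (fun y => (jumpState C y.1, y.2 + 1)) id)
    (choiceStep (fun y => jumpRate C y.1 / rateBound C)
      (fun y => (jumpState C y.1, y.2 + 1)) id) := by
  refine isDriven_choice
    (((continuous_jumpRate C).measurable.comp measurable_fst).div_const _)
    (((measurable_conjState C).comp measurable_fst).prodMk (measurable_snd.add_const 1))
    measurable_id (fun y => div_nonneg (jumpRate_nonneg C _) (NNReal.coe_nonneg _)) fun y => ?_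
  rw [div_le_one (by exact_mod_cast rateBound_pos C), coe_rateBound]
  linarith [jumpRate_le C y.1]

theorem measurable_limitFlow (A C : Mat n) : Measurable fun p : ℝ≥0 × (State n × ℕ) =>
    (flowState A C (p.1 / rateBound C) p.2.1, p.2.2) := by
  refine Continuous.measurable ?_
  exact ((continuous_flowState A C).comp
    ((continuous_fst.div_const _).prodMk (continuous_fst.comp continuous_snd))).prodMk
    (continuous_snd.comp continuous_snd)

theorem isDriven_limitStep (A C : Mat n) : ∃ k, IsDriven noise k (limitStep A C) :=
  ⟨_, (isDriven_limitChoice C).gap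
    (D := fun e y => (flowState A C (e / rateBound C) y.1, y.2)) (measurable_limitFlow A C)⟩

theorem measurable_mark (A C : Mat n) (y : State n × ℕ) (i : ℕ) : Measurable (mark A C y i) :=
  ((isDriven_limitStep A C).choose_spec.measurable_orbit i).comp (by fun_prop)

theorem measurable_clickClock (C : Mat n) (i : ℕ) : Measurable fun e => clickClock C e i :=
  (measurable_cleanSum i).const_mul _

theorem measurable_idx {Ω : Type*} [MeasurableSpace Ω] {s : Ω → ℕ → ℝ≥0} (hs : ∀ ω, IsClock (s ω))
    (hm : ∀ i, Measurable fun ω => s ω i) (t : ℝ≥0) : Measurable fun ω => idx (s ω) t := by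
  refine measurable_of_Ici (f := fun ω => idx (s ω) t) fun i => ?_
  have : (fun ω => idx (s ω) t) ⁻¹' Ici i = {ω | s ω i ≤ t} := by
    ext ω
    exact (hs ω).le_iff.symm
  rw [this]
  exact measurableSet_le (hm i) measurable_const

theorem measurable_apply_idx {Ω X : Type*} [MeasurableSpace Ω] [MeasurableSpace X] {k : Ω → ℕ}
    (hk : Measurable k) {a : ℕ → Ω → X} (ha : ∀ i, Measurable (a i)) :
    Measurable fun ω => a (k ω) ω :=
  (measurable_from_prod_countable_right (f := fun p : ℕ × Ω => a p.1 p.2) ha).comp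
    (hk.prodMk (measurable_id (α := Ω)))

theorem measurable_limitPath (A C : Mat n) (y : State n × ℕ) : Measurable (limitPath A C y) := by
  refine Measurable.subtype_mk (measurable_pi_iff.2 fun t => ?_)
  refine measurable_apply_idx (Ω := Noise) (a := fun i ω => branch A C y ω i t)
    (measurable_idx (s := fun ω : Noise => clickClock C ω.1)
    (fun ω => isClock_clickClock C ω.1) (fun i =>
      (measurable_clickClock C i).comp measurable_fst) t)
    fun i => ?_
  have h1 := measurable_mark A C y i
  have h2 : Measurable fun ω : Noise => t - clickClock C ω.1 i :=
    ((measurable_clickClock C i).comp measurable_fst).const_sub t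
  exact ((continuous_flowState A C).measurable.comp (h2.prodMk h1.fst)).prodMk h1.snd

/-- The noise for which all the potential clicks are well separated and decided. -/
def IsRegular (A C : Mat n) (y : State n × ℕ) (ω : Noise) : Prop :=
  cleanSum ω.1 = partialSum ω.1 ∧ (∀ i, 0 ≤ ω.2 i) ∧
    ∀ i, ω.2 i ≠ jumpRate C (preMark A C y i ω).1 / rateBound C

theorem ae_coin {p : ℝ → Prop} (hp : ∀ᵐ u ∂unif, p u) : ∀ᵐ v ∂(iid unif), ∀ i, p (v i) :=
  ae_all_iff.2 fun i =>
    (measurePreserving_eval_infinitePi (fun _ : ℕ => unif) i).quasiMeasurePreserving.ae hp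

theorem ae_isRegular (A C : Mat n) (y : State n × ℕ) : ∀ᵐ ω ∂noise, IsRegular A C y ω := by
  have h1 : ∀ᵐ ω : Noise ∂noise, cleanSum ω.1 = partialSum ω.1 :=
    Measure.quasiMeasurePreserving_fst.ae ae_cleanSum_eq
  have h2 : ∀ᵐ ω : Noise ∂noise, ∀ i, 0 ≤ ω.2 i := by
    refine Measure.quasiMeasurePreserving_snd.ae (ae_coin ?_)
    exact (ae_restrict_mem measurableSet_Icc).mono fun u hu => hu.1
  have h3 : ∀ᵐ ω : Noise ∂noise, ∀ i, ω.2 i ≠ jumpRate C (preMark A C y i ω).1 / rateBound C := by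
    refine ae_all_iff.2 fun i => ?_
    let q : (State n × ℕ) × Noise → ℝ := fun p =>
      jumpRate C (flowState A C (p.2.1 0 / rateBound C) p.1.1) / rateBound C
    have hq : Measurable q := by
      refine (((continuous_jumpRate C).comp (continuous_flowState A C)).measurable.comp
        (Measurable.prodMk ?_ measurable_fst.fst)).div_const _
      exact ((measurable_pi_apply 0).comp measurable_snd.fst).div_const _
    have hv : Measurable fun p : (State n × ℕ) × Noise => p.2.2 0 :=
      (measurable_pi_apply 0).comp measurable_snd.snd
    have hS : MeasurableSet {p : (State n × ℕ) × Noise | p.2.2 0 = q p} :=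
      measurableSet_eq_fun hv hq
    have h4 : ∀ z : State n × ℕ, ∫⁻ ω : Noise, {p | p.2.2 0 = q p}.indicator 1 (z, ω) ∂noise
        = 0 := by
      intro z
      have hSz : MeasurableSet {ω : Noise | ω.2 0 = q (z, ω)} := measurable_prodMk_left hS
      change ∫⁻ ω : Noise, {ω | ω.2 0 = q (z, ω)}.indicator 1 ω ∂noise = 0
      rw [lintegral_indicator_one hSz, Measure.measure_prod_null hSz]
      refine Eventually.of_forall fun e => ?_
      have h5 : ∀ᵐ v ∂(iid unif), v 0 ≠ q (z, (e, fun _ => 0)) :=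
        (ae_coin (p := fun u => u ≠ q (z, (e, fun _ => 0)))
          (measure_eq_zero_iff_ae_notMem.1 (measure_singleton _))).mono fun v hv => hv 0
      exact (measure_eq_zero_iff_ae_notMem.2 h5 :)
    have h6 := (isDriven_limitStep A C).choose_spec.lintegral_stopped i y
      (Φ := fun _ => 1) measurable_const (H := {p | p.2.2 0 = q p}.indicator 1)
      (measurable_one.indicator hS)
    simp only [one_mul, h4, lintegral_zero] at h6
    have hit : Measurable fun ω : Noise => (limitStep A C)^[i] (y, ω) :=
      ((isDriven_limitStep A C).choose_spec.measurable.iterate i).comp (by fun_prop)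
    filter_upwards [(lintegral_eq_zero_iff ((measurable_one.indicator hS).comp hit)).1 h6]
      with ω hω h7
    have h8 : (limitStep A C)^[i] (y, ω) ∉ {p | p.2.2 0 = q p} := by
      intro h8
      exact one_ne_zero ((indicator_of_mem h8 (1 : (State n × ℕ) × Noise → ENNReal)).symm.trans hω)
    refine h8 ?_
    have h9 : ((limitStep A C)^[i] (y, ω)).2.2 0 = ω.2 i :=
      (gapStep_choice_iterate_coins _ _ _ _ (y, ω) i 0).trans (by rw [zero_add])
    have h10 : ((limitStep A C)^[i] (y, ω)).2.1 0 = ω.1 i :=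
      (gapStep_iterate_gaps _ _ (y, ω) i 0).trans (by rw [zero_add])
    change _ = jumpRate C _ / _
    rw [h9, h10]
    exact h7
  filter_upwards [h1, h2, h3] with ω h1 h2 h3 using ⟨h1, h2, h3⟩

theorem strictMono_lazyTime (δ : ℝ≥0) (e : ℕ → ℝ≥0) : StrictMono (lazyTime δ e) := by
  refine strictMono_nat_of_lt_succ fun i => ?_
  unfold lazyTime
  rw [Finset.sum_range_succ]
  omega

theorem le_floor_of_lazyTime_lt {δ : ℝ≥0} {e : ℕ → ℝ≥0} {i r : ℕ}
    (h : lazyTime δ e i + r < lazyTime δ e (i + 1)) : r ≤ ⌊e i / δ⌋₊ := by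
  unfold lazyTime at h
  rw [Finset.sum_range_succ] at h
  omega

theorem tendsto_lazyTime (r : ℝ≥0) (e : ℕ → ℝ≥0) (i : ℕ) {ι : Type*} {l : Filter ι}
    {h : ι → ℝ≥0} (hh : Tendsto h l (𝓝[>] 0)) :
    Tendsto (fun k => h k * lazyTime (r * h k) e i) l (𝓝 (r⁻¹ * partialSum e i)) := by
  unfold lazyTime partialSum
  rw [Finset.mul_sum]
  simp only [Nat.cast_sum, Finset.mul_sum]
  refine tendsto_finsetSum _ fun l _ => ?_
  have := tendsto_floor_div_mul r (e l) 1 hh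
  simpa only [mul_comm (h _), inv_mul_eq_div] using this

variable {A B : Mat n} (hA : A.IsHermitian) (hB : B.IsHermitian) (C : Mat n)

include hA hB in
/-- Convergence of the counted chains to the counted limit process. -/
theorem skorokhodTendsto_chainPath (y : State n × ℕ) {ω : Noise} (hω : IsRegular A C y ω) {h :
    ℕ → ℝ≥0}
    (hh : Tendsto h atTop (𝓝[>] 0)) (h0 : ∀ k, 0 < h k) (hf : ∀ k, IsFine A B C (h k)) :
    SkorokhodTendsto (fun k => stepPath (h k) fun j => chainPath A B C (h k) y j ω)
      (limitPath A C y ω) := by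
  have hΛ := rateBound_pos C
  have hh0 : Tendsto h atTop (𝓝 0) := hh.mono_right nhdsWithin_le_nhds
  refine skorokhodTendsto_stepPath h0 hh0 (isClock_clickClock C ω.1)
    (K := fun k => lazyTime (rateBound C * h k) ω.1) (fun k => strictMono_lazyTime _ _) (fun k =>
      rfl) (fun i => ?_)
    (y := branch A C y ω) (continuous_branch A C y ω)
    (b := fun k i r => (noClick A B C (h k))^[r] (orbit (macroStep (rateBound C * h k)
      (noClick A B C (h k)) (choiceStep (clickProb A B C (h k)) (click A B C (h k))
        (noClick A B C (h k)))) i (y, ω))) (fun k i r hr => ?_) (fun i u => ?_)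
  · unfold clickClock
    rw [hω.1]
    exact tendsto_lazyTime _ ω.1 i hh
  · unfold chainPath chainStep
    rw [if_pos (hf k)]
    exact orbit_lazyStep (mul_pos hΛ (h0 k)) _ _ (y, ω) i (le_floor_of_lazyTime_lt hr)
  · have h1 : Tendsto (fun p : ℕ × ℕ => p.1) (stepFilter h u) atTop :=
      tendsto_comap.mono_left inf_le_left
    have h2 : Tendsto (fun p : ℕ × ℕ => (p.2 : ℝ≥0) * h p.1) (stepFilter h u) (𝓝 u) :=
      tendsto_comap.mono_left inf_le_right
    have h3 := tendsto_noClick_iterate hA hB C (hh.comp h1) h2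
      ((tendsto_mark hA hB C hh y ω hω.2.1 hω.2.2 i).comp h1)
    unfold branch
    rw [add_tsub_cancel_left]
    exact h3

theorem ae_continuousAt_limitPath (A C : Mat n) (y : State n × ℕ) (t : ℝ≥0) :
    ∀ᵐ ω ∂noise, ContinuousAt (limitPath A C y ω).1 t := by
  have h1 : ∀ᵐ ω : Noise ∂noise, ∀ i, partialSum ω.1 (i + 1) ≠ rateBound C * t :=
    ae_all_iff.2 fun i => Measure.quasiMeasurePreserving_fst.ae (ae_partialSum_ne i _)
  filter_upwards [ae_isRegular A C y, h1] with ω hω h2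
  refine (isClock_clickClock C ω.1).continuousAt (continuous_branch A C y ω) fun i hi => h2 i ?_
  rw [← hi, clickClock, hω.1, mul_inv_cancel_left₀ (rateBound_pos C).ne']

include hA hB in
theorem exists_fine_seq :
    ∃ h : ℕ → ℝ≥0, Tendsto h atTop (𝓝[>] 0) ∧ ∀ k, 0 < h k ∧ IsFine A B C (h k) := by
  obtain ⟨h, h1, h2⟩ := exists_seq_forall_of_frequently
    ((eventually_isFine hA hB C).and self_mem_nhdsWithin).frequently
  exact ⟨h, h1, fun k => ⟨(h2 k).2, (h2 k).1⟩⟩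

/-- The limit process on the states. -/
def statePath (A C : Mat n) (ρ : State n) (ω : Noise) : CadlagPath (State n) :=
  ⟨fun t => ((limitPath A C (ρ, 0) ω).1 t).1,
    (isClock_clickClock C ω.1).isCadlag (a := fun i t => (branch A C (ρ, 0) ω i t).1)
      fun i => continuous_fst.comp (continuous_branch A C (ρ, 0) ω i)⟩

theorem measurable_statePath (A C : Mat n) (ρ : State n) : Measurable (statePath A C ρ) :=
  Measurable.subtype_mk (measurable_pi_iff.2 fun t =>
    (((measurable_pi_apply t).comp measurable_subtype_coe).comp
      (measurable_limitPath A C (ρ, 0))).fst)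

include hA hB in
theorem skorokhodTendsto_statePath (ρ : State n) {ω : Noise} (hω : IsRegular A C (ρ, 0) ω) {h :
    ℕ → ℝ≥0}
    (hh : Tendsto h atTop (𝓝[>] 0)) (h0 : ∀ k, 0 < h k) (hf : ∀ k, IsFine A B C (h k)) :
    SkorokhodTendsto (fun k => stepPath (h k) fun j => (chainPath A B C (h k) (ρ, 0) j ω).1)
      (statePath A C ρ ω) :=
  (skorokhodTendsto_chainPath hA hB C (ρ, 0) hω hh h0 hf).comp uniformContinuous_fst
    (fun _ _ => rfl) fun _ => rfl

include hA in
theorem isMarkovLaw_statePath (ρ : State n) :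
    IsMarkovLaw (nnTime (countOp A C)) ρ (noise.map (statePath A C ρ)) := by
  obtain ⟨h, hh, h0⟩ := exists_fine_seq hA hA C
  have hF := isFellerSemigroup_countOp hA C
  refine isMarkovLaw_of_tendsto hF.nonneg hF.const_one (measurable_statePath A C ρ) (fun k =>
    (h0 k).1)
    (hh.mono_right nhdsWithin_le_nhds)
    (fun k => isChain_chainPath hA hA C (h0 k).1 (ρ, 0)) (fun t => ?_) fun m t f hm => ?_
  · filter_upwards [ae_isRegular A C (ρ, 0), ae_continuousAt_limitPath A C (ρ, 0) t] with ω h1 h2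
    exact (skorokhodTendsto_statePath hA hA C ρ h1 hh (fun k => (h0 k).1)
      fun k => (h0 k).2).tendsto_apply (continuousAt_fst.comp h2)
  · refine tendsto_transitionOp_pow hA hA C t.coe_nonneg hh ?_ f
    simpa using! (continuous_coe.tendsto t).comp hm

end LimitPath

section Laws

theorem measurable_stepPath {X : Type*} [TopologicalSpace X] [MeasurableSpace X] (h : ℝ≥0) :
    Measurable (stepPath (X := X) h) :=
  Measurable.subtype_mk (measurable_pi_iff.2 fun _ => measurable_pi_apply _)

theorem convergesInLaw_of_ae {Ω X : Type*} [MeasurableSpace Ω] {μ : Measure Ω}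
    [IsProbabilityMeasure μ] [UniformSpace X] [MeasurableSpace X] {Y : ℝ≥0 → Ω → CadlagPath X}
    (hY : ∀ h, 0 < h → Measurable (Y h)) {Q : ℝ≥0 → Measure (CadlagPath X)}
    (hQ : ∀ h, 0 < h → Q h = μ.map (Y h)) {Z : Ω → CadlagPath X} (hZ : Measurable Z) {p :
      ℝ≥0 → Prop}
    (hp : ∀ᶠ h in 𝓝[>] 0, p h) (h : ∀ u : ℕ → ℝ≥0, Tendsto u atTop (𝓝[>] 0) → (∀ k, 0 < u k) →
      (∀ k, p (u k)) → ∀ᵐ ω ∂μ, SkorokhodTendsto (fun k => Y (u k) ω) (Z ω)) :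
    ConvergesInLaw Q (μ.map Z) := by
  intro F hF
  refine tendsto_of_seq_tendsto fun u hu => ?_
  obtain ⟨N, hN⟩ := eventually_atTop.1 (hu.eventually (hp.and self_mem_nhdsWithin))
  rw [← tendsto_add_atTop_iff_nat N]
  have hu' := (tendsto_add_atTop_iff_nat N).2 hu
  obtain ⟨c, hc⟩ := hF.bounded
  have hm : ∀ {V : Ω → CadlagPath X}, Measurable V → ∫ x, F x ∂(μ.map V) = ∫ ω, F (V ω) ∂μ :=
    fun hV => integral_map hV.aemeasurable hF.measurable.aestronglyMeasurable
  have hu0 : ∀ k, 0 < u (k + N) := fun k => (hN _ (Nat.le_add_left N k)).2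
  simp only [Function.comp_def, hQ _ (hu0 _), hm (hY _ (hu0 _)), hm hZ]
  refine tendsto_integral_of_dominated_convergence (μ := μ) (fun _ => c)
    (fun k => (hF.measurable.comp (hY _ (hu0 k))).aestronglyMeasurable) (integrable_const
      (μ := μ) c)
    (fun k => Eventually.of_forall fun ω => hc _) ?_
  filter_upwards [h (fun k => u (k + N)) hu' hu0
    fun k => (hN _ (Nat.le_add_left N k)).1] with ω hω
  exact hF.continuous _ _ hω

variable {n : ℕ} [NeZero n]

variable {A B : Mat n} (hA : A.IsHermitian) (hB : B.IsHermitian) (C : Mat n)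

/-- The chains converge in law. -/
theorem exists_chainLaw :
    ∃ Q : ℝ≥0 → State n → Measure (ℕ → State n),
      (∀ h, 0 < h → ∀ ρ, IsChainLaw (transitionOp hA hB C h) ρ (Q h ρ)) ∧
      ∀ ρ, ConvergesInLaw (fun h => (Q h ρ).map (stepPath h))
        (noise.map (statePath A C ρ)) := by
  have hm : ∀ h, 0 < h → ∀ ρ, Measurable fun ω j => (chainPath A B C h (ρ, 0) j ω).1 :=
    fun h hh ρ => measurable_pi_iff.2 (isChain_chainPath hA hB C hh (ρ, 0)).measurable
  refine ⟨fun h ρ => noise.map fun ω j => (chainPath A B C h (ρ, 0) j ω).1, fun h hh ρ =>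
    (isChain_chainPath hA hB C hh (ρ, 0)).isChainLaw (μ := noise) (fun f hf =>
      transitionOp_nonneg hA hB C h hf)
      (transitionOp_one hA hB C h), fun ρ => ?_⟩
  refine convergesInLaw_of_ae (fun h hh => (measurable_stepPath h).comp (hm h hh ρ))
    (fun h hh => Measure.map_map (measurable_stepPath h) (hm h hh ρ))
    (measurable_statePath A C ρ) (eventually_isFine hA hB C) fun u hu h0 hf => ?_
  filter_upwards [ae_isRegular A C (ρ, 0)] with ω hω
  exact skorokhodTendsto_statePath hA hB C ρ hω hu h0 hf

end Laws

section ExpLimit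

variable {E : Type*} [NormedAddCommGroup E] [NormedSpace ℝ E] [CompleteSpace E]

theorem isC0Semigroup_expOp (L : E →L[ℝ] E) : IsC0Semigroup (expOp L) where
  zero := expOp_zero L
  add s t _ _ := by
    let _ : NormedAlgebra ℚ (E →L[ℝ] E) := NormedAlgebra.restrictScalars ℚ ℝ _
    unfold expOp
    rw [add_smul, NormedSpace.exp_add_of_commute (((Commute.refl L).smul_left s).smul_right t)]
  cont x := by
    have h : Continuous (expOp L) :=
      continuous_iff_continuousAt.2 fun s => (hasDerivAt_expOp L s).continuousAt
    fun_prop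

/-- Powers of contractions converge to the semigroup of the limit of their generators. -/
theorem tendsto_pow_expOp {L : E →L[ℝ] E} (hL : ∀ r, 0 ≤ r → ‖expOp L r‖ ≤ 1)
    {ι : Type*} {l : Filter ι} {V : ι → E →L[ℝ] E} (hV1 : ∀ i, ‖V i‖ ≤ 1) {h : ι → ℝ≥0}
    (hh : Tendsto h l (𝓝[>] 0)) (hV : Tendsto (fun i => (h i : ℝ)⁻¹ • (V i - 1)) l (𝓝 L))
    {m : ι → ℕ} {s : ℝ} (hm : Tendsto (fun i => (m i : ℝ) * h i) l (𝓝 s)) (f : E) :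
    Tendsto (fun i => (V i ^ m i) f) l (𝓝 (expOp L s f)) := by
  have hd : HasDerivAt (expOp L) L 0 := by
    simpa [expOp_zero] using hasDerivAt_expOp L 0
  have h1 := hV.sub (tendsto_slope_zero hd hh)
  simp only [expOp_zero, ← smul_sub, sub_sub_sub_cancel_right, sub_self] at h1
  have h2 := (hm.mul (h1.norm.mul_const ‖f‖))
  simp only [norm_zero, zero_mul, mul_zero] at h2
  have h3 : Tendsto (fun i => (V i ^ m i) f - expOp L (m i * h i) f) l (𝓝 0) := by
    refine squeeze_zero_norm' ?_ h2
    filter_upwards [hh.eventually self_mem_nhdsWithin] with i hi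
    have hi' : (0 : ℝ) < h i := by exact_mod_cast hi
    refine (norm_pow_sub_le (isC0Semigroup_expOp L) (h i).coe_nonneg
      (D := {g | ‖g‖ ≤ ‖f‖}) (b := ‖V i - expOp L (h i)‖ * ‖f‖) (fun g hg => ?_) (fun g hg => ?_)
      (m i) (fun j _ => hL _ (by positivity)) f (le_refl ‖f‖)).trans_eq ?_
    · exact ((V i).le_of_opNorm_le (hV1 i) g).trans (by simpa using hg)
    · exact ((V i - expOp L (h i)).le_opNorm g).trans
        (mul_le_mul_of_nonneg_left hg (norm_nonneg _))
    · rw [norm_smul, norm_inv, norm_of_nonneg hi'.le]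
      field_simp
  have h4 := h3.add ((((isC0Semigroup_expOp L).cont f).tendsto s).comp hm)
  simpa using h4

end ExpLimit

section Poisson

variable {n : ℕ} [NeZero n]

/-- The chain with exponential waiting times. -/
def poissonPath (A B C : Mat n) (τ : ℝ≥0) (hτ : 0 < τ) (ρ : State n) (ω : (ℕ → ℝ≥0) × Noise) :
    CadlagPath (State n) :=
  ⟨fun t => (chainPath A B C τ (ρ, 0) (idx (fun i => τ * cleanSum ω.1 i) t) ω.2).1,
    (isClock_mul hτ (isClock_cleanSum ω.1)).isCadlag
      (a := fun i _ => (chainPath A B C τ (ρ, 0) i ω.2).1) fun _ => continuous_const⟩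

variable {A B : Mat n} (hA : A.IsHermitian) (hB : B.IsHermitian) (C : Mat n)

include hA hB in
theorem measurable_poissonPath {τ : ℝ≥0} (hτ : 0 < τ) (ρ : State n) : Measurable
    (poissonPath A B C τ hτ ρ) := by
  refine Measurable.subtype_mk (measurable_pi_iff.2 fun t => ?_)
  refine measurable_apply_idx (Ω := (ℕ → ℝ≥0) × Noise)
    (a := fun i ω => (chainPath A B C τ (ρ, 0) i ω.2).1)
    (measurable_idx (s := fun (ω : (ℕ → ℝ≥0) × Noise) i => τ * cleanSum ω.1 i)
      (fun ω => isClock_mul hτ (isClock_cleanSum ω.1))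
      (fun i => ((measurable_cleanSum i).comp measurable_fst).const_mul τ) t) fun i => ?_
  exact ((isChain_chainPath hA hB C hτ (ρ, 0)).measurable i).comp measurable_snd

theorem orbit_macroStep_id {E Ω : Type*} (δ : ℝ≥0) (G : E × Ω → E × Ω) (i : ℕ)
    (p : E × ((ℕ → ℝ≥0) × Ω)) : orbit (macroStep δ id G) i p = orbit G i (p.1, p.2.2) := by
  induction i generalizing p with
  | zero => rfl
  | succ i ih =>
    have h := ih (macroStep δ id G p)
    unfold orbit at h ⊢
    rw [Function.iterate_succ_apply, Function.iterate_succ_apply, h]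
    simp only [macroStep, gapStep, liftStep, Function.iterate_id, id]

/-- The operator of the chain that moves only at the ends of exponential waiting times. -/
def lazyOp (τ δ : ℝ≥0) :
    (State n →ᵇ ℝ) →L[ℝ] (State n →ᵇ ℝ) :=
  exp (-δ) • 1 + (1 - exp (-δ)) • transitionOp hA hB C τ

theorem norm_lazyOp_le (τ δ : ℝ≥0) : ‖lazyOp hA hB C τ δ‖ ≤ 1 := by
  have hε : 0 ≤ 1 - exp (-(δ : ℝ)) := by simp
  refine ContinuousLinearMap.opNorm_le_bound _ zero_le_one fun f => ?_
  have h1 := (transitionOp hA hB C τ).le_of_opNorm_le (norm_transitionOp_le hA hB C τ) f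
  change ‖exp (-(δ : ℝ)) • f + (1 - exp (-(δ : ℝ))) • transitionOp hA hB C τ f‖ ≤ _
  refine (norm_add_le _ _).trans ?_
  rw [norm_smul, norm_smul, norm_of_nonneg (exp_pos _).le, norm_of_nonneg hε]
  nlinarith [mul_le_mul_of_nonneg_left h1 hε]

theorem lazyOp_nonneg (τ δ : ℝ≥0) {f : State n →ᵇ ℝ} (hf : 0 ≤ f) :
    0 ≤ lazyOp hA hB C τ δ f := fun x =>
  add_nonneg (mul_nonneg (exp_pos _).le (hf x))
    (mul_nonneg (by simp) (transitionOp_nonneg hA hB C τ hf x))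

theorem isChain_lazy {τ : ℝ≥0} (hτ : 0 < τ) (δ : ℝ≥0) (ρ : State n) :
    IsChain ((iid expo).prod noise) (lazyOp hA hB C τ δ) ρ
      fun j ω => (orbit (lazyStep δ id (chainStep A B C τ)) j ((ρ, 0), ω)).1 := by
  have hε : 0 ≤ 1 - exp (-(δ : ℝ)) := by simp
  refine ((isDriven_chainStep hA hB C hτ).lazy δ measurable_id).isChain measurable_fst
    (fun f hf => lazyOp_nonneg hA hB C τ δ hf) (fun f hf z => ?_) (ρ, 0)
  · have hm : Measurable fun z : State n × ℕ => ofReal (f z.1) :=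
      (f.continuous.measurable.comp measurable_fst).ennreal_ofReal
    have hf0 : ∀ ρ, 0 ≤ f ρ := hf
    have hU0 : 0 ≤ transitionOp hA hB C τ f z.1 := transitionOp_nonneg hA hB C τ hf z.1
    rw [lintegral_lazyKernel _ _ _ _ hm, lintegral_chainKernel hA hB C τ hf z, id,
      ← ofReal_mul hε, ← ofReal_mul (exp_pos _).le,
      ← ofReal_add (mul_nonneg hε hU0) (mul_nonneg (exp_pos _).le (hf0 _)), add_comm]
    rfl

theorem isMarkovLaw_poissonPath {τ : ℝ≥0} (hτ : 0 < τ) (ρ : State n) :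
    IsMarkovLaw (poissonSemigroup hA hB C τ) ρ
      (((iid expo).prod noise).map (poissonPath A B C τ hτ ρ)) := by
  obtain ⟨h, hh, h0⟩ := exists_fine_seq hA hB C
  have hh0 : Tendsto h atTop (𝓝 0) := hh.mono_right nhdsWithin_le_nhds
  have hδ : ∀ k, 0 < τ⁻¹ * h k := fun k => mul_pos (inv_pos.2 hτ) (h0 k).1
  have hU : ∀ (m : ℕ → ℕ) (t : ℝ≥0) (f : State n →ᵇ ℝ),
      Tendsto (fun k => (m k : ℝ≥0) * h k) atTop (𝓝 t) →
      Tendsto (fun k => (lazyOp hA hB C τ (τ⁻¹ * h k) ^ m k) f) atTop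
        (𝓝 (poissonSemigroup hA hB C τ t f)) := by
    intro m t f hm
    refine tendsto_pow_expOp (L := poissonGen hA hB C τ)
      (fun r hr => norm_expOp_poissonGen_le hA hB C τ hr)
      (fun k => norm_lazyOp_le hA hB C τ _) hh ?_
      (by simpa using! (continuous_coe.tendsto t).comp hm) f
    have h1 := (tendsto_one_sub_exp_div (r := τ⁻¹) hh).smul_const (transitionOp hA hB C τ - 1)
    rw [NNReal.coe_inv] at h1
    refine h1.congr fun k => ?_
    unfold lazyOp
    rw [div_eq_inv_mul, mul_smul]
    congr 1
    module
  have hU' : ∀ (t : ℝ≥0) (f : State n →ᵇ ℝ),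
      Tendsto (fun k => (lazyOp hA hB C τ (τ⁻¹ * h k) ^ ⌊t / h k⌋₊) f) atTop
        (𝓝 (poissonSemigroup hA hB C τ t f)) := fun t f => by
    exact hU _ t f (tendsto_floor_mul hh t)
  refine isMarkovLaw_of_tendsto (fun t f hf => ?_) (fun t => ?_)
    (measurable_poissonPath hA hB C hτ ρ) (fun k => (h0 k).1) hh0
    (fun k => isChain_lazy hA hB C hτ (τ⁻¹ * h k) ρ) (fun t => ?_) hU
  · refine ge_of_tendsto' (hU' t f) fun k => ?_
    induction ⌊t / h k⌋₊ with
    | zero => exact hf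
    | succ m ih =>
      rw [pow_succ', mul_apply_eq_comp]
      exact lazyOp_nonneg hA hB C τ _ ih
  · refine tendsto_nhds_unique (hU' t 1) ?_
    have h1 : ∀ k m, (lazyOp hA hB C τ (τ⁻¹ * h k) ^ m) 1 = 1 := by
      intro k m
      induction m with
      | zero => rfl
      | succ m ih =>
        have h2 : lazyOp hA hB C τ (τ⁻¹ * h k) 1 = 1 := by
          change exp _ • (1 : State n →ᵇ ℝ) + (1 - exp _) • transitionOp hA hB C τ 1 = 1
          rw [transitionOp_one, ← add_smul, add_sub_cancel, one_smul]
        rw [pow_succ, mul_apply_eq_comp, h2, ih]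
    simp only [h1]
    exact tendsto_const_nhds
  · have hc : ∀ᵐ c ∂(iid expo), cleanSum c = partialSum c ∧ ∀ i, partialSum c (i + 1) ≠ t / τ :=
      ae_cleanSum_eq.and (ae_all_iff.2 fun i => ae_partialSum_ne i _)
    filter_upwards [Measure.quasiMeasurePreserving_fst.ae hc] with ω hω
    have hcl := isClock_mul hτ (isClock_cleanSum ω.1)
    refine SkorokhodTendsto.tendsto_apply
      (x := fun k => stepPath (h k) fun j =>
        (orbit (lazyStep (τ⁻¹ * h k) id (chainStep A B C τ)) j ((ρ, 0), ω)).1)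
      (y := poissonPath A B C τ hτ ρ ω) ?_
      (hcl.continuousAt (a := fun i _ => (chainPath A B C τ (ρ, 0) i ω.2).1)
        (fun _ => continuous_const) fun i hi => hω.2 i ?_)
    · refine skorokhodTendsto_stepPath (fun k => (h0 k).1) hh0 hcl
        (K := fun k => lazyTime (τ⁻¹ * h k) ω.1) (fun k => strictMono_lazyTime _ _) (fun k => rfl)
        (fun i => ?_) (y := fun i _ => (chainPath A B C τ (ρ, 0) i ω.2).1)
        (fun _ => continuous_const) (b := fun k i r => (chainPath A B C τ (ρ, 0) i ω.2).1)
        (fun k i r hr => ?_) fun i u => tendsto_const_nhds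
      · have h1 := tendsto_lazyTime τ⁻¹ ω.1 i hh
        rw [inv_inv, ← hω.1] at h1
        exact h1
      · have h1 := orbit_lazyStep (hδ k) id (chainStep A B C τ) ((ρ, 0), ω) i
          (le_floor_of_lazyTime_lt hr)
        rw [Function.iterate_id, orbit_macroStep_id] at h1
        exact congrArg Prod.fst h1
    · rw [← hi, ← hω.1, mul_div_cancel_left₀ _ hτ.ne']

/-- The chains with exponential waiting times converge in law. -/
theorem exists_poissonLaw :
    ∃ Q : ℝ≥0 → State n → Measure (CadlagPath (State n)),
      (∀ τ, 0 < τ → ∀ ρ, IsMarkovLaw (poissonSemigroup hA hB C τ) ρ (Q τ ρ)) ∧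
      ∀ ρ, ConvergesInLaw (fun τ => Q τ ρ) (noise.map (statePath A C ρ)) := by
  classical
  let Y : ℝ≥0 → State n → (ℕ → ℝ≥0) × Noise → CadlagPath (State n) := fun τ ρ =>
    if hτ : 0 < τ then poissonPath A B C τ hτ ρ else fun ω => statePath A C ρ ω.2
  have hY : ∀ τ (hτ : 0 < τ) ρ, Y τ ρ = poissonPath A B C τ hτ ρ := fun τ hτ ρ => dif_pos hτ
  refine ⟨fun τ ρ => ((iid expo).prod noise).map (Y τ ρ), fun τ hτ ρ => ?_, fun ρ => ?_⟩
  · simp only [hY τ hτ]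
    exact isMarkovLaw_poissonPath hA hB C hτ ρ
  · have h1 : noise.map (statePath A C ρ)
        = ((iid expo).prod noise).map fun ω => statePath A C ρ ω.2 := by
      have h2 : ((iid expo).prod noise).map Prod.snd = noise := Measure.map_snd_prod.trans (by simp)
      conv_lhs => rw [← h2]
      exact Measure.map_map (measurable_statePath A C ρ) measurable_snd
    rw [h1]
    refine convergesInLaw_of_ae
      (fun τ hτ => (hY τ hτ ρ).symm ▸ measurable_poissonPath hA hB C hτ ρ) (fun _ _ => rfl)
      ((measurable_statePath A C ρ).comp measurable_snd) (eventually_isFine hA hB C)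
      fun u hu h0 hf => ?_
    filter_upwards [Measure.quasiMeasurePreserving_snd.ae (ae_isRegular A C (ρ, 0))] with ω hω
    simp only [hY _ (h0 _)]
    exact (skorokhodTendsto_statePath hA hB C ρ hω hu h0 hf).comp_clock h0
      (hu.mono_right nhdsWithin_le_nhds) (isClock_cleanSum ω.1) (tendsto_cleanSum_div ω.1)

end Poisson

/-! ### The Belavkin equation -/

section Flow

variable {n : ℕ} [NeZero n]

variable {A : Mat n} (hA : A.IsHermitian) (C : Mat n)

include hA in
theorem hasDerivAt_conjState_flowMat (ρ : State n)
    (t : ℝ) : HasDerivAt (fun t : ℝ => (conjState (flowMat A C t) ρ).mat)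
      (drift A C (conjState (flowMat A C t) ρ)) t := by
  have key : ∀ ρ : State n, HasDerivAt (fun t : ℝ => (conjState (flowMat A C t) ρ).mat)
      (drift A C ρ) 0 := by
    intro ρ
    have h1 := hasDerivAt_flowMat_conj A C ρ.mat
    rw [trace_effGen A hA C ρ] at h1
    have h0 : flowMat A C 0 * ρ.mat * (flowMat A C 0)ᴴ = ρ.mat := by
      simp [flowMat_zero]
    have h3 : traceL n (drift A C ρ - jumpRate C ρ • ρ.mat) = -jumpRate C ρ := by
      rw [map_sub, map_smul, traceL_apply, traceL_apply, (drift_mem hA C ρ).2, ρ.trace_re]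
      simp
    have h2 := ((traceL n).hasFDerivAt.comp_hasDerivAt (0 : ℝ) h1).congr_deriv h3
    have h4 : (traceL n ∘ fun t => flowMat A C t * ρ.mat * (flowMat A C t)ᴴ) 0 = 1 := by
      rw [Function.comp_apply, h0, traceL_apply, ρ.trace_re]
    have h5 := (h2.inv (by rw [h4]; exact one_ne_zero)).smul h1
    refine (h5.congr_deriv ?_).congr_of_eventuallyEq (Eventually.of_forall fun s => ?_)
    · rw [Pi.inv_apply, h4, h0]
      simp
    · exact conjState_mat (trace_conj_flowMat_pos A C s ρ)
  have h1 := key (conjState (flowMat A C t) ρ)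
  rw [← sub_self t] at h1
  refine (h1.comp_sub_const t t).congr_of_eventuallyEq (Eventually.of_forall fun s => ?_)
  have h2 : flowMat A C (s - t) * flowMat A C t = flowMat A C s := by
    rw [← flowMat_add, sub_add_cancel]
  have h3 : 0 < ((flowMat A C (s - t) * flowMat A C t) * ρ.mat
      * (flowMat A C (s - t) * flowMat A C t)ᴴ).trace.re := by
    rw [h2]
    exact trace_conj_flowMat_pos A C s ρ
  dsimp only
  rw [conjState_conjState h3, h2]

theorem continuous_conjState_flowMat (A C : Mat n) (ρ : State n) :
    Continuous fun t : ℝ => conjState (flowMat A C t) ρ :=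
  continuous_iff_continuousAt.2 fun t => tendsto_conjState (x := fun _ => ρ)
    ((continuous_flowMat A C).tendsto t) tendsto_const_nhds (trace_conj_flowMat_pos A C t ρ)

/-- Integrability with respect to the topology of the norm. -/
def NormIntegrable {E : Type*} [NormedAddCommGroup E] (f : ℝ → E) (a b : ℝ) : Prop :=
  IntervalIntegrable f volume a b

include hA in
/-- The flow integrates the drift. -/
theorem integral_drift_flowState (ρ : State n)
    {a t : ℝ≥0} (hat : a ≤ t) {f : ℝ≥0 → State n}
    (hf : ∀ s, a < s → s < t → f s = flowState A C (s - a) ρ) :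
    NormIntegrable (fun s : ℝ => drift A C (f s.toNNReal)) a t ∧
      ∫ s in (a : ℝ)..t, drift A C (f s.toNNReal) = (flowState A C (t - a) ρ).mat - ρ.mat := by
  have h1 : ∀ s ∈ Ioo (a : ℝ) t,
      drift A C (f s.toNNReal) = drift A C (conjState (flowMat A C (s - a)) ρ) := by
    intro s hs
    have hs0 : 0 ≤ s := a.coe_nonneg.trans hs.1.le
    lift s to ℝ≥0 using hs0
    have h2 : a < s := NNReal.coe_lt_coe.1 hs.1
    rw [Real.toNNReal_coe, hf s h2 (NNReal.coe_lt_coe.1 hs.2), flowState, NNReal.coe_sub h2.le]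
  have h3 : Continuous fun s : ℝ => drift A C (conjState (flowMat A C (s - a)) ρ) :=
    (continuous_drift A C).comp ((continuous_conjState_flowMat A C ρ).comp (continuous_sub_right _))
  have hat' : (a : ℝ) ≤ t := hat
  refine ⟨(intervalIntegrable_congr_uIoo (by rwa [uIoo_of_le hat'])).2
    (h3.intervalIntegrable _ _), ?_⟩
  rw [intervalIntegral.integral_congr_Ioo_of_le hat' h1,
    intervalIntegral.integral_eq_sub_of_hasDerivAt (f := fun s : ℝ =>
      (conjState (flowMat A C (s - a)) ρ).mat)
      (fun s _ => (hasDerivAt_conjState_flowMat hA C ρ (s - a)).comp_sub_const s a)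
      (h3.intervalIntegrable _ _), flowState, NNReal.coe_sub hat]
  congr 1
  have := flowState_zero A C ρ
  rw [flowState, NNReal.coe_zero] at this
  rw [sub_self, this]

end Flow

section Paths

variable {n : ℕ} [NeZero n]

/-- The number of clicks. -/
def clickCount (A C : Mat n) (ρ : State n) (t : ℝ≥0) (ω : Noise) : ℕ :=
  ((limitPath A C (ρ, 0) ω).1 t).2

theorem mark_snd_succ (A C : Mat n) (y : State n × ℕ) (i : ℕ) (ω : Noise) :
    (mark A C y i ω).2 ≤ (mark A C y (i + 1) ω).2 ∧
      (mark A C y (i + 1) ω).2 ≤ (mark A C y i ω).2 + 1 := by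
  rw [mark_succ]
  split_ifs <;> simp [preMark]

theorem monotone_mark_snd (A C : Mat n) (y : State n × ℕ) (ω : Noise) :
    Monotone fun i => (mark A C y i ω).2 :=
  monotone_nat_of_le_succ fun i => (mark_snd_succ A C y i ω).1

theorem neBot_nhdsLT {t : ℝ≥0} (ht : 0 < t) : (𝓝[<] t).NeBot := nhdsLT_neBot_of_exists_lt ⟨0, ht⟩

theorem leftLim_clickCount (A C : Mat n) (ρ : State n) (ω : Noise) {i : ℕ} {t : ℝ≥0}
    (h1 : clickClock C ω.1 i < t) (h2 : t ≤ clickClock C ω.1 (i + 1)) :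
    Function.leftLim (fun u => clickCount A C ρ u ω) t = (mark A C (ρ, 0) i ω).2 :=
  have := neBot_nhdsLT (zero_le.trans_lt h1)
  leftLim_eq_of_tendsto ((isClock_clickClock C ω.1).tendsto_left
    (a := fun i _ => (mark A C (ρ, 0) i ω).2) (fun _ => continuous_const) h1 h2)

theorem leftLim_statePath (A C : Mat n) (ρ : State n) (ω : Noise) {i : ℕ} {t : ℝ≥0}
    (h1 : clickClock C ω.1 i < t) (h2 : t ≤ clickClock C ω.1 (i + 1)) :
    Function.leftLim (statePath A C ρ ω).1 t = (branch A C (ρ, 0) ω i t).1 :=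
  have := neBot_nhdsLT (zero_le.trans_lt h1)
  leftLim_eq_of_tendsto ((isClock_clickClock C ω.1).tendsto_left
    (a := fun i t => (branch A C (ρ, 0) ω i t).1)
    (fun i => continuous_fst.comp (continuous_branch A C (ρ, 0) ω i)) h1 h2)

theorem leftLim_zero {X : Type*} [TopologicalSpace X] (f : ℝ≥0 → X) : Function.leftLim f 0 = f 0 :=
  leftLim_eq_of_eq_bot f (by
    rw [show Iio (0 : ℝ≥0) = ∅ from Iio_bot, nhdsWithin_empty])

theorem isCountingPath_clickCount (A C : Mat n) (ρ : State n) (ω : Noise) :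
    IsCountingPath fun t => clickCount A C ρ t ω where
  zero := by
    have h : idx (clickClock C ω.1) 0 = 0 :=
      (isClock_clickClock C ω.1).idx_eq (isClock_clickClock C ω.1).zero.le
        (zero_le.trans_lt ((isClock_clickClock C ω.1).strictMono zero_lt_one))
    change (mark A C (ρ, 0) (idx (clickClock C ω.1) 0) ω).2 = 0
    rw [h]
    rfl
  mono s t hst := monotone_mark_snd A C (ρ, 0) ω ((isClock_clickClock C ω.1).idx_mono hst)
  right_cont t := continuous_snd.continuousAt.comp_continuousWithinAt
    ((limitPath A C (ρ, 0) ω).2.1 t)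
  unit_jump t := by
    rcases eq_zero_or_pos t with rfl | ht
    · rw [leftLim_zero]
      exact Nat.le_succ _
    · obtain ⟨i, h1, h2⟩ := (isClock_clickClock C ω.1).exists_lt_le ht
      rw [leftLim_clickCount A C ρ ω h1 h2]
      refine le_trans (monotone_mark_snd A C (ρ, 0) ω ?_) (mark_snd_succ A C (ρ, 0) i ω).2
      rw [← (isClock_clickClock C ω.1).strictMono.le_iff_le]
      exact ((isClock_clickClock C ω.1).idx_le t).trans h2

theorem branch_clickClock_succ (A C : Mat n) (y : State n × ℕ) {ω : Noise}
    (hω : cleanSum ω.1 = partialSum ω.1) (i : ℕ) :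
    branch A C y ω i (clickClock C ω.1 (i + 1)) = preMark A C y i ω := by
  unfold branch preMark clickClock
  rw [hω, partialSum, Finset.sum_range_succ, mul_add]
  change (flowState A C ((rateBound C)⁻¹ * partialSum ω.1 i + _ - _) _, _) = _
  rw [add_tsub_cancel_left, inv_mul_eq_div]

variable {A : Mat n} (hA : A.IsHermitian) (C : Mat n)

include hA in
theorem integral_drift_statePath (ρ : State n)
    {ω : Noise} (hω : cleanSum ω.1 = partialSum ω.1) (i : ℕ) (t : ℝ≥0)
    (h1 : clickClock C ω.1 i ≤ t) (h2 : t ≤ clickClock C ω.1 (i + 1)) :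
    NormIntegrable (fun s : ℝ => drift A C ((statePath A C ρ ω).1 s.toNNReal)) 0 t ∧
    (branch A C (ρ, 0) ω i t).1.mat = ρ.mat
      + (∫ s in (0 : ℝ)..t, drift A C ((statePath A C ρ ω).1 s.toNNReal))
      + ∑ l ∈ Finset.range i,
        ((mark A C (ρ, 0) (l + 1) ω).1.mat - (preMark A C (ρ, 0) l ω).1.mat) := by
  have hcl := isClock_clickClock C ω.1
  have hstep : ∀ i t, clickClock C ω.1 i ≤ t → t ≤ clickClock C ω.1 (i + 1) →
      NormIntegrable (fun s : ℝ => drift A C ((statePath A C ρ ω).1 s.toNNReal))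
        (clickClock C ω.1 i) t ∧
      ∫ s in (clickClock C ω.1 i : ℝ)..t, drift A C ((statePath A C ρ ω).1 s.toNNReal)
        = (branch A C (ρ, 0) ω i t).1.mat - (mark A C (ρ, 0) i ω).1.mat := by
    intro i t h1 h2
    refine integral_drift_flowState hA C _ h1 fun s h3 h4 => ?_
    change (branch A C (ρ, 0) ω (idx (clickClock C ω.1) s) s).1 = _
    rw [hcl.idx_eq h3.le (h4.trans_le h2)]
    rfl
  induction i generalizing t with
  | zero =>
    have h3 := hstep 0 t h1 h2
    rw [hcl.zero, NNReal.coe_zero] at h3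
    refine ⟨h3.1, ?_⟩
    rw [h3.2, Finset.sum_range_zero, add_zero]
    change _ = ρ.mat + (_ - ρ.mat)
    abel
  | succ i ih =>
    have h3 := ih _ (hcl.strictMono i.lt_succ_self).le le_rfl
    have h4 := hstep (i + 1) t h1 h2
    refine ⟨IntervalIntegrable.trans h3.1 h4.1, ?_⟩
    rw [← intervalIntegral.integral_add_adjacent_intervals h3.1 h4.1, h4.2,
      Finset.sum_range_succ]
    have h5 := h3.2
    rw [branch_clickClock_succ A C _ hω] at h5
    rw [h5]
    abel

/-- The sum over the jumps. -/
theorem finsum_jumpTimes (A C : Mat n) (ρ : State n) {ω : Noise} (hω : IsRegular A C (ρ, 0) ω)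
    (t : ℝ≥0) :
    ∑ᶠ s ∈ jumpTimes (fun u => clickCount A C ρ u ω) t,
        ((jumpState C (Function.leftLim (statePath A C ρ ω).1 s)).mat
          - (Function.leftLim (statePath A C ρ ω).1 s).mat)
      = ∑ l ∈ Finset.range (idx (clickClock C ω.1) t),
        ((mark A C (ρ, 0) (l + 1) ω).1.mat - (preMark A C (ρ, 0) l ω).1.mat) := by
  classical
  have hcl := isClock_clickClock C ω.1
  let p : ℕ → Prop := fun l => (mark A C (ρ, 0) l ω).2 ≠ (mark A C (ρ, 0) (l + 1) ω).2
  have hN : ∀ l, clickCount A C ρ (clickClock C ω.1 (l + 1)) ω = (mark A C (ρ, 0) (l + 1) ω).2 := by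
    intro l
    change (mark A C (ρ, 0) (idx (clickClock C ω.1) _) ω).2 = _
    rw [hcl.idx_eq le_rfl (hcl.strictMono (l + 1).lt_succ_self)]
  have hleft : ∀ l, Function.leftLim (fun u => clickCount A C ρ u ω) (clickClock C ω.1 (l + 1))
      = (mark A C (ρ, 0) l ω).2 := fun l =>
    leftLim_clickCount A C ρ ω (hcl.strictMono l.lt_succ_self) le_rfl
  have hset : jumpTimes (fun u => clickCount A C ρ u ω) t
      = (((Finset.range (idx (clickClock C ω.1) t)).filter p).image
          fun l => clickClock C ω.1 (l + 1) : Finset ℝ≥0) := by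
    ext s
    simp only [jumpTimes, mem_ofPred_eq, Finset.coe_image, mem_image, Finset.mem_coe,
      Finset.mem_filter, Finset.mem_range]
    constructor
    · rintro ⟨hs, hne⟩
      rcases eq_zero_or_pos s with rfl | hs0
      · exact absurd (leftLim_zero _) hne
      · obtain ⟨i, h1, h2⟩ := hcl.exists_lt_le hs0
        rw [leftLim_clickCount A C ρ ω h1 h2] at hne
        rcases h2.lt_or_eq with h3 | rfl
        · refine absurd ?_ hne
          change _ = (mark A C (ρ, 0) (idx (clickClock C ω.1) s) ω).2
          rw [hcl.idx_eq h1.le h3]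
        · exact ⟨i, ⟨Nat.lt_of_succ_le (hcl.le_iff.1 hs), by rwa [hN] at hne⟩, rfl⟩
    · rintro ⟨l, ⟨hl, hp⟩, rfl⟩
      exact ⟨hcl.le_iff.2 hl, by rw [hleft, hN]; exact hp⟩
  rw [hset, finsum_mem_coe_finset, Finset.sum_image fun l _ l' _ h => by
    simpa using hcl.strictMono.injective h, Finset.sum_filter]
  refine Finset.sum_congr rfl fun l _ => ?_
  rw [leftLim_statePath A C ρ ω (hcl.strictMono l.lt_succ_self) le_rfl,
    branch_clickClock_succ A C _ hω.1]
  by_cases hc : ω.2 l < jumpRate C (preMark A C (ρ, 0) l ω).1 / rateBound C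
  · rw [if_pos, mark_succ, if_pos hc]
    rw [mark_succ, if_pos hc]
    exact (Nat.lt_succ_self _).ne
  · rw [if_neg, mark_succ, if_neg hc, sub_self]
    change ¬ (_ ≠ _)
    rw [mark_succ, if_neg hc]
    exact fun h => h rfl

include hA in
theorem belavkin_equation (ρ : State n)
    {ω : Noise} (hω : IsRegular A C (ρ, 0) ω) (t : ℝ≥0) :
    ((statePath A C ρ ω).1 t).mat = ρ.mat
      + (∫ s in (0 : ℝ)..t, drift A C ((statePath A C ρ ω).1 s.toNNReal))
      + ∑ᶠ s ∈ jumpTimes (fun u => clickCount A C ρ u ω) t,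
        ((jumpState C (Function.leftLim (statePath A C ρ ω).1 s)).mat
          - (Function.leftLim (statePath A C ρ ω).1 s).mat) := by
  rw [finsum_jumpTimes A C ρ hω]
  exact (integral_drift_statePath hA C ρ hω.1 _ t ((isClock_clickClock C ω.1).idx_le t)
    ((isClock_clickClock C ω.1).lt_idx_succ t).le).2

end Paths

section Riemann

theorem integral_step (g : ℕ → ℝ) {h : ℝ≥0} (hh : 0 < h) {c : ℝ} (hg : ∀ j, |g j| ≤ c) (m : ℕ) :
    (∀ a b : ℝ, IntervalIntegrable (fun s : ℝ => g ⌊s.toNNReal / h⌋₊) volume a b) ∧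
    ∫ s in (0 : ℝ)..(m * h : ℝ≥0), g ⌊s.toNNReal / h⌋₊ = h * ∑ j ∈ Finset.range m, g j := by
  have hm : Measurable fun s : ℝ => g ⌊s.toNNReal / h⌋₊ :=
    (measurable_from_nat (f := g)).comp
      (Nat.measurable_floor.comp (measurable_real_toNNReal.div_const h))
  have hi : ∀ a b : ℝ, IntervalIntegrable (fun s : ℝ => g ⌊s.toNNReal / h⌋₊) volume a b :=
    fun a b => (intervalIntegrable_const (c := c)).mono_fun' hm.aestronglyMeasurable
      (Eventually.of_forall fun s => hg _)
  refine ⟨hi, ?_⟩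
  induction m with
  | zero => simp
  | succ m ih =>
    rw [← intervalIntegral.integral_add_adjacent_intervals (hi 0 (m * h : ℝ≥0)) (hi _ _), ih,
      Finset.sum_range_succ, mul_add]
    congr 1
    have h1 : ((m * h : ℝ≥0) : ℝ) ≤ ((m + 1 : ℕ) * h : ℝ≥0) := by
      push_cast
      nlinarith [h.coe_nonneg]
    rw [intervalIntegral.integral_congr_Ioo_of_le (g := fun _ => g m) h1 fun s hs => ?_]
    · rw [intervalIntegral.integral_const, smul_eq_mul]
      push_cast
      ring
    · have hs0 : 0 ≤ s := (NNReal.coe_nonneg _).trans hs.1.le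
      lift s to ℝ≥0 using hs0
      have h2 : ⌊s / h⌋₊ = m := by
        rw [Nat.floor_eq_iff zero_le, le_div_iff₀ hh, div_lt_iff₀ hh]
        exact ⟨NNReal.coe_le_coe.1 hs.1.le, by exact_mod_cast hs.2⟩
      simp only [Real.toNNReal_coe, h2]

theorem tendsto_riemann {f : ℝ≥0 → ℝ} {g : ℕ → ℕ → ℝ} {h : ℕ → ℝ≥0} (hh : ∀ k, 0 < h k)
    {M : ℕ → ℕ} {c : ℝ} {t : ℝ≥0}
    (hM : Tendsto (fun k => (M k : ℝ≥0) * h k) atTop (𝓝 t)) (hg : ∀ k j, |g k j| ≤ c)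
    {S : Set ℝ≥0} (hS : S.Countable)
    (hlim : ∀ u ∉ S, u < t → Tendsto (fun k => g k ⌊u / h k⌋₊) atTop (𝓝 (f u))) :
    Tendsto (fun k => (h k : ℝ) * ∑ j ∈ Finset.range (M k), g k j) atTop
      (𝓝 (∫ s in (0 : ℝ)..t, f s.toNNReal)) := by
  have hst := fun k => integral_step (g k) (hh k) (hg k) (M k)
  have h1 : Tendsto (fun k => ∫ s in (0 : ℝ)..t, g k ⌊s.toNNReal / h k⌋₊) atTop
      (𝓝 (∫ s in (0 : ℝ)..t, f s.toNNReal)) := by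
    refine intervalIntegral.tendsto_integral_filter_of_dominated_convergence (fun _ => c)
      (Eventually.of_forall fun k => ((hst k).1 0 t).aestronglyMeasurable_restrict_uIoc)
      (Eventually.of_forall fun k => Eventually.of_forall fun s _ => hg k _)
      intervalIntegrable_const ?_
    filter_upwards [((hS.insert t).image ((↑) : ℝ≥0 → ℝ)).ae_notMem volume] with s hs hs'
    rw [uIoc_of_le t.coe_nonneg] at hs'
    have hs0 : 0 ≤ s := hs'.1.le
    lift s to ℝ≥0 using hs0
    rw [Real.toNNReal_coe]
    have h2 : s ∉ insert t S := fun h => hs (mem_image_of_mem _ h)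
    rw [mem_insert_iff, not_or] at h2
    exact hlim s h2.2 (lt_of_le_of_ne (NNReal.coe_le_coe.1 hs'.2) h2.1)
  have h2 : Tendsto (fun k => ∫ s in ((M k * h k : ℝ≥0) : ℝ)..t, g k ⌊s.toNNReal / h k⌋₊) atTop
      (𝓝 0) := by
    have h3 : Tendsto (fun k => c * |(t : ℝ) - (M k * h k : ℝ≥0)|) atTop (𝓝 0) := by
      have := (((continuous_coe.tendsto t).comp hM).const_sub (t : ℝ)).abs.const_mul c
      simpa using! this
    exact squeeze_zero_norm
      (fun k => intervalIntegral.norm_integral_le_of_norm_le_const fun s _ => hg k _) h3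
  have h3 := h1.sub h2
  rw [sub_zero] at h3
  refine h3.congr fun k => ?_
  rw [← (hst k).2, ← intervalIntegral.integral_add_adjacent_intervals ((hst k).1 0 (M k * h k :
    ℝ≥0))
    ((hst k).1 _ _), add_sub_cancel_right]

end Riemann

section Compensator

variable {n : ℕ} [NeZero n]

variable {A B : Mat n} (hA : A.IsHermitian) (hB : B.IsHermitian) (C : Mat n)

include hA hB in
/-- The expected number of clicks of the chain. -/
theorem lintegral_clicks {h : ℝ≥0} (hh : 0 < h) (y : State n × ℕ) (K l : ℕ) {Φ :
    (ℕ → State n × ℕ) → ENNReal}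
    (hΦ : Measurable Φ) :
    ∫⁻ ω, Φ (fun j => chainPath A B C h y (min j K) ω)
        * ofReal (chainPath A B C h y (K + l) ω).2 ∂noise
      = ∫⁻ ω, Φ (fun j => chainPath A B C h y (min j K) ω)
        * ofReal ((chainPath A B C h y K ω).2
          + ∑ j ∈ Finset.range l, outcomeProb A B C h 1 (chainPath A B C h y
            (K + j) ω).1) ∂noise := by
  have hG := isDriven_chainStep hA hB C hh
  have hx : ∀ j, Measurable (chainPath A B C h y j) := fun j =>
    (hG.measurable_orbit j).comp (by fun_prop)
  have hp : Measurable (outcomeProb A B C h 1) :=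
    (Complex.continuous_re.comp (continuous_outcome A B C h 1).matrix_trace).measurable
  have hp0 := outcomeProb_nonneg hA hB C h 1
  have hΦm : Measurable fun ω => Φ fun j => chainPath A B C h y (min j K) ω :=
    hΦ.comp (measurable_pi_iff.2 fun j => hx _)
  have hn : Measurable fun z : State n × ℕ => ofReal (z.2 : ℝ) :=
    (measurable_from_nat.comp measurable_snd).ennreal_ofReal
  induction l with
  | zero => simp
  | succ l ih =>
    have h1 := hG.lintegral_stopped (K + l) y (Φ := fun q => Φ fun j => q (min j K))
      (hΦ.comp (measurable_pi_iff.2 fun j => measurable_pi_apply _))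
      (H := fun p => ofReal (chainStep A B C h p).1.2)
      (hn.comp hG.measurable.fst)
    have h2 : ∀ z : State n × ℕ, ∫⁻ ω', ofReal (chainStep A B C h (z, ω')).1.2 ∂noise
        = ofReal z.2 + ofReal (outcomeProb A B C h 1 z.1) := by
      intro z
      have h3 := hG.lintegral z (fun p => ofReal p.1.2) (hn.comp measurable_fst)
      rw [h3]
      simp only [lintegral_const, measure_univ, mul_one]
      rw [chainKernel, lintegral_choiceKernel _ _ _ _ hn, ← ofReal_mul (hp0 _),
        ← ofReal_mul (sub_nonneg.2 (outcomeProb_le_one hA hB C h _)),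
        ← ofReal_add (mul_nonneg (hp0 _) (Nat.cast_nonneg _))
          (mul_nonneg (sub_nonneg.2 (outcomeProb_le_one hA hB C h _)) (Nat.cast_nonneg _)),
        ← ofReal_add (Nat.cast_nonneg _) (hp0 _)]
      congr 1
      simp only [click, noClick]
      push_cast
      ring
    have h3 : ∀ j, min (min j K) (K + l) = min j K := fun j => by omega
    simp only [h2, h3] at h1
    have h4 : ∀ ω, (chainPath A B C h y (K + (l + 1)) ω)
        = (chainStep A B C h ((chainStep A B C h)^[K + l] (y, ω))).1 := fun ω => by
      rw [chainPath, orbit, ← add_assoc, Function.iterate_succ_apply']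
    simp only [h4]
    refine h1.trans ?_
    simp only [mul_add]
    have h5 : ∀ ω, ofReal ((chainPath A B C h y K ω).2 + ∑ j ∈ Finset.range (l + 1),
          outcomeProb A B C h 1 (chainPath A B C h y (K + j) ω).1)
        = ofReal ((chainPath A B C h y K ω).2 + ∑ j ∈ Finset.range l,
          outcomeProb A B C h 1 (chainPath A B C h y (K + j) ω).1)
          + ofReal (outcomeProb A B C h 1 (chainPath A B C h y (K + l) ω).1) := fun ω => by
      rw [Finset.sum_range_succ, ← add_assoc, ofReal_add
        (add_nonneg (Nat.cast_nonneg _) (Finset.sum_nonneg fun j _ => hp0 _)) (hp0 _)]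
    simp only [h5, mul_add]
    have h6 : Measurable fun ω => Φ (fun j => chainPath A B C h y (min j K) ω)
        * ofReal (outcomeProb A B C h 1 (chainPath A B C h y (K + l) ω).1) :=
      hΦm.mul (hp.comp (hx _).fst).ennreal_ofReal
    rw [lintegral_add_right _ h6, ← ih, ← lintegral_add_right _ h6]
    rfl

theorem snd_noClick_iterate (A B C : Mat n) (h : ℝ≥0) (m : ℕ) (z : State n × ℕ) :
    ((noClick A B C h)^[m] z).2 = z.2 := by
  induction m with
  | zero => rfl
  | succ m ih =>
    rw [Function.iterate_succ_apply']
    exact ih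

/-- The chain has at most one click for each potential click. -/
theorem chainPath_snd_le (A B C : Mat n) {h : ℝ≥0} (hh : 0 < h) (hf : IsFine A B C h)
    (ρ : State n) {ω : Noise} (hω : cleanSum ω.1 = partialSum ω.1) (t : ℝ≥0) :
    (chainPath A B C h (ρ, 0) ⌊t / h⌋₊ ω).2 ≤ idx (clickClock C ω.1) t := by
  have hΛ := rateBound_pos C
  have hcl := isClock_natCast (strictMono_lazyTime (rateBound C * h) ω.1) rfl
  set j := ⌊t / h⌋₊
  set i := idx (fun i => (lazyTime (rateBound C * h) ω.1 i : ℝ≥0)) j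
  have h1 : lazyTime (rateBound C * h) ω.1 i ≤ j := by exact_mod_cast hcl.idx_le j
  have h2 : j < lazyTime (rateBound C * h) ω.1 (i + 1) := by exact_mod_cast hcl.lt_idx_succ j
  have h3 : i ≤ idx (clickClock C ω.1) t := by
    rw [← (isClock_clickClock C ω.1).le_iff, clickClock, hω, inv_mul_le_iff₀ hΛ]
    have h4 : partialSum ω.1 i ≤ rateBound C * h * lazyTime (rateBound C * h) ω.1 i := by
      unfold partialSum lazyTime
      rw [Nat.cast_sum, Finset.mul_sum]
      refine Finset.sum_le_sum fun l _ => ?_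
      push_cast
      exact (div_le_iff₀' (mul_pos hΛ hh)).1 (Nat.lt_floor_add_one _).le
    refine h4.trans ?_
    rw [mul_assoc]
    gcongr
    refine (mul_le_mul_of_nonneg_left (Nat.cast_le.2 h1) zero_le).trans ?_
    exact (le_div_iff₀' hh).1 (Nat.floor_le zero_le)
  refine le_trans ?_ h3
  obtain ⟨r, hr⟩ := Nat.exists_eq_add_of_le h1
  unfold chainPath chainStep
  rw [if_pos hf, hr, orbit_lazyStep (mul_pos hΛ hh) _ _ ((ρ, 0), ω) i
    (le_floor_of_lazyTime_lt (hr ▸ h2)), snd_noClick_iterate]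
  generalize i = i
  induction i with
  | zero => exact le_rfl
  | succ i ih =>
    rw [orbit_gapStep_choice]
    split_ifs
    · exact Nat.succ_le_succ ((snd_noClick_iterate _ _ _ _ _ _).trans_le ih)
    · refine (snd_noClick_iterate A B C h 1 _).trans_le ?_
      exact ((snd_noClick_iterate _ _ _ _ _ _).trans_le ih).trans i.le_succ

theorem lintegral_idx_clickClock_ne_top (C : Mat n) (t : ℝ≥0) :
    ∫⁻ ω : Noise, ofReal (idx (clickClock C ω.1) t) ∂noise ≠ ⊤ := by
  have h1 : ∀ e : ℕ → ℝ≥0, cleanSum e = partialSum e → ofReal (idx (clickClock C e) t)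
      ≤ ofReal (exp (rateBound C * t))
        * ∑' i, ofReal (exp (-(partialSum e i : ℝ))) := by
    intro e he
    rw [ENNReal.ofReal_natCast]
    calc (idx (clickClock C e) t : ENNReal)
        = ∑ i ∈ Finset.range (idx (clickClock C e) t), 1 := by simp
      _ ≤ ∑ i ∈ Finset.range (idx (clickClock C e) t),
          ofReal (exp (rateBound C * t))
            * ofReal (exp (-(partialSum e i : ℝ))) := by
        refine Finset.sum_le_sum fun i hi => ?_
        have h2 := (isClock_clickClock C e).le_iff.2 (Finset.mem_range.1 hi).le
        rw [clickClock, he, inv_mul_le_iff₀ (rateBound_pos C)] at h2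
        have h3 : (partialSum e i : ℝ) ≤ rateBound C * t := by exact_mod_cast h2
        rw [← ofReal_mul (exp_pos _).le, ← exp_add, ENNReal.one_le_ofReal]
        exact Real.one_le_exp (by linarith)
      _ ≤ _ := by
        rw [← Finset.mul_sum]
        gcongr
        exact ENNReal.sum_le_tsum _
  have h2 : ∫⁻ e, ofReal (exp (rateBound C * t))
        * ∑' i, ofReal (exp (-(partialSum e i : ℝ))) ∂(iid expo) ≠ ⊤ := by
    have hm : ∀ i, Measurable fun e => ofReal (exp (-(partialSum e i : ℝ))) := fun i =>
      (Real.measurable_exp.comp (measurable_partialSum i).coe_nnreal_real.neg).ennreal_ofReal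
    rw [lintegral_const_mul' _ _ ofReal_ne_top, lintegral_tsum fun i => (hm i).aemeasurable]
    simp only [lintegral_exp_neg_partialSum]
    rw [ENNReal.tsum_geometric, ENNReal.one_sub_inv_two, inv_inv]
    exact ENNReal.mul_ne_top ofReal_ne_top (by simp)
  refine ne_top_of_le_ne_top h2 ?_
  have h3 : ∫⁻ ω : Noise, ofReal (idx (clickClock C ω.1) t) ∂noise
      = ∫⁻ e, ofReal (idx (clickClock C e) t) ∂(iid expo) := by
    refine (measurePreserving_fst (μ := iid expo) (ν := iid unif)).lintegral_comp
      (f := fun e => ofReal (idx (clickClock C e) t)) ?_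
    exact (measurable_from_nat.comp (measurable_idx (s := fun e => clickClock C e)
      (fun e => isClock_clickClock C e) (measurable_clickClock C) t)).ennreal_ofReal
  rw [h3]
  exact lintegral_mono_ae (ae_cleanSum_eq.mono h1)

end Compensator

section Martingale

variable {n : ℕ} [NeZero n]

theorem measurable_limitPath_apply (A C : Mat n) (y : State n × ℕ) (t : ℝ≥0) :
    Measurable fun ω => (limitPath A C y ω).1 t :=
  ((measurable_pi_apply t).comp measurable_subtype_coe).comp (measurable_limitPath A C y)

/-- The filtration of the limit process and the number of clicks. -/
def clickFiltration (A C : Mat n) (ρ : State n) :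
    Filtration ℝ≥0 (inferInstance : MeasurableSpace Noise) where
  seq t := ⨆ r : Iic t,
    MeasurableSpace.comap (fun ω => (limitPath A C (ρ, 0) ω).1 r) inferInstance
  mono' s t hst := iSup_le fun r => le_iSup (fun r : Iic t =>
    MeasurableSpace.comap (fun ω => (limitPath A C (ρ, 0) ω).1 r) inferInstance)
    ⟨r.1, (mem_Iic.1 r.2).trans hst⟩
  le' _ := iSup_le fun _ => (measurable_limitPath_apply A C (ρ, 0) _).comap_le

theorem measurable_clickFiltration (A C : Mat n) (ρ : State n) {s t : ℝ≥0} (hst : s ≤ t) :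
    Measurable[clickFiltration A C ρ t] fun ω => (limitPath A C (ρ, 0) ω).1 s :=
  Measurable.of_comap_le (le_iSup (fun r : Iic t =>
    MeasurableSpace.comap (fun ω => (limitPath A C (ρ, 0) ω).1 r) inferInstance) ⟨s, hst⟩)

/-- The integrated intensity. -/
def compensator (A C : Mat n) (ρ : State n) (t : ℝ≥0) (ω : Noise) : ℝ :=
  ∫ s in (0 : ℝ)..t, jumpRate C ((statePath A C ρ ω).1 s.toNNReal)

theorem abs_jumpRate_le (C : Mat n) (ρ : State n) : |jumpRate C ρ| ≤ ‖C‖ ^ 2 := by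
  rw [abs_of_nonneg (jumpRate_nonneg C ρ)]
  exact jumpRate_le C ρ

theorem measurable_compensator (A C : Mat n) (ρ : State n) (t : ℝ≥0) :
    Measurable[clickFiltration A C ρ t] (compensator A C ρ t) := by
  rcases eq_zero_or_pos t with rfl | ht
  · have h0 : compensator A C ρ 0 = fun _ => 0 := by
      funext ω
      simp [compensator]
    rw [h0]
    exact measurable_const
  let h : ℕ → ℝ≥0 := fun k => t / (k + 1)
  have hh : ∀ k, 0 < h k := fun k => div_pos ht (by positivity)
  have hMh : ∀ k : ℕ, ((k + 1 : ℕ) : ℝ≥0) * h k = t := fun k => by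
    push_cast
    exact mul_div_cancel₀ _ (by positivity)
  have hh0 : Tendsto h atTop (𝓝 0) := by
    have := (tendsto_one_div_add_atTop_nhds_zero_nat (𝕜 := ℝ≥0)).const_mul t
    simpa [h, div_eq_mul_inv] using this
  refine @measurable_of_tendsto_metrizable _ _ (clickFiltration A C ρ t) _ _ _ _
    (fun k ω => (h k : ℝ) * ∑ j ∈ Finset.range (k + 1),
      jumpRate C ((statePath A C ρ ω).1 ((j + 1 : ℕ) * h k))) _ (fun k => ?_)
    (tendsto_pi_nhds.2 fun ω => ?_)
  · refine Measurable.const_mul (Finset.measurable_sum _ fun j hj => ?_) _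
    have h1 : ((j + 1 : ℕ) : ℝ≥0) * h k ≤ t := by
      rw [← hMh k]
      gcongr
      exact Nat.lt_succ_iff.1 (Finset.mem_range.1 hj)
    exact ((continuous_jumpRate C).measurable.comp measurable_fst).comp
      (measurable_clickFiltration A C ρ h1)
  · refine tendsto_riemann (f := fun s => jumpRate C ((statePath A C ρ ω).1 s))
      (g := fun k j => jumpRate C ((statePath A C ρ ω).1 ((j + 1 : ℕ) * h k)))
      (M := fun k => k + 1) hh (by simp only [hMh]; exact tendsto_const_nhds)
      (fun k j => abs_jumpRate_le C _) countable_empty fun u _ _ => ?_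
    refine ((continuous_jumpRate C).tendsto _).comp ?_
    refine Tendsto.comp ((statePath A C ρ ω).2.1 u) (tendsto_nhdsWithin_iff.2 ⟨?_, ?_⟩)
    · have h1 : Tendsto (fun k => u + h k) atTop (𝓝 u) := by simpa using hh0.const_add u
      refine tendsto_of_tendsto_of_tendsto_of_le_of_le tendsto_const_nhds h1 (fun k => ?_)
        fun k => ?_
      · push_cast
        exact ((div_lt_iff₀ (hh k)).1 (Nat.lt_floor_add_one (u / h k))).le
      · push_cast
        rw [add_mul, one_mul]
        gcongr
        exact (le_div_iff₀ (hh k)).1 (Nat.floor_le zero_le)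
    · refine Eventually.of_forall fun k => ?_
      push_cast
      exact ((div_lt_iff₀ (hh k)).1 (Nat.lt_floor_add_one (u / h k))).le

theorem norm_compensator_le (A C : Mat n) (ρ : State n) (t : ℝ≥0) (ω : Noise) :
    ‖compensator A C ρ t ω‖ ≤ ‖C‖ ^ 2 * t := by
  have h1 := intervalIntegral.norm_integral_le_of_norm_le_const (a := (0 : ℝ)) (b := t)
    (f := fun s : ℝ => jumpRate C ((statePath A C ρ ω).1 s.toNNReal)) (C := ‖C‖ ^ 2)
    fun s _ => abs_jumpRate_le C _
  simpa [compensator] using h1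

variable {A B : Mat n} (hA : A.IsHermitian) (hB : B.IsHermitian) (C : Mat n)

include hA hB in
/-- The accumulated click probabilities converge to the integrated intensity. -/
theorem tendsto_sum_outcomeProb (ρ : State n) {ω : Noise} (hω : IsRegular A C (ρ, 0) ω) {h :
    ℕ → ℝ≥0}
    (hh : Tendsto h atTop (𝓝[>] 0)) (h0 : ∀ k, 0 < h k ∧ IsFine A B C (h k)) (t : ℝ≥0) :
    Tendsto (fun k => ∑ j ∈ Finset.range ⌊t / h k⌋₊,
      outcomeProb A B C (h k) 1 (chainPath A B C (h k) (ρ, 0) j ω).1) atTop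
      (𝓝 (compensator A C ρ t ω)) := by
  have h1 := tendsto_riemann (f := fun s => jumpRate C ((statePath A C ρ ω).1 s))
    (g := fun k j => outcomeProb A B C (h k) 1 (chainPath A B C (h k) (ρ, 0) j ω).1 / h k)
    (c := rateBound C) (fun k => (h0 k).1) (tendsto_floor_mul hh t) (fun k j => ?_)
    (countable_range fun i => clickClock C ω.1 (i + 1)) fun u hu _ => ?_
  · refine h1.congr fun k => ?_
    have hk : (h k : ℝ) ≠ 0 := NNReal.coe_ne_zero.2 (h0 k).1.ne'
    rw [← Finset.sum_div, mul_div_cancel₀ _ hk]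
  · have hk : (0 : ℝ) < h k := by exact_mod_cast (h0 k).1
    rw [abs_of_nonneg (div_nonneg (outcomeProb_nonneg hA hB C _ 1 _) hk.le), div_le_iff₀ hk]
    exact (h0 k).2.outcomeProb_le _
  · refine tendsto_outcomeProb_div hA hB C hh ?_
    refine (skorokhodTendsto_statePath hA hB C ρ hω hh (fun k => (h0 k).1)
      fun k => (h0 k).2).tendsto_apply ?_
    exact continuousAt_fst.comp ((isClock_clickClock C ω.1).continuousAt
      (continuous_branch A C (ρ, 0) ω) fun i hi => hu ⟨i, hi⟩)

theorem clickCount_le (A C : Mat n) (ρ : State n) (t : ℝ≥0) (ω : Noise) :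
    clickCount A C ρ t ω ≤ idx (clickClock C ω.1) t := by
  change (mark A C (ρ, 0) _ ω).2 ≤ _
  generalize idx (clickClock C ω.1) t = i
  induction i with
  | zero => exact le_rfl
  | succ i ih => exact (mark_snd_succ A C (ρ, 0) i ω).2.trans (Nat.succ_le_succ ih)

theorem measurable_clickCount (A C : Mat n) (ρ : State n) {s t : ℝ≥0} (hst : s ≤ t) :
    Measurable[clickFiltration A C ρ t] fun ω => (clickCount A C ρ s ω : ℝ) :=
  (measurable_from_nat.comp measurable_snd).comp (measurable_clickFiltration A C ρ hst)

theorem integrable_clickCount (A C : Mat n) (ρ : State n) (t : ℝ≥0) :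
    Integrable (fun ω => (clickCount A C ρ t ω : ℝ)) noise := by
  refine ⟨((measurable_clickCount A C ρ le_rfl).mono ((clickFiltration A C ρ).le t)
    le_rfl).aestronglyMeasurable, lt_of_le_of_lt (lintegral_mono fun ω => ?_)
    (lintegral_idx_clickClock_ne_top C t).lt_top⟩
  rw [Real.enorm_of_nonneg (Nat.cast_nonneg _)]
  exact ofReal_le_ofReal (Nat.cast_le.2 (clickCount_le A C ρ t ω))

theorem compensator_mono (A C : Mat n) (ρ : State n) {ω : Noise} (hω : IsRegular A C (ρ, 0) ω)
    (hA : A.IsHermitian) {s t : ℝ≥0} (hst : s ≤ t) :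
    compensator A C ρ s ω ≤ compensator A C ρ t ω := by
  obtain ⟨h, hh, h0⟩ := exists_fine_seq hA hA C
  refine le_of_tendsto_of_tendsto' (tendsto_sum_outcomeProb hA hA C ρ hω hh h0 s)
    (tendsto_sum_outcomeProb hA hA C ρ hω hh h0 t) fun k => ?_
  exact Finset.sum_le_sum_of_subset_of_nonneg
    (Finset.range_mono (Nat.floor_mono (div_le_div_of_nonneg_right hst zero_le)))
    fun j _ _ => outcomeProb_nonneg hA hA C _ 1 _

include hA in
theorem martingale_clickCount (ρ : State n) :
    Martingale (fun t ω => (clickCount A C ρ t ω : ℝ) - compensator A C ρ t ω)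
      (clickFiltration A C ρ) noise := by
  have hcm : ∀ t, Measurable (compensator A C ρ t) := fun t =>
    (measurable_compensator A C ρ t).mono ((clickFiltration A C ρ).le t) le_rfl
  have hnm : ∀ t, Measurable fun ω => (clickCount A C ρ t ω : ℝ) := fun t =>
    (measurable_clickCount A C ρ le_rfl).mono ((clickFiltration A C ρ).le t) le_rfl
  have hci : ∀ t, Integrable (compensator A C ρ t) noise := fun t =>
    Integrable.of_bound (hcm t).aestronglyMeasurable (‖C‖ ^ 2 * t)
      (Eventually.of_forall (norm_compensator_le A C ρ t))
  have had : ∀ t, StronglyMeasurable[clickFiltration A C ρ t]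
      fun ω => (clickCount A C ρ t ω : ℝ) - compensator A C ρ t ω := fun t =>
    ((measurable_clickCount A C ρ le_rfl).sub (measurable_compensator A C ρ t)).stronglyMeasurable
  refine ⟨had, fun s t hst => ?_⟩
  have hint : ∀ t, Integrable (fun ω => (clickCount A C ρ t ω : ℝ) - compensator A C ρ t ω) noise :=
    fun t => (integrable_clickCount A C ρ t).sub (hci t)
  refine (ae_eq_condExp_of_forall_setIntegral_eq ((clickFiltration A C ρ).le s) (hint t)
    (fun S _ _ => (hint s).integrableOn) (fun S hS _ => ?_) (had s).aestronglyMeasurable).symm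
  let W : Noise → ℝ := fun ω =>
    clickCount A C ρ s ω + max (compensator A C ρ t ω - compensator A C ρ s ω) 0
  have hWm : Measurable W := (hnm s).add (((hcm t).sub (hcm s)).max measurable_const)
  have hWe : W =ᵐ[noise] fun ω => (clickCount A C ρ s ω : ℝ)
      + (compensator A C ρ t ω - compensator A C ρ s ω) := by
    filter_upwards [ae_isRegular A C (ρ, 0)] with ω hω
    simp only [W]
    rw [max_eq_left (sub_nonneg.2 (compensator_mono A C ρ hω hA hst))]
  have key : ∫ ω in S, (clickCount A C ρ t ω : ℝ) ∂noise = ∫ ω in S, W ω ∂noise := by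
    refine setIntegral_eq_of_forall_prod
      (Y := fun (r : Iic s) ω => (limitPath A C (ρ, 0) ω).1 r)
      (fun r => measurable_limitPath_apply A C (ρ, 0) r) (hnm t) hWm
      (integrable_clickCount A C ρ t) (fun ω => Nat.cast_nonneg _)
      (fun ω => add_nonneg (Nat.cast_nonneg _) (le_max_right _ _)) (fun J g => ?_) hS
    obtain ⟨h, hh, h0⟩ := exists_fine_seq hA hA C
    have hxm : ∀ k j, Measurable (chainPath A A C (h k) (ρ, 0) j) := fun k j =>
      ((isDriven_chainStep hA hA C (h0 k).1).measurable_orbit j).comp (by fun_prop)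
    have hpm : ∀ k, Measurable (outcomeProb A A C (h k) 1) := fun k =>
      (Complex.continuous_re.comp (continuous_outcome A A C (h k) 1).matrix_trace).measurable
    have hx : ∀ r : ℝ≥0, ∀ᵐ ω ∂noise, Tendsto
        (fun k => chainPath A A C (h k) (ρ, 0) ⌊r / h k⌋₊ ω) atTop
        (𝓝 ((limitPath A C (ρ, 0) ω).1 r)) := fun r => by
      filter_upwards [ae_isRegular A C (ρ, 0), ae_continuousAt_limitPath A C (ρ, 0) r] with ω h1 h2
      exact (skorokhodTendsto_chainPath hA hA C (ρ, 0) h1 hh (fun k => (h0 k).1)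
        fun k => (h0 k).2).tendsto_apply h2
    have hn : ∀ r : ℝ≥0, ∀ᵐ ω ∂noise, Tendsto
        (fun k => ((chainPath A A C (h k) (ρ, 0) ⌊r / h k⌋₊ ω).2 : ℝ)) atTop
        (𝓝 (clickCount A C ρ r ω : ℝ)) := fun r => (hx r).mono fun ω h1 =>
      ((continuous_of_discreteTopology (f := ((↑) : ℕ → ℝ))).tendsto _).comp
        ((continuous_snd.tendsto _).comp h1)
    have hdom : ∀ (r : ℝ≥0) k, ∀ᵐ ω ∂noise,
        ((chainPath A A C (h k) (ρ, 0) ⌊r / h k⌋₊ ω).2 : ℝ) ≤ idx (clickClock C ω.1) r :=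
      fun r k => (ae_isRegular A C (ρ, 0)).mono fun ω hω =>
        Nat.cast_le.2 (chainPath_snd_le A A C (h0 k).1 (h0 k).2 ρ hω.1 r)
    let D : ℕ → Noise → ℝ := fun k ω =>
      (chainPath A A C (h k) (ρ, 0) ⌊s / h k⌋₊ ω).2
        + ∑ j ∈ Finset.range (⌊t / h k⌋₊ - ⌊s / h k⌋₊), outcomeProb A A C (h k) 1
          (chainPath A A C (h k) (ρ, 0) (⌊s / h k⌋₊ + j) ω).1
    have hfl : ∀ k {u v : ℝ≥0}, u ≤ v → ⌊u / h k⌋₊ ≤ ⌊v / h k⌋₊ := fun k u v huv =>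
      Nat.floor_mono (div_le_div_of_nonneg_right huv zero_le)
    have hD : ∀ᵐ ω ∂noise, Tendsto (fun k => D k ω) atTop (𝓝 (W ω)) := by
      filter_upwards [ae_isRegular A C (ρ, 0), hn s, hWe] with ω h1 h2 h3
      rw [h3]
      refine (h2.add ((tendsto_sum_outcomeProb hA hA C ρ h1 hh h0 t).sub
        (tendsto_sum_outcomeProb hA hA C ρ h1 hh h0 s))).congr fun k => ?_
      rw [← Finset.sum_range_add_sum_Ico _ (hfl k hst), add_sub_cancel_left,
        Finset.sum_Ico_eq_sum_range]
    have hDle : ∀ k, ∀ᵐ ω ∂noise, D k ω ≤ idx (clickClock C ω.1) s + rateBound C * t := fun k => by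
      filter_upwards [hdom s k] with ω h1
      refine add_le_add h1 ?_
      have hk : (0 : ℝ) < h k := by exact_mod_cast (h0 k).1
      refine (Finset.sum_le_card_nsmul _ _ (rateBound C * h k : ℝ) fun j _ =>
        (h0 k).2.outcomeProb_le _).trans ?_
      rw [Finset.card_range, nsmul_eq_mul]
      have h2 : ((⌊t / h k⌋₊ : ℝ≥0) * h k : ℝ≥0) ≤ t :=
        (le_div_iff₀ (h0 k).1).1 (Nat.floor_le zero_le)
      have h3 : (⌊t / h k⌋₊ : ℝ) * h k ≤ t := by exact_mod_cast h2
      have h4 : ((⌊t / h k⌋₊ - ⌊s / h k⌋₊ : ℕ) : ℝ) ≤ ⌊t / h k⌋₊ := Nat.cast_le.2 (Nat.sub_le _ _)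
      calc ((⌊t / h k⌋₊ - ⌊s / h k⌋₊ : ℕ) : ℝ) * (rateBound C * h k)
          ≤ ⌊t / h k⌋₊ * (rateBound C * h k) := by gcongr
        _ = rateBound C * (⌊t / h k⌋₊ * h k) := by ring
        _ ≤ rateBound C * t := by gcongr
    have hL := tendsto_lintegral_prod_mul (μ := noise) J g
      (Y := fun k (r : Iic s) => chainPath A A C (h k) (ρ, 0) ⌊(r : ℝ≥0) / h k⌋₊)
      (fun k r => hxm k _) (Z := fun r ω => (limitPath A C (ρ, 0) ω).1 r) (fun r => hx r)
      (V := fun k ω => ((chainPath A A C (h k) (ρ, 0) ⌊t / h k⌋₊ ω).2 : ℝ))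
      (fun k => measurable_from_nat.comp (hxm k _).snd) (hn t)
      (lintegral_idx_clickClock_ne_top C t) (hdom t)
    have hR := tendsto_lintegral_prod_mul (μ := noise) J g
      (Y := fun k (r : Iic s) => chainPath A A C (h k) (ρ, 0) ⌊(r : ℝ≥0) / h k⌋₊)
      (fun k r => hxm k _) (Z := fun r ω => (limitPath A C (ρ, 0) ω).1 r) (fun r => hx r)
      (V := D) (fun k => (measurable_from_nat.comp (hxm k _).snd).add
        (Finset.measurable_sum _ fun j _ => (hpm k).comp (hxm k _).fst)) hD
      (W := fun ω => idx (clickClock C ω.1) s + rateBound C * t) (by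
        refine ne_top_of_le_ne_top ?_ (lintegral_mono fun ω => ENNReal.ofReal_add_le)
        rw [lintegral_add_right _ measurable_const]
        rw [lintegral_const, measure_univ, mul_one]
        exact ENNReal.add_ne_top.2 ⟨lintegral_idx_clickClock_ne_top C s, ofReal_ne_top⟩) hDle
    refine tendsto_nhds_unique hL (hR.congr fun k => ?_)
    have h2 := lintegral_clicks hA hA C (h0 k).1 (ρ, 0) ⌊s / h k⌋₊ (⌊t / h k⌋₊ - ⌊s / h k⌋₊)
      (Φ := fun q => ∏ i ∈ J, (g i (q ⌊(i : ℝ≥0) / h k⌋₊) : ENNReal))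
      (Finset.measurable_prod _ fun i _ => ((g i).continuous.measurable.comp
        (measurable_pi_apply _)).coe_nnreal_ennreal)
    have h3 : ∀ i : Iic s, min ⌊(i : ℝ≥0) / h k⌋₊ ⌊s / h k⌋₊ = ⌊(i : ℝ≥0) / h k⌋₊ := fun i =>
      min_eq_left (hfl k i.2)
    rw [Nat.add_sub_of_le (hfl k hst)] at h2
    simp only [h3] at h2
    exact h2.symm
  have h1 : ∫ ω in S, W ω ∂noise = ∫ ω in S, ((clickCount A C ρ s ω : ℝ)
      + (compensator A C ρ t ω - compensator A C ρ s ω)) ∂noise :=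
    integral_congr_ae (ae_restrict_of_ae hWe)
  have hi : IntegrableOn (fun ω => compensator A C ρ t ω - compensator A C ρ s ω) S noise :=
    ((hci t).sub (hci s)).integrableOn
  rw [h1, integral_add (integrable_clickCount A C ρ s).integrableOn hi, integral_sub
    (hci t).integrableOn (hci s).integrableOn] at key
  rw [integral_sub (integrable_clickCount A C ρ s).integrableOn (hci s).integrableOn,
    integral_sub (integrable_clickCount A C ρ t).integrableOn (hci t).integrableOn, key]
  ring

include hA in
theorem solvesBelavkin_limitPath (ρ : State n) :
    SolvesBelavkin A C ρ noise (clickFiltration A C ρ) (statePath A C ρ)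
      (clickCount A C ρ) where
  adapted_state t := measurable_fst.comp (measurable_clickFiltration A C ρ le_rfl)
  adapted_count t := measurable_snd.comp (measurable_clickFiltration A C ρ le_rfl)
  counting := Eventually.of_forall (isCountingPath_clickCount A C ρ)
  compensated := martingale_clickCount hA C ρ
  equation := (ae_isRegular A C (ρ, 0)).mono fun _ hω => belavkin_equation hA C ρ hω

end Martingale

end QFilter

end

open QFilter in
theorem mainTheorem1 (n : ℕ) (hn : 1 ≤ n) :
    ∃ κ : ℝ → ℝ → ℝ → ℝ≥0 → ℝ,
      ∀ (A C : Matrix (Fin n) (Fin n) ℂ) (hA : A.IsHermitian),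
        ∃ (T : ℝ≥0 → (State n →ᵇ ℝ) →L[ℝ] (State n →ᵇ ℝ))
          (P : State n → Measure (CadlagPath (State n))),
          -- (i) the Feller semigroup generated by the counting generator, and its process
          IsFellerSemigroup T ∧
          (∀ f ∈ Ck n 1, ∃ g, (f, g) ∈ generatorGraph T ∧
            ∀ ρ, g ρ = countGenerator hA C f ρ) ∧
          IsCore T (Ck n 1) ∧ IsCore T (Ck n 2) ∧
          ((IsUnit C ∨ C.rank ≤ 1) → ∀ k : ℕ, k = 1 ∨ k = 2 →
            (∀ s, ∀ f ∈ Ck n k, T s f ∈ Ck n k) ∧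
            ∀ t, ∃ c : ℝ, ∀ s ≤ t, ∀ f ∈ Ck n k, ckNorm k (T s f) ≤ c * ckNorm k f) ∧
          (∀ ρ, IsMarkovLaw T ρ (P ρ)) ∧
          -- the process solves the Belavkin equation
          (∀ ρ, ∃ (Ω : Type) (m : MeasurableSpace Ω) (μ : Measure Ω) (ℱ : Filtration ℝ≥0 m)
            (Z : Ω → CadlagPath (State n)) (N : ℝ≥0 → Ω → ℕ),
            IsProbabilityMeasure μ ∧ Measurable Z ∧ μ.map Z = P ρ ∧
              SolvesBelavkin A C ρ μ ℱ Z N) ∧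
          ∀ (B : Matrix (Fin n) (Fin n) ℂ) (hB : B.IsHermitian),
            -- (ii) convergence of the discrete-time chains
            ((∀ (f : State n →ᵇ ℝ) (s : ℝ≥0),
                Tendsto (fun h : ℝ≥0 => (transitionOp hA hB C h ^ ⌊s / h⌋₊) f)
                  (𝓝[>] 0) (𝓝 (T s f))) ∧
              (∃ Q : ℝ≥0 → State n → Measure (ℕ → State n),
                (∀ h, 0 < h → ∀ ρ, IsChainLaw (transitionOp hA hB C h) ρ (Q h ρ)) ∧
                ∀ ρ, ConvergesInLaw (fun h => (Q h ρ).map (stepPath h)) (P ρ)) ∧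
              ∀ f ∈ Ck n 2, ∀ t s h : ℝ≥0, s ≤ t → 0 < h →
                ‖(transitionOp hA hB C h ^ ⌊s / h⌋₊) f - T s f‖
                  ≤ (√(h : ℝ) * s + ((s : ℝ) - h * (⌊s / h⌋₊ : ℝ)))
                    * κ ‖A‖ ‖B‖ ‖C‖ t * ckNorm 2 f) ∧
            -- (iii) convergence of the continuous-time chains
            ((∀ (f : State n →ᵇ ℝ) (s : ℝ≥0),
                Tendsto (fun τ : ℝ≥0 => poissonSemigroup hA hB C τ s f)
                  (𝓝[>] 0) (𝓝 (T s f))) ∧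
              (∃ Q : ℝ≥0 → State n → Measure (CadlagPath (State n)),
                (∀ τ, 0 < τ → ∀ ρ, IsMarkovLaw (poissonSemigroup hA hB C τ) ρ (Q τ ρ)) ∧
                ∀ ρ, ConvergesInLaw (fun τ => Q τ ρ) (P ρ)) ∧
              ∀ f ∈ Ck n 2, ∀ t s τ : ℝ≥0, s ≤ t → 0 < τ →
                ‖poissonSemigroup hA hB C τ s f - T s f‖
                  ≤ √(τ : ℝ) * s * κ ‖A‖ ‖B‖ ‖C‖ t * ckNorm 2 f) := by
  have : NeZero n := ⟨by omega⟩
  choose c1 hc1 h1 using exists_rate_chain n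
  choose c2 hc2 h2 using exists_rate_poisson n
  refine ⟨fun a b c _ => max (c1 (max a (max b c))) (c2 (max a (max b c))), fun A C hA =>
    ⟨nnTime (countOp A C), fun ρ => noise.map (statePath A C ρ), isFellerSemigroup_countOp hA C,
      fun f hf => ⟨_, mem_generatorGraph_countOp hA C hf,
        fun ρ => (countGenerator_eq hA C f ρ).symm⟩,
      (isPerturbation_countOp A C).isCore (isC0Group_flowOp A C) (isCore_flowOp hA C le_rfl),
      (isPerturbation_countOp A C).isCore (isC0Group_flowOp A C) (isCore_flowOp hA C one_le_two),
      fun hC k _ => countOp_mem_Ck_and_bound A hC k, isMarkovLaw_statePath hA C,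
      fun ρ => ⟨Noise, inferInstance, noise, clickFiltration A C ρ, statePath A C ρ,
        clickCount A C ρ, inferInstance, measurable_statePath A C ρ, rfl,
        solvesBelavkin_limitPath hA C ρ⟩,
      fun B hB => ⟨⟨fun f s => ?_, exists_chainLaw hA hB C, fun f hf t s h _ hh => ?_⟩,
        fun f s => tendsto_poissonSemigroup hA hB C s f,
          exists_poissonLaw hA hB C, fun f hf t s τ _ hτ => ?_⟩⟩⟩
  · exact tendsto_transitionOp_pow hA hB C s.coe_nonneg tendsto_id
      (floor_mul_tendsto tendsto_id s) f
  · have hfl : 0 ≤ (s : ℝ) - h * (⌊s / h⌋₊ : ℝ) := by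
      have h3 : (⌊s / h⌋₊ : ℝ≥0) * h ≤ s := (le_div_iff₀ hh).1 (Nat.floor_le zero_le)
      have h4 : (⌊s / h⌋₊ : ℝ) * h ≤ s := by exact_mod_cast h3
      linarith
    refine (h1 _ A B C (le_max_left _ _) ((le_max_left _ _).trans (le_max_right _ _))
      ((le_max_right _ _).trans (le_max_right _ _)) hA hB f hf s h hh).trans ?_
    gcongr
    · exact ckNorm_nonneg 2 f
    · exact le_max_left _ _
  · refine (h2 _ A B C (le_max_left _ _) ((le_max_left _ _).trans (le_max_right _ _))
      ((le_max_right _ _).trans (le_max_right _ _)) hA hB f hf s τ hτ).trans ?_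
    gcongr
    · exact ckNorm_nonneg 2 f
    · exact le_max_right _ _
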